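/- **Setting.** Let $d\ge 0$, $T>0$, $\mathbb T^d=(\mathbb R/\mathbb Z)^d$ with its probability Haar measure $\mathrm dk$, $\hat f(k)=\sum_x f(x)e^{-2\pi i x\cdot k}$ and $\langle x\rangle=\sqrt{1+x^2}$. Let $\omega:\mathbb T^d\to\mathbb R$ be even with real-analytic periodic extension to $\mathbb R^d$, and let $V:\mathbb Z^d\to\mathbb R$ be even and summable. *Gas.* For $L\in\mathbb N$, $L\ge1$, put $\Omega^*=\{0,\frac1L,\dots,\frac{L-1}L\}^d$, $\int_{\Omega^*}\mathrm dk=L^{-d}\sum_{k\in\Omega^*}$, $\delta_L(k)=L^d\,\mathbf 1(k \bmod 1=0)$, and let $\hat a(k)$, $k\in\Omega^*$, be the fermionic annihilation operators with $\{\hat a(k),\hat a(k')^*\}=\delta_L(k-k')$. Let $\langle\cdot\rangle_{\lambda}$ be the Gibbs state $Z^{-1}\mathrm{Tr}(e^{-H_\lambda/T}\,\cdot\,)$ of $$H_\lambda=\int_{\Omega^*}\mathrm dk\,\omega(k)\hat a(k)^*\hat a(k)+\frac\lambda2\int_{(\Omega^*)^4}\mathrm dk_1\cdots\mathrm dk_4\,\delta_L(k_1+k_2-k_3-k_4)\hat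 V(k_2-k_3)\hat a(k_1)^*\hat a(k_2)^*\hat a(k_3)\hat a(k_4),$$ put $W_L^\lambda(k)=L^{-d}\langle\hat a(k)^*\hat a(k)\rangle_\lambda$ and define the modified dispersion relation $$\omega^\lambda(k_1)=\omega(k_1)+\lambda\int_{\Omega^*}\mathrm dk_2\,W_L^\lambda(k_2)\big[\hat V(0)-\hat V(k_1-k_2)\big],\qquad k_1\in\mathbb T^d .$$ *Dispersivity.* Assume that for some $\delta>0$, $L_0$, $\lambda_0>0$ and $C$ the propagators $p_t^{\lambda}(x)=\int_{\mathbb T^d}\mathrm dk\,e^{2\pi i x\cdot k}e^{-it\omega^\lambda(k)}$ satisfy $\sum_{x\in\mathbb Z^d}|p_t^\lambda(x)|^3\le C\langle t\rangle^{-1-\delta}$ for all $t\in\mathbb R$, $0\le\lambda<\lambda_0$ and $L\ge L_0$. *Equilibrium and decay coefficient.* Let $W^0(k)=(e^{\omega(k)/T}+1)^{-1}$, $W^0(k,-1)=W^0(k)$, $W^0(k,1)=1-W^0(k)$, $W^0_j=W^0(k_j)$, $\omega_j=\omega(k_j)$, and $$\nu(k_1)=\int_0^\infty\mathrm ds\int_{\mathbb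 T^{3d}}\mathrm dk_2\,\mathrm dk_3\,\mathrm dk_4\,\delta(k_1+k_2-k_3-k_4)\,\hat V(k_2-k_3)\big(\hat V(k_2-k_3)-\hat V(k_2-k_4)\big)e^{is(\omega_1+\omega_2-\omega_3-\omega_4)}\big(W^0_3W^0_4-W^0_2W^0_4+W^0_2(1-W^0_3)\big).$$ *Parameters.* Let $\gamma>0$, $a_0=\frac1{24}\min(\frac14,2\gamma,2\delta)$, $b_0=16(3+\frac1{a_0})$, $N_0(\lambda)=\max\big(1,\lfloor a_0|\ln\lambda|/\ln\langle\ln\lambda\rangle\rfloor\big)$, and $\kappa_n=0$ for $n<N_0/2$, $\kappa_n=\lambda^2N_0^{b_0}$ for $n\ge N_0/2$. **Graphs.** A graph with $n$ interactions is a pair $G=(\ell,S)$. The history $\ell=(\ell_1,\dots,\ell_n)$, with $1\le\ell_j\le 2(n-j)+1$, describes the plus tree from bottom to top. Slice $j\in\{0,\dots,n\}$ has the edges $0,1,\dots,2(n-j)+1$; edge $0$ is the minus tree, which has no interaction. Between slices $j-1$ and $j$ the edges $\ell_j,\ell_j+1,\ell_j+2$ of slice $j-1$ are fused into the edge $\ell_j$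 of slice $j$; the other edges continue, in the same order. $S$ is a pairing of the $2n+2$ edges of slice $0$, whose pairs are written $A=(a,b)$ with $a<b$. Parities: in slice $n$ the edges $0,1$ have parities $-1,+1$; an edge of parity $\sigma$ that is split into three (going down) gives edges of parities $-1,\sigma,+1$; otherwise parities are inherited. *Loss motives.* A loss motive is attached to an edge $e\ge1$ of slice $0$ of parity $\sigma$, by means of data $(o,c,P)$: two new interactions are added at the bottom, the upper one splitting $e$ into $e,e+1,e+2$, and the lower one splitting $e+o$, so that $e$ is replaced by the five edges $e,\dots,e+4$; the edge $e+c$ takes over the partner of $e$, and $P$ gives the two new pairs (numbers relative to $e$; a pair $(x,y)$ is abbreviated $xy$). For $\sigma=+1$ the data are $$(0,2;03,14),\ (1,3;02,14),\ (2,4;12,03),\ (0,2;13,04),\ (1,2;03,14),\ (2,3;12,04),$$ and for $\sigma=-1$ their mirror images under $o\mapsto2-o$, $c\mapsto4-c$, $x\mapsto4-x$. *Gain motives.* A gain motive replaces a pair $(a,b)$, $a\ge1$, whose left leg $a$ has parity $\sigma$: both legs are split into three edges, numbered $0,1,2$ below $a$ and $3,4,5$ below $b$ (two new interactions at the bottom,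 in either order), and these six edges are paired by $\{23,04,15\}$ or $\{23,14,05\}$ if $\sigma=-1$, and by $\{05,24,13\}$ or $\{05,14,23\}$ if $\sigma=+1$. *Leading graphs.* For a graph $G$ and $A=(a,b)\in S$ let $\mathrm{Att}(G,A)$ be the set of graphs obtained from $G$ by attaching one motive to $A$: the six loss motives on $b$ if $a=0$ (then $A$ is called the root pair), and the six loss motives on $a$, the six on $b$ and the four gain motives if $a\neq0$. The only leading graph with $0$ motives is $n=0$, $S=\{(0,1)\}$; the leading graphs with $m+1$ motives are the elements of $\mathrm{Att}(G,A)$, where $G$ is a leading graph with $m$ motives and $A$ a pair of $G$. A leading graph with $m$ motives has $n=2m$ interactions. **Amplitudes.** Let $\varepsilon(S)$ be the sign of the permutation that lists the pairs $(a,b)$ of $S$ one after the other, ordered by $a$. Give every pair $A=(a,b)\in S$ a free momentum $q_A\in\mathbb T^d$; in slice $0$ the edges $a$ and $b$ have the momenta $q_A$ and $-q_A$, and the momentum of a fused edge is the sum of the momenta of the three edges that are fused. Let $k_{\rm top}$ be the momentum of the edge $1$ of slice $n$, and let the $j$-th interaction fuse edges of momenta $p_1,p_2,p_3$ (left to right)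 into an edge of parity $\sigma_j$; put $$U_j=\tfrac12\big[(1+\sigma_j)\hat V(p_1+p_2)+(1-\sigma_j)\hat V(p_2+p_3)\big],\qquad \Theta_j=\omega^\lambda(p_3)-\omega^\lambda(p_1)+\sigma_j\big(\omega^\lambda(p_2)-\omega^\lambda(p_1+p_2+p_3)\big),$$ and $\gamma_j=\sum_{i=j+1}^n\Theta_i-i\kappa_{n-j}$ for $0\le j\le n$. For $\phi:\mathbb T^d\to\mathbb C$ the cut-off-free main-term amplitude at time $\tau\ge 0$ is $$\mathcal F[\phi](G,\tau)=(-i\lambda)^n\varepsilon(S)\int\prod_{A\in S}\mathrm dq_A\;\phi(k_{\rm top})\prod_{j=1}^n\sigma_jU_j\prod_{A=(a,b)\in S}\mathbf 1(\sigma_{a}=-\sigma_{b})W^0(q_A,\sigma_{a})\int_{[0,\infty)^{n+1}}\mathrm dr\,\delta\Big(\tau-\sum_{j=0}^nr_j\Big)\prod_{j=0}^ne^{-ir_j\gamma_j},$$ where $\sigma_{a},\sigma_{b}$ are the parities of the edges $a,b$ in slice $0$. **Claim.** Let $f,g:\mathbb Z^d\to\mathbb C$ have finite support and put $\phi=\hat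 g^*\hat f$. For every $k_1$ the $s$-integral that defines $\nu(k_1)$ converges absolutely, and $\nu$ is bounded and measurable. For every $t>0$ and $m\ge0$, as $\lambda\to0^+$ and uniformly in $L\ge L_0$: 1. (Convergence of leading terms.) With $n=2m$, $$\sum_{G\text{ leading, }m\text{ motives}}\mathcal F[\phi](G,t\lambda^{-2})\;\longrightarrow\;\int_{\mathbb T^d}\mathrm dk\,\hat g(k)^*\hat f(k)W^0(k)\,\nu(k)^m\,\frac{(-t)^m}{m!}.$$ 2. (Root pair: $W^0$ is replaced by $-W^0\nu$.) For every leading graph $G$ with $m$ motives and its root pair $A$, $$\sum_{H\in\mathrm{Att}(G,A)}\mathcal F[\phi](H,t\lambda^{-2})-\frac t{m+1}\,\mathcal F[-\nu\phi](G,t\lambda^{-2})\;\longrightarrow\;0 .$$ 3. (Cancellation at the other pairs.) For every leading graph $G$ with $m$ motives and every pair $A$ of $G$ other than the root pair, $$\sum_{H\in\mathrm{Att}(G,A)}\mathcal F[\phi](H,t\lambda^{-2})\;\longrightarrow\;0 .$$ -/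

import Mathlib

open MeasureTheory Filter Topology Set

namespace Kinetic

noncomputable section

/-! ### Fourier transform on `ℤ^d`, momenta in the torus `𝕋^d = (ℝ/ℤ)^d` -/

/-- The Fourier transform `f̂ k = ∑ₓ f x e^{-2πi k·x}` of a finitely supported `f : ℤ^d → ℂ`. -/
def fourierFin {d : ℕ} (f : (Fin d → ℤ) →₀ ℂ) (k : UnitAddTorus (Fin d)) : ℂ :=
  f.sum fun x z => z * UnitAddTorus.mFourier (-x) k

/-- The Fourier transform `V̂ k = ∑ₓ V x e^{-2πi k·x}` of a summable even real potential; it is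
real because `V` is even. -/
def Vhat {d : ℕ} (V : (Fin d → ℤ) → ℝ) (k : UnitAddTorus (Fin d)) : ℝ :=
  (∑' x, (V x : ℂ) * UnitAddTorus.mFourier (-x) k).re

/-- The Japanese bracket `⟨x⟩ = √(1 + x²)`. -/
def japanese (x : ℝ) : ℝ := Real.sqrt (1 + x ^ 2)

/-! ### The interacting Fermi gas in a periodic box of side `L` and its Gibbs state

The momenta are `k ∈ Ω* = {0, 1/L, …, (L-1)/L}^d`, indexed by `(ℤ/L)^d`.  The fermionic Fock space
has the occupation number basis indexed by the finite sets of occupied modes. -/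

/-- The point of the torus with the coordinates `kᵢ / L`. -/
def dualPoint {d L : ℕ} [NeZero L] (k : Fin d → ZMod L) : UnitAddTorus (Fin d) :=
  fun i => ZMod.toAddCircle (k i)

/-- The normalised fermionic annihilation operator of the mode `k` (Jordan-Wigner form, relative
to an enumeration of the modes): it maps the basis vector `insert k A`, `k ∉ A`, to
`± A` and kills the basis vectors in which `k` is empty. -/
def modeAnnihilation {ι : Type} [Fintype ι] [DecidableEq ι] (k : ι) :
    Matrix (Finset ι) (Finset ι) ℂ :=
  Matrix.of fun A B =>
    if k ∉ A ∧ B = insert k A then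
      (-1) ^ (A.filter fun j => Fintype.equivFin ι j < Fintype.equivFin ι k).card
    else 0

/-- The operator `â k`, normalised such that `{â k, (â k')*} = L^d 1(k = k')`. -/
def annihilation {d L : ℕ} [NeZero L] (k : Fin d → ZMod L) :
    Matrix (Finset (Fin d → ZMod L)) (Finset (Fin d → ZMod L)) ℂ :=
  (Real.sqrt ((L : ℝ) ^ d) : ℂ) • modeAnnihilation k

/-- The many-body Hamiltonian (kinetic energy `ω` plus pair interaction `lam * V (x - y)` over all
pairs of particles), written in momentum space:
`H = ∫ dk ω(k) â(k)* â(k)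
  + (lam/2) ∫ dk₁ dk₂ dk₃ dk₄ δ_L(k₁+k₂-k₃-k₄) V̂(k₂-k₃) â(k₁)* â(k₂)* â(k₃) â(k₄)`,
where `∫ dk = L^{-d} ∑_{k ∈ Ω*}` and `δ_L(k) = L^d 1(k = 0)`. -/
def hamiltonian {d : ℕ} (L : ℕ) [NeZero L] (ω : UnitAddTorus (Fin d) → ℝ)
    (V : (Fin d → ℤ) → ℝ) (lam : ℝ) :
    Matrix (Finset (Fin d → ZMod L)) (Finset (Fin d → ZMod L)) ℂ :=
  (((L : ℂ) ^ d)⁻¹) • (∑ k : Fin d → ZMod L,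
      (ω (dualPoint k) : ℂ) • ((annihilation k).conjTranspose * annihilation k))
  + ((lam : ℂ) / 2 * (((L : ℂ) ^ d)⁻¹) ^ 4) •
    ∑ k₁ : Fin d → ZMod L, ∑ k₂ : Fin d → ZMod L, ∑ k₃ : Fin d → ZMod L, ∑ k₄ : Fin d → ZMod L,
      ((if k₁ + k₂ - k₃ - k₄ = 0 then (L : ℂ) ^ d else 0) * (Vhat V (dualPoint (k₂ - k₃)) : ℂ)) •
        ((annihilation k₁).conjTranspose * (annihilation k₂).conjTranspose *
          annihilation k₃ * annihilation k₄)

/-- The expectation `⟨A⟩ = Tr (e^{-H/T} A) / Tr e^{-H/T}` in the Gibbs state at temperature `T`. -/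
def gibbs {d : ℕ} (L : ℕ) [NeZero L] (T : ℝ) (ω : UnitAddTorus (Fin d) → ℝ)
    (V : (Fin d → ℤ) → ℝ) (lam : ℝ)
    (A : Matrix (Finset (Fin d → ZMod L)) (Finset (Fin d → ZMod L)) ℂ) : ℂ :=
  (NormedSpace.exp (-((1 / T : ℝ) : ℂ) • hamiltonian L ω V lam) * A).trace /
    (NormedSpace.exp (-((1 / T : ℝ) : ℂ) • hamiltonian L ω V lam)).trace

/-- The momentum distribution of the Gibbs state: `⟨â(k)* â(k')⟩ = δ_L(k - k') W(k)`. -/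
def gibbsW {d : ℕ} (L : ℕ) [NeZero L] (T : ℝ) (ω : UnitAddTorus (Fin d) → ℝ)
    (V : (Fin d → ℤ) → ℝ) (lam : ℝ) (k : Fin d → ZMod L) : ℝ :=
  (gibbs L T ω V lam ((annihilation k).conjTranspose * annihilation k)).re / (L : ℝ) ^ d

/-- The modified dispersion relation `ω^lam = ω + lam R`, with
`R(k₁) = ∫_{Ω*} dk₂ W(k₂) [V̂(0) - V̂(k₁ - k₂)]`, as a function on the whole torus. -/
def modDisp {d : ℕ} (L : ℕ) [NeZero L] (T : ℝ) (ω : UnitAddTorus (Fin d) → ℝ)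
    (V : (Fin d → ℤ) → ℝ) (lam : ℝ) (k₁ : UnitAddTorus (Fin d)) : ℝ :=
  ω k₁ + lam * (((L : ℝ) ^ d)⁻¹ * ∑ k₂ : Fin d → ZMod L,
    gibbsW L T ω V lam k₂ * (Vhat V 0 - Vhat V (k₁ - dualPoint k₂)))

/-- The free propagator `p_t(x) = ∫ dk e^{2πi x·k} e^{-i t w(k)}` of a dispersion relation `w`. -/
def propagator {d : ℕ} (w : UnitAddTorus (Fin d) → ℝ) (t : ℝ) (x : Fin d → ℤ) : ℂ :=
  ∫ k : UnitAddTorus (Fin d),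
    UnitAddTorus.mFourier x k * Complex.exp (-(Complex.I * (t : ℂ) * (w k : ℂ)))

/-- `ℓ³`-dispersivity with exponent `δ`: for all small `lam ≥ 0` the propagator of the modified
dispersion relation satisfies `‖p_t‖₃³ ≤ C ⟨t⟩^{-1-δ}`, uniformly in `lam` and in the
volumes `L ≥ L₀`. -/
def L3Dispersive {d : ℕ} (T : ℝ) (ω : UnitAddTorus (Fin d) → ℝ) (V : (Fin d → ℤ) → ℝ)
    (δ : ℝ) (L₀ : ℕ) : Prop :=
  ∃ lam₀ > 0, ∃ C : ℝ, ∀ lam : ℝ, 0 ≤ lam → lam < lam₀ → ∀ L : ℕ+, L₀ ≤ (L : ℕ) → ∀ t : ℝ,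
    Summable (fun x => ‖propagator (modDisp (L : ℕ) T ω V lam) t x‖ ^ 3) ∧
    ∑' x, ‖propagator (modDisp (L : ℕ) T ω V lam) t x‖ ^ 3 ≤ C * japanese t ^ (-1 - δ)

/-- The equilibrium of the free gas, `W⁰(k) = 1 / (e^{ω(k)/T} + 1)`. -/
def W0 {d : ℕ} (T : ℝ) (ω : UnitAddTorus (Fin d) → ℝ) (k : UnitAddTorus (Fin d)) : ℝ :=
  1 / (Real.exp (1 / T * ω k) + 1)

/-- `W⁰(k, σ)`, equal to `W⁰(k)` for `σ = -1` and to `1 - W⁰(k)` for `σ = 1`. -/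
def W0s {d : ℕ} (T : ℝ) (ω : UnitAddTorus (Fin d) → ℝ) (k : UnitAddTorus (Fin d)) (σ : ℤ) : ℝ :=
  if σ = -1 then W0 T ω k else 1 - W0 T ω k

/-- The integrand, as a function of the time `s`, in the definition of `ν(k₁)`; the momentum
constraint `k₁ + k₂ = k₃ + k₄` has been used to eliminate `k₄`. -/
def nuIntegrand {d : ℕ} (T : ℝ) (ω : UnitAddTorus (Fin d) → ℝ) (V : (Fin d → ℤ) → ℝ)
    (k₁ : UnitAddTorus (Fin d)) (s : ℝ) : ℂ :=
  ∫ p : UnitAddTorus (Fin d) × UnitAddTorus (Fin d),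
    let k₂ := p.1
    let k₃ := p.2
    let k₄ := k₁ + k₂ - k₃
    ((Vhat V (k₂ - k₃) * (Vhat V (k₂ - k₃) - Vhat V (k₂ - k₄)) : ℝ) : ℂ) *
      Complex.exp (Complex.I * (s : ℂ) * ((ω k₁ + ω k₂ - ω k₃ - ω k₄ : ℝ) : ℂ)) *
      ((W0 T ω k₃ * W0 T ω k₄ - W0 T ω k₂ * W0 T ω k₄ + W0 T ω k₂ * (1 - W0 T ω k₃) : ℝ) : ℂ)

/-- The decay coefficient `ν(k₁) = ∫₀^∞ ds …`. -/
def nu {d : ℕ} (T : ℝ) (ω : UnitAddTorus (Fin d) → ℝ) (V : (Fin d → ℤ) → ℝ)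
    (k₁ : UnitAddTorus (Fin d)) : ℂ :=
  ∫ s in Ioi (0 : ℝ), nuIntegrand T ω V k₁ s

/-! ### The parameters of the expansion -/

/-- `a₀ = γ'/24`, `γ' = min (1/4, 2γ, 2δ)`. -/
def a0 (γ δ : ℝ) : ℝ := min (1 / 4) (min (2 * γ) (2 * δ)) / 24

/-- `b₀ = 16 (3 + 1/a₀)`. -/
def b0 (γ δ : ℝ) : ℝ := 16 * (3 + 1 / a0 γ δ)

/-- `N₀ = max (1, ⌊a₀ |ln lam| / ln ⟨ln lam⟩⌋)`. -/
def N0 (γ δ lam : ℝ) : ℕ :=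
  max 1 ⌊a0 γ δ * |Real.log lam| / Real.log (japanese (Real.log lam))⌋₊

/-- `κ_n = 0` for `n < N₀/2`, and `κ_n = lam² N₀^{b₀}` from there on. -/
def kappa (γ δ lam : ℝ) (n : ℕ) : ℝ :=
  if (n : ℝ) < (N0 γ δ lam : ℝ) / 2 then 0 else lam ^ 2 * (N0 γ δ lam : ℝ) ^ b0 γ δ

end

/-! ### Paired Feynman graphs of the main term

A graph is a pair `(ℓ, S)`.  The list `ℓ = [ℓ₁, …, ℓ_n]` is the interaction history of the plus
tree, from the bottom to the top: in the time slice `j` the edges `ℓ_j, ℓ_j + 1, ℓ_j + 2` of the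
slice `j - 1` are fused into the edge `ℓ_j`.  In every slice the edge number `0` is the
single edge of the minus tree, and the edges of the plus tree have the numbers `1, 2, …`; the slice
`j` has `1 + 2 (n - j)` of them.  `S` is a pairing of the edges `0, …, 2n + 1` of the
initial slice, given as the set of its pairs `(a, b)`, `a < b` (left leg and right leg). -/

abbrev PairedGraph := List ℕ × Finset (ℕ × ℕ)

/-- The edges of the slice `j` from those of the slice `j - 1`: the edges `p, p + 1, p + 2` are
fused into the edge `p`, whose momentum is the sum of theirs. -/
def fuse {G : Type*} [Add G] (p : ℕ) (row : ℕ → G) : ℕ → G := fun l =>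
  if l < p then row l else if l = p then row p + row (p + 1) + row (p + 2) else row (l + 2)

/-- The parities of the slice `j - 1` from those of the slice `j`: the edge `p` of parity
`σ` becomes three edges of parities `-1, σ, 1`. -/
def splitParity (p : ℕ) (row : ℕ → ℤ) : ℕ → ℤ := fun l =>
  if l < p then row l else if l = p then -1 else if l = p + 1 then row p
  else if l = p + 2 then 1 else row (l - 2)

/-- The parities of the initial slice; the two top edges have parities `-1` and `1`. -/
def parity : List ℕ → ℕ → ℤ
  | [] => fun l => if l = 0 then -1 else 1
  | p :: ℓ => splitParity p (parity ℓ)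

/-! ### Leading motives and leading graphs

A loss motive is attached to an edge `e` of the plus tree in the initial slice.  First `e` is split
into three edges, then one of these three is split again; `e` is thus replaced by five edges
`e, …, e + 4`.  One of the five takes over the partner of `e`, the other four are paired. -/

/-- Loss motives `(o, c, P)` for an edge of parity `σ`: `o ∈ {0,1,2}` is the edge that is split the
second time, `c ∈ {0,…,4}` is the edge that takes over the partner, and `P` are the two
new pairs.  For `σ = 1` these are L1, …, L6, in this order; those for `σ = -1` are their mirror
images. -/
def lossMotives (σ : ℤ) : Finset (ℕ × ℕ × Finset (ℕ × ℕ)) :=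
  if σ = 1 then
    {(0, 2, {(0, 3), (1, 4)}), (1, 3, {(0, 2), (1, 4)}), (2, 4, {(1, 2), (0, 3)}),
     (0, 2, {(1, 3), (0, 4)}), (1, 2, {(0, 3), (1, 4)}), (2, 3, {(1, 2), (0, 4)})}
  else
    {(2, 2, {(1, 4), (0, 3)}), (1, 1, {(2, 4), (0, 3)}), (0, 0, {(2, 3), (1, 4)}),
     (2, 2, {(1, 3), (0, 4)}), (1, 2, {(1, 4), (0, 3)}), (0, 1, {(2, 3), (0, 4)})}

/-- The graph obtained by attaching a loss motive to the edge `e`. -/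
def attachLoss (G : PairedGraph) (e : ℕ) (M : ℕ × ℕ × Finset (ℕ × ℕ)) : PairedGraph :=
  let r : ℕ → ℕ := fun i => if i < e then i else if i = e then e + M.2.1 else i + 4
  ((e + M.1) :: e :: G.1,
    G.2.image (fun A => (r A.1, r A.2)) ∪ M.2.2.image (fun A => (e + A.1, e + A.2)))

/-- All graphs obtained by attaching a loss motive of the suitable parity to the edge `e`. -/
def lossAttachments (G : PairedGraph) (e : ℕ) : Finset PairedGraph :=
  (lossMotives (parity G.1 e)).image (attachLoss G e)

/-- The pairings of a gain motive that replaces a pair whose left leg has parity `σ`.  Both legs are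
split into three edges, `0, 1, 2` below the left leg and `3, 4, 5` below the right leg.  For
`σ = -1` the first pairing is that of G1⁻ and G2⁻ and the second that of G3⁻ and G4⁻; those for
`σ = 1` are obtained by reversing the order of the edges below each vertex. -/
def gainPairings (σ : ℤ) : Finset (Finset (ℕ × ℕ)) :=
  if σ = -1 then {{(2, 3), (0, 4), (1, 5)}, {(2, 3), (1, 4), (0, 5)}}
  else {{(0, 5), (2, 4), (1, 3)}, {(0, 5), (1, 4), (2, 3)}}

/-- The graph obtained by replacing the pair `A` of `G` by a gain motive with pairing `P`.  The new
vertex below the left leg is the upper one if `leftUpper`, otherwise the lower one. -/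
def attachGain (G : PairedGraph) (A : ℕ × ℕ) (leftUpper : Bool) (P : Finset (ℕ × ℕ)) :
    PairedGraph :=
  let r : ℕ → ℕ := fun i => if i < A.1 then i else if i < A.2 then i + 2 else i + 4
  let s : ℕ → ℕ := fun x => if x < 3 then A.1 + x else A.2 + 2 + (x - 3)
  ((if leftUpper then [A.2 + 2, A.1] else [A.1, A.2]) ++ G.1,
    (G.2.erase A).image (fun B => (r B.1, r B.2)) ∪ P.image (fun B => (s B.1, s B.2)))

/-- All graphs obtained by replacing the pair `A` by a gain motive of the suitable parity. -/
def gainAttachments (G : PairedGraph) (A : ℕ × ℕ) : Finset PairedGraph :=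
  ((Finset.univ : Finset Bool) ×ˢ gainPairings (parity G.1 A.1)).image
    fun M => attachGain G A M.1 M.2

/-- All graphs obtained by attaching a leading motive to the pair `A` of `G`.  If `A` is the
root pair, the one that contains the edge `0` of the minus tree, then only the loss motives on
its right leg keep the minus tree free of interactions.  To any other pair one may attach the
loss motives on either leg and the gain motives. -/
def attachments (G : PairedGraph) (A : ℕ × ℕ) : Finset PairedGraph :=
  if A.1 = 0 then lossAttachments G A.2
  else lossAttachments G A.1 ∪ lossAttachments G A.2 ∪ gainAttachments G A

/-- The leading graphs with `m` leading motives (hence `n = 2m` interactions) and no interaction in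
the minus tree: start from the single pair and attach leading motives to pairs `m` times. -/
def leadingGraphs : ℕ → Finset PairedGraph
  | 0 => {([], {(0, 1)})}
  | m + 1 => (leadingGraphs m).biUnion fun G => G.2.biUnion fun A => attachments G A

/-- The sign `ε(S)` of the permutation that lists the pairs of `S` one after the other, ordered by
their left legs: `(-1)` to the number of its inversions. -/
def pairingSign (S : Finset (ℕ × ℕ)) : ℤ :=
  (-1) ^ ((S ×ˢ S).filter (fun P => P.1.1 < P.2.1)).sum fun P =>
    ((({P.1.1, P.1.2} : Finset ℕ) ×ˢ ({P.2.1, P.2.2} : Finset ℕ)).filter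
      fun x => x.2 < x.1).card

/-- The momenta of the initial slice: the delta functions `δ(k_{0,a} + k_{0,b})` of the pairs are
resolved by giving each pair one free momentum `q`, with `k_{0,a} = q` and `k_{0,b} = -q`. -/
def initialMomenta {G : Type*} [AddCommGroup G] (S : Finset (ℕ × ℕ)) (q : S → G) : ℕ → G :=
  fun i => ∑ A : S, if A.1.1 = i then q A else if A.1.2 = i then -q A else 0

/-- The vertices from the bottom to the top: the momenta of the three edges which are fused, and
the parity of the resulting edge. -/
def vertices {G : Type*} [Add G] : List ℕ → (ℕ → G) → List ((G × G × G) × ℤ)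
  | [], _ => []
  | p :: ℓ, row => ((row p, row (p + 1), row (p + 2)), parity ℓ p) :: vertices ℓ (fuse p row)

/-- The momentum of the top edge of the plus tree. -/
def topMomentum {G : Type*} [Add G] : List ℕ → (ℕ → G) → G
  | [], row => row 1
  | p :: ℓ, row => topMomentum ℓ (fuse p row)

noncomputable section

/-- The phase `Θ(k₂,k₃,k₄,σ) = w(k₄) - w(k₂) + σ (w(k₃) - w(k₂+k₃+k₄))` of a vertex. -/
def phase {d : ℕ} (w : UnitAddTorus (Fin d) → ℝ)
    (v : (UnitAddTorus (Fin d) × UnitAddTorus (Fin d) × UnitAddTorus (Fin d)) × ℤ) : ℝ :=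
  w v.1.2.2 - w v.1.1 + (v.2 : ℝ) * (w v.1.2.1 - w (v.1.1 + v.1.2.1 + v.1.2.2))

/-- The interaction factor `½ [(1+σ) V̂(k₂+k₃) + (1-σ) V̂(k₃+k₄)]` of a vertex. -/
def interaction {d : ℕ} (V : (Fin d → ℤ) → ℝ)
    (v : (UnitAddTorus (Fin d) × UnitAddTorus (Fin d) × UnitAddTorus (Fin d)) × ℤ) : ℝ :=
  1 / 2 * ((1 + (v.2 : ℝ)) * Vhat V (v.1.1 + v.1.2.1) +
    (1 - (v.2 : ℝ)) * Vhat V (v.1.2.1 + v.1.2.2))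

/-- The time integral `∫_{r₀,…,r_n ≥ 0} dr δ(τ - ∑ⱼ rⱼ) ∏ⱼ e^{-i rⱼ γⱼ}`; the delta function
has been used to eliminate `r_n`. -/
def timeIntegral (n : ℕ) (γ : ℕ → ℂ) (τ : ℝ) : ℂ :=
  ∫ r in {r : Fin n → ℝ | (∀ j, 0 ≤ r j) ∧ ∑ j, r j ≤ τ},
    (∏ j : Fin n, Complex.exp (-(Complex.I * (r j : ℂ) * γ j))) *
      Complex.exp (-(Complex.I * ((τ - ∑ j, r j : ℝ) : ℂ) * γ n))

/-- The amplitude of a paired graph without momentum cut-off, for the dispersion relation `w`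
in the phases, the function `φ` of the top momentum, and the total time `τ`.
With `n` interactions it carries the factor `(-i lam)^n ε(S)`, a factor
`σ U` and a phase `Θ` for each vertex and a factor `W⁰(k, σ)` for each pair, where `k` and `σ`
belong to its left leg; the phase of the slice `j` is `γ_j = ∑_{l > j} Θ_l - i κ_{n-j}`.
The momenta of all edges are determined by the free momenta `q` of the pairs. -/
def amplitude {d : ℕ} (T : ℝ) (ω : UnitAddTorus (Fin d) → ℝ) (V : (Fin d → ℤ) → ℝ)
    (w : UnitAddTorus (Fin d) → ℝ) (κ : ℕ → ℝ) (lam : ℝ) (φ : UnitAddTorus (Fin d) → ℂ)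
    (τ : ℝ) (G : PairedGraph) : ℂ :=
  (-Complex.I * (lam : ℂ)) ^ G.1.length * (pairingSign G.2 : ℂ) *
    ∫ q : G.2 → UnitAddTorus (Fin d),
      let k := initialMomenta G.2 q
      let vs := vertices G.1 k
      φ (topMomentum G.1 k) *
        (vs.map fun v => (((v.2 : ℝ) * interaction V v : ℝ) : ℂ)).prod *
        (∏ A : G.2, if parity G.1 A.1.1 = -parity G.1 A.1.2
          then (W0s T ω (k A.1.1) (parity G.1 A.1.1) : ℂ) else 0) *
        timeIntegral G.1.length
          (fun j => ((((vs.drop j).map (phase w)).sum : ℝ) : ℂ) -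
            Complex.I * (κ (G.1.length - j) : ℂ)) τ

/-- The amplitude of the paired graph `G` in the Duhamel expansion at the kinetic time
`t lam⁻²`: the phases are formed with the modified dispersion relation of the box of side
`L`, and `κ = κ(lam)`. -/
def mainAmplitude {d : ℕ} (T : ℝ) (ω : UnitAddTorus (Fin d) → ℝ) (V : (Fin d → ℤ) → ℝ)
    (γ δ : ℝ) (φ : UnitAddTorus (Fin d) → ℂ) (t lam : ℝ) (L : ℕ+) (G : PairedGraph) : ℂ :=
  amplitude T ω V (modDisp (L : ℕ) T ω V lam) (kappa γ δ lam) lam φ (t * lam ^ (-2 : ℤ)) G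

end

end Kinetic

/-! In a leading graph the interactions come in consecutive pairs whose phases cancel when the
momenta respect the pairing (`IsLeading.phase_add`). As λ → 0 one has N₀ → ∞, so κ vanishes for all
indices up to 2m and the phases γ_j vanish in the even slices. The even durations therefore only
contribute the volume (τ - Σ s)^m / m! of a simplex, and the durations s of the odd slices remain
(`timeIntegral_eq`, `amplitude_eq`). At τ = tλ⁻² the prefactor λ^{2m} turns this weight into t^m /
m!, while ω^λ → ω at a rate that is uniform in L. So every leading amplitude converges to (-t)^m /
m! times an integral over all s ≥ 0 (`tendsto_amplitude`), provided that the momentum integrals have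
a majorant that is integrable in s and independent of λ and L.

The majorant is built by integrating out the lowest motive first. This turns the motive into a
collision integral, a function of the momentum of the pair to which it is attached
(`momentumIntegral_lossGraph`, `momentumIntegral_gainGraph`). The Fourier coefficients of a
collision of plane waves are products of three propagators. Hence ℓ³-dispersivity keeps the
collision in the class of functions e^{iτw} g, with g an absolutely convergent Fourier series, and
its mass decays like a sum of terms ⟨T ± s⟩^{-1-δ}, where the T are the oscillation times of the
weights (`phasedWiener_collision`). The integral of such a term over s does not depend on T, which
is what lets the bound pass through the induction over the motives (`exists_momentumBound`).

It remains to sum the limits over the motives attached to one pair. The six loss motives on a leg of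
parity σ multiply the weight of the pair by the integrand of ν at the time σs (`sum_lossGraph`). At
the root pair only the right leg, of parity 1, is available, and the integral over s > 0 produces ν;
as ν is even and the root pair carries the top momentum up to sign, ν can be moved into φ. At any
other pair the two legs, and the two orders of the gain vertices, supply both signs of the time, so
that s effectively runs over ℝ. By detailed balance loss minus gain is, up to a sign, the momentum
integral of D e^{isx} (e^{-x/T} - 1), where x is the energy defect; formally ∫ ds produces δ(x),
which kills the last factor (`integral_balance_eq_zero`). Since a leading graph determines its last
motive (`attachments_unique`), the first claim follows by induction, each motive at the root
replacing φ by φν. -/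

namespace Kinetic

/-! ### Symmetries of the Gibbs state -/

section Relabelling

variable {ι : Type} [Fintype ι]

/-- The sign of a relabelling of the modes on the basis vector with the occupied modes `A`. -/
noncomputable def relabelSign (π : Equiv.Perm ι) (A : Finset ι) : ℂ :=
  ∏ i ∈ A, ∏ j ∈ A,
    if Fintype.equivFin ι i < Fintype.equivFin ι j ∧
      ¬ Fintype.equivFin ι (π i) < Fintype.equivFin ι (π j) then -1 else 1

/-- The unitary implementing the relabelling `π` of the modes. -/
noncomputable def relabel [DecidableEq ι] (π : Equiv.Perm ι) : Matrix (Finset ι) (Finset ι) ℂ :=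
  Matrix.of fun A B => if A = B.map π.toEmbedding then relabelSign π B else 0

lemma relabelSign_sq (π : Equiv.Perm ι) (A : Finset ι) :
    relabelSign π A * relabelSign π A = 1 := by
  simp only [relabelSign, ← Finset.prod_mul_distrib]
  refine Finset.prod_eq_one fun i _ => Finset.prod_eq_one fun j _ => ?_
  split_ifs <;> norm_num

lemma star_relabelSign (π : Equiv.Perm ι) (A : Finset ι) :
    star (relabelSign π A) = relabelSign π A := by
  simp only [relabelSign, star_prod]
  refine Finset.prod_congr rfl fun i _ => Finset.prod_congr rfl fun j _ => ?_
  split_ifs <;> simp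

/-- The new mode `k` only adds the two ordered pairs it forms with each `j ∈ A`; one of them is an
inversion exactly when `π` reverses the order of `j` and `k`, that is, when exactly one of the two
Jordan-Wigner factors is -1. -/
lemma relabelSign_insert [DecidableEq ι] (π : Equiv.Perm ι) {k : ι} {A : Finset ι} (hk : k ∉ A) :
    relabelSign π (insert k A) = relabelSign π A *
      ((∏ j ∈ A, if Fintype.equivFin ι j < Fintype.equivFin ι k then -1 else 1) *
        ∏ j ∈ A, if Fintype.equivFin ι (π j) < Fintype.equivFin ι (π k) then -1 else 1) := by
  unfold relabelSign
  rw [Finset.prod_insert hk, Finset.prod_insert hk]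
  simp only [lt_self_iff_false, false_and, if_false, one_mul]
  rw [Finset.prod_congr rfl fun i _ => Finset.prod_insert hk, Finset.prod_mul_distrib,
    ← mul_assoc, ← Finset.prod_mul_distrib, mul_comm]
  congr 1
  rw [← Finset.prod_mul_distrib]
  refine Finset.prod_congr rfl fun j hj => ?_
  have hne : j ≠ k := fun h => hk (h ▸ hj)
  have h1 : Fintype.equivFin ι j ≠ Fintype.equivFin ι k := fun h =>
    hne ((Fintype.equivFin ι).injective h)
  have h2 : Fintype.equivFin ι (π j) ≠ Fintype.equivFin ι (π k) := fun h =>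
    hne (π.injective ((Fintype.equivFin ι).injective h))
  rcases lt_or_gt_of_ne h1 with h1 | h1 <;> rcases lt_or_gt_of_ne h2 with h2 | h2 <;>
    simp [h1, h2, h1.not_gt, h2.not_gt]

lemma modeAnnihilation_insert [DecidableEq ι] {k : ι} {A : Finset ι} (hk : k ∉ A) :
    modeAnnihilation k A (insert k A) =
      ∏ j ∈ A, if Fintype.equivFin ι j < Fintype.equivFin ι k then -1 else 1 := by
  simp only [modeAnnihilation, Matrix.of_apply, hk, not_false_eq_true, and_self, if_true]
  rw [Finset.prod_ite]
  simp

/-- The inversion sign in `relabel` is designed to compensate the change of the Jordan-Wigner string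
under the relabelling; a permutation of the basis vectors without signs would not intertwine the
annihilation operators. -/
lemma modeAnnihilation_mul_relabel [DecidableEq ι] (π : Equiv.Perm ι) (k : ι) :
    modeAnnihilation (π k) * relabel π = relabel π * modeAnnihilation k := by
  ext A B
  obtain ⟨A, rfl⟩ : ∃ A' : Finset ι, A = A'.map π.toEmbedding :=
    ⟨A.map π.symm.toEmbedding, by ext; simp [Finset.mem_map_equiv]⟩
  have hinj : ∀ C : Finset ι, A.map π.toEmbedding = C.map π.toEmbedding ↔ C = A := fun C =>
    ⟨fun h => (Finset.map_injective _ h).symm, fun h => by rw [h]⟩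
  have hL : (modeAnnihilation (π k) * relabel π) (A.map π.toEmbedding) B =
      modeAnnihilation (π k) (A.map π.toEmbedding) (B.map π.toEmbedding) * relabelSign π B := by
    simp [Matrix.mul_apply, relabel]
  have hR : (relabel π * modeAnnihilation k) (A.map π.toEmbedding) B =
      relabelSign π A * modeAnnihilation k A B := by
    simp [Matrix.mul_apply, relabel, hinj]
  rw [hL, hR]
  by_cases h : k ∉ A ∧ B = insert k A
  · obtain ⟨hk, rfl⟩ := h
    have hk' : π k ∉ A.map π.toEmbedding := by simpa using hk
    have h1 : (insert k A).map π.toEmbedding = insert (π k) (A.map π.toEmbedding) := by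
      rw [Finset.map_insert]; rfl
    rw [h1, modeAnnihilation_insert hk', modeAnnihilation_insert hk, relabelSign_insert π hk,
      Finset.prod_map]
    have h2 : (∏ j ∈ A, if Fintype.equivFin ι (π j) < Fintype.equivFin ι (π k) then (-1 : ℂ)
        else 1) * (∏ j ∈ A, if Fintype.equivFin ι (π j) < Fintype.equivFin ι (π k) then (-1 : ℂ)
        else 1) = 1 := by
      rw [← Finset.prod_mul_distrib]
      exact Finset.prod_eq_one fun j _ => by split_ifs <;> norm_num
    simp only [Equiv.coe_toEmbedding]
    linear_combination (relabelSign π A * ∏ j ∈ A,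
      if Fintype.equivFin ι j < Fintype.equivFin ι k then (-1 : ℂ) else 1) * h2
  · have h' : ¬ (π k ∉ A.map π.toEmbedding ∧
        B.map π.toEmbedding = insert (π k) (A.map π.toEmbedding)) := by
      rintro ⟨h1, h2⟩
      refine h ⟨by simpa using h1, Finset.map_injective π.toEmbedding ?_⟩
      rw [h2, Finset.map_insert]; rfl
    simp only [modeAnnihilation, Matrix.of_apply, if_neg h, if_neg h', zero_mul, mul_zero]

lemma relabel_mem_unitary [DecidableEq ι] (π : Equiv.Perm ι) :
    relabel π ∈ unitary (Matrix (Finset ι) (Finset ι) ℂ) := by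
  have h : (relabel π).conjTranspose * relabel π = 1 := by
    ext A B
    simp only [Matrix.mul_apply, Matrix.conjTranspose_apply, relabel, Matrix.of_apply]
    rw [Finset.sum_eq_single (B.map π.toEmbedding)]
    · by_cases hAB : A = B
      · subst hAB; simp [star_relabelSign, relabelSign_sq]
      · have : ¬ B.map π.toEmbedding = A.map π.toEmbedding := fun h =>
          hAB (Finset.map_injective _ h).symm
        rw [if_neg this, Matrix.one_apply_ne hAB]; simp
    · intro C _ hC; simp [hC]
    · simp
  rw [Unitary.mem_iff]
  exact ⟨h, mul_eq_one_comm.mp h⟩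

end Relabelling

/-! ### Fourier series of the potential, the Hamiltonian, and the modified dispersion relation -/

section Gas

variable {d : ℕ}

lemma norm_mFourier_apply (n : Fin d → ℤ) (k : UnitAddTorus (Fin d)) :
    ‖UnitAddTorus.mFourier n k‖ = 1 := by
  simp only [UnitAddTorus.mFourier, ContinuousMap.coe_mk, norm_prod, fourier_apply,
    Circle.norm_coe, Finset.prod_const_one]

lemma mFourier_apply_neg (n : Fin d → ℤ) (k : UnitAddTorus (Fin d)) :
    UnitAddTorus.mFourier n (-k) = UnitAddTorus.mFourier (-n) k := by
  simp [UnitAddTorus.mFourier, fourier_apply]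

lemma mFourier_add_apply (n : Fin d → ℤ) (k l : UnitAddTorus (Fin d)) :
    UnitAddTorus.mFourier n (k + l) = UnitAddTorus.mFourier n k * UnitAddTorus.mFourier n l := by
  simp [UnitAddTorus.mFourier, fourier_apply, Finset.prod_mul_distrib, AddCircle.toCircle_add]

lemma summable_norm_Vhat {V : (Fin d → ℤ) → ℝ} (hV : Summable V) (k : UnitAddTorus (Fin d)) :
    Summable fun x => ‖(V x : ℂ) * UnitAddTorus.mFourier (-x) k‖ := by
  simpa [norm_mul, norm_mFourier_apply] using hV.abs

/-- The real part in `Vhat` loses nothing: since V is even, the substitution x ↦ -x turns the series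
into its complex conjugate. -/
lemma Vhat_hasSum {V : (Fin d → ℤ) → ℝ} (hV : Summable V) (hV' : ∀ x, V (-x) = V x)
    (k : UnitAddTorus (Fin d)) :
    HasSum (fun x => (V x : ℂ) * UnitAddTorus.mFourier (-x) k) (Vhat V k : ℂ) := by
  have hs := (summable_norm_Vhat hV k).of_norm.hasSum
  have him : (starRingEnd ℂ) (∑' x, (V x : ℂ) * UnitAddTorus.mFourier (-x) k) =
      ∑' x, (V x : ℂ) * UnitAddTorus.mFourier (-x) k := by
    rw [Complex.conj_tsum, ← (Equiv.neg (Fin d → ℤ)).tsum_eq]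
    refine tsum_congr fun x => ?_
    simp [hV', UnitAddTorus.mFourier_neg]
  have : (Vhat V k : ℂ) = ∑' x, (V x : ℂ) * UnitAddTorus.mFourier (-x) k :=
    Complex.conj_eq_iff_re.mp him
  rw [this]
  exact hs

lemma Vhat_neg {V : (Fin d → ℤ) → ℝ} (hV' : ∀ x, V (-x) = V x) (k : UnitAddTorus (Fin d)) :
    Vhat V (-k) = Vhat V k := by
  unfold Vhat
  rw [← (Equiv.neg (Fin d → ℤ)).tsum_eq]
  simp only [Equiv.neg_apply, hV', neg_neg, mFourier_apply_neg]

lemma abs_Vhat_le {V : (Fin d → ℤ) → ℝ} (hV : Summable V) (k : UnitAddTorus (Fin d)) :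
    |Vhat V k| ≤ ∑' x, |V x| := by
  refine (Complex.abs_re_le_norm _).trans ((norm_tsum_le_tsum_norm (summable_norm_Vhat hV k)).trans
    (le_of_eq (tsum_congr fun x => ?_)))
  simp [norm_mFourier_apply]

lemma continuous_Vhat {V : (Fin d → ℤ) → ℝ} (hV : Summable V) : Continuous (Vhat V) := by
  refine Complex.continuous_re.comp (continuous_tsum (fun x => by fun_prop) hV.abs fun x k => ?_)
  simp [norm_mFourier_apply]

variable {L : ℕ} [NeZero L]

lemma dualPoint_neg (k : Fin d → ZMod L) : dualPoint (-k) = -dualPoint k := by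
  funext i; simp [dualPoint]

/-- Taking adjoints reverses the four operators of the interaction; the reversal of the names k₁, …,
k₄ undoes this, because V̂ is even. Self-adjointness gives the positivity of e^{-H/T}. -/
lemma hamiltonian_isHermitian (ω : UnitAddTorus (Fin d) → ℝ) {V : (Fin d → ℤ) → ℝ}
    (hV' : ∀ x, V (-x) = V x) (lam : ℝ) : (hamiltonian L ω V lam).IsHermitian := by
  unfold hamiltonian Matrix.IsHermitian
  rw [Matrix.conjTranspose_add, Matrix.conjTranspose_smul, Matrix.conjTranspose_smul]
  congr 1
  · congr 1
    · simp
    · simp [Matrix.conjTranspose_sum, Matrix.conjTranspose_smul, Matrix.conjTranspose_mul]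
  · congr 1
    · simp
    · simp only [Matrix.conjTranspose_sum, Matrix.conjTranspose_smul, Matrix.conjTranspose_mul,
        Matrix.conjTranspose_conjTranspose]
      have hswap : ∀ F : (Fin d → ZMod L) → (Fin d → ZMod L) → (Fin d → ZMod L) →
          (Fin d → ZMod L) → Matrix (Finset (Fin d → ZMod L)) (Finset (Fin d → ZMod L)) ℂ,
          ∑ k₁, ∑ k₂, ∑ k₃, ∑ k₄, F k₁ k₂ k₃ k₄ = ∑ k₁, ∑ k₂, ∑ k₃, ∑ k₄, F k₄ k₃ k₂ k₁ := by
        intro F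
        have e1 : ∀ F : (Fin d → ZMod L) → (Fin d → ZMod L) → (Fin d → ZMod L) →
          (Fin d → ZMod L) → Matrix (Finset (Fin d → ZMod L)) (Finset (Fin d → ZMod L)) ℂ,
          ∑ k₁, ∑ k₂, ∑ k₃, ∑ k₄, F k₁ k₂ k₃ k₄ =
            ∑ p : (Fin d → ZMod L) × (Fin d → ZMod L) × (Fin d → ZMod L) × (Fin d → ZMod L),
              F p.1 p.2.1 p.2.2.1 p.2.2.2 := by
          intro F; simp only [Fintype.sum_prod_type]
        rw [e1, e1 (fun k₁ k₂ k₃ k₄ => F k₄ k₃ k₂ k₁)]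
        exact Fintype.sum_equiv ⟨fun p => (p.2.2.2, p.2.2.1, p.2.1, p.1),
          fun p => (p.2.2.2, p.2.2.1, p.2.1, p.1), fun _ => rfl, fun _ => rfl⟩ _ _ fun _ => rfl
      rw [hswap]
      refine Finset.sum_congr rfl fun k₁ _ => Finset.sum_congr rfl fun k₂ _ =>
        Finset.sum_congr rfl fun k₃ _ => Finset.sum_congr rfl fun k₄ _ => ?_
      have hc : (k₄ + k₃ - k₂ - k₁ = 0) ↔ (k₁ + k₂ - k₃ - k₄ = 0) := by
        rw [← neg_eq_zero]
        have : -(k₄ + k₃ - k₂ - k₁) = k₁ + k₂ - k₃ - k₄ := by abel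
        rw [this]
      have hd : Vhat V (dualPoint (k₃ - k₂)) = Vhat V (dualPoint (k₂ - k₃)) := by
        rw [← neg_sub, dualPoint_neg, Vhat_neg hV']
      simp only [hc, hd, star_mul', Matrix.mul_assoc]
      congr 1
      split_ifs <;> simp

/-- Operators on the Fock space of the box of side `L`. -/
abbrev FockMatrix (d L : ℕ) := Matrix (Finset (Fin d → ZMod L)) (Finset (Fin d → ZMod L)) ℂ

/-- Conjugation with the reflection `k ↦ -k` of the modes. -/
noncomputable def reflection (d L : ℕ) [NeZero L] :
    unitary (Matrix (Finset (Fin d → ZMod L)) (Finset (Fin d → ZMod L)) ℂ) :=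
  ⟨relabel (Equiv.neg (Fin d → ZMod L)), relabel_mem_unitary _⟩

lemma conj_annihilation (k : Fin d → ZMod L) :
    Unitary.conjStarAlgAut ℂ _ (reflection d L) (annihilation k) = annihilation (-k) := by
  rw [Unitary.conjStarAlgAut_apply]
  have h := modeAnnihilation_mul_relabel (Equiv.neg (Fin d → ZMod L)) k
  have hu : (reflection d L : FockMatrix d L) * star (reflection d L : FockMatrix d L) = 1 :=
    Unitary.mul_star_self_of_mem (reflection d L).2
  have h' : (reflection d L : FockMatrix d L) * annihilation k =
      annihilation (-k) * (reflection d L : FockMatrix d L) := by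
    simp only [annihilation, Matrix.mul_smul, Matrix.smul_mul]
    congr 1
    exact h.symm
  rw [h', mul_assoc, hu, mul_one]

lemma conj_annihilation_conjTranspose (k : Fin d → ZMod L) :
    Unitary.conjStarAlgAut ℂ _ (reflection d L) (annihilation k).conjTranspose =
      (annihilation (-k)).conjTranspose := by
  rw [← Matrix.star_eq_conjTranspose, map_star, conj_annihilation, Matrix.star_eq_conjTranspose]

lemma conj_hamiltonian {ω : UnitAddTorus (Fin d) → ℝ} (hω : ∀ k, ω (-k) = ω k)
    {V : (Fin d → ℤ) → ℝ} (hV' : ∀ x, V (-x) = V x) (lam : ℝ) :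
    Unitary.conjStarAlgAut ℂ _ (reflection d L) (hamiltonian L ω V lam) =
      hamiltonian L ω V lam := by
  unfold hamiltonian
  simp only [map_add, map_smul, map_sum, map_mul, conj_annihilation,
    conj_annihilation_conjTranspose]
  refine congrArg₂ (· + ·) (congrArg _ ?_) (congrArg _ ?_)
  · refine Fintype.sum_equiv (Equiv.neg (Fin d → ZMod L)) _ _ fun k => ?_
    simp only [Equiv.neg_apply, dualPoint_neg, hω]
  · refine Fintype.sum_equiv (Equiv.neg (Fin d → ZMod L)) _ _ fun k₁ => ?_
    refine Fintype.sum_equiv (Equiv.neg (Fin d → ZMod L)) _ _ fun k₂ => ?_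
    refine Fintype.sum_equiv (Equiv.neg (Fin d → ZMod L)) _ _ fun k₃ => ?_
    refine Fintype.sum_equiv (Equiv.neg (Fin d → ZMod L)) _ _ fun k₄ => ?_
    have hc : (-k₁ + -k₂ - -k₃ - -k₄ = 0) ↔ (k₁ + k₂ - k₃ - k₄ = 0) := by
      rw [← neg_eq_zero]
      have : -(-k₁ + -k₂ - -k₃ - -k₄) = k₁ + k₂ - k₃ - k₄ := by abel
      rw [this]
    have hd : Vhat V (dualPoint (-k₂ - -k₃)) = Vhat V (dualPoint (k₂ - k₃)) := by
      have : -k₂ - -k₃ = -(k₂ - k₃) := by abel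
      rw [this, dualPoint_neg, Vhat_neg hV']
    simp only [Equiv.neg_apply, hc, hd]

/-- The reflection of the modes is implemented by a unitary that commutes with H, and the trace is
invariant under conjugation. Through this lemma ω^λ is even, on which all the phase cancellations
rest. -/
lemma gibbsW_neg (T : ℝ) {ω : UnitAddTorus (Fin d) → ℝ} (hω : ∀ k, ω (-k) = ω k)
    {V : (Fin d → ℤ) → ℝ} (hV' : ∀ x, V (-x) = V x) (lam : ℝ) (k : Fin d → ZMod L) :
    gibbsW L T ω V lam (-k) = gibbsW L T ω V lam k := by
  unfold gibbsW gibbs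
  set X := -((1 / T : ℝ) : ℂ) • hamiltonian L ω V lam with hX
  have hcX : Unitary.conjStarAlgAut ℂ _ (reflection d L) X = X := by
    rw [hX, map_smul, conj_hamiltonian hω hV']
  have hsu : star (reflection d L : FockMatrix d L) * (reflection d L : FockMatrix d L) = 1 :=
    Unitary.star_mul_self_of_mem (reflection d L).2
  have hus : (reflection d L : FockMatrix d L) * star (reflection d L : FockMatrix d L) = 1 :=
    Unitary.mul_star_self_of_mem (reflection d L).2
  have hinv : (reflection d L : FockMatrix d L)⁻¹ = star (reflection d L : FockMatrix d L) :=
    Matrix.inv_eq_right_inv hus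
  have hE : Unitary.conjStarAlgAut ℂ _ (reflection d L) (NormedSpace.exp X) =
      NormedSpace.exp X := by
    conv_rhs => rw [← hcX]
    rw [Unitary.conjStarAlgAut_apply, Unitary.conjStarAlgAut_apply, ← hinv]
    exact (Matrix.exp_conj _ X (IsUnit.of_mul_eq_one _ hus)).symm
  have htr : ∀ Y : Matrix (Finset (Fin d → ZMod L)) (Finset (Fin d → ZMod L)) ℂ,
      (Unitary.conjStarAlgAut ℂ _ (reflection d L) Y).trace = Y.trace := by
    intro Y
    rw [Unitary.conjStarAlgAut_apply, Matrix.trace_mul_comm, ← mul_assoc, hsu, one_mul]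
  have h := htr (NormedSpace.exp X * ((annihilation k).conjTranspose * annihilation k))
  rw [map_mul, hE, map_mul, conj_annihilation, conj_annihilation_conjTranspose] at h
  rw [h]

lemma modeAnnihilation_conjTranspose_mul_self {ι : Type} [Fintype ι] [DecidableEq ι] (k : ι) :
    (modeAnnihilation k).conjTranspose * modeAnnihilation k =
      Matrix.diagonal fun A : Finset ι => if k ∈ A then (1 : ℂ) else 0 := by
  ext A B
  simp only [Matrix.mul_apply, Matrix.conjTranspose_apply]
  rw [Finset.sum_eq_single (B.erase k)]
  · by_cases hB : k ∈ B
    · have hB' : B = insert k (B.erase k) := (Finset.insert_erase hB).symm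
      have hB2 : modeAnnihilation k (B.erase k) B =
          (-1) ^ ((B.erase k).filter fun j =>
            Fintype.equivFin ι j < Fintype.equivFin ι k).card := by
        simp only [modeAnnihilation, Matrix.of_apply]
        rw [if_pos ⟨Finset.notMem_erase k B, hB'⟩]
      by_cases hAB : A = B
      · subst hAB
        rw [hB2, Matrix.diagonal_apply_eq, if_pos hB]
        simp [← mul_pow]
      · rw [Matrix.diagonal_apply_ne _ hAB]
        have : modeAnnihilation k (B.erase k) A = 0 := by
          simp only [modeAnnihilation, Matrix.of_apply]
          rw [if_neg]
          rintro ⟨_, h⟩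
          exact hAB (h.trans hB'.symm)
        simp [this]
    · have hz : modeAnnihilation k (B.erase k) B = 0 := by
        simp only [modeAnnihilation, Matrix.of_apply]
        rw [if_neg]
        rintro ⟨_, h⟩
        exact hB (h ▸ Finset.mem_insert_self _ _)
      rw [hz, mul_zero]
      by_cases hAB : A = B
      · subst hAB; simp [hB]
      · rw [Matrix.diagonal_apply_ne _ hAB]
  · intro C _ hC
    have : modeAnnihilation k C B = 0 := by
      simp only [modeAnnihilation, Matrix.of_apply]
      rw [if_neg]
      rintro ⟨h1, rfl⟩
      exact hC (Finset.erase_insert h1).symm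
    rw [this, mul_zero]
  · simp

/-- This is the Pauli principle: W averages the occupation numbers 0 and 1 with the diagonal entries
of e^{-H/T} as weights, and these are nonnegative because e^X = (e^{X/2})* e^{X/2}. -/
lemma abs_gibbsW_le (T : ℝ) (ω : UnitAddTorus (Fin d) → ℝ)
    {V : (Fin d → ℤ) → ℝ} (hV' : ∀ x, V (-x) = V x) (lam : ℝ) (k : Fin d → ZMod L) :
    |gibbsW L T ω V lam k| ≤ 1 := by
  unfold gibbsW gibbs
  set X := -((1 / T : ℝ) : ℂ) • hamiltonian L ω V lam with hX
  have hXh : (((1 / 2 : ℝ) : ℂ) • X).IsHermitian := by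
    rw [hX, smul_smul, Matrix.IsHermitian, Matrix.conjTranspose_smul,
      (hamiltonian_isHermitian ω hV' lam).eq]
    congr 1
    simp
  have hexp : NormedSpace.exp X =
      (NormedSpace.exp (((1 / 2 : ℝ) : ℂ) • X)).conjTranspose *
        NormedSpace.exp (((1 / 2 : ℝ) : ℂ) • X) := by
    rw [hXh.exp.eq, ← Matrix.exp_add_of_commute _ _ (Commute.refl _), ← add_smul]
    norm_num
  open scoped ComplexOrder in
  have hdiag : ∀ A, 0 ≤ (NormedSpace.exp X) A A := by
    intro A
    rw [hexp]
    exact (Matrix.posSemidef_conjTranspose_mul_self _).diag_nonneg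
  open scoped ComplexOrder in
  have hre : ∀ A, 0 ≤ ((NormedSpace.exp X) A A).re ∧ ((NormedSpace.exp X) A A).im = 0 := fun A =>
    ⟨(Complex.le_def.mp (hdiag A)).1, (Complex.le_def.mp (hdiag A)).2.symm⟩
  have hL : (0 : ℝ) < (L : ℝ) ^ d := by
    have : 0 < L := Nat.pos_of_ne_zero (NeZero.ne L)
    positivity
  have hnum : (annihilation k).conjTranspose * annihilation k =
      (((L : ℝ) ^ d : ℝ) : ℂ) • Matrix.diagonal
        fun A : Finset (Fin d → ZMod L) => if k ∈ A then (1 : ℂ) else 0 := by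
    rw [annihilation, Matrix.conjTranspose_smul, Matrix.smul_mul, Matrix.mul_smul, smul_smul,
      modeAnnihilation_conjTranspose_mul_self]
    congr 1
    rw [Complex.star_def, Complex.conj_ofReal, ← Complex.ofReal_mul,
      Real.mul_self_sqrt hL.le]
  set Z : ℝ := ∑ A, ((NormedSpace.exp X) A A).re with hZ
  set N : ℝ := ∑ A, if k ∈ A then ((NormedSpace.exp X) A A).re else 0 with hN
  have hof : ∀ A, (NormedSpace.exp X) A A = ((((NormedSpace.exp X) A A).re : ℝ) : ℂ) := fun A =>
    Complex.ext (by simp) (by simp [(hre A).2])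
  have htrZ : (NormedSpace.exp X).trace = (Z : ℂ) := by
    rw [Matrix.trace, hZ]
    push_cast
    exact Finset.sum_congr rfl fun A _ => hof A
  have htrN : (NormedSpace.exp X * ((annihilation k).conjTranspose * annihilation k)).trace =
      (((L : ℝ) ^ d * N : ℝ) : ℂ) := by
    rw [hnum, Matrix.mul_smul, Matrix.trace_smul, smul_eq_mul, Complex.ofReal_mul]
    congr 1
    rw [Matrix.trace, hN]
    push_cast
    refine Finset.sum_congr rfl fun A _ => ?_
    rw [Matrix.diag_apply, Matrix.mul_diagonal]
    split_ifs
    · rw [mul_one]; exact hof A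
    · simp
  rw [htrZ, htrN, ← Complex.ofReal_div, Complex.ofReal_re]
  have hN0 : 0 ≤ N := Finset.sum_nonneg fun A _ => by
    split_ifs
    exacts [(hre A).1, le_rfl]
  have hNZ : N ≤ Z := Finset.sum_le_sum fun A _ => by
    split_ifs
    exacts [le_rfl, (hre A).1]
  rw [show (L : ℝ) ^ d * N / Z / (L : ℝ) ^ d = N / Z by field_simp, abs_of_nonneg
    (div_nonneg hN0 (hN0.trans hNZ))]
  exact div_le_one_of_le₀ hNZ (hN0.trans hNZ)

lemma modDisp_neg (T : ℝ) {ω : UnitAddTorus (Fin d) → ℝ} (hω : ∀ k, ω (-k) = ω k)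
    {V : (Fin d → ℤ) → ℝ} (hV' : ∀ x, V (-x) = V x) (lam : ℝ) (k : UnitAddTorus (Fin d)) :
    modDisp L T ω V lam (-k) = modDisp L T ω V lam k := by
  unfold modDisp
  rw [hω]
  congr 3
  refine Fintype.sum_equiv (Equiv.neg (Fin d → ZMod L)) _ _ fun k₂ => ?_
  rw [Equiv.neg_apply, gibbsW_neg T hω hV', dualPoint_neg,
    show k - -dualPoint k₂ = -(-k - dualPoint k₂) by abel, Vhat_neg hV']

lemma continuous_modDisp (T : ℝ) {ω : UnitAddTorus (Fin d) → ℝ} (hω : Continuous ω)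
    {V : (Fin d → ℤ) → ℝ} (hV : Summable V) (lam : ℝ) : Continuous (modDisp L T ω V lam) := by
  unfold modDisp
  have := continuous_Vhat hV
  fun_prop

/-- Each of the L^d terms of the average is at most 2 Σ|V|. The absence of L from the bound is the
source of the uniformity in the volume. -/
lemma abs_modDisp_sub_le (T : ℝ) (ω : UnitAddTorus (Fin d) → ℝ) {V : (Fin d → ℤ) → ℝ}
    (hV : Summable V) (hV' : ∀ x, V (-x) = V x) (lam : ℝ) (k : UnitAddTorus (Fin d)) :
    |modDisp L T ω V lam k - ω k| ≤ |lam| * (2 * ∑' x, |V x|) := by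
  unfold modDisp
  rw [add_sub_cancel_left, abs_mul]
  refine mul_le_mul_of_nonneg_left ?_ (abs_nonneg _)
  have hL : (0 : ℝ) < (L : ℝ) ^ d := by
    have : 0 < L := Nat.pos_of_ne_zero (NeZero.ne L)
    positivity
  rw [abs_mul, abs_of_pos (inv_pos.mpr hL), inv_mul_le_iff₀ hL]
  refine (Finset.abs_sum_le_sum_abs _ _).trans ((Finset.sum_le_card_nsmul _ _
    (2 * ∑' x, |V x|) fun k₂ _ => ?_).trans ?_)
  · rw [abs_mul, two_mul]
    have h1 := abs_gibbsW_le T ω hV' lam k₂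
    have h2 := abs_Vhat_le hV 0
    have h3 := abs_Vhat_le hV (k - dualPoint k₂)
    have h4 := abs_sub (Vhat V 0) (Vhat V (k - dualPoint k₂))
    nlinarith [abs_nonneg (Vhat V 0 - Vhat V (k - dualPoint k₂)),
      abs_nonneg (gibbsW L T ω V lam k₂)]
  · simp [ZMod.card]

lemma modDisp_zero (T : ℝ) (ω : UnitAddTorus (Fin d) → ℝ) (V : (Fin d → ℤ) → ℝ) :
    modDisp L T ω V 0 = ω := by
  funext k; simp [modDisp]

end Gas

/-! ### The Haar measure of the torus -/

lemma volume_unitAddCircle : (volume : Measure UnitAddCircle) = AddCircle.haarAddCircle := by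
  rw [AddCircle.volume_eq_smul_haarAddCircle]; simp

instance isProbabilityMeasure_unitAddCircle :
    IsProbabilityMeasure (volume : Measure UnitAddCircle) := by
  rw [volume_unitAddCircle]; infer_instance

instance isNegInvariant_unitAddCircle : (volume : Measure UnitAddCircle).IsNegInvariant := by
  rw [volume_unitAddCircle]; infer_instance

instance borelSpace_torus_prod {d : ℕ} :
    BorelSpace (UnitAddTorus (Fin d) × UnitAddTorus (Fin d)) := Prod.borelSpace

instance measurableNeg_torus_prod {d : ℕ} :
    MeasurableNeg (UnitAddTorus (Fin d) × UnitAddTorus (Fin d)) :=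
  ⟨measurable_fst.neg.prodMk measurable_snd.neg⟩

instance isNegInvariant_torus_prod {d : ℕ} :
    (volume : Measure (UnitAddTorus (Fin d) × UnitAddTorus (Fin d))).IsNegInvariant :=
  ⟨((Measure.measurePreserving_neg (volume : Measure (UnitAddTorus (Fin d)))).prod
    (Measure.measurePreserving_neg (volume : Measure (UnitAddTorus (Fin d))))).map_eq⟩

lemma mFourierCoeff_eq {d : ℕ} (f : UnitAddTorus (Fin d) → ℂ) (n : Fin d → ℤ) :
    UnitAddTorus.mFourierCoeff f n = ∫ t, UnitAddTorus.mFourier (-n) t * f t := by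
  rw [volume_pi, volume_unitAddCircle]; rfl

/-! ### Absolutely convergent expansions in characters -/

section AbsSum

variable {Γ Γ' X X' : Type*}

/-- `F` is the sum of an absolutely convergent series of the functions `χ a`, whose coefficients
have the total mass `M` at most. -/
def AbsSum (χ : Γ → X → ℂ) (F : X → ℂ) (M : ℝ) : Prop :=
  ∃ (ι : Type) (_ : Countable ι) (c : ι → ℂ) (a : ι → Γ), Summable (fun i => ‖c i‖) ∧
    ∑' i, ‖c i‖ ≤ M ∧ ∀ x, HasSum (fun i => c i * χ (a i) x) (F x)

variable {χ : Γ → X → ℂ} {χ' : Γ' → X' → ℂ} {F G : X → ℂ} {M N : ℝ}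

lemma AbsSum.nonneg (h : AbsSum χ F M) : 0 ≤ M := by
  obtain ⟨ι, _, c, a, _, hM, _⟩ := h
  exact (tsum_nonneg fun i => norm_nonneg _).trans hM

lemma AbsSum.mono (h : AbsSum χ F M) (hMN : M ≤ N) : AbsSum χ F N := by
  obtain ⟨ι, hι, c, a, hs, hM, hF⟩ := h
  exact ⟨ι, hι, c, a, hs, hM.trans hMN, hF⟩

lemma AbsSum.norm_le (hχ : ∀ a x, ‖χ a x‖ ≤ 1) (h : AbsSum χ F M) (x : X) : ‖F x‖ ≤ M := by
  obtain ⟨ι, _, c, a, hs, hM, hF⟩ := h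
  have hle : ∀ i, ‖c i * χ (a i) x‖ ≤ ‖c i‖ := fun i => by
    rw [norm_mul]; exact mul_le_of_le_one_right (norm_nonneg _) (hχ _ _)
  have hs' : Summable fun i => ‖c i * χ (a i) x‖ :=
    Summable.of_nonneg_of_le (fun _ => norm_nonneg _) hle hs
  rw [← (hF x).tsum_eq]
  exact (norm_tsum_le_tsum_norm hs').trans ((hs'.tsum_le_tsum hle hs).trans hM)

lemma AbsSum.continuous [TopologicalSpace X] (hχ : ∀ a x, ‖χ a x‖ ≤ 1)
    (hc : ∀ a, Continuous (χ a)) (h : AbsSum χ F M) : Continuous F := by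
  obtain ⟨ι, _, c, a, hs, _, hF⟩ := h
  have : F = fun x => ∑' i, c i * χ (a i) x := funext fun x => (hF x).tsum_eq.symm
  rw [this]
  refine continuous_tsum (fun i => continuous_const.mul (hc _)) hs fun i x => ?_
  rw [norm_mul]; exact mul_le_of_le_one_right (norm_nonneg _) (hχ _ _)

/-- The product of two series is indexed by pairs, and products of characters are characters: this
is the Banach algebra property of the Wiener algebra. -/
lemma AbsSum.mul [Add Γ] (hχ : ∀ a x, ‖χ a x‖ ≤ 1) (hadd : ∀ a b x, χ (a + b) x = χ a x * χ b x)
    (hF : AbsSum χ F M) (hG : AbsSum χ G N) : AbsSum χ (fun x => F x * G x) (M * N) := by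
  have hM0 := hF.nonneg
  obtain ⟨ι, _, c, a, hs, hM, hF⟩ := hF
  obtain ⟨κ, _, e, b, ht, hN, hG⟩ := hG
  refine ⟨ι × κ, inferInstance, fun p => c p.1 * e p.2, fun p => a p.1 + b p.2, ?_, ?_, ?_⟩
  · simpa only [norm_mul] using hs.mul_of_nonneg ht (fun _ => norm_nonneg _) fun _ => norm_nonneg _
  · simp only [norm_mul]
    rw [← hs.tsum_mul_tsum ht
      (hs.mul_of_nonneg ht (fun _ => norm_nonneg _) fun _ => norm_nonneg _)]
    exact mul_le_mul hM hN (tsum_nonneg fun _ => norm_nonneg _) hM0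
  · intro x
    have hle : ∀ i, ‖c i * χ (a i) x‖ ≤ ‖c i‖ := fun i => by
      rw [norm_mul]; exact mul_le_of_le_one_right (norm_nonneg _) (hχ _ _)
    have hle' : ∀ i, ‖e i * χ (b i) x‖ ≤ ‖e i‖ := fun i => by
      rw [norm_mul]; exact mul_le_of_le_one_right (norm_nonneg _) (hχ _ _)
    have h1 := Summable.of_nonneg_of_le (fun _ => norm_nonneg _) hle hs
    have h2 := Summable.of_nonneg_of_le (fun _ => norm_nonneg _) hle' ht
    have h3 := summable_mul_of_summable_norm h1 h2
    have h4 := HasSum.mul (hF x) (hG x) h3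
    have h5 : (fun p : ι × κ => c p.1 * e p.2 * χ (a p.1 + b p.2) x) =
        fun p => c p.1 * χ (a p.1) x * (e p.2 * χ (b p.2) x) := by
      funext p; rw [hadd]; ring
    rw [h5]
    exact h4

/-- A homomorphism such as (k₂, k₃, k₄) ↦ k₂ - k₃ pulls characters back to characters; this lifts
functions of one momentum to functions of three. -/
lemma AbsSum.comp (φ : X' → X) (m : Γ → Γ') (h : ∀ a x, χ' (m a) x = χ a (φ x))
    (hF : AbsSum χ F M) : AbsSum χ' (fun x => F (φ x)) M := by
  obtain ⟨ι, hι, c, a, hs, hM, hF⟩ := hF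
  exact ⟨ι, hι, c, fun i => m (a i), hs, hM, fun x => by simpa only [h] using hF (φ x)⟩

lemma absSum_one [Zero Γ] (h : ∀ x, χ 0 x = 1) : AbsSum χ (fun _ => 1) 1 :=
  ⟨Unit, inferInstance, fun _ => 1, fun _ => 0, (hasSum_fintype _).summable, by simp,
    fun x => by simp [h]⟩

/-- An absolutely convergent superposition of functions of uniformly bounded mass: the double series
is rearranged into a single one over a sigma type. -/
lemma absSum_of_hasSum {ι : Type} [Countable ι] {c : ι → ℂ} (hc : Summable fun i => ‖c i‖)
    {f : ι → X → ℂ} {B : ℝ} (hf : ∀ i, AbsSum χ (f i) B) (hχ : ∀ a x, ‖χ a x‖ ≤ 1)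
    (hF : ∀ x, HasSum (fun i => c i * f i x) (F x)) : AbsSum χ F ((∑' i, ‖c i‖) * B) := by
  choose κ hκ e a hs hB hfs using hf
  have hrow : ∀ i, Summable fun j => ‖c i * e i j‖ := fun i => by
    simpa only [norm_mul] using (hs i).mul_left ‖c i‖
  have hle : ∀ i, ∑' j, ‖c i * e i j‖ ≤ ‖c i‖ * B := fun i => by
    simp only [norm_mul, tsum_mul_left]
    exact mul_le_mul_of_nonneg_left (hB i) (norm_nonneg _)
  have hsum : Summable fun p : (i : ι) × κ i => ‖c p.1 * e p.1 p.2‖ := by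
    rw [summable_sigma_of_nonneg fun _ => norm_nonneg _]
    exact ⟨hrow, Summable.of_nonneg_of_le (fun i => tsum_nonneg fun _ => norm_nonneg _) hle
      (hc.mul_right B)⟩
  refine ⟨(i : ι) × κ i, inferInstance, fun p => c p.1 * e p.1 p.2, fun p => a p.1 p.2, hsum,
    ?_, fun x => ?_⟩
  · rw [hsum.tsum_sigma' hrow, ← tsum_mul_right]
    exact Summable.tsum_le_tsum hle (Summable.of_nonneg_of_le
      (fun i => tsum_nonneg fun _ => norm_nonneg _) hle (hc.mul_right B)) (hc.mul_right B)
  · have hsx : Summable fun p : (i : ι) × κ i => c p.1 * e p.1 p.2 * χ (a p.1 p.2) x := by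
      refine Summable.of_norm (Summable.of_nonneg_of_le (fun _ => norm_nonneg _) (fun p => ?_) hsum)
      rw [norm_mul]; exact mul_le_of_le_one_right (norm_nonneg _) (hχ _ _)
    have h1 : HasSum (fun i => c i * f i x) (∑' p : (i : ι) × κ i,
        c p.1 * e p.1 p.2 * χ (a p.1 p.2) x) :=
      hsx.hasSum.sigma fun i => by simpa only [mul_assoc] using (hfs i x).mul_left (c i)
    rw [(hF x).unique h1]
    exact hsx.hasSum

end AbsSum

/-! ### The Wiener class with a phase, and the collision kernel -/

section Wiener

variable {d : ℕ}

/-- The characters of `𝕋^d × 𝕋^d × 𝕋^d`. -/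
noncomputable def tripleChar (a : (Fin d → ℤ) × (Fin d → ℤ) × (Fin d → ℤ))
    (k : UnitAddTorus (Fin d) × UnitAddTorus (Fin d) × UnitAddTorus (Fin d)) : ℂ :=
  UnitAddTorus.mFourier a.1 k.1 * UnitAddTorus.mFourier a.2.1 k.2.1 *
    UnitAddTorus.mFourier a.2.2 k.2.2

/-- Functions with an absolutely convergent Fourier series of mass `M` at most. -/
def WienerBound (g : UnitAddTorus (Fin d) → ℂ) (M : ℝ) : Prop :=
  AbsSum (fun (a : Fin d → ℤ) (k : UnitAddTorus (Fin d)) => UnitAddTorus.mFourier a k) g M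

/-- Functions `e^{i τ w} g`, where `g` has an absolutely convergent Fourier series. -/
def PhasedWiener (w : UnitAddTorus (Fin d) → ℝ) (τ : ℝ) (h : UnitAddTorus (Fin d) → ℂ) (M : ℝ) :
    Prop :=
  ∃ g, WienerBound g M ∧ ∀ k, h k = Complex.exp (Complex.I * τ * w k) * g k

/-- An even continuous dispersion relation whose propagator decays in `ℓ³`. -/
structure Dispersive (C δ : ℝ) (w : UnitAddTorus (Fin d) → ℝ) : Prop where
  continuous : Continuous w
  even : ∀ k, w (-k) = w k
  summable : ∀ t, Summable fun x => ‖propagator w t x‖ ^ 3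
  bound : ∀ t, ∑' x, ‖propagator w t x‖ ^ 3 ≤ C * japanese t ^ (-1 - δ)

lemma mFourier_zero_apply (k : UnitAddTorus (Fin d)) : UnitAddTorus.mFourier 0 k = 1 := by
  simp [UnitAddTorus.mFourier_zero]

lemma norm_tripleChar_le (a k) : ‖tripleChar (d := d) a k‖ ≤ 1 := by
  simp [tripleChar, norm_mFourier_apply]

lemma tripleChar_add (a b k) :
    tripleChar (d := d) (a + b) k = tripleChar a k * tripleChar b k := by
  simp only [tripleChar, Prod.fst_add, Prod.snd_add, UnitAddTorus.mFourier_add]; ring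

lemma norm_exp_I_mul_mul (a b : ℝ) : ‖Complex.exp (Complex.I * a * b)‖ = 1 := by
  rw [mul_assoc, ← Complex.ofReal_mul, mul_comm, Complex.norm_exp_ofReal_mul_I]

lemma WienerBound.continuous {g : UnitAddTorus (Fin d) → ℂ} {M : ℝ} (h : WienerBound g M) :
    Continuous g :=
  AbsSum.continuous (fun _ _ => (norm_mFourier_apply _ _).le) (fun _ => by fun_prop) h

lemma WienerBound.mul {f g : UnitAddTorus (Fin d) → ℂ} {M N : ℝ} (hf : WienerBound f M)
    (hg : WienerBound g N) : WienerBound (fun k => f k * g k) (M * N) :=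
  AbsSum.mul (fun _ _ => (norm_mFourier_apply _ _).le)
    (fun _ _ _ => UnitAddTorus.mFourier_add) hf hg

variable {w : UnitAddTorus (Fin d) → ℝ} {τ τ' M N : ℝ} {h h' : UnitAddTorus (Fin d) → ℂ}

lemma PhasedWiener.continuous (hw : Continuous w) (hh : PhasedWiener w τ h M) : Continuous h := by
  obtain ⟨g, hg, he⟩ := hh
  have hgc := hg.continuous
  rw [funext he]
  fun_prop

lemma PhasedWiener.norm_le (hh : PhasedWiener w τ h M) (k) : ‖h k‖ ≤ M := by
  obtain ⟨g, hg, he⟩ := hh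
  rw [he, norm_mul, norm_exp_I_mul_mul, one_mul]
  exact AbsSum.norm_le (fun _ _ => (norm_mFourier_apply _ _).le) hg k

lemma PhasedWiener.nonneg (hh : PhasedWiener w τ h M) : 0 ≤ M := by
  obtain ⟨g, hg, he⟩ := hh
  exact AbsSum.nonneg hg

/-- Oscillation times add under multiplication. This is how the time of a pair accumulates when a
loss motive multiplies its weight by a collision. -/
lemma PhasedWiener.mul (hh : PhasedWiener w τ h M) (hh' : PhasedWiener w τ' h' N) :
    PhasedWiener w (τ + τ') (fun k => h k * h' k) (M * N) := by
  obtain ⟨g, hg, he⟩ := hh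
  obtain ⟨g', hg', he'⟩ := hh'
  refine ⟨_, hg.mul hg', fun k => ?_⟩
  simp only [he, he']
  push_cast
  rw [mul_add, add_mul, Complex.exp_add]
  ring

lemma WienerBound.phased (w : UnitAddTorus (Fin d) → ℝ) (hh : WienerBound h M) :
    PhasedWiener w 0 h M :=
  ⟨h, hh, fun k => by simp⟩

lemma wienerBound_one : WienerBound (fun _ : UnitAddTorus (Fin d) => (1 : ℂ)) 1 :=
  absSum_one mFourier_zero_apply

/-- A plane wave times a phase. -/
noncomputable def wave (w : UnitAddTorus (Fin d) → ℝ) (τ : ℝ) (a : Fin d → ℤ)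
    (k : UnitAddTorus (Fin d)) : ℂ :=
  Complex.exp (Complex.I * τ * w k) * UnitAddTorus.mFourier a k

lemma norm_wave (w : UnitAddTorus (Fin d) → ℝ) (τ : ℝ) (a k) : ‖wave w τ a k‖ = 1 := by
  rw [wave, norm_mul, norm_exp_I_mul_mul, norm_mFourier_apply, one_mul]

/-- The propagator is defined with e^{-itw} and the wave with e^{+iτw}, whence the time -τ. -/
lemma integral_mFourier_mul_wave (w : UnitAddTorus (Fin d) → ℝ) (τ : ℝ) (a x : Fin d → ℤ) :
    ∫ k, UnitAddTorus.mFourier x k * wave w τ a k = propagator w (-τ) (a + x) := by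
  unfold propagator wave
  refine integral_congr_ae (Eventually.of_forall fun k => ?_)
  simp only [UnitAddTorus.mFourier_add]
  rw [show -(Complex.I * ((-τ : ℝ) : ℂ) * (w k : ℂ)) = Complex.I * τ * w k by push_cast; ring]
  ring

lemma continuous_wave (hw : Continuous w) (τ : ℝ) (a) : Continuous (wave w τ a) := by
  unfold wave; fun_prop

lemma integrable_of_continuous_torus {d' : Type*} [TopologicalSpace d'] [CompactSpace d']
    [MeasurableSpace d'] [OpensMeasurableSpace d'] {μ : Measure d'} [IsFiniteMeasure μ]
    {f : d' → ℂ} [SecondCountableTopology d'] (hf : Continuous f) : Integrable f μ := by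
  obtain ⟨B, hB⟩ := (isCompact_range hf).isBounded.exists_norm_le
  exact Integrable.of_bound hf.aestronglyMeasurable B
    (Eventually.of_forall fun x => hB _ ⟨x, rfl⟩)

/-- A pointwise substitute for Hölder's inequality: it bounds the sum of a product of three
propagators by three ℓ³ sums. It follows from a³ + b³ + c³ - 3abc = ½ (a + b + c)((a - b)² + (b -
c)² + (a - c)²). -/
lemma mul_mul_le_add_cubes {a b c : ℝ} (ha : 0 ≤ a) (hb : 0 ≤ b) (hc : 0 ≤ c) :
    a * b * c ≤ a ^ 3 + b ^ 3 + c ^ 3 := by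
  nlinarith [mul_nonneg (add_nonneg (add_nonneg ha hb) hc) (add_nonneg (add_nonneg
    (sq_nonneg (a - b)) (sq_nonneg (b - c))) (sq_nonneg (a - c))),
    mul_nonneg (mul_nonneg ha hb) hc]

/-- The Fourier coefficients of a triple of waves with the momentum constraint `k₄ = q + k₂ - k₃`
are products of three propagators. -/
lemma wienerBound_triple_wave {C δ : ℝ} (hw : Dispersive C δ w) (τ₂ τ₃ τ₄ : ℝ)
    (a b c : Fin d → ℤ) :
    WienerBound (fun q => ∫ p : UnitAddTorus (Fin d) × UnitAddTorus (Fin d),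
      wave w τ₂ a p.1 * wave w τ₃ b p.2 * wave w τ₄ c (q + p.1 - p.2))
      (C * (japanese τ₂ ^ (-1 - δ) + japanese τ₃ ^ (-1 - δ) + japanese τ₄ ^ (-1 - δ))) := by
  have c2 := continuous_wave hw.continuous τ₂ a
  have c3 := continuous_wave hw.continuous τ₃ b
  have c4 := continuous_wave hw.continuous τ₄ c
  set F : UnitAddTorus (Fin d) → ℂ := fun q => ∫ p : UnitAddTorus (Fin d) × UnitAddTorus (Fin d),
      wave w τ₂ a p.1 * wave w τ₃ b p.2 * wave w τ₄ c (q + p.1 - p.2) with hF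
  have hFc : Continuous F := by
    refine continuous_of_dominated (bound := fun _ => 1) (fun q => ?_) (fun q => ?_) ?_ ?_
    · exact Continuous.aestronglyMeasurable (by fun_prop)
    · exact Eventually.of_forall fun p => by simp [norm_wave]
    · exact integrable_const _
    · exact Eventually.of_forall fun p => by fun_prop
  -- With k₄ = q + k₂ - k₃ as the variable in place of q, the three momenta are independent, and the
  -- character of q splits into one character for each of them.
  have hcoef : ∀ x, UnitAddTorus.mFourierCoeff F x =
      propagator w (-τ₂) (a + x) * propagator w (-τ₃) (b + -x) * propagator w (-τ₄) (c + -x) := by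
    intro x
    rw [mFourierCoeff_eq]
    simp only [hF]
    simp only [← integral_const_mul]
    rw [integral_integral_swap (ν := (volume : Measure (UnitAddTorus (Fin d) × UnitAddTorus (Fin d))))]
    · have : ∀ p : UnitAddTorus (Fin d) × UnitAddTorus (Fin d),
          ∫ q, UnitAddTorus.mFourier (-x) q *
            (wave w τ₂ a p.1 * wave w τ₃ b p.2 * wave w τ₄ c (q + p.1 - p.2)) =
          (UnitAddTorus.mFourier x p.1 * wave w τ₂ a p.1) *
            (UnitAddTorus.mFourier (-x) p.2 * wave w τ₃ b p.2) *
            propagator w (-τ₄) (c + -x) := by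
        intro p
        rw [← integral_mFourier_mul_wave, ← integral_const_mul,
          ← integral_add_right_eq_self (fun q => _ * (_ * wave w τ₄ c q)) (p.1 - p.2)]
        refine integral_congr_ae (Eventually.of_forall fun q => ?_)
        have h1 : UnitAddTorus.mFourier (-x) (q + (p.1 - p.2)) =
            UnitAddTorus.mFourier (-x) q * UnitAddTorus.mFourier (-x) p.1 *
              UnitAddTorus.mFourier x p.2 := by
          rw [sub_eq_add_neg, mFourier_add_apply, mFourier_add_apply, mFourier_apply_neg, neg_neg,
            mul_assoc]
        have h2 : UnitAddTorus.mFourier x p.1 * UnitAddTorus.mFourier (-x) p.1 = 1 := by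
          rw [← UnitAddTorus.mFourier_add, add_neg_cancel, mFourier_zero_apply]
        have h3 : UnitAddTorus.mFourier (-x) p.2 * UnitAddTorus.mFourier x p.2 = 1 := by
          rw [← UnitAddTorus.mFourier_add, neg_add_cancel, mFourier_zero_apply]
        beta_reduce
        rw [h1]
        simp only [← add_sub_assoc]
        generalize wave w τ₄ c (q + p.1 - p.2) = W
        linear_combination (-UnitAddTorus.mFourier (-x) q * wave w τ₂ a p.1 * wave w τ₃ b p.2 * W) *
          (UnitAddTorus.mFourier (-x) p.2 * UnitAddTorus.mFourier x p.2 * h2 + h3)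
      simp only [this]
      rw [integral_mul_const]
      congr 1
      have h4 := integral_prod_mul (μ := (volume : Measure (UnitAddTorus (Fin d))))
        (ν := (volume : Measure (UnitAddTorus (Fin d))))
        (fun k => UnitAddTorus.mFourier x k * wave w τ₂ a k)
        (fun k => UnitAddTorus.mFourier (-x) k * wave w τ₃ b k)
      rw [integral_mFourier_mul_wave, integral_mFourier_mul_wave] at h4
      exact h4
    · refine integrable_of_continuous_torus ?_
      fun_prop
  -- The shifts and reflections of the lattice argument are bijections and leave the ℓ³ sums
  -- unchanged; the sign of τ is irrelevant since ⟨τ⟩ is even.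
  have hsum3 : ∀ (τ : ℝ) (e : (Fin d → ℤ) ≃ (Fin d → ℤ)),
      Summable (fun x => ‖propagator w (-τ) (e x)‖ ^ 3) ∧
        ∑' x, ‖propagator w (-τ) (e x)‖ ^ 3 ≤ C * japanese τ ^ (-1 - δ) := by
    intro τ e
    refine ⟨(e.summable_iff (f := fun x => ‖propagator w (-τ) x‖ ^ 3)).mpr (hw.summable _), ?_⟩
    rw [e.tsum_eq fun x => ‖propagator w (-τ) x‖ ^ 3]
    refine (hw.bound _).trans (le_of_eq ?_)
    simp [japanese]
  obtain ⟨s2, b2⟩ := hsum3 τ₂ (Equiv.addLeft a)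
  obtain ⟨s3, b3⟩ := hsum3 τ₃ ((Equiv.neg _).trans (Equiv.addLeft b))
  obtain ⟨s4, b4⟩ := hsum3 τ₄ ((Equiv.neg _).trans (Equiv.addLeft c))
  have hle : ∀ x, ‖UnitAddTorus.mFourierCoeff F x‖ ≤ ‖propagator w (-τ₂) (Equiv.addLeft a x)‖ ^ 3 +
      ‖propagator w (-τ₃) ((Equiv.neg _).trans (Equiv.addLeft b) x)‖ ^ 3 +
      ‖propagator w (-τ₄) ((Equiv.neg _).trans (Equiv.addLeft c) x)‖ ^ 3 := by
    intro x
    rw [hcoef, norm_mul, norm_mul]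
    exact mul_mul_le_add_cubes (norm_nonneg _) (norm_nonneg _) (norm_nonneg _)
  have hsn := Summable.of_nonneg_of_le (fun _ => norm_nonneg _) hle ((s2.add s3).add s4)
  refine ⟨Fin d → ℤ, inferInstance, UnitAddTorus.mFourierCoeff F, id, hsn, ?_, fun q => ?_⟩
  · refine (hsn.tsum_le_tsum hle ((s2.add s3).add s4)).trans ?_
    rw [(s2.add s3).tsum_add s4, s2.tsum_add s3]
    linarith
  -- A continuous function with summable Fourier coefficients is the pointwise sum of its Fourier
  -- series.
  · have := UnitAddTorus.hasSum_mFourier_series_apply_of_summable (f := ⟨F, hFc⟩) hsn.of_norm q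
    simpa only [smul_eq_mul, ContinuousMap.coe_mk, id] using! this

/-- The interaction factor of a collision: squared (`x = false`) or with exchange (`x = true`). -/
noncomputable def collisionFactor (V : (Fin d → ℤ) → ℝ) (x : Bool)
    (k₂ k₃ k₄ : UnitAddTorus (Fin d)) : ℝ :=
  Vhat V (k₂ - k₃) * Vhat V (k₂ - if x then k₄ else k₃)

/-- The collision kernel at time `τ`, with the weights `h₂, h₃, h₄`. -/
noncomputable def collision (V : (Fin d → ℤ) → ℝ) (w : UnitAddTorus (Fin d) → ℝ) (x : Bool) (τ : ℝ)
    (h₂ h₃ h₄ : UnitAddTorus (Fin d) → ℂ) (q : UnitAddTorus (Fin d)) : ℂ :=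
  ∫ p : UnitAddTorus (Fin d) × UnitAddTorus (Fin d),
    (collisionFactor V x p.1 p.2 (q + p.1 - p.2) : ℂ) *
      Complex.exp (Complex.I * τ * ((w q + w p.1 - w p.2 - w (q + p.1 - p.2) : ℝ) : ℂ)) *
      (h₂ p.1 * h₃ p.2 * h₄ (q + p.1 - p.2))

lemma absSum_Vhat {V : (Fin d → ℤ) → ℝ} (hV : Summable V) (hV' : ∀ x, V (-x) = V x) :
    WienerBound (fun k => (Vhat V k : ℂ)) (∑' x, |V x|) := by
  refine ⟨Fin d → ℤ, inferInstance, fun x => (V x : ℂ), fun x => -x, ?_, ?_, fun k => ?_⟩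
  · simpa using hV.abs
  · simp
  · exact Vhat_hasSum hV hV' k

lemma absSum_collisionFactor {V : (Fin d → ℤ) → ℝ} (hV : Summable V) (hV' : ∀ x, V (-x) = V x)
    (x : Bool) : AbsSum tripleChar
      (fun k : UnitAddTorus (Fin d) × UnitAddTorus (Fin d) × UnitAddTorus (Fin d) =>
        (collisionFactor V x k.1 k.2.1 k.2.2 : ℂ)) ((∑' x, |V x|) * ∑' x, |V x|) := by
  have h3 : AbsSum tripleChar
      (fun k : UnitAddTorus (Fin d) × UnitAddTorus (Fin d) × UnitAddTorus (Fin d) =>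
        (Vhat V (k.1 - k.2.1) : ℂ)) (∑' x, |V x|) :=
    AbsSum.comp (χ' := tripleChar) (fun k : UnitAddTorus (Fin d) × UnitAddTorus (Fin d) ×
      UnitAddTorus (Fin d) => k.1 - k.2.1) (fun a => (a, -a, 0)) (fun a k => by
        simp [tripleChar, sub_eq_add_neg, mFourier_add_apply, mFourier_apply_neg,
          mFourier_zero_apply]) (absSum_Vhat hV hV')
  have h4 : AbsSum tripleChar
      (fun k : UnitAddTorus (Fin d) × UnitAddTorus (Fin d) × UnitAddTorus (Fin d) =>
        (Vhat V (k.1 - k.2.2) : ℂ)) (∑' x, |V x|) :=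
    AbsSum.comp (χ' := tripleChar) (fun k : UnitAddTorus (Fin d) × UnitAddTorus (Fin d) ×
      UnitAddTorus (Fin d) => k.1 - k.2.2) (fun a => (a, 0, -a)) (fun a k => by
        simp [tripleChar, sub_eq_add_neg, mFourier_add_apply, mFourier_apply_neg,
          mFourier_zero_apply]) (absSum_Vhat hV hV')
  unfold collisionFactor
  cases x
  · simpa using h3.mul norm_tripleChar_le tripleChar_add h3
  · simpa using h3.mul norm_tripleChar_le tripleChar_add h4

/-- The decay of a collision with outgoing phases `T₂, T₃, T₄`. -/
noncomputable def collisionDecay (δ τ T : ℝ) : ℝ :=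
  japanese (T + τ) ^ (-1 - δ) + japanese (T - τ) ^ (-1 - δ)

lemma japanese_pos (x : ℝ) : 0 < japanese x := Real.sqrt_pos.mpr (by positivity)

lemma japanese_neg (x : ℝ) : japanese (-x) = japanese x := by simp [japanese]

lemma continuous_japanese_rpow (s : ℝ) : Continuous fun x => japanese x ^ s := by
  refine Continuous.rpow_const ?_ fun x => Or.inl (japanese_pos x).ne'
  unfold japanese; fun_prop

lemma collisionDecay_nonneg (δ τ T : ℝ) : 0 ≤ collisionDecay δ τ T :=
  add_nonneg (Real.rpow_nonneg (japanese_pos _).le _) (Real.rpow_nonneg (japanese_pos _).le _)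

lemma collisionDecay_neg (δ τ T : ℝ) : collisionDecay δ (-τ) T = collisionDecay δ τ T := by
  simp [collisionDecay, add_comm, sub_eq_add_neg]

/-- The total mass of the interaction potential, squared. -/
noncomputable def potentialMass (V : (Fin d → ℤ) → ℝ) : ℝ := (∑' x, |V x|) * ∑' x, |V x|

lemma potentialMass_nonneg (V : (Fin d → ℤ) → ℝ) : 0 ≤ potentialMass V := mul_self_nonneg _

/-- The central estimate. The interaction factor and the weights are expanded in characters of the
three momenta; every term is then a triple wave with the times T₂ + τ, T₃ - τ, T₄ - τ, to which the
dispersive bound applies. The factor e^{iτw(q)} does not take part in the integration and becomes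
the phase of the result. -/
lemma phasedWiener_collision {C δ : ℝ} (hC : 0 ≤ C) (hw : Dispersive C δ w) {V : (Fin d → ℤ) → ℝ}
    (hV : Summable V) (hV' : ∀ x, V (-x) = V x) (x : Bool) (τ : ℝ) {T₂ T₃ T₄ M₂ M₃ M₄ : ℝ}
    {h₂ h₃ h₄ : UnitAddTorus (Fin d) → ℂ} (H₂ : PhasedWiener w T₂ h₂ M₂)
    (H₃ : PhasedWiener w T₃ h₃ M₃) (H₄ : PhasedWiener w T₄ h₄ M₄) :
    PhasedWiener w τ (collision V w x τ h₂ h₃ h₄)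
      (potentialMass V * (M₂ * M₃ * M₄) * (C * (collisionDecay δ τ T₂ + collisionDecay δ τ T₃ +
        collisionDecay δ τ T₄))) := by
  have hM₂ := H₂.nonneg
  have hM₃ := H₃.nonneg
  have hM₄ := H₄.nonneg
  obtain ⟨g₂, G₂, e₂⟩ := H₂
  obtain ⟨g₃, G₃, e₃⟩ := H₃
  obtain ⟨g₄, G₄, e₄⟩ := H₄
  have A₂ : AbsSum tripleChar
      (fun k : UnitAddTorus (Fin d) × UnitAddTorus (Fin d) × UnitAddTorus (Fin d) => g₂ k.1) M₂ :=
    AbsSum.comp (χ' := tripleChar) (fun k : UnitAddTorus (Fin d) × UnitAddTorus (Fin d) ×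
      UnitAddTorus (Fin d) => k.1) (fun a => (a, 0, 0)) (fun a k => by
        simp [tripleChar, mFourier_zero_apply]) G₂
  have A₃ : AbsSum tripleChar
      (fun k : UnitAddTorus (Fin d) × UnitAddTorus (Fin d) × UnitAddTorus (Fin d) => g₃ k.2.1) M₃ :=
    AbsSum.comp (χ' := tripleChar) (fun k : UnitAddTorus (Fin d) × UnitAddTorus (Fin d) ×
      UnitAddTorus (Fin d) => k.2.1) (fun a => (0, a, 0)) (fun a k => by
        simp [tripleChar, mFourier_zero_apply]) G₃
  have A₄ : AbsSum tripleChar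
      (fun k : UnitAddTorus (Fin d) × UnitAddTorus (Fin d) × UnitAddTorus (Fin d) => g₄ k.2.2) M₄ :=
    AbsSum.comp (χ' := tripleChar) (fun k : UnitAddTorus (Fin d) × UnitAddTorus (Fin d) ×
      UnitAddTorus (Fin d) => k.2.2) (fun a => (0, 0, a)) (fun a k => by
        simp [tripleChar, mFourier_zero_apply]) G₄
  obtain ⟨ι, hι, c, a, hs, hM, hsum⟩ := (absSum_collisionFactor hV hV' x).mul norm_tripleChar_le
    tripleChar_add ((A₂.mul norm_tripleChar_le tripleChar_add A₃).mul norm_tripleChar_le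
      tripleChar_add A₄)
  set f : ι → UnitAddTorus (Fin d) → ℂ := fun i q =>
    ∫ p : UnitAddTorus (Fin d) × UnitAddTorus (Fin d), wave w (T₂ + τ) (a i).1 p.1 *
      wave w (T₃ - τ) (a i).2.1 p.2 * wave w (T₄ - τ) (a i).2.2 (q + p.1 - p.2) with hf
  set B : ℝ := C * (japanese (T₂ + τ) ^ (-1 - δ) + japanese (T₃ - τ) ^ (-1 - δ) +
    japanese (T₄ - τ) ^ (-1 - δ)) with hB
  have hfB : ∀ i, WienerBound (f i) B := fun i => wienerBound_triple_wave hw _ _ _ _ _ _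
  set g : UnitAddTorus (Fin d) → ℂ := fun q => ∫ p : UnitAddTorus (Fin d) × UnitAddTorus (Fin d),
    Complex.exp (Complex.I * ((T₂ + τ : ℝ) : ℂ) * w p.1) *
      Complex.exp (Complex.I * ((T₃ - τ : ℝ) : ℂ) * w p.2) *
      Complex.exp (Complex.I * ((T₄ - τ : ℝ) : ℂ) * w (q + p.1 - p.2)) *
      ((collisionFactor V x p.1 p.2 (q + p.1 - p.2) : ℂ) *
        (g₂ p.1 * g₃ p.2 * g₄ (q + p.1 - p.2))) with hg
  have hgs : ∀ q, HasSum (fun i => c i * f i q) (g q) := by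
    intro q
    have hwc := hw.continuous
    have key := hasSum_integral_of_summable_integral_norm
      (μ := (volume : Measure (UnitAddTorus (Fin d) × UnitAddTorus (Fin d))))
      (F := fun i p => c i * (wave w (T₂ + τ) (a i).1 p.1 *
        wave w (T₃ - τ) (a i).2.1 p.2 * wave w (T₄ - τ) (a i).2.2 (q + p.1 - p.2)))
      (fun i => by
        refine integrable_of_continuous_torus ?_
        have c2 := continuous_wave hw.continuous (T₂ + τ) (a i).1
        have c3 := continuous_wave hw.continuous (T₃ - τ) (a i).2.1
        have c4 := continuous_wave hw.continuous (T₄ - τ) (a i).2.2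
        fun_prop)
      (by simpa [norm_wave] using! hs)
    simp only [integral_const_mul] at key
    have hq : g q = ∫ p : UnitAddTorus (Fin d) × UnitAddTorus (Fin d), ∑' i,
        c i * (wave w (T₂ + τ) (a i).1 p.1 * wave w (T₃ - τ) (a i).2.1 p.2 *
          wave w (T₄ - τ) (a i).2.2 (q + p.1 - p.2)) := ?_
    · rw [hq]; exact key
    refine integral_congr_ae (Eventually.of_forall fun p => ?_)
    have := (hsum (p.1, p.2, q + p.1 - p.2)).mul_left
      (Complex.exp (Complex.I * ((T₂ + τ : ℝ) : ℂ) * w p.1) *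
      Complex.exp (Complex.I * ((T₃ - τ : ℝ) : ℂ) * w p.2) *
      Complex.exp (Complex.I * ((T₄ - τ : ℝ) : ℂ) * w (q + p.1 - p.2)))
    simp only at this ⊢
    rw [← this.tsum_eq]
    refine tsum_congr fun i => ?_
    simp only [wave, tripleChar]
    ring
  have hgW := absSum_of_hasSum (χ := fun (a : Fin d → ℤ) (k : UnitAddTorus (Fin d)) =>
    UnitAddTorus.mFourier a k) hs hfB (fun _ _ => (norm_mFourier_apply _ _).le) hgs
  -- `collisionDecay` contains both signs of τ, so that it is even in τ and need not record the side
  -- of the collision on which a momentum stands; only one sign occurs for each momentum.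
  have hBle : B ≤ C * (collisionDecay δ τ T₂ + collisionDecay δ τ T₃ + collisionDecay δ τ T₄) := by
    refine mul_le_mul_of_nonneg_left ?_ hC
    have := fun y => Real.rpow_nonneg (japanese_pos y).le (-1 - δ)
    unfold collisionDecay
    linarith [this (T₂ - τ), this (T₃ + τ), this (T₄ + τ)]
  refine ⟨g, hgW.mono ?_, fun q => ?_⟩
  · have hB0 : 0 ≤ B := by
      have := fun y => Real.rpow_nonneg (japanese_pos y).le (-1 - δ)
      have h1 := this (T₂ + τ)
      have h2 := this (T₃ - τ)
      have h3 := this (T₄ - τ)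
      positivity
    refine mul_le_mul hM hBle hB0 ?_
    have := potentialMass_nonneg V
    positivity
  · simp only [collision, hg]
    rw [← integral_const_mul]
    refine integral_congr_ae (Eventually.of_forall fun p => ?_)
    simp only [e₂, e₃, e₄]
    push_cast
    have hE : Complex.exp (Complex.I * τ * (w q + w p.1 - w p.2 - w (q + p.1 - p.2))) *
        (Complex.exp (Complex.I * T₂ * w p.1) * Complex.exp (Complex.I * T₃ * w p.2) *
          Complex.exp (Complex.I * T₄ * w (q + p.1 - p.2))) =
        Complex.exp (Complex.I * τ * w q) * (Complex.exp (Complex.I * (T₂ + τ) * w p.1) *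
          Complex.exp (Complex.I * (T₃ - τ) * w p.2) *
          Complex.exp (Complex.I * (T₄ - τ) * w (q + p.1 - p.2))) := by
      simp only [← Complex.exp_add]
      congr 1
      ring
    linear_combination (collisionFactor V x p.1 p.2 (q + p.1 - p.2) : ℂ) *
      (g₂ p.1 * g₃ p.2 * g₄ (q + p.1 - p.2)) * hE

lemma collision_neg (hw : ∀ k, w (-k) = w k) {V : (Fin d → ℤ) → ℝ} (hV' : ∀ x, V (-x) = V x)
    (x : Bool) (τ : ℝ) {h₂ h₃ h₄ : UnitAddTorus (Fin d) → ℂ} (H₂ : ∀ k, h₂ (-k) = h₂ k)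
    (H₃ : ∀ k, h₃ (-k) = h₃ k) (H₄ : ∀ k, h₄ (-k) = h₄ k) (q) :
    collision V w x τ h₂ h₃ h₄ (-q) = collision V w x τ h₂ h₃ h₄ q := by
  unfold collision
  rw [← integral_neg_eq_self]
  refine integral_congr_ae (Eventually.of_forall fun p => ?_)
  have h1 : -q + (-p).1 - (-p).2 = -(q + p.1 - p.2) := by
    simp only [Prod.fst_neg, Prod.snd_neg]; abel
  have h2 : -p.1 - -p.2 = -(p.1 - p.2) := by abel
  have h3 : -p.1 - -(q + p.1 - p.2) = -(p.1 - (q + p.1 - p.2)) := by abel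
  have h4 : collisionFactor V x (-p.1) (-p.2) (-(q + p.1 - p.2)) =
      collisionFactor V x p.1 p.2 (q + p.1 - p.2) := by
    unfold collisionFactor
    cases x <;> simp only [h2, h3, Vhat_neg hV', if_true, if_false, Bool.false_eq_true]
  beta_reduce
  rw [h1]
  simp only [Prod.fst_neg, Prod.snd_neg, hw, H₂, H₃, H₄, h4]

end Wiener

/-! ### Smooth functions on the torus have absolutely convergent Fourier series -/

section Smooth

open scoped ContDiff

variable {d : ℕ}

/-- The projection `ℝ^d → 𝕋^d`. -/
def torusMk (x : Fin d → ℝ) : UnitAddTorus (Fin d) := fun i => (x i : UnitAddCircle)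

lemma isOpenQuotientMap_torusMk : IsOpenQuotientMap (torusMk (d := d)) :=
  IsOpenQuotientMap.piMap (f := fun (_ : Fin d) (x : ℝ) => (x : UnitAddCircle))
    fun _ => QuotientAddGroup.isOpenQuotientMap_mk

lemma continuous_of_comp_torusMk {Y : Type*} [TopologicalSpace Y] {f : UnitAddTorus (Fin d) → Y}
    (hf : Continuous (f ∘ torusMk)) : Continuous f :=
  isOpenQuotientMap_torusMk.isQuotientMap.continuous_iff.mpr hf

/-- The partial derivative of a function on the torus. -/
noncomputable def torusDeriv (i : Fin d) (f : UnitAddTorus (Fin d) → ℂ) (k : UnitAddTorus (Fin d)) :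
    ℂ :=
  deriv (fun s : ℝ => f (k + Pi.single i (s : UnitAddCircle))) 0

variable {f : UnitAddTorus (Fin d) → ℂ}

lemma torusMk_add_single (x : Fin d → ℝ) (i : Fin d) (s : ℝ) :
    torusMk x + Pi.single i (s : UnitAddCircle) = torusMk (x + Pi.single i s) := by
  funext j
  by_cases h : j = i
  · subst h; simp [torusMk]
  · simp [torusMk, h]

lemma hasDerivAt_shift (hf : ContDiff ℝ ∞ (f ∘ torusMk)) (i : Fin d) (x : Fin d → ℝ) :
    HasDerivAt (fun s : ℝ => f (torusMk x + Pi.single i (s : UnitAddCircle)))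
      (fderiv ℝ (f ∘ torusMk) x (Pi.single i 1)) 0 := by
  have h1 : HasFDerivAt (f ∘ torusMk) (fderiv ℝ (f ∘ torusMk) x)
      (x + (0 : ℝ) • (Pi.single i 1 : Fin d → ℝ)) := by
    rw [zero_smul, add_zero]
    exact (hf.differentiable (by simp)).differentiableAt.hasFDerivAt
  have h2 : HasDerivAt (fun s : ℝ => x + s • (Pi.single i 1 : Fin d → ℝ))
      (Pi.single i 1 : Fin d → ℝ) 0 := by
    simpa using ((hasDerivAt_id (0 : ℝ)).smul_const (Pi.single i 1 : Fin d → ℝ)).const_add x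
  have h3 := h1.comp_hasDerivAt (0 : ℝ) h2
  refine h3.congr_of_eventuallyEq (Eventually.of_forall fun s => ?_)
  simp only [torusMk_add_single, Function.comp]
  congr 2
  funext j
  by_cases h : j = i
  · subst h; simp
  · simp [h]

lemma torusDeriv_comp_torusMk (hf : ContDiff ℝ ∞ (f ∘ torusMk)) (i : Fin d) :
    torusDeriv i f ∘ torusMk = fun x => fderiv ℝ (f ∘ torusMk) x (Pi.single i 1) :=
  funext fun x => (hasDerivAt_shift hf i x).deriv

lemma contDiff_torusDeriv (hf : ContDiff ℝ ∞ (f ∘ torusMk)) (i : Fin d) :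
    ContDiff ℝ ∞ (torusDeriv i f ∘ torusMk) := by
  rw [torusDeriv_comp_torusMk hf]
  exact (hf.fderiv_right (by simp)).clm_apply contDiff_const

lemma hasDerivAt_torusDeriv (hf : ContDiff ℝ ∞ (f ∘ torusMk)) (i : Fin d)
    (k : UnitAddTorus (Fin d)) (s : ℝ) :
    HasDerivAt (fun s : ℝ => f (k + Pi.single i (s : UnitAddCircle)))
      (torusDeriv i f (k + Pi.single i (s : UnitAddCircle))) s := by
  obtain ⟨x, hx⟩ := isOpenQuotientMap_torusMk.surjective (k + Pi.single i (s : UnitAddCircle))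
  have h1 := hasDerivAt_shift hf i x
  have h2 : torusDeriv i f (torusMk x) = _ := h1.deriv
  rw [← h2, hx] at h1
  have h3 : HasDerivAt (fun u : ℝ => u - s) 1 s := by simpa using (hasDerivAt_id s).sub_const s
  have h4 := h1.scomp_of_eq s h3 (sub_self s).symm
  rw [one_smul] at h4
  refine h4.congr_of_eventuallyEq (Eventually.of_forall fun u => ?_)
  simp only [Function.comp]
  rw [add_assoc, ← Pi.single_add, ← AddCircle.coe_add]
  simp

/-- Integration by parts without boundary terms: the coefficient of the translated function is
differentiated at s = 0 in two ways, under the integral, and after moving the translation onto the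
character, where it becomes a factor e^{2πi nᵢ s}. -/
lemma mFourierCoeff_torusDeriv (hf : ContDiff ℝ ∞ (f ∘ torusMk)) (i : Fin d) (n : Fin d → ℤ) :
    UnitAddTorus.mFourierCoeff (torusDeriv i f) n =
      2 * Real.pi * Complex.I * n i * UnitAddTorus.mFourierCoeff f n := by
  have hfc := continuous_of_comp_torusMk hf.continuous
  have hdc := continuous_of_comp_torusMk (contDiff_torusDeriv hf i).continuous
  obtain ⟨B, hB⟩ := (isCompact_range hdc).isBounded.exists_norm_le
  have hL : HasDerivAt (fun s : ℝ => ∫ k, UnitAddTorus.mFourier (-n) k *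
      f (k + Pi.single i (s : UnitAddCircle)))
      (∫ k, UnitAddTorus.mFourier (-n) k *
        torusDeriv i f (k + Pi.single i ((0 : ℝ) : UnitAddCircle))) 0 := by
    refine (hasDerivAt_integral_of_dominated_loc_of_deriv_le (𝕜 := ℝ) (x₀ := 0) (bound := fun _ => B)
      (F := fun s k => UnitAddTorus.mFourier (-n) k * f (k + Pi.single i (s : UnitAddCircle)))
      (F' := fun s k => UnitAddTorus.mFourier (-n) k *
        torusDeriv i f (k + Pi.single i (s : UnitAddCircle))) (s := univ) Filter.univ_mem
      (Eventually.of_forall fun s => ?_) ?_ ?_ ?_ ?_ ?_).2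
    · exact Continuous.aestronglyMeasurable (by fun_prop)
    · exact integrable_of_continuous_torus (by fun_prop)
    · exact Continuous.aestronglyMeasurable (by fun_prop)
    · refine Eventually.of_forall fun k s _ => ?_
      rw [norm_mul, norm_mFourier_apply, one_mul]
      exact hB _ ⟨_, rfl⟩
    · exact integrable_const _
    · exact Eventually.of_forall fun k s _ => (hasDerivAt_torusDeriv hf i k s).const_mul _
  have hmono : ∀ s : ℝ, UnitAddTorus.mFourier (-n) (-(Pi.single i (s : UnitAddCircle))) =
      Complex.exp (2 * Real.pi * Complex.I * n i * s) := by
    intro s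
    rw [mFourier_apply_neg, neg_neg]
    simp only [UnitAddTorus.mFourier, ContinuousMap.coe_mk]
    rw [Finset.prod_eq_single i]
    · rw [Pi.single_eq_same, fourier_coe_apply]
      congr 1; simp
    · intro j _ hj
      rw [Pi.single_eq_of_ne hj]
      simp
    · simp
  have hR : (fun s : ℝ => ∫ k, UnitAddTorus.mFourier (-n) k *
      f (k + Pi.single i (s : UnitAddCircle))) =
      fun s : ℝ => Complex.exp (2 * Real.pi * Complex.I * n i * s) *
        UnitAddTorus.mFourierCoeff f n := by
    funext s
    rw [mFourierCoeff_eq, ← integral_const_mul]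
    refine (integral_add_right_eq_self (μ := volume)
      (fun k : UnitAddTorus (Fin d) => UnitAddTorus.mFourier (-n) k *
        f (k + Pi.single i (s : UnitAddCircle))) (-Pi.single i (s : UnitAddCircle))).symm.trans ?_
    refine integral_congr_ae (Eventually.of_forall fun k => ?_)
    beta_reduce
    rw [mFourier_add_apply, hmono, neg_add_cancel_right]
    ring
  have hR' : HasDerivAt (fun s : ℝ => Complex.exp (2 * Real.pi * Complex.I * n i * s) *
        UnitAddTorus.mFourierCoeff f n)
      (2 * Real.pi * Complex.I * n i * UnitAddTorus.mFourierCoeff f n) 0 := by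
    have h1 : HasDerivAt (fun s : ℝ => 2 * Real.pi * Complex.I * n i * (s : ℂ))
        (2 * Real.pi * Complex.I * n i) 0 := by
      simpa using (Complex.ofRealCLM.hasDerivAt (x := (0 : ℝ))).const_mul
        (2 * Real.pi * Complex.I * n i)
    simpa using h1.cexp.mul_const (UnitAddTorus.mFourierCoeff f n)
  rw [hR] at hL
  have := hL.unique hR'
  rw [← this, mFourierCoeff_eq]
  simp

/-- Each derivative in the direction i gains a factor 2π|nᵢ| ≥ |nᵢ|, and derivatives of smooth
functions on the compact torus are bounded. -/
lemma exists_mFourierCoeff_mul_pow_le (i : Fin d) (N : ℕ) :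
    ∀ f : UnitAddTorus (Fin d) → ℂ, ContDiff ℝ ∞ (f ∘ torusMk) →
      ∃ B, ∀ n, ‖UnitAddTorus.mFourierCoeff f n‖ * |(n i : ℝ)| ^ N ≤ B := by
  induction N with
  | zero =>
    intro f hf
    obtain ⟨B, hB⟩ := (isCompact_range
      (continuous_of_comp_torusMk hf.continuous)).isBounded.exists_norm_le
    refine ⟨B, fun n => ?_⟩
    rw [pow_zero, mul_one, mFourierCoeff_eq]
    refine (norm_integral_le_of_norm_le_const (C := B) (Eventually.of_forall fun k => ?_)).trans
      (by simp)
    rw [norm_mul, norm_mFourier_apply, one_mul]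
    exact hB _ ⟨k, rfl⟩
  | succ N ih =>
    intro f hf
    obtain ⟨B, hB⟩ := ih _ (contDiff_torusDeriv hf i)
    refine ⟨B, fun n => ?_⟩
    have h := hB n
    rw [mFourierCoeff_torusDeriv hf] at h
    have h1 : ‖2 * (Real.pi : ℂ) * Complex.I * n i * UnitAddTorus.mFourierCoeff f n‖ =
        2 * Real.pi * |(n i : ℝ)| * ‖UnitAddTorus.mFourierCoeff f n‖ := by
      simp [abs_of_pos Real.pi_pos]
    rw [h1] at h
    have h2 : 1 ≤ 2 * Real.pi := by linarith [Real.pi_gt_three]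
    have h3 : 0 ≤ ‖UnitAddTorus.mFourierCoeff f n‖ * |(n i : ℝ)| ^ (N + 1) := by positivity
    calc ‖UnitAddTorus.mFourierCoeff f n‖ * |(n i : ℝ)| ^ (N + 1)
        ≤ 2 * Real.pi * (‖UnitAddTorus.mFourierCoeff f n‖ * |(n i : ℝ)| ^ (N + 1)) :=
          le_mul_of_one_le_left h3 h2
      _ = 2 * Real.pi * |(n i : ℝ)| * ‖UnitAddTorus.mFourierCoeff f n‖ * |(n i : ℝ)| ^ N := by
          ring
      _ ≤ B := h

lemma summable_prod_pi {g : ℤ → ℝ} (hg : Summable g) (hg0 : ∀ n, 0 ≤ g n) :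
    ∀ d : ℕ, Summable fun n : Fin d → ℤ => ∏ i, g (n i)
  | 0 => (hasSum_fintype _).summable
  | d + 1 => by
    rw [← (Fin.consEquiv fun _ => ℤ).summable_iff]
    have := hg.mul_of_nonneg (summable_prod_pi hg hg0 d) hg0
      fun _ => Finset.prod_nonneg fun _ _ => hg0 _
    refine this.congr fun p => ?_
    simp [Fin.prod_univ_succ, Fin.consEquiv]

/-- Taking 2d derivatives in the direction of the largest |nᵢ| gives the decay (1 + ‖n‖)^{-2d},
which is dominated by the summable product of the (1 + |nᵢ|)^{-2}: two powers for each coordinate.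
-/
lemma exists_wienerBound (hf : ContDiff ℝ ∞ (f ∘ torusMk)) : ∃ M, WienerBound f M := by
  have hfc := continuous_of_comp_torusMk hf.continuous
  choose B hB using fun i => exists_mFourierCoeff_mul_pow_le (d := d) i (2 * d) f hf
  obtain ⟨B₀, hB₀⟩ := (isCompact_range hfc).isBounded.exists_norm_le
  have hB₀' : ∀ n, ‖UnitAddTorus.mFourierCoeff f n‖ ≤ B₀ := fun n => by
    rw [mFourierCoeff_eq]
    refine (norm_integral_le_of_norm_le_const (C := B₀) (Eventually.of_forall fun k => ?_)).trans
      (by simp)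
    rw [norm_mul, norm_mFourier_apply, one_mul]
    exact hB₀ _ ⟨k, rfl⟩
  have hg : Summable fun n : ℤ => ((1 + |(n : ℝ)|) ^ 2)⁻¹ := by
    refine Summable.of_norm_bounded_eventually (g := fun n : ℤ => 1 / (n : ℝ) ^ 2)
      (Real.summable_one_div_int_pow.mpr one_lt_two) ?_
    refine (Set.finite_singleton (0 : ℤ)).subset fun n hn => ?_
    by_contra h0
    refine hn ?_
    have h1 : (0 : ℝ) < |(n : ℝ)| := abs_pos.mpr (by exact_mod_cast h0)
    change ‖((1 + |(n : ℝ)|) ^ 2)⁻¹‖ ≤ 1 / (n : ℝ) ^ 2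
    rw [Real.norm_of_nonneg (by positivity), one_div, ← sq_abs (n : ℝ)]
    gcongr
    linarith
  have hB0 : ∀ i, 0 ≤ B i := fun i => (by positivity : (0:ℝ) ≤ _).trans (hB i 0)
  -- The power of 2 comes from (1 + x)^{2d} ≤ 2^{2d-1}(1 + x^{2d}). The first B₀ belongs to the term
  -- 1; the second one takes care of d = 0, where the sum over i is empty.
  set K : ℝ := 2 ^ (2 * d - 1) * (B₀ + (B₀ + ∑ i, B i)) with hK
  have hle : ∀ n, ‖UnitAddTorus.mFourierCoeff f n‖ ≤ K * ∏ i, ((1 + |(n i : ℝ)|) ^ 2)⁻¹ := by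
    intro n
    rw [Finset.prod_inv_distrib, ← div_eq_mul_inv, le_div_iff₀
      (Finset.prod_pos fun i _ => by positivity)]
    have h1 : ∏ i, (1 + |(n i : ℝ)|) ^ 2 ≤ (1 + ‖n‖) ^ (2 * d) := by
      refine (Finset.prod_le_prod (fun i _ => by positivity) (fun i _ =>
        (pow_le_pow_left₀ (by positivity) (add_le_add_right (b := |(n i : ℝ)|) (c := ‖n‖)
          ?_ 1) 2 : _ ≤ (1 + ‖n‖) ^ 2))).trans (le_of_eq ?_)
      · have := norm_le_pi_norm n i
        rwa [Int.norm_eq_abs] at this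
      · simp [pow_mul]
    have hS : 0 ≤ ∑ i, B i := Finset.sum_nonneg fun i _ => hB0 i
    have h2 : ‖UnitAddTorus.mFourierCoeff f n‖ * ‖n‖ ^ (2 * d) ≤ B₀ + ∑ i, B i := by
      rcases Nat.eq_zero_or_pos d with rfl | hd
      · simp only [mul_zero, pow_zero, mul_one]
        linarith [hB₀' n]
      · have : Nonempty (Fin d) := ⟨⟨0, hd⟩⟩
        obtain ⟨i, hi⟩ := Finite.exists_max fun i => ‖n i‖
        have hi' : ‖n‖ = ‖n i‖ := le_antisymm ((pi_norm_le_iff_of_nonneg (norm_nonneg _)).mpr hi)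
          (norm_le_pi_norm n i)
        rw [hi', Int.norm_eq_abs]
        refine (hB i n).trans ((Finset.single_le_sum (fun j _ => hB0 j)
          (Finset.mem_univ i)).trans ?_)
        linarith [(norm_nonneg _).trans (hB₀' n)]
    calc ‖UnitAddTorus.mFourierCoeff f n‖ * ∏ i, (1 + |(n i : ℝ)|) ^ 2
        ≤ ‖UnitAddTorus.mFourierCoeff f n‖ * (2 ^ (2 * d - 1) * (1 ^ (2 * d) + ‖n‖ ^ (2 * d))) := by
          gcongr
          exact h1.trans (add_pow_le zero_le_one (norm_nonneg _) _)
      _ = 2 ^ (2 * d - 1) * (‖UnitAddTorus.mFourierCoeff f n‖ +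
            ‖UnitAddTorus.mFourierCoeff f n‖ * ‖n‖ ^ (2 * d)) := by rw [one_pow]; ring
      _ ≤ K := by
          rw [hK]
          gcongr
          exact hB₀' n
  have hs : Summable fun n => ‖UnitAddTorus.mFourierCoeff f n‖ :=
    Summable.of_nonneg_of_le (fun _ => norm_nonneg _) hle
      ((summable_prod_pi hg (fun _ => by positivity) d).mul_left K)
  refine ⟨_, Fin d → ℤ, inferInstance, UnitAddTorus.mFourierCoeff f, id, hs, le_rfl, fun k => ?_⟩
  have := UnitAddTorus.hasSum_mFourier_series_apply_of_summable (f := ⟨f, hfc⟩) hs.of_norm k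
  simpa only [smul_eq_mul, ContinuousMap.coe_mk, id] using! this

end Smooth

lemma integrable_japanese_rpow {δ : ℝ} (hδ : 0 < δ) :
    Integrable fun x : ℝ => japanese x ^ (-1 - δ) := by
  have := integrable_rpow_neg_one_add_norm_sq (E := ℝ) (μ := volume) (r := 1 + δ) (by simp [hδ])
  refine this.congr (Eventually.of_forall fun x => ?_)
  simp only [japanese, Real.norm_eq_abs, sq_abs]
  rw [Real.sqrt_eq_rpow, ← Real.rpow_mul (by positivity)]
  congr 1
  ring

/-! ### Momentum rows and the integral over the free momenta of a pairing -/

section Rows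

variable {d : ℕ}

instance borelSpace_row : BorelSpace (ℕ → UnitAddTorus (Fin d)) := Pi.borelSpace

/-- The row in which the two legs of the pair `A` carry the momenta `u` and `-u`. -/
def leg {G : Type*} [AddCommGroup G] (A : ℕ × ℕ) (u : G) : ℕ → G :=
  fun i => if A.1 = i then u else if A.2 = i then -u else 0

lemma initialMomenta_eq_sum {G : Type*} [AddCommGroup G] (S : Finset (ℕ × ℕ)) (q : S → G) :
    initialMomenta S q = ∑ A : S, leg A.1 (q A) := by
  funext i; simp [initialMomenta, leg, Finset.sum_apply]

lemma continuous_leg (A : ℕ × ℕ) :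
    Continuous fun u : UnitAddTorus (Fin d) => leg A u := by
  refine continuous_pi fun i => ?_
  unfold leg
  split_ifs <;> fun_prop

lemma continuous_initialMomenta (S : Finset (ℕ × ℕ)) :
    Continuous fun q : S → UnitAddTorus (Fin d) => initialMomenta S q := by
  simp only [initialMomenta_eq_sum]
  refine continuous_finsetSum _ fun A _ => (continuous_leg A.1).comp (continuous_apply A)

/-- The integral of a function of the initial row over the free momenta of the pairing `S`. -/
noncomputable def rowIntegral (S : Finset (ℕ × ℕ)) (F : (ℕ → UnitAddTorus (Fin d)) → ℂ) : ℂ :=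
  ∫ q : S → UnitAddTorus (Fin d), F (initialMomenta S q)

/-- The row is additive in the pairs, so Fubini's theorem separates the momenta of the old pairs
from those of a motive. -/
lemma rowIntegral_union {S S' : Finset (ℕ × ℕ)} (h : Disjoint S S')
    {F : (ℕ → UnitAddTorus (Fin d)) → ℂ} (hF : Measurable F) (hb : ∃ B, ∀ k, ‖F k‖ ≤ B) :
    rowIntegral (S ∪ S') F = rowIntegral S fun k => rowIntegral S' fun k' => F (k + k') := by
  obtain ⟨B, hB⟩ := hb
  unfold rowIntegral
  rw [← (volume_preserving_piFinsetUnion (fun _ => UnitAddTorus (Fin d)) h).integral_comp']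
  have hrow : ∀ p : (S → UnitAddTorus (Fin d)) × (S' → UnitAddTorus (Fin d)),
      initialMomenta (S ∪ S') (MeasurableEquiv.piFinsetUnion (fun _ => UnitAddTorus (Fin d)) h p) =
        initialMomenta S p.1 + initialMomenta S' p.2 := by
    rintro ⟨q, q'⟩
    simp only [initialMomenta_eq_sum]
    rw [← (Equiv.Finset.union S S' h).sum_comp, Fintype.sum_sum_type]
    congr 1
    · refine Finset.sum_congr rfl fun A _ => ?_
      exact congrArg (leg A.1) (Equiv.piFinsetUnion_left (fun _ => UnitAddTorus (Fin d)) h A.2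
        (Finset.mem_union_left _ A.2))
    · refine Finset.sum_congr rfl fun A _ => ?_
      exact congrArg (leg A.1) (Equiv.piFinsetUnion_right (fun _ => UnitAddTorus (Fin d)) h A.2
        (Finset.mem_union_right _ A.2))
  simp only [hrow]
  refine integral_prod (fun p : (S → UnitAddTorus (Fin d)) × (S' → UnitAddTorus (Fin d)) =>
    F (initialMomenta S p.1 + initialMomenta S' p.2)) ?_
  refine Integrable.of_bound (C := B) ?_ (Eventually.of_forall fun p => hB _)
  refine (hF.comp ?_).aestronglyMeasurable
  refine measurable_pi_iff.mpr fun i => ?_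
  have h1 := (continuous_initialMomenta (d := d) S).measurable
  have h2 := (continuous_initialMomenta (d := d) S').measurable
  exact ((measurable_pi_iff.mp h1 i).comp measurable_fst).add
    ((measurable_pi_iff.mp h2 i).comp measurable_snd)

lemma rowIntegral_singleton (A : ℕ × ℕ) (F : (ℕ → UnitAddTorus (Fin d)) → ℂ) :
    rowIntegral {A} F = ∫ u, F (leg A u) := by
  unfold rowIntegral
  have := (volume_preserving_funUnique ({A} : Finset (ℕ × ℕ))
    (UnitAddTorus (Fin d))).integral_comp' (fun u => F (leg A u))
  rw [← this]
  refine integral_congr_ae (Eventually.of_forall fun q => ?_)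
  simp only [initialMomenta_eq_sum]
  rw [Fintype.sum_unique]
  rfl

/-- The extension by zero leaves the edges outside the range of `r` empty; there the edges of a new
motive are filled in. -/
lemma rowIntegral_image {S : Finset (ℕ × ℕ)} {r : ℕ → ℕ} (hr : Function.Injective r)
    (F : (ℕ → UnitAddTorus (Fin d)) → ℂ) :
    rowIntegral (S.image fun A => (r A.1, r A.2)) F =
      rowIntegral S fun k => F (Function.extend r k 0) := by
  unfold rowIntegral
  have hinj : Function.Injective fun A : ℕ × ℕ => (r A.1, r A.2) := fun A B h => by
    simp only [Prod.mk.injEq] at h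
    exact Prod.ext (hr h.1) (hr h.2)
  let e : S ≃ S.image fun A => (r A.1, r A.2) :=
    Equiv.ofBijective (fun A => ⟨(r A.1.1, r A.1.2), Finset.mem_image_of_mem _ A.2⟩)
      ⟨fun A B h => Subtype.ext (hinj (congrArg Subtype.val h)), fun B => by
        obtain ⟨A, hA, hB⟩ := Finset.mem_image.mp B.2
        exact ⟨⟨A, hA⟩, Subtype.ext hB⟩⟩
  rw [← (volume_measurePreserving_piCongrLeft (fun _ => UnitAddTorus (Fin d)) e).integral_comp']
  refine integral_congr_ae (Eventually.of_forall fun q => ?_)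
  beta_reduce
  congr 1
  rw [initialMomenta_eq_sum, ← e.sum_comp]
  have h1 : ∀ A : S, (MeasurableEquiv.piCongrLeft (fun _ => UnitAddTorus (Fin d)) e) q (e A) =
      q A := fun A => Equiv.piCongrLeft_apply_apply (fun _ => UnitAddTorus (Fin d)) e q A
  simp only [h1]
  funext i
  rw [Finset.sum_apply]
  by_cases hi : ∃ j, r j = i
  · obtain ⟨j, rfl⟩ := hi
    rw [hr.extend_apply]
    simp only [initialMomenta]
    refine Finset.sum_congr rfl fun A _ => ?_
    change leg (r A.1.1, r A.1.2) (q A) (r j) = _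
    simp only [leg, hr.eq_iff]
  · rw [Function.extend_apply' _ _ _ hi]
    refine Finset.sum_eq_zero fun A _ => ?_
    change leg (r A.1.1, r A.1.2) (q A) i = _
    rw [leg, if_neg fun h => hi ⟨_, h⟩, if_neg fun h => hi ⟨_, h⟩]

lemma rowIntegral_insert {S : Finset (ℕ × ℕ)} {A : ℕ × ℕ} (h : A ∉ S)
    {F : (ℕ → UnitAddTorus (Fin d)) → ℂ} (hF : Measurable F) (hb : ∃ B, ∀ k, ‖F k‖ ≤ B) :
    rowIntegral (insert A S) F = rowIntegral S fun k => ∫ u, F (k + leg A u) := by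
  rw [Finset.insert_eq, Finset.union_comm, rowIntegral_union (by simpa using h) hF hb]
  simp only [rowIntegral_singleton]

/-- The momenta are compatible with the pairing `S`. -/
def Admissible {G : Type*} [AddCommGroup G] (S : Finset (ℕ × ℕ)) (k : ℕ → G) : Prop :=
  ∀ A ∈ S, k A.2 = -k A.1

/-- The pairs of `S` are disjoint, and their legs are in increasing order. -/
structure IsPairing (S : Finset (ℕ × ℕ)) : Prop where
  lt : ∀ A ∈ S, A.1 < A.2
  disj : ∀ A ∈ S, ∀ B ∈ S, A ≠ B → A.1 ≠ B.1 ∧ A.1 ≠ B.2 ∧ A.2 ≠ B.1 ∧ A.2 ≠ B.2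

lemma IsPairing.initialMomenta_fst {G : Type*} [AddCommGroup G] {S : Finset (ℕ × ℕ)}
    (hS : IsPairing S) (q : S → G) (A : S) : initialMomenta S q A.1.1 = q A := by
  rw [initialMomenta, Finset.sum_eq_single A]
  · simp
  · intro B _ hB
    have h := hS.disj B.1 B.2 A.1 A.2 fun h => hB (Subtype.ext h)
    rw [if_neg h.1, if_neg h.2.2.1]
  · simp

lemma IsPairing.admissible_initialMomenta {G : Type*} [AddCommGroup G] {S : Finset (ℕ × ℕ)}
    (hS : IsPairing S) (q : S → G) : Admissible S (initialMomenta S q) := by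
  intro A hA
  rw [hS.initialMomenta_fst q ⟨A, hA⟩, initialMomenta, Finset.sum_eq_single ⟨A, hA⟩]
  · simp [(hS.lt A hA).ne]
  · intro B _ hB
    have h := hS.disj B.1 B.2 A hA fun h => hB (Subtype.ext h)
    rw [if_neg h.2.1, if_neg h.2.2.2]
  · simp

/-- The integral only sees rows in which paired edges carry opposite momenta, so these constraints
may be used for the integrands. -/
lemma IsPairing.rowIntegral_congr {S : Finset (ℕ × ℕ)} (hS : IsPairing S)
    {F F' : (ℕ → UnitAddTorus (Fin d)) → ℂ} (h : ∀ k, Admissible S k → F k = F' k) :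
    rowIntegral S F = rowIntegral S F' :=
  integral_congr_ae (Eventually.of_forall fun q => h _ (hS.admissible_initialMomenta q))

end Rows

/-! ### The integrand of a graph -/

section Integrand

variable {d : ℕ}

/-- The product of the factors `σ U` of the vertices. -/
noncomputable def vertexProd (V : (Fin d → ℤ) → ℝ)
    (vs : List ((UnitAddTorus (Fin d) × UnitAddTorus (Fin d) × UnitAddTorus (Fin d)) × ℤ)) : ℂ :=
  (vs.map fun v => (((v.2 : ℝ) * interaction V v : ℝ) : ℂ)).prod

/-- The total phase, when the slices with odd number have the durations `s`. -/
noncomputable def totalPhase (w : UnitAddTorus (Fin d) → ℝ) {m : ℕ}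
    (vs : List ((UnitAddTorus (Fin d) × UnitAddTorus (Fin d) × UnitAddTorus (Fin d)) × ℤ))
    (s : Fin m → ℝ) : ℝ :=
  ∑ i : Fin m, s i * phase w (vs.getD (2 * i + 1) default)

/-- The integrand of a graph, without the weights of the pairs. -/
noncomputable def graphIntegrand (V : (Fin d → ℤ) → ℝ) (w : UnitAddTorus (Fin d) → ℝ)
    (φ : UnitAddTorus (Fin d) → ℂ) {m : ℕ} (ℓ : List ℕ) (s : Fin m → ℝ)
    (k : ℕ → UnitAddTorus (Fin d)) : ℂ :=
  φ (topMomentum ℓ k) * vertexProd V (vertices ℓ k) *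
    Complex.exp (-(Complex.I * (totalPhase w (vertices ℓ k) s : ℂ)))

/-- The momentum integral of a graph, with the weights `h A` of the pairs and the durations `s` of
the slices with odd number. -/
noncomputable def momentumIntegral (V : (Fin d → ℤ) → ℝ) (w : UnitAddTorus (Fin d) → ℝ)
    (φ : UnitAddTorus (Fin d) → ℂ) {m : ℕ} (G : PairedGraph)
    (h : ℕ × ℕ → UnitAddTorus (Fin d) → ℂ) (s : Fin m → ℝ) : ℂ :=
  rowIntegral G.2 fun k => graphIntegrand V w φ G.1 s k * ∏ A ∈ G.2, h A (k A.1)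

lemma continuous_fuse (p : ℕ) :
    Continuous fun k : ℕ → UnitAddTorus (Fin d) => fuse p k := by
  refine continuous_pi fun i => ?_
  unfold fuse
  split_ifs <;> fun_prop

lemma continuous_topMomentum (ℓ : List ℕ) :
    Continuous fun k : ℕ → UnitAddTorus (Fin d) => topMomentum ℓ k := by
  induction ℓ with
  | nil => exact continuous_apply 1
  | cons p ℓ ih => exact ih.comp (continuous_fuse p)

variable {V : (Fin d → ℤ) → ℝ} {w : UnitAddTorus (Fin d) → ℝ}

lemma continuous_interaction (hV : Summable V) (σ : ℤ) :
    Continuous fun p : UnitAddTorus (Fin d) × UnitAddTorus (Fin d) × UnitAddTorus (Fin d) =>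
      interaction V (p, σ) := by
  unfold interaction
  have := continuous_Vhat hV
  fun_prop

lemma continuous_phase (hw : Continuous w) (σ : ℤ) :
    Continuous fun p : UnitAddTorus (Fin d) × UnitAddTorus (Fin d) × UnitAddTorus (Fin d) =>
      phase w (p, σ) := by
  unfold phase
  fun_prop

lemma continuous_vertexProd (hV : Summable V) (ℓ : List ℕ) :
    Continuous fun k : ℕ → UnitAddTorus (Fin d) => vertexProd V (vertices ℓ k) := by
  induction ℓ with
  | nil => simpa [vertexProd, vertices] using continuous_const
  | cons p ℓ ih =>
    have h1 : ∀ k : ℕ → UnitAddTorus (Fin d), vertexProd V (vertices (p :: ℓ) k) =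
        (((parity ℓ p : ℝ) * interaction V ((k p, k (p + 1), k (p + 2)), parity ℓ p) : ℝ) : ℂ) *
          vertexProd V (vertices ℓ (fuse p k)) := fun k => by simp [vertexProd, vertices]
    simp only [h1]
    have h2 := (continuous_interaction hV (parity ℓ p)).comp
      (((continuous_apply p).prodMk ((continuous_apply (p + 1)).prodMk
        (continuous_apply (p + 2)))) : Continuous fun k : ℕ → UnitAddTorus (Fin d) => _)
    have h3 := ih.comp (continuous_fuse p)
    simp only [Function.comp_def] at h2 h3
    fun_prop

lemma continuous_phase_getD (hw : Continuous w) (ℓ : List ℕ) (j : ℕ) :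
    Continuous fun k : ℕ → UnitAddTorus (Fin d) => phase w ((vertices ℓ k).getD j default) := by
  induction ℓ generalizing j with
  | nil => simpa [vertices] using continuous_const
  | cons p ℓ ih =>
    cases j with
    | zero =>
      have h2 := (continuous_phase hw (parity ℓ p)).comp
        (((continuous_apply p).prodMk ((continuous_apply (p + 1)).prodMk
          (continuous_apply (p + 2)))) : Continuous fun k : ℕ → UnitAddTorus (Fin d) => _)
      simpa [vertices] using! h2
    | succ j => simpa [vertices] using! (ih j).comp (continuous_fuse p)

lemma continuous_totalPhase (hw : Continuous w) (ℓ : List ℕ) {m : ℕ} :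
    Continuous fun p : (Fin m → ℝ) × (ℕ → UnitAddTorus (Fin d)) =>
      totalPhase w (vertices ℓ p.2) p.1 := by
  unfold totalPhase
  refine continuous_finsetSum _ fun i _ => ?_
  exact ((continuous_apply i).comp continuous_fst).mul
    ((continuous_phase_getD hw ℓ _).comp continuous_snd)

lemma exists_bound_of_continuous {F : (ℕ → UnitAddTorus (Fin d)) → ℂ} (hF : Continuous F) :
    ∃ B, ∀ k, ‖F k‖ ≤ B := by
  obtain ⟨B, hB⟩ := (isCompact_range hF).isBounded.exists_norm_le
  exact ⟨B, fun k => hB _ ⟨k, rfl⟩⟩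

lemma measurable_graphIntegrand_uncurry (hV : Summable V) (hw : Continuous w)
    {φ : UnitAddTorus (Fin d) → ℂ} (hφ : Measurable φ) {m : ℕ} (ℓ : List ℕ) :
    Measurable fun p : (Fin m → ℝ) × (ℕ → UnitAddTorus (Fin d)) =>
      graphIntegrand V w φ ℓ p.1 p.2 := by
  unfold graphIntegrand
  have h1 := (continuous_totalPhase hw ℓ (m := m)).measurable
  have h2 := (continuous_vertexProd hV ℓ).measurable.comp
    (measurable_snd : Measurable fun p : (Fin m → ℝ) × (ℕ → UnitAddTorus (Fin d)) => p.2)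
  have h3 := hφ.comp ((continuous_topMomentum ℓ).measurable.comp
    (measurable_snd : Measurable fun p : (Fin m → ℝ) × (ℕ → UnitAddTorus (Fin d)) => p.2))
  refine (h3.mul h2).mul (Complex.measurable_exp.comp ?_)
  fun_prop

lemma measurable_graphIntegrand (hV : Summable V) (hw : Continuous w)
    {φ : UnitAddTorus (Fin d) → ℂ} (hφ : Measurable φ) {m : ℕ} (ℓ : List ℕ) (s : Fin m → ℝ) :
    Measurable (graphIntegrand V w φ ℓ s) :=
  (measurable_graphIntegrand_uncurry hV hw hφ ℓ).comp measurable_prodMk_left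

lemma norm_graphIntegrand_eq (V : (Fin d → ℤ) → ℝ) (w : UnitAddTorus (Fin d) → ℝ)
    (φ : UnitAddTorus (Fin d) → ℂ) {m : ℕ} (ℓ : List ℕ) (s : Fin m → ℝ)
    (k : ℕ → UnitAddTorus (Fin d)) : ‖graphIntegrand V w φ ℓ s k‖ =
      ‖φ (topMomentum ℓ k)‖ * ‖vertexProd V (vertices ℓ k)‖ := by
  unfold graphIntegrand
  rw [norm_mul, norm_mul, ← mul_neg, ← Complex.ofReal_neg, mul_comm Complex.I,
    Complex.norm_exp_ofReal_mul_I, mul_one]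

/-- A bound on the integrand of a graph that is uniform in the times and the dispersion relation. -/
lemma exists_norm_graphIntegrand_le (hV : Summable V) {φ : UnitAddTorus (Fin d) → ℂ}
    (hφ : ∃ B, ∀ k, ‖φ k‖ ≤ B) (ℓ : List ℕ) :
    ∃ B, ∀ (w : UnitAddTorus (Fin d) → ℝ) (m : ℕ) (s : Fin m → ℝ) (k : ℕ → UnitAddTorus (Fin d)),
      ‖graphIntegrand V w φ ℓ s k‖ ≤ B := by
  obtain ⟨B, hB⟩ := hφ
  obtain ⟨B', hB'⟩ := exists_bound_of_continuous (continuous_vertexProd hV ℓ)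
  refine ⟨B * B', fun w m s k => ?_⟩
  rw [norm_graphIntegrand_eq]
  exact mul_le_mul (hB _) (hB' k) (norm_nonneg _) ((norm_nonneg _).trans (hB 0))

lemma continuous_weights {S : Finset (ℕ × ℕ)} {h : ℕ × ℕ → UnitAddTorus (Fin d) → ℂ}
    (hh : ∀ A, Continuous (h A)) :
    Continuous fun k : ℕ → UnitAddTorus (Fin d) => ∏ A ∈ S, h A (k A.1) :=
  continuous_finsetProd _ fun A _ => (hh A).comp (continuous_apply A.1)

lemma measurable_weightedIntegrand (hV : Summable V) (hw : Continuous w)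
    {φ : UnitAddTorus (Fin d) → ℂ} (hφ : Measurable φ) {m : ℕ} (G : PairedGraph)
    {h : ℕ × ℕ → UnitAddTorus (Fin d) → ℂ} (hh : ∀ A, Continuous (h A)) (s : Fin m → ℝ) :
    Measurable fun k => graphIntegrand V w φ G.1 s k * ∏ A ∈ G.2, h A (k A.1) :=
  (measurable_graphIntegrand hV hw hφ G.1 s).mul (continuous_weights hh).measurable

lemma exists_norm_weightedIntegrand_le (hV : Summable V) {φ : UnitAddTorus (Fin d) → ℂ}
    (hφ : ∃ B, ∀ k, ‖φ k‖ ≤ B) (G : PairedGraph)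
    {h : ℕ × ℕ → UnitAddTorus (Fin d) → ℂ} (hh : ∀ A, Continuous (h A)) :
    ∃ B, ∀ (w : UnitAddTorus (Fin d) → ℝ) (m : ℕ) (s : Fin m → ℝ) (k : ℕ → UnitAddTorus (Fin d)),
      ‖graphIntegrand V w φ G.1 s k * ∏ A ∈ G.2, h A (k A.1)‖ ≤ B := by
  obtain ⟨B, hB⟩ := exists_norm_graphIntegrand_le hV hφ G.1
  obtain ⟨B', hB'⟩ := exists_bound_of_continuous (continuous_weights (S := G.2) hh)
  refine ⟨B * B', fun w m s k => ?_⟩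
  rw [norm_mul]
  exact mul_le_mul (hB w m s k) (hB' k) (norm_nonneg _)
    ((norm_nonneg _).trans (hB w m s k))

end Integrand

/-! ### The two vertices of a leading motive -/

section Motives

set_option linter.unusedSimpArgs false

variable {d : ℕ} {V : (Fin d → ℤ) → ℝ} {w : UnitAddTorus (Fin d) → ℝ}

lemma even_congr {G Y : Type*} [AddCommGroup G] {f : G → Y} (hf : ∀ k, f (-k) = f k) {x y : G}
    (h : x = y ∨ x = -y) : f x = f y := by
  rcases h with rfl | rfl
  · rfl
  · exact hf y

/-- The constraints of the pairs fix the momenta of the edges in terms of the collision only up to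
signs, and an even dispersion relation does not see these. -/
lemma phase_eq (hw : ∀ k, w (-k) = w k) (a b c s : UnitAddTorus (Fin d))
    {p₁ p₂ p₃ : UnitAddTorus (Fin d)} {σ : ℤ} (h₁ : p₁ = a ∨ p₁ = -a) (h₂ : p₂ = b ∨ p₂ = -b)
    (h₃ : p₃ = c ∨ p₃ = -c) (hs : p₁ + p₂ + p₃ = s ∨ p₁ + p₂ + p₃ = -s) :
    phase w ((p₁, p₂, p₃), σ) = w c - w a + σ * (w b - w s) := by
  rw [← even_congr hw h₁, ← even_congr hw h₂, ← even_congr hw h₃, ← even_congr hw hs]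
  rfl

lemma interaction_one (hV' : ∀ x, V (-x) = V x) (x : UnitAddTorus (Fin d))
    {p₁ p₂ p₃ : UnitAddTorus (Fin d)} (h : p₁ + p₂ = x ∨ p₁ + p₂ = -x) :
    interaction V ((p₁, p₂, p₃), 1) = Vhat V x := by
  rw [← even_congr (Vhat_neg hV') h]
  simp only [interaction]
  push_cast
  ring

lemma interaction_neg_one (hV' : ∀ x, V (-x) = V x) (x : UnitAddTorus (Fin d))
    {p₁ p₂ p₃ : UnitAddTorus (Fin d)} (h : p₂ + p₃ = x ∨ p₂ + p₃ = -x) :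
    interaction V ((p₁, p₂, p₃), -1) = Vhat V x := by
  rw [← even_congr (Vhat_neg hV') h]
  simp only [interaction]
  push_cast
  ring

/-- The two vertices of a motive, the lower one `low` and the upper one `up`, have opposite
phases, and together with the sign `ε` they amount to a collision of the momenta
`q + k₂ = k₃ + k₄`. -/
def PairLocal (V : (Fin d → ℤ) → ℝ) (w : UnitAddTorus (Fin d) → ℝ) (ε : ℤ)
    (low up : (UnitAddTorus (Fin d) × UnitAddTorus (Fin d) × UnitAddTorus (Fin d)) × ℤ)
    (sgn : ℤ) (x : Bool) (σ : ℤ) (q k₂ k₃ : UnitAddTorus (Fin d)) : Prop :=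
  phase w low = σ * (w q + w k₂ - w k₃ - w (q + k₂ - k₃)) ∧
  phase w up = -(σ * (w q + w k₂ - w k₃ - w (q + k₂ - k₃))) ∧
  ε * (low.2 * interaction V low * (up.2 * interaction V up)) =
    sgn * collisionFactor V x k₂ k₃ (q + k₂ - k₃)

/-- The loss motives `(o, c, B, C)` for an edge of parity `σ`, where `B` and `C` are the two new
pairs. -/
def lossData (σ : ℤ) : Fin 6 → ℕ × ℕ × (ℕ × ℕ) × (ℕ × ℕ) :=
  if σ = 1 then
    ![(0, 2, (0, 3), (1, 4)), (1, 3, (0, 2), (1, 4)), (2, 4, (0, 3), (1, 2)),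
      (0, 2, (1, 3), (0, 4)), (1, 2, (0, 3), (1, 4)), (2, 3, (0, 4), (1, 2))]
  else
    ![(2, 2, (1, 4), (0, 3)), (1, 1, (2, 4), (0, 3)), (0, 0, (1, 4), (2, 3)),
      (2, 2, (1, 3), (0, 4)), (1, 2, (1, 4), (0, 3)), (0, 1, (0, 4), (2, 3))]

/-- The sign that a loss motive contributes to the sign of the pairing. -/
def lossCrossing : Fin 6 → ℤ := ![-1, 1, 1, 1, -1, -1]

/-- The sign of a loss motive. -/
def lossSign : Fin 6 → ℤ := ![1, 1, 1, -1, -1, -1]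

/-- Whether a loss motive is of exchange type. -/
def lossExchange : Fin 6 → Bool := ![false, true, false, true, false, true]

/-- The momenta `(k₂, k₃)` of the collision, in terms of the momentum `q` of the edge and of
the momenta `u, v` of the new pairs. -/
def lossMomenta {G : Type*} [AddCommGroup G] (σ : ℤ) (i : Fin 6) (q u v : G) : G × G :=
  if σ = 1 then
    (![(-u + -v - q, -u), (-u, -v), (-u, v), (-u + -v - q, -u), (-u, q + -u - -v), (-u, v)] :
      Fin 6 → G × G) i
  else
    (![(u + v - q, u), (u, v), (u, -v), (u + v - q, u), (u, q + u - v), (u, -v)] :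
      Fin 6 → G × G) i

/-- Both vertices of a motive join the same four momenta q, k₂, k₃, k₄ up to signs, one of these
momenta running on the edge between the two vertices. Hence the phases are opposite, and each V̂ has
the argument k₂ - k₃ or k₂ - k₄. The twelve motives are checked one by one; the argument only
differs in the assignment of the momenta. -/
lemma pairLocal_loss (hw : ∀ k, w (-k) = w k) (hV' : ∀ x, V (-x) = V x) {σ : ℤ}
    (hσ : σ = 1 ∨ σ = -1) (i : Fin 6) (a : ℕ → UnitAddTorus (Fin d))
    (hB : a (lossData σ i).2.2.1.2 = -a (lossData σ i).2.2.1.1)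
    (hC : a (lossData σ i).2.2.2.2 = -a (lossData σ i).2.2.2.1) :
    PairLocal V w (lossCrossing i)
      ((a (lossData σ i).1, a ((lossData σ i).1 + 1), a ((lossData σ i).1 + 2)),
        splitParity 0 (fun _ => σ) (lossData σ i).1)
      ((fuse (lossData σ i).1 a 0, fuse (lossData σ i).1 a 1, fuse (lossData σ i).1 a 2), σ)
      (lossSign i) (lossExchange i) σ (a (lossData σ i).2.1)
      (lossMomenta σ i (a (lossData σ i).2.1) (a (lossData σ i).2.2.1.1)
        (a (lossData σ i).2.2.2.1)).1
      (lossMomenta σ i (a (lossData σ i).2.1) (a (lossData σ i).2.2.1.1)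
        (a (lossData σ i).2.2.2.1)).2 := by
  rcases hσ with rfl | rfl <;> fin_cases i
  · change a 3 = -a 0 at hB
    change a 4 = -a 1 at hC
    change PairLocal V w (-1) ((a 0, a 1, a 2), -1) ((a 0 + a 1 + a 2, a 3, a 4), 1) (1)
      false (1) (a 2) (-a 0 + -a 1 - a 2) (-a 0)
    refine ⟨(phase_eq hw (-a 0) (a 2 + (-a 0 + -a 1 - a 2) - (-a 0)) (a 2) (-a 0 + -a 1 - a 2)
        ?_ ?_ ?_ ?_).trans ?_,
      (phase_eq hw (-a 0 + -a 1 - a 2) (-a 0) (a 2 + (-a 0 + -a 1 - a 2) - (-a 0)) (a 2)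
        ?_ ?_ ?_ ?_).trans ?_, ?_⟩
    -- The eleventh goal is the identity for the interactions, after four sign conditions and one
    -- linear identity for each of the two phases. The momentum transferred at each vertex is named
    -- in the collision variables; the remaining goals, here and in the other cases, are linear
    -- identities.
    on_goal 11 => rw [interaction_neg_one hV' ((-a 0 + -a 1 - a 2) - (-a 0)),
      interaction_one hV' ((-a 0 + -a 1 - a 2) - (-a 0))]
    all_goals try simp only [*, collisionFactor, reduceIte, Bool.false_eq_true,
      neg_neg, true_or, or_true]
    all_goals first | done | (left; abel1) | (right; abel1) | (push_cast; ring1)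
  · change a 2 = -a 0 at hB
    change a 4 = -a 1 at hC
    change PairLocal V w (1) ((a 1, a 2, a 3), 1) ((a 0, a 1 + a 2 + a 3, a 4), 1) (1)
      true (1) (a 3) (-a 0) (-a 1)
    refine ⟨(phase_eq hw (-a 1) (-a 0) (a 3) (a 3 + (-a 0) - (-a 1))
        ?_ ?_ ?_ ?_).trans ?_,
      (phase_eq hw (-a 0) (a 3 + (-a 0) - (-a 1)) (-a 1) (a 3)
        ?_ ?_ ?_ ?_).trans ?_, ?_⟩
    on_goal 11 => rw [interaction_one hV' ((-a 0) - (-a 1)),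
      interaction_one hV' ((-a 0) - (a 3 + (-a 0) - (-a 1)))]
    all_goals try simp only [*, collisionFactor, reduceIte, Bool.false_eq_true,
      neg_neg, true_or, or_true]
    all_goals first | done | (left; abel1) | (right; abel1) | (push_cast; ring1)
  · change a 3 = -a 0 at hB
    change a 2 = -a 1 at hC
    change PairLocal V w (1) ((a 2, a 3, a 4), 1) ((a 0, a 1, a 2 + a 3 + a 4), 1) (1)
      false (1) (a 4) (-a 0) (a 1)
    refine ⟨(phase_eq hw (a 1) (-a 0) (a 4) (a 4 + (-a 0) - (a 1))
        ?_ ?_ ?_ ?_).trans ?_,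
      (phase_eq hw (-a 0) (a 1) (a 4 + (-a 0) - (a 1)) (a 4)
        ?_ ?_ ?_ ?_).trans ?_, ?_⟩
    on_goal 11 => rw [interaction_one hV' ((-a 0) - (a 1)),
      interaction_one hV' ((-a 0) - (a 1))]
    all_goals try simp only [*, collisionFactor, reduceIte, Bool.false_eq_true,
      neg_neg, true_or, or_true]
    all_goals first | done | (left; abel1) | (right; abel1) | (push_cast; ring1)
  · change a 3 = -a 1 at hB
    change a 4 = -a 0 at hC
    change PairLocal V w (1) ((a 0, a 1, a 2), -1) ((a 0 + a 1 + a 2, a 3, a 4), 1) (-1)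
      true (1) (a 2) (-a 1 + -a 0 - a 2) (-a 1)
    refine ⟨(phase_eq hw (a 2 + (-a 1 + -a 0 - a 2) - (-a 1)) (-a 1) (a 2) (-a 1 + -a 0 - a 2)
        ?_ ?_ ?_ ?_).trans ?_,
      (phase_eq hw (-a 1 + -a 0 - a 2) (-a 1) (a 2 + (-a 1 + -a 0 - a 2) - (-a 1)) (a 2)
        ?_ ?_ ?_ ?_).trans ?_, ?_⟩
    on_goal 11 => rw [interaction_neg_one hV' ((-a 1 + -a 0 - a 2) - (a 2 + (-a 1 + -a 0 - a 2) - (-a 1))),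
      interaction_one hV' ((-a 1 + -a 0 - a 2) - (-a 1))]
    all_goals try simp only [*, collisionFactor, reduceIte, Bool.false_eq_true,
      neg_neg, true_or, or_true]
    all_goals first | done | (left; abel1) | (right; abel1) | (push_cast; ring1)
  · change a 3 = -a 0 at hB
    change a 4 = -a 1 at hC
    change PairLocal V w (-1) ((a 1, a 2, a 3), 1) ((a 0, a 1 + a 2 + a 3, a 4), 1) (-1)
      false (1) (a 2) (-a 0) (a 2 + -a 0 - -a 1)
    refine ⟨(phase_eq hw (a 2 + (-a 0) - (a 2 + -a 0 - -a 1)) (a 2) (-a 0) (a 2 + -a 0 - -a 1)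
        ?_ ?_ ?_ ?_).trans ?_,
      (phase_eq hw (-a 0) (a 2 + -a 0 - -a 1) (a 2 + (-a 0) - (a 2 + -a 0 - -a 1)) (a 2)
        ?_ ?_ ?_ ?_).trans ?_, ?_⟩
    on_goal 11 => rw [interaction_one hV' ((-a 0) - (a 2 + -a 0 - -a 1)),
      interaction_one hV' ((-a 0) - (a 2 + -a 0 - -a 1))]
    all_goals try simp only [*, collisionFactor, reduceIte, Bool.false_eq_true,
      neg_neg, true_or, or_true]
    all_goals first | done | (left; abel1) | (right; abel1) | (push_cast; ring1)
  · change a 4 = -a 0 at hB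
    change a 2 = -a 1 at hC
    change PairLocal V w (-1) ((a 2, a 3, a 4), 1) ((a 0, a 1, a 2 + a 3 + a 4), 1) (-1)
      true (1) (a 3) (-a 0) (a 1)
    refine ⟨(phase_eq hw (a 1) (a 3) (-a 0) (a 3 + (-a 0) - (a 1))
        ?_ ?_ ?_ ?_).trans ?_,
      (phase_eq hw (-a 0) (a 1) (a 3 + (-a 0) - (a 1)) (a 3)
        ?_ ?_ ?_ ?_).trans ?_, ?_⟩
    on_goal 11 => rw [interaction_one hV' ((-a 0) - (a 3 + (-a 0) - (a 1))),
      interaction_one hV' ((-a 0) - (a 1))]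
    all_goals try simp only [*, collisionFactor, reduceIte, Bool.false_eq_true,
      neg_neg, true_or, or_true]
    all_goals first | done | (left; abel1) | (right; abel1) | (push_cast; ring1)
  · change a 4 = -a 1 at hB
    change a 3 = -a 0 at hC
    change PairLocal V w (-1) ((a 2, a 3, a 4), 1) ((a 0, a 1, a 2 + a 3 + a 4), -1) (1)
      false (-1) (a 2) (a 1 + a 0 - a 2) (a 1)
    refine ⟨(phase_eq hw (a 2) (a 2 + (a 1 + a 0 - a 2) - (a 1)) (a 1) (a 1 + a 0 - a 2)
        ?_ ?_ ?_ ?_).trans ?_,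
      (phase_eq hw (a 2 + (a 1 + a 0 - a 2) - (a 1)) (a 1) (a 1 + a 0 - a 2) (a 2)
        ?_ ?_ ?_ ?_).trans ?_, ?_⟩
    on_goal 11 => rw [interaction_one hV' ((a 1 + a 0 - a 2) - (a 1)),
      interaction_neg_one hV' ((a 1 + a 0 - a 2) - (a 1))]
    all_goals try simp only [*, collisionFactor, reduceIte, Bool.false_eq_true,
      neg_neg, true_or, or_true]
    all_goals first | done | (left; abel1) | (right; abel1) | (push_cast; ring1)
  · change a 4 = -a 2 at hB
    change a 3 = -a 0 at hC
    change PairLocal V w (1) ((a 1, a 2, a 3), -1) ((a 0, a 1 + a 2 + a 3, a 4), -1) (1)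
      true (-1) (a 1) (a 2) (a 0)
    refine ⟨(phase_eq hw (a 1) (a 2) (a 0) (a 1 + (a 2) - (a 0))
        ?_ ?_ ?_ ?_).trans ?_,
      (phase_eq hw (a 0) (a 1 + (a 2) - (a 0)) (a 2) (a 1)
        ?_ ?_ ?_ ?_).trans ?_, ?_⟩
    on_goal 11 => rw [interaction_neg_one hV' ((a 2) - (a 0)),
      interaction_neg_one hV' ((a 2) - (a 1 + (a 2) - (a 0)))]
    all_goals try simp only [*, collisionFactor, reduceIte, Bool.false_eq_true,
      neg_neg, true_or, or_true]
    all_goals first | done | (left; abel1) | (right; abel1) | (push_cast; ring1)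
  · change a 4 = -a 1 at hB
    change a 3 = -a 2 at hC
    change PairLocal V w (1) ((a 0, a 1, a 2), -1) ((a 0 + a 1 + a 2, a 3, a 4), -1) (1)
      false (-1) (a 0) (a 1) (-a 2)
    refine ⟨(phase_eq hw (a 0) (a 1) (-a 2) (a 0 + (a 1) - (-a 2))
        ?_ ?_ ?_ ?_).trans ?_,
      (phase_eq hw (a 0 + (a 1) - (-a 2)) (-a 2) (a 1) (a 0)
        ?_ ?_ ?_ ?_).trans ?_, ?_⟩
    on_goal 11 => rw [interaction_neg_one hV' ((a 1) - (-a 2)),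
      interaction_neg_one hV' ((a 1) - (-a 2))]
    all_goals try simp only [*, collisionFactor, reduceIte, Bool.false_eq_true,
      neg_neg, true_or, or_true]
    all_goals first | done | (left; abel1) | (right; abel1) | (push_cast; ring1)
  · change a 3 = -a 1 at hB
    change a 4 = -a 0 at hC
    change PairLocal V w (1) ((a 2, a 3, a 4), 1) ((a 0, a 1, a 2 + a 3 + a 4), -1) (-1)
      true (-1) (a 2) (a 1 + a 0 - a 2) (a 1)
    refine ⟨(phase_eq hw (a 2) (a 1) (a 2 + (a 1 + a 0 - a 2) - (a 1)) (a 1 + a 0 - a 2)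
        ?_ ?_ ?_ ?_).trans ?_,
      (phase_eq hw (a 2 + (a 1 + a 0 - a 2) - (a 1)) (a 1) (a 1 + a 0 - a 2) (a 2)
        ?_ ?_ ?_ ?_).trans ?_, ?_⟩
    on_goal 11 => rw [interaction_one hV' ((a 1 + a 0 - a 2) - (a 2 + (a 1 + a 0 - a 2) - (a 1))),
      interaction_neg_one hV' ((a 1 + a 0 - a 2) - (a 1))]
    all_goals try simp only [*, collisionFactor, reduceIte, Bool.false_eq_true,
      neg_neg, true_or, or_true]
    all_goals first | done | (left; abel1) | (right; abel1) | (push_cast; ring1)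
  · change a 4 = -a 1 at hB
    change a 3 = -a 0 at hC
    change PairLocal V w (-1) ((a 1, a 2, a 3), -1) ((a 0, a 1 + a 2 + a 3, a 4), -1) (-1)
      false (-1) (a 2) (a 1) (a 2 + a 1 - a 0)
    refine ⟨(phase_eq hw (a 1) (a 2) (a 2 + (a 1) - (a 2 + a 1 - a 0)) (a 2 + a 1 - a 0)
        ?_ ?_ ?_ ?_).trans ?_,
      (phase_eq hw (a 2 + (a 1) - (a 2 + a 1 - a 0)) (a 2 + a 1 - a 0) (a 1) (a 2)
        ?_ ?_ ?_ ?_).trans ?_, ?_⟩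
    on_goal 11 => rw [interaction_neg_one hV' ((a 1) - (a 2 + a 1 - a 0)),
      interaction_neg_one hV' ((a 1) - (a 2 + a 1 - a 0))]
    all_goals try simp only [*, collisionFactor, reduceIte, Bool.false_eq_true,
      neg_neg, true_or, or_true]
    all_goals first | done | (left; abel1) | (right; abel1) | (push_cast; ring1)
  · change a 4 = -a 0 at hB
    change a 3 = -a 2 at hC
    change PairLocal V w (-1) ((a 0, a 1, a 2), -1) ((a 0 + a 1 + a 2, a 3, a 4), -1) (-1)
      true (-1) (a 1) (a 0) (-a 2)
    refine ⟨(phase_eq hw (a 0) (a 1) (-a 2) (a 1 + (a 0) - (-a 2))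
        ?_ ?_ ?_ ?_).trans ?_,
      (phase_eq hw (a 1 + (a 0) - (-a 2)) (-a 2) (a 0) (a 1)
        ?_ ?_ ?_ ?_).trans ?_, ?_⟩
    on_goal 11 => rw [interaction_neg_one hV' ((a 0) - (a 1 + (a 0) - (-a 2))),
      interaction_neg_one hV' ((a 0) - (-a 2))]
    all_goals try simp only [*, collisionFactor, reduceIte, Bool.false_eq_true,
      neg_neg, true_or, or_true]
    all_goals first | done | (left; abel1) | (right; abel1) | (push_cast; ring1)

/-- The edges below the left leg which are paired with the edges `0, 1, 2` below the right leg in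
a gain motive. -/
def gainPartner (σ : ℤ) (i : Fin 2) : Fin 3 → ℕ :=
  if σ = 1 then (![![1, 2, 0], ![2, 1, 0]] : Fin 2 → Fin 3 → ℕ) i
  else (![![2, 0, 1], ![2, 1, 0]] : Fin 2 → Fin 3 → ℕ) i

/-- The sign that a gain motive contributes to the sign of the pairing. -/
def gainCrossing : Fin 2 → ℤ := ![-1, 1]

/-- Whether a gain motive is of exchange type. -/
def gainExchange : Fin 2 → Bool := ![true, false]

/-- The edges below the left leg which carry the momenta `-k₂, k₃, k₄` of the collision. -/
def gainEdge (σ : ℤ) : Fin 3 → ℕ := if σ = 1 then ![0, 1, 2] else ![2, 1, 0]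

/-- The vertex below the right leg carries minus the momenta below the left leg, permuted by
`gainPartner`, and its parity is the opposite one; therefore its phase is the opposite one. Which of
the two vertices is the lower one only decides the sign of the collision time. -/
lemma pairLocal_gain (hw : ∀ k, w (-k) = w k) (hV' : ∀ x, V (-x) = V x) {σ : ℤ}
    (hσ : σ = 1 ∨ σ = -1) (i : Fin 2) (leftUpper : Bool) (a : ℕ → UnitAddTorus (Fin d)) :
    PairLocal V w (gainCrossing i)
      (if leftUpper then ((-a (gainPartner σ i 0), -a (gainPartner σ i 1), -a (gainPartner σ i 2)),
        -σ) else ((a 0, a 1, a 2), σ))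
      (if leftUpper then ((a 0, a 1, a 2), σ) else ((-a (gainPartner σ i 0),
        -a (gainPartner σ i 1), -a (gainPartner σ i 2)), -σ))
      (-gainCrossing i) (gainExchange i) (if leftUpper then σ else -σ) (a 0 + a 1 + a 2)
      (-a (gainEdge σ 0)) (a (gainEdge σ 1)) := by
  rcases hσ with rfl | rfl <;> fin_cases i <;> rcases leftUpper with _ | _
  · change PairLocal V w (-1) ((a 0, a 1, a 2), 1) ((-a 1, -a 2, -a 0), -1) (1)
      true (-1) (a 0 + a 1 + a 2) (-a 0) (a 1)
    refine ⟨(phase_eq hw (-a 0) (a 1) (a 0 + a 1 + a 2 + (-a 0) - (a 1)) (a 0 + a 1 + a 2)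
        ?_ ?_ ?_ ?_).trans ?_,
      (phase_eq hw (a 1) (a 0 + a 1 + a 2 + (-a 0) - (a 1)) (-a 0) (a 0 + a 1 + a 2)
        ?_ ?_ ?_ ?_).trans ?_, ?_⟩
    on_goal 11 => rw [interaction_one hV' ((-a 0) - (a 1)),
      interaction_neg_one hV' ((-a 0) - (a 0 + a 1 + a 2 + (-a 0) - (a 1)))]
    all_goals try simp only [*, collisionFactor, reduceIte, Bool.false_eq_true,
      neg_neg, true_or, or_true]
    all_goals first | done | (left; abel1) | (right; abel1) | (push_cast; ring1)
  · change PairLocal V w (-1) ((-a 1, -a 2, -a 0), -1) ((a 0, a 1, a 2), 1) (1)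
      true (1) (a 0 + a 1 + a 2) (-a 0) (a 1)
    refine ⟨(phase_eq hw (a 1) (a 0 + a 1 + a 2 + (-a 0) - (a 1)) (-a 0) (a 0 + a 1 + a 2)
        ?_ ?_ ?_ ?_).trans ?_,
      (phase_eq hw (-a 0) (a 1) (a 0 + a 1 + a 2 + (-a 0) - (a 1)) (a 0 + a 1 + a 2)
        ?_ ?_ ?_ ?_).trans ?_, ?_⟩
    on_goal 11 => rw [interaction_neg_one hV' ((-a 0) - (a 0 + a 1 + a 2 + (-a 0) - (a 1))),
      interaction_one hV' ((-a 0) - (a 1))]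
    all_goals try simp only [*, collisionFactor, reduceIte, Bool.false_eq_true,
      neg_neg, true_or, or_true]
    all_goals first | done | (left; abel1) | (right; abel1) | (push_cast; ring1)
  · change PairLocal V w (1) ((a 0, a 1, a 2), 1) ((-a 2, -a 1, -a 0), -1) (-1)
      false (-1) (a 0 + a 1 + a 2) (-a 0) (a 1)
    refine ⟨(phase_eq hw (-a 0) (a 1) (a 0 + a 1 + a 2 + (-a 0) - (a 1)) (a 0 + a 1 + a 2)
        ?_ ?_ ?_ ?_).trans ?_,
      (phase_eq hw (a 0 + a 1 + a 2 + (-a 0) - (a 1)) (a 1) (-a 0) (a 0 + a 1 + a 2)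
        ?_ ?_ ?_ ?_).trans ?_, ?_⟩
    on_goal 11 => rw [interaction_one hV' ((-a 0) - (a 1)),
      interaction_neg_one hV' ((-a 0) - (a 1))]
    all_goals try simp only [*, collisionFactor, reduceIte, Bool.false_eq_true,
      neg_neg, true_or, or_true]
    all_goals first | done | (left; abel1) | (right; abel1) | (push_cast; ring1)
  · change PairLocal V w (1) ((-a 2, -a 1, -a 0), -1) ((a 0, a 1, a 2), 1) (-1)
      false (1) (a 0 + a 1 + a 2) (-a 0) (a 1)
    refine ⟨(phase_eq hw (a 0 + a 1 + a 2 + (-a 0) - (a 1)) (a 1) (-a 0) (a 0 + a 1 + a 2)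
        ?_ ?_ ?_ ?_).trans ?_,
      (phase_eq hw (-a 0) (a 1) (a 0 + a 1 + a 2 + (-a 0) - (a 1)) (a 0 + a 1 + a 2)
        ?_ ?_ ?_ ?_).trans ?_, ?_⟩
    on_goal 11 => rw [interaction_neg_one hV' ((-a 0) - (a 1)),
      interaction_one hV' ((-a 0) - (a 1))]
    all_goals try simp only [*, collisionFactor, reduceIte, Bool.false_eq_true,
      neg_neg, true_or, or_true]
    all_goals first | done | (left; abel1) | (right; abel1) | (push_cast; ring1)
  · change PairLocal V w (-1) ((a 0, a 1, a 2), -1) ((-a 2, -a 0, -a 1), 1) (1)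
      true (1) (a 0 + a 1 + a 2) (-a 2) (a 1)
    refine ⟨(phase_eq hw (a 0 + a 1 + a 2 + (-a 2) - (a 1)) (a 1) (-a 2) (a 0 + a 1 + a 2)
        ?_ ?_ ?_ ?_).trans ?_,
      (phase_eq hw (-a 2) (a 0 + a 1 + a 2 + (-a 2) - (a 1)) (a 1) (a 0 + a 1 + a 2)
        ?_ ?_ ?_ ?_).trans ?_, ?_⟩
    on_goal 11 => rw [interaction_neg_one hV' ((-a 2) - (a 1)),
      interaction_one hV' ((-a 2) - (a 0 + a 1 + a 2 + (-a 2) - (a 1)))]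
    all_goals try simp only [*, collisionFactor, reduceIte, Bool.false_eq_true,
      neg_neg, true_or, or_true]
    all_goals first | done | (left; abel1) | (right; abel1) | (push_cast; ring1)
  · change PairLocal V w (-1) ((-a 2, -a 0, -a 1), 1) ((a 0, a 1, a 2), -1) (1)
      true (-1) (a 0 + a 1 + a 2) (-a 2) (a 1)
    refine ⟨(phase_eq hw (-a 2) (a 0 + a 1 + a 2 + (-a 2) - (a 1)) (a 1) (a 0 + a 1 + a 2)
        ?_ ?_ ?_ ?_).trans ?_,
      (phase_eq hw (a 0 + a 1 + a 2 + (-a 2) - (a 1)) (a 1) (-a 2) (a 0 + a 1 + a 2)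
        ?_ ?_ ?_ ?_).trans ?_, ?_⟩
    on_goal 11 => rw [interaction_one hV' ((-a 2) - (a 0 + a 1 + a 2 + (-a 2) - (a 1))),
      interaction_neg_one hV' ((-a 2) - (a 1))]
    all_goals try simp only [*, collisionFactor, reduceIte, Bool.false_eq_true,
      neg_neg, true_or, or_true]
    all_goals first | done | (left; abel1) | (right; abel1) | (push_cast; ring1)
  · change PairLocal V w (1) ((a 0, a 1, a 2), -1) ((-a 2, -a 1, -a 0), 1) (-1)
      false (1) (a 0 + a 1 + a 2) (-a 2) (a 1)
    refine ⟨(phase_eq hw (a 0 + a 1 + a 2 + (-a 2) - (a 1)) (a 1) (-a 2) (a 0 + a 1 + a 2)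
        ?_ ?_ ?_ ?_).trans ?_,
      (phase_eq hw (-a 2) (a 1) (a 0 + a 1 + a 2 + (-a 2) - (a 1)) (a 0 + a 1 + a 2)
        ?_ ?_ ?_ ?_).trans ?_, ?_⟩
    on_goal 11 => rw [interaction_neg_one hV' ((-a 2) - (a 1)),
      interaction_one hV' ((-a 2) - (a 1))]
    all_goals try simp only [*, collisionFactor, reduceIte, Bool.false_eq_true,
      neg_neg, true_or, or_true]
    all_goals first | done | (left; abel1) | (right; abel1) | (push_cast; ring1)
  · change PairLocal V w (1) ((-a 2, -a 1, -a 0), 1) ((a 0, a 1, a 2), -1) (-1)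
      false (-1) (a 0 + a 1 + a 2) (-a 2) (a 1)
    refine ⟨(phase_eq hw (-a 2) (a 1) (a 0 + a 1 + a 2 + (-a 2) - (a 1)) (a 0 + a 1 + a 2)
        ?_ ?_ ?_ ?_).trans ?_,
      (phase_eq hw (a 0 + a 1 + a 2 + (-a 2) - (a 1)) (a 1) (-a 2) (a 0 + a 1 + a 2)
        ?_ ?_ ?_ ?_).trans ?_, ?_⟩
    on_goal 11 => rw [interaction_one hV' ((-a 2) - (a 1)),
      interaction_neg_one hV' ((-a 2) - (a 1))]
    all_goals try simp only [*, collisionFactor, reduceIte, Bool.false_eq_true,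
      neg_neg, true_or, or_true]
    all_goals first | done | (left; abel1) | (right; abel1) | (push_cast; ring1)

end Motives

/-! ### The combinatorics of the attachment of motives -/

section Combinatorics

lemma parity_eq_one_or (ℓ : List ℕ) (i : ℕ) : parity ℓ i = 1 ∨ parity ℓ i = -1 := by
  induction ℓ generalizing i with
  | nil => unfold parity; split_ifs <;> simp
  | cons p ℓ ih => unfold parity splitParity; split_ifs <;> simp [ih]

lemma neg_one_or_one_neg {σ : ℤ} (h : σ = 1 ∨ σ = -1) : -σ = 1 ∨ -σ = -1 := by omega

/-- The renumbering of the edges when a loss motive is attached. -/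
def lossShift (e c : ℕ) : ℕ → ℕ := fun i => if i < e then i else if i = e then e + c else i + 4

lemma lossShift_strictMono {c : ℕ} (hc : c ≤ 4) (e : ℕ) : StrictMono (lossShift e c) := by
  intro i j hij
  unfold lossShift
  split_ifs <;> omega

lemma lossShift_self (e c : ℕ) : lossShift e c e = e + c := by simp [lossShift]

lemma lossShift_of_ne {e i : ℕ} (c : ℕ) (h : i ≠ e) :
    lossShift e c i < e ∨ e + 4 < lossShift e c i := by
  unfold lossShift
  split_ifs <;> omega

/-- The two pairs of a loss motive. -/
def lossPairs (σ : ℤ) (i : Fin 6) : Finset (ℕ × ℕ) :=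
  {(lossData σ i).2.2.1, (lossData σ i).2.2.2}

/-- The graph obtained by attaching the `i`-th loss motive to the edge `e`. -/
def lossGraph (G : PairedGraph) (e : ℕ) (i : Fin 6) : PairedGraph :=
  attachLoss G e ((lossData (parity G.1 e) i).1, (lossData (parity G.1 e) i).2.1,
    lossPairs (parity G.1 e) i)

/-- The position of an edge of a motive relative to the split edge. -/
abbrev translate (e : ℕ) (A : ℕ × ℕ) : ℕ × ℕ := (e + A.1, e + A.2)

/-- The renumbering of pairs. -/
abbrev mapPair (r : ℕ → ℕ) (A : ℕ × ℕ) : ℕ × ℕ := (r A.1, r A.2)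

lemma mapPair_injective {r : ℕ → ℕ} (hr : Function.Injective r) :
    Function.Injective (mapPair r) := fun A B h => by
  simp only [mapPair, Prod.mk.injEq] at h
  exact Prod.ext (hr h.1) (hr h.2)

lemma lossGraph_fst (G : PairedGraph) (e : ℕ) (i : Fin 6) :
    (lossGraph G e i).1 = (e + (lossData (parity G.1 e) i).1) :: e :: G.1 := rfl

lemma lossGraph_snd (G : PairedGraph) (e : ℕ) (i : Fin 6) :
    (lossGraph G e i).2 = G.2.image (mapPair (lossShift e (lossData (parity G.1 e) i).2.1)) ∪
      {translate e (lossData (parity G.1 e) i).2.2.1,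
        translate e (lossData (parity G.1 e) i).2.2.2} := by
  simp only [lossGraph, attachLoss, lossPairs, Finset.image_insert, Finset.image_singleton]
  rfl

/-- The indexing by `Fin 6`, with the two pairs in a fixed order, allows signs, weights and leg
parities to be tabulated once for both parities of the edge. -/
lemma lossAttachments_eq (G : PairedGraph) (e : ℕ) :
    lossAttachments G e = Finset.univ.image (lossGraph G e) := by
  have h : ∀ σ : ℤ, σ = 1 ∨ σ = -1 → lossMotives σ = Finset.univ.image fun i : Fin 6 =>
      ((lossData σ i).1, (lossData σ i).2.1, lossPairs σ i) := by
    rintro σ (rfl | rfl) <;> decide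
  rw [lossAttachments, h _ (parity_eq_one_or _ _), Finset.image_image]
  rfl

/-- The parities of the five edges of a loss motive. -/
def lossParity (σ : ℤ) (i : Fin 6) : ℕ → ℤ :=
  splitParity (lossData σ i).1 (splitParity 0 fun _ => σ)

/-- The numerical data of the loss motives. -/
lemma lossData_spec {σ : ℤ} (hσ : σ = 1 ∨ σ = -1) (i : Fin 6) :
    (lossData σ i).1 ≤ 2 ∧ (lossData σ i).2.1 ≤ 4 ∧
    ((lossData σ i).2.2.1.1 < (lossData σ i).2.2.1.2 ∧ (lossData σ i).2.2.1.2 ≤ 4) ∧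
    ((lossData σ i).2.2.2.1 < (lossData σ i).2.2.2.2 ∧ (lossData σ i).2.2.2.2 ≤ 4) ∧
    ((lossData σ i).2.2.1.1 ≠ (lossData σ i).2.1 ∧ (lossData σ i).2.2.1.2 ≠ (lossData σ i).2.1 ∧
      (lossData σ i).2.2.2.1 ≠ (lossData σ i).2.1 ∧
      (lossData σ i).2.2.2.2 ≠ (lossData σ i).2.1) ∧
    ((lossData σ i).2.2.1.1 ≠ (lossData σ i).2.2.2.1 ∧
      (lossData σ i).2.2.1.1 ≠ (lossData σ i).2.2.2.2 ∧
      (lossData σ i).2.2.1.2 ≠ (lossData σ i).2.2.2.1 ∧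
      (lossData σ i).2.2.1.2 ≠ (lossData σ i).2.2.2.2) := by
  have h1 : σ = 1 ∨ σ = -1 := hσ
  rcases h1 with rfl | rfl
  · revert i; decide
  · revert i; decide

/-- The parities of the left legs of the two pairs of a loss motive. -/
def lossLegParity : Fin 6 → ℤ × ℤ :=
  ![(-1, -1), (-1, -1), (-1, 1), (-1, -1), (-1, -1), (-1, 1)]

/-- The table `lossLegParity` serves both values of σ: the mirror image flips all parities, but it
also exchanges the left and the right leg of a pair, so the parity of the left leg is unchanged. -/
lemma lossParity_spec {σ : ℤ} (hσ : σ = 1 ∨ σ = -1) (i : Fin 6) :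
    lossParity σ i (lossData σ i).2.1 = σ ∧
    lossParity σ i (lossData σ i).2.2.1.1 = (lossLegParity i).1 ∧
    lossParity σ i (lossData σ i).2.2.1.2 = -(lossLegParity i).1 ∧
    lossParity σ i (lossData σ i).2.2.2.1 = (lossLegParity i).2 ∧
    lossParity σ i (lossData σ i).2.2.2.2 = -(lossLegParity i).2 := by
  rcases hσ with rfl | rfl
  · revert i; decide
  · revert i; decide

lemma splitParity_add (e o j : ℕ) (row : ℕ → ℤ) :
    splitParity (e + o) row (e + j) = splitParity o (fun i => row (e + i)) j := by
  unfold splitParity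
  by_cases h1 : j < o
  · rw [if_pos (by omega), if_pos h1]
  by_cases h2 : j = o
  · subst h2
    simp
  by_cases h3 : j = o + 1
  · subst h3
    rw [if_neg (by omega), if_neg (by omega), if_pos (by omega), if_neg (by omega),
      if_neg (by omega), if_pos rfl]
  by_cases h4 : j = o + 2
  · subst h4
    rw [if_neg (by omega), if_neg (by omega), if_neg (by omega), if_pos (by omega),
      if_neg (by omega), if_neg (by omega), if_neg (by omega), if_pos rfl]
  · rw [if_neg (by omega), if_neg (by omega), if_neg (by omega), if_neg (by omega),
      if_neg (by omega), if_neg (by omega), if_neg (by omega), if_neg (by omega),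
      Nat.add_sub_assoc (by omega)]

lemma splitParity_congr {o j n : ℕ} {row row' : ℕ → ℤ} (h : ∀ i ≤ n, row i = row' i)
    (ho : o ≤ n) (hj : j ≤ n + 2) : splitParity o row j = splitParity o row' j := by
  unfold splitParity
  split_ifs with h1 h2 h3 h4
  · exact h j (by omega)
  · rfl
  · exact h o ho
  · rfl
  · exact h _ (by omega)

lemma splitParity_zero_congr {j : ℕ} (row : ℕ → ℤ) (hj : j ≤ 2) :
    splitParity 0 row j = splitParity 0 (fun _ => row 0) j := by
  interval_cases j <;> rfl

lemma parity_loss_low (ℓ : List ℕ) (e : ℕ) {o : ℕ} (ho : o ≤ 2) :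
    parity (e :: ℓ) (e + o) = splitParity 0 (fun _ => parity ℓ e) o := by
  change splitParity (e + 0) (parity ℓ) (e + o) = _
  rw [splitParity_add, splitParity_zero_congr _ ho]
  rfl

lemma parity_loss_new (ℓ : List ℕ) (e : ℕ) {o j : ℕ} (ho : o ≤ 2) (hj : j ≤ 4) :
    parity ((e + o) :: e :: ℓ) (e + j) =
      splitParity o (splitParity 0 fun _ => parity ℓ e) j := by
  change splitParity (e + o) (parity (e :: ℓ)) (e + j) = _
  rw [splitParity_add]
  exact splitParity_congr (n := 2) (fun i hi => parity_loss_low ℓ e hi) ho hj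

lemma parity_loss_old (ℓ : List ℕ) {e o l : ℕ} (c : ℕ) (ho : o ≤ 2) (hl : l ≠ e) :
    parity ((e + o) :: e :: ℓ) (lossShift e c l) = parity ℓ l := by
  change splitParity (e + o) (splitParity e (parity ℓ)) _ = _
  unfold lossShift
  rcases lt_or_gt_of_ne hl with h | h
  · rw [if_pos h]
    unfold splitParity
    rw [if_pos (by omega), if_pos h]
  · rw [if_neg (by omega), if_neg hl]
    unfold splitParity
    rw [if_neg (by omega), if_neg (by omega), if_neg (by omega), if_neg (by omega),
      if_neg (by omega), if_neg (by omega), if_neg (by omega), if_neg (by omega)]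
    congr 1

lemma parity_lossGraph_old (G : PairedGraph) (e : ℕ) (i : Fin 6) (l : ℕ) :
    parity (lossGraph G e i).1 (lossShift e (lossData (parity G.1 e) i).2.1 l) =
      parity G.1 l := by
  have hσ := parity_eq_one_or G.1 e
  obtain ⟨ho, hc, -⟩ := lossData_spec hσ i
  rw [lossGraph_fst]
  by_cases hl : l = e
  · subst hl
    rw [lossShift_self, parity_loss_new _ _ ho hc]
    exact (lossParity_spec hσ i).1
  · exact parity_loss_old _ _ ho hl

lemma parity_lossGraph_new (G : PairedGraph) (e : ℕ) (i : Fin 6) {j : ℕ} (hj : j ≤ 4) :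
    parity (lossGraph G e i).1 (e + j) = lossParity (parity G.1 e) i j := by
  rw [lossGraph_fst, parity_loss_new _ _ (lossData_spec (parity_eq_one_or G.1 e) i).1 hj]
  rfl

/-! #### Gain motives -/

/-- The renumbering of the edges when a pair is replaced by a gain motive. -/
def gainShift (A : ℕ × ℕ) : ℕ → ℕ :=
  fun i => if i < A.1 then i else if i < A.2 then i + 2 else i + 4

/-- The numbers of the six edges of a gain motive. -/
def gainSlot (A : ℕ × ℕ) : ℕ → ℕ := fun x => if x < 3 then A.1 + x else A.2 + 2 + (x - 3)

lemma gainShift_strictMono (A : ℕ × ℕ) : StrictMono (gainShift A) := by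
  intro i j hij
  unfold gainShift
  split_ifs <;> omega

lemma gainSlot_strictMono {A : ℕ × ℕ} (h : A.1 < A.2) : StrictMono (gainSlot A) := by
  intro i j hij
  unfold gainSlot
  split_ifs <;> omega

/-- The pairs of the gain motives; the left leg of the `j`-th pair is the edge `gainEdge σ j`. -/
def gainData (σ : ℤ) : Fin 2 → Fin 3 → ℕ × ℕ :=
  if σ = 1 then ![![(0, 5), (1, 3), (2, 4)], ![(0, 5), (1, 4), (2, 3)]]
  else ![![(2, 3), (1, 5), (0, 4)], ![(2, 3), (1, 4), (0, 5)]]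

/-- The graph obtained by replacing the pair `A` by the `i`-th gain motive. -/
def gainGraph (G : PairedGraph) (A : ℕ × ℕ) (leftUpper : Bool) (i : Fin 2) : PairedGraph :=
  attachGain G A leftUpper (Finset.univ.image (gainData (parity G.1 A.1) i))

/-- The `j`-th pair of the gain motive. -/
def gainPair (σ : ℤ) (A : ℕ × ℕ) (i : Fin 2) (j : Fin 3) : ℕ × ℕ :=
  mapPair (gainSlot A) (gainData σ i j)

lemma gainGraph_fst (G : PairedGraph) (A : ℕ × ℕ) (leftUpper : Bool) (i : Fin 2) :
    (gainGraph G A leftUpper i).1 = if leftUpper then (A.2 + 2) :: A.1 :: G.1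
      else A.1 :: A.2 :: G.1 := by
  cases leftUpper <;> rfl

lemma gainGraph_snd (G : PairedGraph) (A : ℕ × ℕ) (leftUpper : Bool) (i : Fin 2) :
    (gainGraph G A leftUpper i).2 = (G.2.erase A).image (mapPair (gainShift A)) ∪
      Finset.univ.image (gainPair (parity G.1 A.1) A i) := by
  simp only [gainGraph, attachGain, Finset.image_image]
  rfl

lemma gainAttachments_eq (G : PairedGraph) (A : ℕ × ℕ) :
    gainAttachments G A = Finset.univ.image fun p : Bool × Fin 2 => gainGraph G A p.1 p.2 := by
  have h : ∀ σ : ℤ, σ = 1 ∨ σ = -1 → gainPairings σ =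
      Finset.univ.image fun i : Fin 2 => Finset.univ.image (gainData σ i) := by
    rintro σ (rfl | rfl) <;> decide
  rw [gainAttachments, h _ (parity_eq_one_or _ _)]
  ext H
  simp only [Finset.mem_image, Finset.mem_product, Finset.mem_univ, true_and, Prod.exists]
  constructor
  · rintro ⟨b, P, ⟨i, rfl⟩, rfl⟩
    exact ⟨b, i, rfl⟩
  · rintro ⟨b, i, rfl⟩
    exact ⟨b, _, ⟨i, rfl⟩, rfl⟩

lemma gainData_spec {σ : ℤ} (hσ : σ = 1 ∨ σ = -1) (i : Fin 2) (j : Fin 3) :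
    (gainData σ i j).1 = gainEdge σ j ∧ gainEdge σ j < 3 ∧ 3 ≤ (gainData σ i j).2 ∧
      (gainData σ i j).2 < 6 ∧ gainPartner σ i ⟨((gainData σ i j).2 - 3) % 3,
        Nat.mod_lt _ (by norm_num)⟩ = gainEdge σ j := by
  rcases hσ with rfl | rfl
  · revert i j; decide
  · revert i j; decide

lemma gainData_injective {σ : ℤ} (hσ : σ = 1 ∨ σ = -1) (i : Fin 2) (j j' : Fin 3) (h : j ≠ j') :
    gainEdge σ j ≠ gainEdge σ j' ∧ (gainData σ i j).2 ≠ (gainData σ i j').2 := by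
  rcases hσ with rfl | rfl
  · revert i j j'; decide
  · revert i j j'; decide

/-- The parities of the left legs of the pairs of a gain motive. -/
def gainLegParity (σ : ℤ) : Fin 3 → ℤ := ![-σ, σ, σ]

/-- The parities of the six edges of a gain motive. -/
def gainParity (σ : ℤ) (x : ℕ) : ℤ :=
  if x < 3 then splitParity 0 (fun _ => σ) x else splitParity 0 (fun _ => -σ) (x - 3)

lemma gainParity_spec {σ : ℤ} (hσ : σ = 1 ∨ σ = -1) (i : Fin 2) (j : Fin 3) :
    gainParity σ (gainData σ i j).1 = gainLegParity σ j ∧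
      gainParity σ (gainData σ i j).2 = -gainLegParity σ j := by
  rcases hσ with rfl | rfl
  · revert i j; decide
  · revert i j; decide

/-- Splittings of two different edges commute up to the shift by 2 that the splitting of the left
leg causes on the right leg. So the parities do not depend on the order of the gain vertices. -/
lemma parity_gain_eq (ℓ : List ℕ) {a b : ℕ} (h : a < b) :
    parity ((b + 2) :: a :: ℓ) = parity (a :: b :: ℓ) := by
  funext l
  change splitParity (b + 2) (splitParity a (parity ℓ)) l =
    splitParity a (splitParity b (parity ℓ)) l
  grind (splits := 20) [splitParity]

lemma parity_gainGraph (G : PairedGraph) {A : ℕ × ℕ} (h : A.1 < A.2) (leftUpper : Bool)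
    (i : Fin 2) : parity (gainGraph G A leftUpper i).1 = parity (A.1 :: A.2 :: G.1) := by
  rw [gainGraph_fst]
  cases leftUpper
  · rfl
  · simp [parity_gain_eq _ h]

lemma parity_gain_old (ℓ : List ℕ) {A : ℕ × ℕ} (h : A.1 < A.2) {l : ℕ} (h1 : l ≠ A.1)
    (h2 : l ≠ A.2) : parity (A.1 :: A.2 :: ℓ) (gainShift A l) = parity ℓ l := by
  change splitParity A.1 (splitParity A.2 (parity ℓ)) _ = _
  unfold gainShift splitParity
  split_ifs <;> first | rfl | omega

lemma parity_gain_new (ℓ : List ℕ) {A : ℕ × ℕ} (h : A.1 < A.2)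
    (hA : parity ℓ A.2 = -parity ℓ A.1) {x : ℕ} (hx : x < 6) :
    parity (A.1 :: A.2 :: ℓ) (gainSlot A x) = gainParity (parity ℓ A.1) x := by
  change splitParity A.1 (splitParity A.2 (parity ℓ)) _ = _
  unfold gainSlot gainParity
  interval_cases x <;> grind (splits := 20) [splitParity]

end Combinatorics

/-! #### Momenta of the edges of a motive -/

section MotiveRows

variable {G : Type*} [AddCommGroup G]

lemma fuse_add (e o j : ℕ) (k : ℕ → G) : fuse (e + o) k (e + j) = fuse o (fun l => k (e + l)) j := by
  grind [fuse]

lemma fuse_fuse_loss (e : ℕ) {o : ℕ} (ho : o ≤ 2) (k : ℕ → G) (l : ℕ) :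
    fuse e (fuse (e + o) k) l = if l < e then k l else if l = e then
      k e + k (e + 1) + k (e + 2) + k (e + 3) + k (e + 4) else k (l + 4) := by
  unfold fuse
  rcases lt_trichotomy l e with h | h | h
  · rw [if_pos h, if_pos (by omega), if_pos h]
  · subst h
    simp only [lt_irrefl, if_false, if_true]
    interval_cases o <;> simp [add_assoc]
  · rw [if_neg (by omega), if_neg (by omega), if_neg (by omega), if_neg (by omega),
      if_neg (by omega), if_neg (by omega)]

/-- The two new pairs lie entirely among the five edges and drop out of the sum; only the edge that
takes over the partner is left. -/
lemma lossEdges_sum {σ : ℤ} (hσ : σ = 1 ∨ σ = -1) (i : Fin 6) (a : ℕ → G)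
    (hB : a (lossData σ i).2.2.1.2 = -a (lossData σ i).2.2.1.1)
    (hC : a (lossData σ i).2.2.2.2 = -a (lossData σ i).2.2.2.1) :
    a 0 + a 1 + a 2 + a 3 + a 4 = a (lossData σ i).2.1 := by
  rcases hσ with rfl | rfl <;> fin_cases i
  all_goals
    simp [lossData] at hB hC ⊢
    simp only [hB, hC]
    abel1

/-- Above the two new vertices the motive is invisible: the fused edge carries the momentum of the
edge that took over the partner, and the history of the old graph sees its own row. -/
lemma fuse_loss {σ : ℤ} (hσ : σ = 1 ∨ σ = -1) (i : Fin 6) (e : ℕ) (k : ℕ → G)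
    (hB : k (e + (lossData σ i).2.2.1.2) = -k (e + (lossData σ i).2.2.1.1))
    (hC : k (e + (lossData σ i).2.2.2.2) = -k (e + (lossData σ i).2.2.2.1)) :
    fuse e (fuse (e + (lossData σ i).1) k) = k ∘ lossShift e (lossData σ i).2.1 := by
  funext l
  rw [fuse_fuse_loss e (lossData_spec hσ i).1, Function.comp_apply, lossShift]
  split_ifs
  · rfl
  · exact lossEdges_sum hσ i (fun j => k (e + j)) hB hC
  · rfl

/-- The momenta of the edges before a pair was replaced by a gain motive. -/
def gainFuse (A : ℕ × ℕ) (k : ℕ → G) : ℕ → G := fun l =>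
  if l = A.1 then k A.1 + k (A.1 + 1) + k (A.1 + 2)
  else if l = A.2 then k (A.2 + 2) + k (A.2 + 3) + k (A.2 + 4) else k (gainShift A l)

/-- If the right vertex is the lower one, it is met while the left leg still consists of three
edges, hence at the position `A.2 + 2`. Both orders lead to the same row above the motive. -/
lemma fuse_gain {A : ℕ × ℕ} (h : A.1 < A.2) (k : ℕ → G) :
    fuse A.1 (fuse (A.2 + 2) k) = gainFuse A k ∧ fuse A.2 (fuse A.1 k) = gainFuse A k := by
  constructor
  · funext l
    grind (splits := 20) [fuse, gainFuse, gainShift]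
  · funext l
    grind (splits := 20) [fuse, gainFuse, gainShift]

lemma gainPartner_of_pairs {σ : ℤ} (hσ : σ = 1 ∨ σ = -1) (i : Fin 2) (A : ℕ × ℕ) {k : ℕ → G}
    (hk : ∀ j, k (gainPair σ A i j).2 = -k (gainPair σ A i j).1) (y : Fin 3) :
    k (A.2 + 2 + y) = -k (A.1 + gainPartner σ i y) := by
  have h : ∀ y : Fin 3, ∃ j, (gainData σ i j).2 = 3 + y ∧ (gainData σ i j).1 = gainPartner σ i y ∧
      gainPartner σ i y < 3 := by
    clear hk
    rcases hσ with rfl | rfl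
    · revert i; decide
    · revert i; decide
  obtain ⟨j, h1, h2, h3⟩ := h y
  have := hk j
  simp only [gainPair, mapPair, h1, h2, gainSlot, if_pos h3] at this
  simpa using this

lemma gainPartner_sum {σ : ℤ} (hσ : σ = 1 ∨ σ = -1) (i : Fin 2) (a : ℕ → G) :
    -a (gainPartner σ i 0) + -a (gainPartner σ i 1) + -a (gainPartner σ i 2) =
      -(a 0 + a 1 + a 2) := by
  rcases hσ with rfl | rfl <;> fin_cases i
  all_goals
    simp [gainPartner]
    abel1

end MotiveRows

/-! ### Vertices and top momentum of a graph with an attached motive -/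

section MotiveVertices

variable {d : ℕ} {V : (Fin d → ℤ) → ℝ} {w : UnitAddTorus (Fin d) → ℝ}

lemma vertices_lossGraph (hw : ∀ k, w (-k) = w k) (hV' : ∀ x, V (-x) = V x) (G : PairedGraph)
    (e : ℕ) (i : Fin 6) (k : ℕ → UnitAddTorus (Fin d)) {σ : ℤ} (hσ : parity G.1 e = σ)
    (hB : k (e + (lossData σ i).2.2.1.2) = -k (e + (lossData σ i).2.2.1.1))
    (hC : k (e + (lossData σ i).2.2.2.2) = -k (e + (lossData σ i).2.2.2.1)) :
    ∃ low up, vertices (lossGraph G e i).1 k = low :: up ::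
        vertices G.1 (k ∘ lossShift e (lossData σ i).2.1) ∧
      PairLocal V w (lossCrossing i) low up (lossSign i) (lossExchange i) σ
        (k (e + (lossData σ i).2.1))
        (lossMomenta σ i (k (e + (lossData σ i).2.1)) (k (e + (lossData σ i).2.2.1.1))
          (k (e + (lossData σ i).2.2.2.1))).1
        (lossMomenta σ i (k (e + (lossData σ i).2.1)) (k (e + (lossData σ i).2.2.1.1))
          (k (e + (lossData σ i).2.2.2.1))).2 := by
  have hσ' : σ = 1 ∨ σ = -1 := hσ ▸ parity_eq_one_or G.1 e
  refine ⟨_, _, ?_, pairLocal_loss hw hV' hσ' i (fun j => k (e + j)) hB hC⟩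
  rw [lossGraph_fst, hσ]
  simp only [vertices]
  rw [fuse_loss hσ' i e k hB hC, parity_loss_low _ _ (lossData_spec hσ' i).1, hσ,
    ← fuse_add e _ 0, ← fuse_add e _ 1, ← fuse_add e _ 2]
  rfl

lemma vertices_gainGraph (hw : ∀ k, w (-k) = w k) (hV' : ∀ x, V (-x) = V x) (G : PairedGraph)
    {A : ℕ × ℕ} (hA : A.1 < A.2) (i : Fin 2) (leftUpper : Bool) (k : ℕ → UnitAddTorus (Fin d))
    {σ : ℤ} (hσ : parity G.1 A.1 = σ) (hσ' : parity G.1 A.2 = -σ)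
    (hk : ∀ j, k (gainPair σ A i j).2 = -k (gainPair σ A i j).1) :
    ∃ low up, vertices (gainGraph G A leftUpper i).1 k = low :: up ::
        vertices G.1 (gainFuse A k) ∧
      PairLocal V w (gainCrossing i) low up (-gainCrossing i) (gainExchange i)
        (if leftUpper then σ else -σ) (k A.1 + k (A.1 + 1) + k (A.1 + 2))
        (-k (A.1 + gainEdge σ 0)) (k (A.1 + gainEdge σ 1)) := by
  have hs : σ = 1 ∨ σ = -1 := hσ ▸ parity_eq_one_or G.1 A.1
  refine ⟨_, _, ?_, pairLocal_gain hw hV' hs i leftUpper (fun j => k (A.1 + j))⟩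
  have hp := gainPartner_of_pairs hs i A hk
  have h0 := hp 0
  have h1 := hp 1
  have h2 := hp 2
  simp only [Fin.val_zero, Fin.val_one, Fin.val_two, add_zero] at h0 h1 h2
  rw [gainGraph_fst]
  cases leftUpper
  · simp only [vertices, Bool.false_eq_true, if_false]
    rw [(fuse_gain hA k).2, ← h0, ← h1, ← h2, hσ']
    have e1 : parity (A.2 :: G.1) A.1 = σ := by
      change splitParity _ _ _ = _
      rw [splitParity, if_pos hA, hσ]
    have e2 : ∀ y, fuse A.1 k (A.2 + y) = k (A.2 + 2 + y) := fun y => by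
      unfold fuse
      rw [if_neg (by omega), if_neg (by omega)]
      congr 1
      omega
    rw [e1, e2 1, e2 2]
    have := e2 0
    simp only [add_zero] at this ⊢
    rw [this]
  · simp only [vertices, if_true]
    rw [(fuse_gain hA k).1, ← h0, ← h1, ← h2, hσ]
    have e1 : parity (A.1 :: G.1) (A.2 + 2) = -σ := by
      change splitParity _ _ _ = _
      rw [splitParity, if_neg (by omega), if_neg (by omega), if_neg (by omega), if_neg (by omega),
        Nat.add_sub_cancel, hσ']
    have e2 : ∀ y ≤ 2, fuse (A.2 + 2) k (A.1 + y) = k (A.1 + y) := fun y hy => by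
      unfold fuse
      rw [if_pos (by omega)]
    rw [e1, e2 1 (by omega), e2 2 (by omega)]
    have := e2 0 (by omega)
    simp only [add_zero] at this ⊢
    rw [this]

lemma topMomentum_lossGraph (G : PairedGraph) (e : ℕ) (i : Fin 6)
    (k : ℕ → UnitAddTorus (Fin d)) {σ : ℤ} (hσ : parity G.1 e = σ)
    (hB : k (e + (lossData σ i).2.2.1.2) = -k (e + (lossData σ i).2.2.1.1))
    (hC : k (e + (lossData σ i).2.2.2.2) = -k (e + (lossData σ i).2.2.2.1)) :
    topMomentum (lossGraph G e i).1 k =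
      topMomentum G.1 (k ∘ lossShift e (lossData σ i).2.1) := by
  rw [lossGraph_fst, hσ]
  simp only [topMomentum]
  rw [fuse_loss (hσ ▸ parity_eq_one_or G.1 e) i e k hB hC]

lemma topMomentum_gainGraph (G : PairedGraph) {A : ℕ × ℕ} (hA : A.1 < A.2) (i : Fin 2)
    (leftUpper : Bool) (k : ℕ → UnitAddTorus (Fin d)) :
    topMomentum (gainGraph G A leftUpper i).1 k = topMomentum G.1 (gainFuse A k) := by
  rw [gainGraph_fst]
  cases leftUpper
  · simp only [topMomentum, Bool.false_eq_true, if_false]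
    rw [(fuse_gain hA k).2]
  · simp only [topMomentum, if_true]
    rw [(fuse_gain hA k).1]

end MotiveVertices

/-! #### The sign of a pairing -/

section Signs

/-- The sign that a pair of pairs contributes to the sign of the pairing. -/
def crossing (P Q : ℕ × ℕ) : ℤ := if P.1 < Q.1 ∧ Q.1 < P.2 ∧ P.2 < Q.2 then -1 else 1

/-- Two disjoint pairs contribute no inversion if one lies to the left of the other, two if they are
nested, and one if they cross. So only crossings matter for the sign. -/
lemma pairingSign_eq {S : Finset (ℕ × ℕ)} (hS : IsPairing S) :
    pairingSign S = ∏ P ∈ S, ∏ Q ∈ S, crossing P Q := by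
  rw [pairingSign, ← Finset.prod_pow_eq_pow_sum, Finset.prod_filter, Finset.prod_product]
  refine Finset.prod_congr rfl fun P hP => Finset.prod_congr rfl fun Q hQ => ?_
  have h1 := hS.lt P hP
  have h2 := hS.lt Q hQ
  by_cases hPQ : P = Q
  · subst hPQ
    simp [crossing]
  obtain ⟨-, -, h3, h4⟩ := hS.disj P hP Q hQ hPQ
  obtain ⟨p, p'⟩ := P
  obtain ⟨q, q'⟩ := Q
  simp only at h1 h2 h3 h4 ⊢
  simp only [crossing]
  by_cases h : p < q
  · rw [if_pos h]
    rcases lt_or_gt_of_ne h3 with h5 | h5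
    · rw [if_neg (by omega), Finset.filter_eq_empty_iff.mpr]
      · simp
      · simp only [Finset.mem_product, Finset.mem_insert, Finset.mem_singleton, Prod.forall]
        omega
    · rcases lt_or_gt_of_ne h4 with h6 | h6
      · rw [if_pos ⟨h, h5, h6⟩]
        have : (({p, p'} : Finset ℕ) ×ˢ ({q, q'} : Finset ℕ)).filter (fun x => x.2 < x.1) =
            {(p', q)} := by
          ext ⟨x, y⟩
          simp only [Finset.mem_filter, Finset.mem_product, Finset.mem_insert,
            Finset.mem_singleton, Prod.mk.injEq]
          omega
        rw [this]
        rfl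
      · rw [if_neg (by omega)]
        have : (({p, p'} : Finset ℕ) ×ˢ ({q, q'} : Finset ℕ)).filter (fun x => x.2 < x.1) =
            {(p', q), (p', q')} := by
          ext ⟨x, y⟩
          simp only [Finset.mem_filter, Finset.mem_product, Finset.mem_insert,
            Finset.mem_singleton, Prod.mk.injEq]
          omega
        rw [this, Finset.card_pair (by simp; omega)]
        norm_num
  · rw [if_neg h, if_neg (by omega)]

lemma IsPairing.subset {S S' : Finset (ℕ × ℕ)} (hS : IsPairing S) (h : S' ⊆ S) : IsPairing S' :=
  ⟨fun A hA => hS.lt A (h hA), fun A hA B hB => hS.disj A (h hA) B (h hB)⟩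

lemma IsPairing.image {S : Finset (ℕ × ℕ)} (hS : IsPairing S) {r : ℕ → ℕ} (hr : StrictMono r) :
    IsPairing (S.image (mapPair r)) := by
  constructor
  · intro A hA
    obtain ⟨A, hA', rfl⟩ := Finset.mem_image.mp hA
    exact hr (hS.lt A hA')
  · intro A hA B hB hAB
    obtain ⟨A, hA', rfl⟩ := Finset.mem_image.mp hA
    obtain ⟨B, hB', rfl⟩ := Finset.mem_image.mp hB
    have := hS.disj A hA' B hB' fun h => hAB (by rw [h])
    simpa only [mapPair, ne_eq, hr.injective.eq_iff] using this

/-- The legs of the two pairs are different. -/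
def Separated (P Q : ℕ × ℕ) : Prop := P.1 ≠ Q.1 ∧ P.1 ≠ Q.2 ∧ P.2 ≠ Q.1 ∧ P.2 ≠ Q.2

lemma IsPairing.union {S N : Finset (ℕ × ℕ)} (hS : IsPairing S) (hN : IsPairing N)
    (h : ∀ P ∈ S, ∀ Q ∈ N, Separated P Q) : IsPairing (S ∪ N) := by
  constructor
  · intro A hA
    rcases Finset.mem_union.mp hA with hA | hA
    exacts [hS.lt A hA, hN.lt A hA]
  · intro A hA B hB hAB
    rcases Finset.mem_union.mp hA with hA | hA <;> rcases Finset.mem_union.mp hB with hB | hB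
    · exact hS.disj A hA B hB hAB
    · exact h A hA B hB
    · have := h B hB A hA
      exact ⟨this.1.symm, this.2.2.1.symm, this.2.1.symm, this.2.2.2.symm⟩
    · exact hN.disj A hA B hB hAB

lemma pairingSign_image {S : Finset (ℕ × ℕ)} (hS : IsPairing S) {r : ℕ → ℕ} (hr : StrictMono r) :
    pairingSign (S.image (mapPair r)) = pairingSign S := by
  have hinj := mapPair_injective hr.injective
  rw [pairingSign_eq hS, pairingSign_eq (hS.image hr), Finset.prod_image hinj.injOn]
  refine Finset.prod_congr rfl fun P _ => ?_
  rw [Finset.prod_image hinj.injOn]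
  simp only [crossing, hr.lt_iff_lt]

/-- The sign that a pair of pairs, in any order, contributes to the sign of the pairing. -/
def symCrossing (P Q : ℕ × ℕ) : ℤ := crossing P Q * crossing Q P

lemma pairingSign_union {S N : Finset (ℕ × ℕ)} (h : IsPairing (S ∪ N)) (hd : Disjoint S N) :
    pairingSign (S ∪ N) =
      pairingSign S * pairingSign N * ∏ P ∈ S, ∏ Q ∈ N, symCrossing P Q := by
  rw [pairingSign_eq h, pairingSign_eq (h.subset Finset.subset_union_left),
    pairingSign_eq (h.subset Finset.subset_union_right)]
  simp only [Finset.prod_union hd, Finset.prod_mul_distrib, symCrossing]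
  rw [Finset.prod_comm (s := S) (t := N) (f := fun P Q => crossing Q P)]
  ring

end Signs

/-! #### The pairings of the graphs with an attached motive -/

section Attached

/-- `e` is one of the two legs of the pair `A`. -/
def IsLeg (A : ℕ × ℕ) (e : ℕ) : Prop := e = A.1 ∨ e = A.2

lemma IsPairing.not_isLeg {S : Finset (ℕ × ℕ)} (hS : IsPairing S) {A P : ℕ × ℕ} {e : ℕ}
    (hA : A ∈ S) (he : IsLeg A e) (hP : P ∈ S) (hne : P ≠ A) : P.1 ≠ e ∧ P.2 ≠ e := by
  obtain ⟨h1, h2, h3, h4⟩ := hS.disj P hP A hA hne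
  rcases he with rfl | rfl
  exacts [⟨h1, h3⟩, ⟨h2, h4⟩]

lemma IsPairing.eq_of_isLeg {S : Finset (ℕ × ℕ)} (hS : IsPairing S) {A P : ℕ × ℕ} {e : ℕ}
    (hA : A ∈ S) (he : IsLeg A e) (hP : P ∈ S) (hP' : IsLeg P e) : P = A := by
  by_contra hne
  have := hS.not_isLeg hA he hP hne
  rcases hP' with rfl | rfl
  exacts [this.1 rfl, this.2 rfl]

lemma strictMono_add (e : ℕ) : StrictMono (e + ·) := fun _ _ h => Nat.add_lt_add_left h e

lemma lossGraph_snd' (G : PairedGraph) (e : ℕ) (i : Fin 6) :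
    (lossGraph G e i).2 = G.2.image (mapPair (lossShift e (lossData (parity G.1 e) i).2.1)) ∪
      (lossPairs (parity G.1 e) i).image (mapPair (e + ·)) := rfl

lemma mem_lossPairs {σ : ℤ} (hσ : σ = 1 ∨ σ = -1) {i : Fin 6} {Q : ℕ × ℕ}
    (hQ : Q ∈ lossPairs σ i) :
    Q.1 < Q.2 ∧ Q.2 ≤ 4 ∧ Q.1 ≠ (lossData σ i).2.1 ∧ Q.2 ≠ (lossData σ i).2.1 := by
  obtain ⟨-, -, hB, hC, h, -⟩ := lossData_spec hσ i
  rcases Finset.mem_insert.mp hQ with rfl | hQ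
  · exact ⟨hB.1, hB.2, h.1, h.2.1⟩
  · rw [Finset.mem_singleton] at hQ
    subst hQ
    exact ⟨hC.1, hC.2, h.2.2⟩

lemma isPairing_lossPairs {σ : ℤ} (hσ : σ = 1 ∨ σ = -1) (i : Fin 6) :
    IsPairing (lossPairs σ i) := by
  obtain ⟨-, -, hB, hC, -, h⟩ := lossData_spec hσ i
  constructor
  · exact fun A hA => (mem_lossPairs hσ hA).1
  · intro A hA B hB hAB
    simp only [lossPairs, Finset.mem_insert, Finset.mem_singleton] at hA hB
    rcases hA with rfl | rfl <;> rcases hB with rfl | rfl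
    · exact absurd rfl hAB
    · exact h
    · exact ⟨h.1.symm, h.2.2.1.symm, h.2.1.symm, h.2.2.2.symm⟩
    · exact absurd rfl hAB

lemma separated_loss {e c : ℕ} {P Q : ℕ × ℕ} (hQ : Q.1 < Q.2) (hQ' : Q.2 ≤ 4) (h1 : Q.1 ≠ c)
    (h2 : Q.2 ≠ c) : Separated (mapPair (lossShift e c) P) (mapPair (e + ·) Q) := by
  have h : ∀ x : ℕ, ∀ y ≤ 4, y ≠ c → lossShift e c x ≠ e + y := fun x y hy hyc => by
    unfold lossShift
    split_ifs <;> omega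
  exact ⟨h _ _ (by omega) h1, h _ _ (by omega) h2, h _ _ (by omega) h1, h _ _ (by omega) h2⟩

lemma isPairing_lossGraph {G : PairedGraph} (hG : IsPairing G.2) (e : ℕ) (i : Fin 6) :
    IsPairing (lossGraph G e i).2 := by
  have hσ := parity_eq_one_or G.1 e
  rw [lossGraph_snd']
  refine (hG.image (lossShift_strictMono (lossData_spec hσ i).2.1 e)).union
    ((isPairing_lossPairs hσ i).image (strictMono_add e)) fun P hP Q hQ => ?_
  obtain ⟨P, -, rfl⟩ := Finset.mem_image.mp hP
  obtain ⟨Q, hQ', rfl⟩ := Finset.mem_image.mp hQ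
  obtain ⟨h1, h2, h3, h4⟩ := mem_lossPairs hσ hQ'
  exact separated_loss h1 h2 h3 h4

lemma Separated.ne {P Q : ℕ × ℕ} (h : Separated P Q) : P ≠ Q := fun h' => h.1 (by rw [h'])

lemma disjoint_loss (G : PairedGraph) (e : ℕ) (i : Fin 6) :
    Disjoint (G.2.image (mapPair (lossShift e (lossData (parity G.1 e) i).2.1)))
      ((lossPairs (parity G.1 e) i).image (mapPair (e + ·))) := by
  rw [Finset.disjoint_left]
  intro P hP hQ
  obtain ⟨P, -, rfl⟩ := Finset.mem_image.mp hP
  obtain ⟨Q, hQ', hPQ⟩ := Finset.mem_image.mp hQ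
  obtain ⟨h1, h2, h3, h4⟩ := mem_lossPairs (parity_eq_one_or G.1 e) hQ'
  exact (separated_loss (P := P) (e := e) h1 h2 h3 h4).ne hPQ.symm

/-- The legs of a pair that does not contain `e` stay outside the block of the five new edges, and
the new pair is contained in this block. -/
lemma symCrossing_loss_of_ne {e c : ℕ} {P Q : ℕ × ℕ} (h1 : P.1 ≠ e) (h2 : P.2 ≠ e)
    (hQ : Q.1 < Q.2) (hQ' : Q.2 ≤ 4) :
    symCrossing (mapPair (lossShift e c) P) (mapPair (e + ·) Q) = 1 := by
  have h1 := lossShift_of_ne c h1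
  have h2 := lossShift_of_ne c h2
  simp only [symCrossing, crossing]
  split_ifs <;> first | rfl | omega

/-- The pair that contains `e` enters the block at the edge c and has its other leg outside; it
crosses exactly the new pairs that straddle c. -/
lemma symCrossing_loss {e c : ℕ} {A Q : ℕ × ℕ} (hA : A.1 < A.2) (he : IsLeg A e)
    (hQ : Q.1 < Q.2) (hQ' : Q.2 ≤ 4) :
    symCrossing (mapPair (lossShift e c) A) (mapPair (e + ·) Q) =
      if Q.1 < c ∧ c < Q.2 then -1 else 1 := by
  rcases he with rfl | rfl
  · have h := lossShift_of_ne (e := A.1) c hA.ne'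
    have h' := lossShift_self A.1 c
    have h3 : A.1 < lossShift A.1 c A.2 := by unfold lossShift; split_ifs <;> omega
    simp only [symCrossing, crossing, h']
    split_ifs <;> first | rfl | omega
  · have h := lossShift_of_ne (e := A.2) c hA.ne
    have h' := lossShift_self A.2 c
    have h3 : lossShift A.2 c A.1 < A.2 := by unfold lossShift; split_ifs; omega
    simp only [symCrossing, crossing, h']
    split_ifs <;> first | rfl | omega

/-- The change of sign is local: the crossing of the two new pairs with each other and their
crossings with the pair that enters the block. It does not depend on the rest of the graph, so it
can be read off from the table. -/
lemma pairingSign_lossGraph {G : PairedGraph} (hG : IsPairing G.2) {A : ℕ × ℕ} (hA : A ∈ G.2)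
    {e : ℕ} (he : IsLeg A e) (i : Fin 6) :
    pairingSign (lossGraph G e i).2 = pairingSign G.2 * lossCrossing i := by
  have hσ := parity_eq_one_or G.1 e
  have hr := lossShift_strictMono (lossData_spec hσ i).2.1 e
  have hp := isPairing_lossGraph hG e i
  have key : ∀ σ : ℤ, σ = 1 ∨ σ = -1 → ∀ i : Fin 6, pairingSign (lossPairs σ i) *
      ∏ Q ∈ lossPairs σ i, (if Q.1 < (lossData σ i).2.1 ∧ (lossData σ i).2.1 < Q.2 then -1 else 1)
        = lossCrossing i := by
    rintro σ (rfl | rfl) <;> decide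
  rw [lossGraph_snd'] at hp ⊢
  rw [pairingSign_union hp (disjoint_loss G e i), pairingSign_image hG hr,
    pairingSign_image (isPairing_lossPairs hσ i) (strictMono_add e), mul_assoc, ← key _ hσ i,
    Finset.prod_image (mapPair_injective hr.injective).injOn]
  congr 2
  rw [Finset.prod_eq_single A]
  · rw [Finset.prod_image (mapPair_injective (strictMono_add e).injective).injOn]
    refine Finset.prod_congr rfl fun Q hQ => ?_
    obtain ⟨h1, h2, -⟩ := mem_lossPairs hσ hQ
    exact symCrossing_loss (hG.lt A hA) he h1 h2
  · intro P hP hne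
    refine Finset.prod_eq_one fun Q hQ => ?_
    obtain ⟨Q, hQ', rfl⟩ := Finset.mem_image.mp hQ
    obtain ⟨h1, h2, -⟩ := mem_lossPairs hσ hQ'
    obtain ⟨h3, h4⟩ := hG.not_isLeg hA he hP hne
    exact symCrossing_loss_of_ne h3 h4 h1 h2
  · exact fun h => absurd hA h

/-- The new pairs are recognised as those contained in the block of five edges, which makes it
possible to reconstruct the old pairing. -/
lemma lossGraph_filter (G : PairedGraph) (hG : IsPairing G.2) (e : ℕ) (i : Fin 6) :
    (lossGraph G e i).2.filter (fun Q => e ≤ Q.1 ∧ Q.2 ≤ e + 4) =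
        (lossPairs (parity G.1 e) i).image (mapPair (e + ·)) ∧
      (lossGraph G e i).2.filter (fun Q => ¬(e ≤ Q.1 ∧ Q.2 ≤ e + 4)) =
        G.2.image (mapPair (lossShift e (lossData (parity G.1 e) i).2.1)) := by
  have h1 : ∀ Q ∈ (lossPairs (parity G.1 e) i).image (mapPair (e + ·)),
      e ≤ Q.1 ∧ Q.2 ≤ e + 4 := fun Q hQ => by
    obtain ⟨Q, hQ', rfl⟩ := Finset.mem_image.mp hQ
    have := mem_lossPairs (parity_eq_one_or G.1 e) hQ'
    simp only
    omega
  have h2 : ∀ Q ∈ G.2.image (mapPair (lossShift e (lossData (parity G.1 e) i).2.1)),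
      ¬(e ≤ Q.1 ∧ Q.2 ≤ e + 4) := fun Q hQ => by
    obtain ⟨Q, hQ', rfl⟩ := Finset.mem_image.mp hQ
    have := hG.lt Q hQ'
    simp only [lossShift]
    split_ifs <;> omega
  rw [lossGraph_snd', Finset.filter_union, Finset.filter_union, Finset.filter_true_of_mem h1,
    Finset.filter_false_of_mem h2, Finset.filter_true_of_mem h2, Finset.filter_false_of_mem
    fun Q hQ => not_not.mpr (h1 Q hQ)]
  simp

/-- The history starts with e + o and e, followed by the old history; so it yields e and o. The
pairs inside the block together with o then determine the motive, and the other pairs the old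
pairing. -/
lemma lossGraph_injective {G G' : PairedGraph} (hG : IsPairing G.2) (hG' : IsPairing G'.2)
    {e e' : ℕ} {i i' : Fin 6} (h : lossGraph G e i = lossGraph G' e' i') :
    G = G' ∧ e = e' ∧ i = i' := by
  have hl : (lossGraph G e i).1 = (lossGraph G' e' i').1 := by rw [h]
  rw [lossGraph_fst, lossGraph_fst] at hl
  simp only [List.cons.injEq] at hl
  obtain ⟨h1, rfl, h2⟩ := hl
  rw [← h2] at h1
  have hσ := parity_eq_one_or G.1 e
  obtain ⟨f1, f2⟩ := lossGraph_filter G hG e i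
  obtain ⟨f1', f2'⟩ := lossGraph_filter G' hG' e i'
  rw [h, f1', ← h2] at f1
  rw [h, f2', ← h2] at f2
  have hi : i = i' := by
    have key : ∀ σ : ℤ, σ = 1 ∨ σ = -1 → ∀ i i' : Fin 6, (lossData σ i).1 = (lossData σ i').1 →
        lossPairs σ i' = lossPairs σ i → i = i' := by
      rintro σ (rfl | rfl) <;> decide
    exact key _ hσ i i' (by omega)
      (Finset.image_injective (mapPair_injective (strictMono_add e).injective) f1)
  subst hi
  have h3 := Finset.image_injective (mapPair_injective
    (lossShift_strictMono (lossData_spec hσ i).2.1 e).injective) f2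
  exact ⟨Prod.ext h2 h3.symm, rfl, rfl⟩

lemma isPairing_gainPairs {σ : ℤ} (hσ : σ = 1 ∨ σ = -1) (i : Fin 2) :
    IsPairing (Finset.univ.image (gainData σ i)) := by
  constructor
  · intro P hP
    obtain ⟨j, -, rfl⟩ := Finset.mem_image.mp hP
    have := gainData_spec hσ i j
    omega
  · intro P hP Q hQ hPQ
    obtain ⟨j, -, rfl⟩ := Finset.mem_image.mp hP
    obtain ⟨j', -, rfl⟩ := Finset.mem_image.mp hQ
    have h1 := gainData_spec hσ i j
    have h2 := gainData_spec hσ i j'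
    have h3 := gainData_injective hσ i j j' fun h => hPQ (by rw [h])
    omega

lemma gainGraph_snd' (G : PairedGraph) (A : ℕ × ℕ) (leftUpper : Bool) (i : Fin 2) :
    (gainGraph G A leftUpper i).2 = (G.2.erase A).image (mapPair (gainShift A)) ∪
      (Finset.univ.image (gainData (parity G.1 A.1) i)).image (mapPair (gainSlot A)) := rfl

lemma mem_gainPairs {σ : ℤ} (hσ : σ = 1 ∨ σ = -1) {i : Fin 2} {Q : ℕ × ℕ}
    (hQ : Q ∈ Finset.univ.image (gainData σ i)) : Q.1 < 3 ∧ 3 ≤ Q.2 ∧ Q.2 < 6 := by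
  obtain ⟨j, -, rfl⟩ := Finset.mem_image.mp hQ
  have := gainData_spec hσ i j
  omega

lemma gainShift_of_ne {A : ℕ × ℕ} (hA : A.1 < A.2) {x : ℕ} (h1 : x ≠ A.1) (h2 : x ≠ A.2) :
    (x < A.1 ∧ gainShift A x < A.1) ∨
    (A.1 < x ∧ x < A.2 ∧ A.1 + 2 < gainShift A x ∧ gainShift A x < A.2 + 2) ∨
    (A.2 < x ∧ A.2 + 4 < gainShift A x) := by
  unfold gainShift
  split_ifs <;> omega

lemma gainSlot_spec (A : ℕ × ℕ) {x : ℕ} (hx : x < 6) :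
    (x < 3 ∧ A.1 ≤ gainSlot A x ∧ gainSlot A x ≤ A.1 + 2) ∨
    (3 ≤ x ∧ A.2 + 2 ≤ gainSlot A x ∧ gainSlot A x ≤ A.2 + 4) := by
  unfold gainSlot
  split_ifs <;> omega

lemma separated_gain {A P Q : ℕ × ℕ} (hA : A.1 < A.2) (hP : Separated P A)
    (hQ : Q.1 < 3 ∧ 3 ≤ Q.2 ∧ Q.2 < 6) :
    Separated (mapPair (gainShift A) P) (mapPair (gainSlot A) Q) := by
  have h1 := gainShift_of_ne hA hP.1 hP.2.1
  have h2 := gainShift_of_ne hA hP.2.2.1 hP.2.2.2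
  have h3 := gainSlot_spec A (x := Q.1) (by omega)
  have h4 := gainSlot_spec A (x := Q.2) (by omega)
  simp only [Separated]
  omega

/-- Every new pair runs from the block below the left leg of `A` to the block below its right leg,
so it crosses an old pair precisely when `A` did. -/
lemma symCrossing_gain {A P Q : ℕ × ℕ} (hA : A.1 < A.2) (hP : Separated P A) (hP' : P.1 < P.2)
    (hQ : Q.1 < 3 ∧ 3 ≤ Q.2 ∧ Q.2 < 6) :
    symCrossing (mapPair (gainShift A) P) (mapPair (gainSlot A) Q) = symCrossing P A := by
  have h1 := gainShift_of_ne hA hP.1 hP.2.1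
  have h2 := gainShift_of_ne hA hP.2.2.1 hP.2.2.2
  have h3 := gainSlot_spec A (x := Q.1) (by omega)
  have h4 := gainSlot_spec A (x := Q.2) (by omega)
  simp only [symCrossing, crossing]
  split_ifs <;> first | rfl | omega

lemma isPairing_gainGraph {G : PairedGraph} (hG : IsPairing G.2) {A : ℕ × ℕ} (hA : A ∈ G.2)
    (leftUpper : Bool) (i : Fin 2) : IsPairing (gainGraph G A leftUpper i).2 := by
  have hσ := parity_eq_one_or G.1 A.1
  rw [gainGraph_snd']
  refine ((hG.subset (Finset.erase_subset A G.2)).image (gainShift_strictMono A)).union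
    ((isPairing_gainPairs hσ i).image (gainSlot_strictMono (hG.lt A hA))) fun P hP Q hQ => ?_
  obtain ⟨P, hP', rfl⟩ := Finset.mem_image.mp hP
  obtain ⟨Q, hQ', rfl⟩ := Finset.mem_image.mp hQ
  obtain ⟨h1, h2⟩ := Finset.mem_erase.mp hP'
  exact separated_gain (hG.lt A hA) (hG.disj P h2 A hA h1) (mem_gainPairs hσ hQ')

lemma disjoint_gain {G : PairedGraph} (hG : IsPairing G.2) {A : ℕ × ℕ} (hA : A ∈ G.2)
    (i : Fin 2) : Disjoint ((G.2.erase A).image (mapPair (gainShift A)))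
      ((Finset.univ.image (gainData (parity G.1 A.1) i)).image (mapPair (gainSlot A))) := by
  rw [Finset.disjoint_left]
  intro P hP hQ
  obtain ⟨P, hP', rfl⟩ := Finset.mem_image.mp hP
  obtain ⟨Q, hQ', hPQ⟩ := Finset.mem_image.mp hQ
  obtain ⟨h1, h2⟩ := Finset.mem_erase.mp hP'
  exact (separated_gain (hG.lt A hA) (hG.disj P h2 A hA h1)
    (mem_gainPairs (parity_eq_one_or G.1 A.1) hQ')).ne hPQ.symm

lemma symCrossing_pow_three (P Q : ℕ × ℕ) : symCrossing P Q ^ 3 = symCrossing P Q := by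
  simp only [symCrossing, crossing]
  split_ifs <;> norm_num

/-- The pair `A` is replaced by three pairs, each of which crosses the old pairs as `A` did; the
cube of a sign is the sign itself, so only the crossings among the three new pairs matter. -/
lemma pairingSign_gainGraph {G : PairedGraph} (hG : IsPairing G.2) {A : ℕ × ℕ} (hA : A ∈ G.2)
    (leftUpper : Bool) (i : Fin 2) :
    pairingSign (gainGraph G A leftUpper i).2 = pairingSign G.2 * gainCrossing i := by
  have hσ := parity_eq_one_or G.1 A.1
  have hp := isPairing_gainGraph hG hA leftUpper i
  have key : ∀ σ : ℤ, σ = 1 ∨ σ = -1 → ∀ i : Fin 2,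
      pairingSign (Finset.univ.image (gainData σ i)) = gainCrossing i ∧
        (Finset.univ.image (gainData σ i)).card = 3 := by
    rintro σ (rfl | rfl) <;> decide
  have hS : G.2 = G.2.erase A ∪ {A} := by
    rw [Finset.union_comm, ← Finset.insert_eq, Finset.insert_erase hA]
  have hS' : pairingSign G.2 =
      pairingSign (G.2.erase A) * ∏ P ∈ G.2.erase A, symCrossing P A := by
    conv_lhs => rw [hS]
    rw [pairingSign_union (hS ▸ hG) (by simp)]
    have : pairingSign {A} = 1 := by
      rw [pairingSign_eq (hG.subset (Finset.singleton_subset_iff.mpr hA))]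
      simp [crossing]
    simp [this]
  rw [gainGraph_snd'] at hp ⊢
  rw [pairingSign_union hp (disjoint_gain hG hA i),
    pairingSign_image (hG.subset (Finset.erase_subset A G.2)) (gainShift_strictMono A),
    pairingSign_image (isPairing_gainPairs hσ i) (gainSlot_strictMono (hG.lt A hA)),
    (key _ hσ i).1, Finset.prod_image (mapPair_injective (gainShift_strictMono A).injective).injOn,
    hS']
  rw [mul_assoc, mul_assoc, mul_comm (gainCrossing i)]
  congr 2
  refine Finset.prod_congr rfl fun P hP => ?_
  obtain ⟨h1, h2⟩ := Finset.mem_erase.mp hP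
  rw [Finset.prod_image (mapPair_injective (gainSlot_strictMono (hG.lt A hA)).injective).injOn,
    Finset.prod_congr rfl fun Q hQ => symCrossing_gain (hG.lt A hA) (hG.disj P h2 A hA h1)
      (hG.lt P h2) (mem_gainPairs hσ hQ), Finset.prod_const, (key _ hσ i).2,
    symCrossing_pow_three]

lemma gainGraph_filter {G : PairedGraph} (hG : IsPairing G.2) {A : ℕ × ℕ} (hA : A ∈ G.2)
    (leftUpper : Bool) (i : Fin 2) :
    (gainGraph G A leftUpper i).2.filter (fun Q => A.1 ≤ Q.1 ∧ Q.1 ≤ A.1 + 2) =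
        (Finset.univ.image (gainData (parity G.1 A.1) i)).image (mapPair (gainSlot A)) ∧
      (gainGraph G A leftUpper i).2.filter (fun Q => ¬(A.1 ≤ Q.1 ∧ Q.1 ≤ A.1 + 2)) =
        (G.2.erase A).image (mapPair (gainShift A)) := by
  have h1 : ∀ Q ∈ (Finset.univ.image (gainData (parity G.1 A.1) i)).image (mapPair (gainSlot A)),
      A.1 ≤ Q.1 ∧ Q.1 ≤ A.1 + 2 := fun Q hQ => by
    obtain ⟨Q, hQ', rfl⟩ := Finset.mem_image.mp hQ
    have h := mem_gainPairs (parity_eq_one_or G.1 A.1) hQ'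
    have := gainSlot_spec A (x := Q.1) (by omega)
    simp only
    omega
  have h2 : ∀ Q ∈ (G.2.erase A).image (mapPair (gainShift A)),
      ¬(A.1 ≤ Q.1 ∧ Q.1 ≤ A.1 + 2) := fun Q hQ => by
    obtain ⟨P, hP', rfl⟩ := Finset.mem_image.mp hQ
    obtain ⟨h1, h2⟩ := Finset.mem_erase.mp hP'
    have h3 := hG.disj P h2 A hA h1
    have := gainShift_of_ne (hG.lt A hA) h3.1 h3.2.1
    have := hG.lt A hA
    simp only
    omega
  rw [gainGraph_snd', Finset.filter_union, Finset.filter_union, Finset.filter_true_of_mem h1,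
    Finset.filter_false_of_mem h2, Finset.filter_true_of_mem h2, Finset.filter_false_of_mem
    fun Q hQ => not_not.mpr (h1 Q hQ)]
  simp

/-- The first two entries of the history increase if the left vertex is the lower one and decrease
otherwise, so that they reveal the order and the legs. The motive is then read off from the pairs
that start in the block of the left leg. -/
lemma gainGraph_injective {G G' : PairedGraph} (hG : IsPairing G.2) (hG' : IsPairing G'.2)
    {A A' : ℕ × ℕ} (hA : A ∈ G.2) (hA' : A' ∈ G'.2) {b b' : Bool} {i i' : Fin 2}
    (h : gainGraph G A b i = gainGraph G' A' b' i') : G = G' ∧ A = A' ∧ b = b' ∧ i = i' := by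
  have hl : (gainGraph G A b i).1 = (gainGraph G' A' b' i').1 := by rw [h]
  have hlt := hG.lt A hA
  have hlt' := hG'.lt A' hA'
  have h1 : b = b' ∧ A = A' ∧ G.1 = G'.1 := by
    rw [gainGraph_fst, gainGraph_fst] at hl
    rcases b with _ | _ <;> rcases b' with _ | _ <;>
      simp only [Bool.false_eq_true, if_false, if_true, List.cons.injEq] at hl
    · exact ⟨rfl, Prod.ext hl.1 hl.2.1, hl.2.2⟩
    · omega
    · omega
    · exact ⟨rfl, Prod.ext hl.2.1 (by omega), hl.2.2⟩
  obtain ⟨rfl, rfl, h2⟩ := h1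
  have hσ := parity_eq_one_or G.1 A.1
  obtain ⟨f1, f2⟩ := gainGraph_filter hG hA b i
  obtain ⟨f1', f2'⟩ := gainGraph_filter hG' hA' b i'
  rw [h, f1', ← h2] at f1
  rw [h, f2'] at f2
  have hi : i = i' := by
    have key : ∀ σ : ℤ, σ = 1 ∨ σ = -1 → ∀ i i' : Fin 2,
        Finset.univ.image (gainData σ i') = Finset.univ.image (gainData σ i) → i = i' := by
      rintro σ (rfl | rfl) <;> decide
    exact key _ hσ i i'
      (Finset.image_injective (mapPair_injective (gainSlot_strictMono hlt).injective) f1)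
  have h3 := Finset.image_injective (mapPair_injective (gainShift_strictMono A).injective) f2
  refine ⟨Prod.ext h2 ?_, rfl, rfl, hi⟩
  rw [← Finset.insert_erase hA, ← Finset.insert_erase hA', h3]

/-- The first entry of the history exceeds the second by o ∈ {0, 1, 2} for a loss motive. For a gain
motive it is either smaller, or larger by at least 3. -/
lemma lossGraph_ne_gainGraph {G G' : PairedGraph} {A' : ℕ × ℕ} (hA' : A'.1 < A'.2)
    {e : ℕ} {i : Fin 6} {b' : Bool} {i' : Fin 2} : lossGraph G e i ≠ gainGraph G' A' b' i' := by
  intro h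
  have hl : (lossGraph G e i).1 = (gainGraph G' A' b' i').1 := by rw [h]
  have := (lossData_spec (parity_eq_one_or G.1 e) i).1
  rw [lossGraph_fst, gainGraph_fst] at hl
  rcases b' with _ | _ <;>
    simp only [Bool.false_eq_true, if_false, if_true, List.cons.injEq] at hl <;> omega

lemma mem_attachments {G H : PairedGraph} (hG : IsPairing G.2) {A : ℕ × ℕ} (hA : A ∈ G.2)
    (h : H ∈ attachments G A) :
    (∃ e i, IsLeg A e ∧ 1 ≤ e ∧ H = lossGraph G e i) ∨
      (1 ≤ A.1 ∧ ∃ b i, H = gainGraph G A b i) := by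
  have hlt := hG.lt A hA
  unfold attachments at h
  rw [lossAttachments_eq, lossAttachments_eq, gainAttachments_eq] at h
  split_ifs at h with h0
  · obtain ⟨i, -, rfl⟩ := Finset.mem_image.mp h
    exact Or.inl ⟨A.2, i, Or.inr rfl, by omega, rfl⟩
  · simp only [Finset.mem_union, Finset.mem_image, Finset.mem_univ, true_and, Prod.exists] at h
    rcases h with (⟨i, rfl⟩ | ⟨i, rfl⟩) | ⟨b, i, rfl⟩
    · exact Or.inl ⟨A.1, i, Or.inl rfl, by omega, rfl⟩
    · exact Or.inl ⟨A.2, i, Or.inr rfl, by omega, rfl⟩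
    · exact Or.inr ⟨by omega, b, i, rfl⟩

/-- A graph remembers its last motive and the pair that carried it. This excludes multiple counting
in the recursive definition of the leading graphs. -/
lemma attachments_unique {G G' H : PairedGraph} (hG : IsPairing G.2) (hG' : IsPairing G'.2)
    {A A' : ℕ × ℕ} (hA : A ∈ G.2) (hA' : A' ∈ G'.2) (h : H ∈ attachments G A)
    (h' : H ∈ attachments G' A') : G = G' ∧ A = A' := by
  rcases mem_attachments hG hA h with ⟨e, i, he, -, rfl⟩ | ⟨-, b, i, rfl⟩ <;>
    rcases mem_attachments hG' hA' h' with ⟨e', i', he', -, hH⟩ | ⟨-, b', i', hH⟩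
  · obtain ⟨rfl, rfl, -⟩ := lossGraph_injective hG hG' hH
    exact ⟨rfl, hG.eq_of_isLeg hA' he' hA he⟩
  · exact absurd hH (lossGraph_ne_gainGraph (hG'.lt A' hA'))
  · exact absurd hH.symm (lossGraph_ne_gainGraph (hG.lt A hA))
  · obtain ⟨h1, h2, -⟩ := gainGraph_injective hG hG' hA hA' hH
    exact ⟨h1, h2⟩

lemma sum_attachments_root {G : PairedGraph} (hG : IsPairing G.2) {A : ℕ × ℕ}
    (h0 : A.1 = 0) (F : PairedGraph → ℂ) :
    ∑ H ∈ attachments G A, F H = ∑ i, F (lossGraph G A.2 i) := by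
  rw [attachments, if_pos h0, lossAttachments_eq, Finset.sum_image]
  exact fun i _ i' _ h => (lossGraph_injective hG hG h).2.2

lemma sum_attachments_of_ne {G : PairedGraph} (hG : IsPairing G.2) {A : ℕ × ℕ} (hA : A ∈ G.2)
    (h0 : A.1 ≠ 0) (F : PairedGraph → ℂ) :
    ∑ H ∈ attachments G A, F H = ∑ i, F (lossGraph G A.1 i) + ∑ i, F (lossGraph G A.2 i) +
      ∑ i, (F (gainGraph G A true i) + F (gainGraph G A false i)) := by
  have hlt := hG.lt A hA
  rw [attachments, if_neg h0, lossAttachments_eq, lossAttachments_eq, gainAttachments_eq,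
    Finset.sum_union, Finset.sum_union, Finset.sum_image, Finset.sum_image, Finset.sum_image]
  · rw [← Finset.univ_product_univ, Finset.sum_product, Fintype.sum_bool]
    simp only [Finset.sum_add_distrib]
  · intro p _ p' _ h
    obtain ⟨-, -, h1, h2⟩ := gainGraph_injective hG hG hA hA h
    exact Prod.ext h1 h2
  · exact fun i _ i' _ h => (lossGraph_injective hG hG h).2.2
  · exact fun i _ i' _ h => (lossGraph_injective hG hG h).2.2
  · rw [Finset.disjoint_left]
    intro H h h'
    obtain ⟨i, -, rfl⟩ := Finset.mem_image.mp h
    obtain ⟨i', -, h''⟩ := Finset.mem_image.mp h'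
    exact hlt.ne' (lossGraph_injective hG hG h'').2.1
  · rw [Finset.disjoint_left]
    intro H h h'
    obtain ⟨p, -, rfl⟩ := Finset.mem_image.mp h'
    rcases Finset.mem_union.mp h with h | h
    all_goals
      obtain ⟨i, -, h''⟩ := Finset.mem_image.mp h
      exact lossGraph_ne_gainGraph hlt h''

end Attached

/-! #### Leading graphs -/

section Leading

variable {d : ℕ}

/-- The properties of the leading graphs with `m` motives. -/
structure IsLeading (d m : ℕ) (G : PairedGraph) : Prop where
  length : G.1.length = 2 * m
  pairing : IsPairing G.2
  pos : ∀ p ∈ G.1, 1 ≤ p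
  parity_snd : ∀ A ∈ G.2, parity G.1 A.2 = -parity G.1 A.1
  root : ∃ b, (0, b) ∈ G.2 ∧ ∀ k : ℕ → UnitAddTorus (Fin d), Admissible G.2 k →
    topMomentum G.1 k = k b
  phase_add : ∀ w : UnitAddTorus (Fin d) → ℝ, (∀ k, w (-k) = w k) →
    ∀ k : ℕ → UnitAddTorus (Fin d), Admissible G.2 k → ∀ i < m,
      phase w ((vertices G.1 k).getD (2 * i) default) +
        phase w ((vertices G.1 k).getD (2 * i + 1) default) = 0

lemma admissible_loss {G : PairedGraph} {e : ℕ} {i : Fin 6} {k : ℕ → UnitAddTorus (Fin d)}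
    (hk : Admissible (lossGraph G e i).2 k) :
    Admissible G.2 (k ∘ lossShift e (lossData (parity G.1 e) i).2.1) ∧
    k (e + (lossData (parity G.1 e) i).2.2.1.2) = -k (e + (lossData (parity G.1 e) i).2.2.1.1) ∧
    k (e + (lossData (parity G.1 e) i).2.2.2.2) = -k (e + (lossData (parity G.1 e) i).2.2.2.1) := by
  rw [lossGraph_snd'] at hk
  refine ⟨fun A hA => ?_, ?_, ?_⟩
  · exact hk _ (Finset.mem_union_left _ (Finset.mem_image_of_mem _ hA))
  · exact hk _ (Finset.mem_union_right _ (Finset.mem_image_of_mem _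
      (Finset.mem_insert_self _ _)))
  · exact hk _ (Finset.mem_union_right _ (Finset.mem_image_of_mem _
      (Finset.mem_insert_of_mem (Finset.mem_singleton_self _))))

lemma admissible_gain {G : PairedGraph} (hG : IsPairing G.2) {A : ℕ × ℕ} (hA : A ∈ G.2)
    {b : Bool} {i : Fin 2} {k : ℕ → UnitAddTorus (Fin d)}
    (hk : Admissible (gainGraph G A b i).2 k) :
    Admissible G.2 (gainFuse A k) ∧
    ∀ j, k (gainPair (parity G.1 A.1) A i j).2 = -k (gainPair (parity G.1 A.1) A i j).1 := by
  rw [gainGraph_snd] at hk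
  have hs := parity_eq_one_or G.1 A.1
  have hk' : ∀ j, k (gainPair (parity G.1 A.1) A i j).2 = -k (gainPair (parity G.1 A.1) A i j).1 :=
    fun j => hk _ (Finset.mem_union_right _ (Finset.mem_image_of_mem _ (Finset.mem_univ _)))
  refine ⟨fun P hP => ?_, hk'⟩
  by_cases hPA : P = A
  · subst hPA
    have hp := gainPartner_of_pairs hs i P hk'
    have h0 := hp 0
    have h1 := hp 1
    have h2 := hp 2
    simp only [Fin.val_zero, Fin.val_one, Fin.val_two, add_zero] at h0 h1 h2
    rw [gainFuse, if_neg (hG.lt P hA).ne', if_pos rfl, gainFuse, if_pos rfl]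
    exact (congrArg₂ _ (congrArg₂ _ h0 h1) h2).trans
      (gainPartner_sum hs i fun j => k (P.1 + j))
  · obtain ⟨h1, h2, h3, h4⟩ := hG.disj P hP A hA hPA
    rw [gainFuse, if_neg h3, if_neg h4, gainFuse, if_neg h1, if_neg h2]
    exact hk _ (Finset.mem_union_left _ (Finset.mem_image_of_mem _ (Finset.mem_erase.mpr ⟨hPA, hP⟩)))

lemma phase_add_cons {m : ℕ} {w : UnitAddTorus (Fin d) → ℝ}
    {low up : (UnitAddTorus (Fin d) × UnitAddTorus (Fin d) × UnitAddTorus (Fin d)) × ℤ}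
    {vs : List ((UnitAddTorus (Fin d) × UnitAddTorus (Fin d) × UnitAddTorus (Fin d)) × ℤ)}
    (h : phase w low + phase w up = 0)
    (h' : ∀ i < m, phase w (vs.getD (2 * i) default) + phase w (vs.getD (2 * i + 1) default) = 0)
    (i : ℕ) (hi : i < m + 1) : phase w ((low :: up :: vs).getD (2 * i) default) +
      phase w ((low :: up :: vs).getD (2 * i + 1) default) = 0 := by
  cases i with
  | zero => exact h
  | succ i => exact h' i (by omega)

lemma IsLeading.loss {m : ℕ} {G : PairedGraph} (hG : IsLeading d m G) {e : ℕ} (he : 1 ≤ e)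
    (i : Fin 6) : IsLeading d (m + 1) (lossGraph G e i) := by
  have hσ := parity_eq_one_or G.1 e
  refine ⟨?_, isPairing_lossGraph hG.pairing e i, ?_, ?_, ?_, ?_⟩
  · rw [lossGraph_fst]
    simp only [List.length_cons, hG.length]
    ring
  · rw [lossGraph_fst]
    intro p hp
    simp only [List.mem_cons] at hp
    rcases hp with rfl | rfl | hp
    exacts [by omega, he, hG.pos p hp]
  · intro A hA
    rw [lossGraph_snd'] at hA
    rcases Finset.mem_union.mp hA with hA | hA
    · obtain ⟨A, hA', rfl⟩ := Finset.mem_image.mp hA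
      simp only [parity_lossGraph_old, hG.parity_snd A hA']
    · obtain ⟨Q, hQ, rfl⟩ := Finset.mem_image.mp hA
      have h := mem_lossPairs hσ hQ
      simp only
      rw [parity_lossGraph_new _ _ _ h.2.1, parity_lossGraph_new _ _ _ (by omega)]
      obtain ⟨-, h1, h2, h3, h4⟩ := lossParity_spec hσ i
      simp only [lossPairs, Finset.mem_insert, Finset.mem_singleton] at hQ
      rcases hQ with rfl | rfl
      exacts [by rw [h1, h2], by rw [h3, h4]]
  · obtain ⟨b, hb, htop⟩ := hG.root
    refine ⟨lossShift e (lossData (parity G.1 e) i).2.1 b, ?_, fun k hk => ?_⟩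
    · rw [lossGraph_snd']
      refine Finset.mem_union_left _ (Finset.mem_image.mpr ⟨_, hb, ?_⟩)
      simp only [mapPair, Prod.mk.injEq, and_true]
      rw [lossShift, if_pos (by omega)]
    · obtain ⟨h1, h2, h3⟩ := admissible_loss hk
      rw [topMomentum_lossGraph G e i k rfl h2 h3, htop _ h1]
      rfl
  · intro w hw k hk
    obtain ⟨h1, h2, h3⟩ := admissible_loss hk
    -- Only the phases are needed here, so the potential may be taken to be zero.
    obtain ⟨low, up, hv, hl⟩ := vertices_lossGraph (V := fun _ => 0) hw (fun _ => rfl) G e i k rfl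
      h2 h3
    rw [hv]
    exact phase_add_cons (by rw [hl.1, hl.2.1]; ring) (hG.phase_add w hw _ h1)

/-- The condition `1 ≤ A.1` ensures that the root pair is not the one that is removed, and that no
vertex is placed in the minus tree. -/
lemma IsLeading.gain {m : ℕ} {G : PairedGraph} (hG : IsLeading d m G) {A : ℕ × ℕ} (hA : A ∈ G.2)
    (h0 : 1 ≤ A.1) (b : Bool) (i : Fin 2) : IsLeading d (m + 1) (gainGraph G A b i) := by
  have hσ := parity_eq_one_or G.1 A.1
  have hlt := hG.pairing.lt A hA
  refine ⟨?_, isPairing_gainGraph hG.pairing hA b i, ?_, ?_, ?_, ?_⟩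
  · rw [gainGraph_fst]
    cases b <;> simp only [if_true, if_false, Bool.false_eq_true, List.length_cons, hG.length] <;>
      ring
  · rw [gainGraph_fst]
    intro p hp
    cases b <;> simp only [if_true, if_false, Bool.false_eq_true, List.mem_cons] at hp <;>
      rcases hp with rfl | rfl | hp <;> first | omega | exact hG.pos p hp
  · intro P hP
    rw [gainGraph_snd'] at hP
    rw [parity_gainGraph G hlt]
    rcases Finset.mem_union.mp hP with hP | hP
    · obtain ⟨P, hP', rfl⟩ := Finset.mem_image.mp hP
      obtain ⟨hne, hP'⟩ := Finset.mem_erase.mp hP'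
      obtain ⟨h1, h2, h3, h4⟩ := hG.pairing.disj P hP' A hA hne
      simp only
      rw [parity_gain_old _ hlt h1 h2, parity_gain_old _ hlt h3 h4, hG.parity_snd P hP']
    · obtain ⟨Q, hQ, rfl⟩ := Finset.mem_image.mp hP
      have h := mem_gainPairs hσ hQ
      simp only
      rw [parity_gain_new _ hlt (hG.parity_snd A hA) (by omega),
        parity_gain_new _ hlt (hG.parity_snd A hA) (by omega)]
      obtain ⟨j, -, rfl⟩ := Finset.mem_image.mp hQ
      rw [(gainParity_spec hσ i j).1, (gainParity_spec hσ i j).2]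
  · obtain ⟨c, hc, htop⟩ := hG.root
    have hne : ((0, c) : ℕ × ℕ) ≠ A := fun h => by
      have : A.1 = 0 := by rw [← h]
      omega
    obtain ⟨-, -, h3, h4⟩ := hG.pairing.disj _ hc A hA hne
    refine ⟨gainShift A c, ?_, fun k hk => ?_⟩
    · rw [gainGraph_snd']
      refine Finset.mem_union_left _ (Finset.mem_image.mpr ⟨_, Finset.mem_erase.mpr ⟨hne, hc⟩, ?_⟩)
      simp only [mapPair, Prod.mk.injEq, and_true]
      rw [gainShift, if_pos (by omega)]
    · obtain ⟨h1, -⟩ := admissible_gain hG.pairing hA hk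
      rw [topMomentum_gainGraph G hlt, htop _ h1, gainFuse, if_neg h3, if_neg h4]
  · intro w hw k hk
    obtain ⟨h1, h2⟩ := admissible_gain hG.pairing hA hk
    obtain ⟨low, up, hv, hl⟩ := vertices_gainGraph (V := fun _ => 0) hw (fun _ => rfl) G hlt i b k
      rfl (hG.parity_snd A hA) h2
    rw [hv]
    exact phase_add_cons (by rw [hl.1, hl.2.1]; ring) (hG.phase_add w hw _ h1)

lemma isLeading_of_mem {m : ℕ} {G : PairedGraph} (hG : G ∈ leadingGraphs m) :
    IsLeading d m G := by
  induction m generalizing G with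
  | zero =>
    simp only [leadingGraphs, Finset.mem_singleton] at hG
    subst hG
    refine ⟨rfl, ⟨by simp, by simp⟩, by simp, by simp [parity], ⟨1, by simp, ?_⟩, by simp⟩
    exact fun k _ => rfl
  | succ m ih =>
    simp only [leadingGraphs, Finset.mem_biUnion] at hG
    obtain ⟨G', hG', A, hA, hH⟩ := hG
    rcases mem_attachments (ih hG').pairing hA hH with ⟨e, i, -, he, rfl⟩ | ⟨h0, b, i, rfl⟩
    · exact (ih hG').loss he i
    · exact (ih hG').gain hA h0 b i

lemma sum_leadingGraphs_succ (m : ℕ) (F : PairedGraph → ℂ) :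
    ∑ G ∈ leadingGraphs (m + 1), F G =
      ∑ G ∈ leadingGraphs m, ∑ A ∈ G.2, ∑ H ∈ attachments G A, F H := by
  -- The combinatorial properties do not involve the dimension, which is set to 0.
  have hl : ∀ G ∈ leadingGraphs m, IsPairing G.2 := fun G hG =>
    (isLeading_of_mem (d := 0) hG).pairing
  rw [leadingGraphs, Finset.sum_biUnion]
  · refine Finset.sum_congr rfl fun G hG => Finset.sum_biUnion fun A hA A' hA' hne => ?_
    rw [Function.onFun, Finset.disjoint_left]
    exact fun H h h' => hne (attachments_unique (hl G hG) (hl G hG) hA hA' h h').2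
  · intro G hG G' hG' hne
    rw [Function.onFun, Finset.disjoint_left]
    intro H h h'
    obtain ⟨A, hA, h⟩ := Finset.mem_biUnion.mp h
    obtain ⟨A', hA', h'⟩ := Finset.mem_biUnion.mp h'
    exact hne (attachments_unique (hl G hG) (hl G' hG') hA hA' h h').1

lemma parity_zero {ℓ : List ℕ} (h : ∀ p ∈ ℓ, 1 ≤ p) : parity ℓ 0 = -1 := by
  induction ℓ with
  | nil => rfl
  | cons p ℓ ih =>
    have h1 := h p (by simp)
    rw [parity, splitParity, if_pos (by omega)]
    exact ih fun q hq => h q (by simp [hq])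

end Leading

/-! ### The momentum integral of a graph with an attached motive -/

section Substitutions

variable {d : ℕ} {V : (Fin d → ℤ) → ℝ} {w : UnitAddTorus (Fin d) → ℝ}

/-- The kernel of a collision. -/
noncomputable def collisionKernel (V : (Fin d → ℤ) → ℝ) (w : UnitAddTorus (Fin d) → ℝ) (x : Bool)
    (τ : ℝ) (q : UnitAddTorus (Fin d)) (p : UnitAddTorus (Fin d) × UnitAddTorus (Fin d)) : ℂ :=
  (collisionFactor V x p.1 p.2 (q + p.1 - p.2) : ℂ) *
    Complex.exp (Complex.I * τ * ((w q + w p.1 - w p.2 - w (q + p.1 - p.2) : ℝ) : ℂ))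

lemma collision_eq (x : Bool) (τ : ℝ) (h₂ h₃ h₄ : UnitAddTorus (Fin d) → ℂ)
    (q : UnitAddTorus (Fin d)) : collision V w x τ h₂ h₃ h₄ q =
      ∫ p, collisionKernel V w x τ q p * (h₂ p.1 * h₃ p.2 * h₄ (q + p.1 - p.2)) := rfl

lemma continuous_collisionFactor (hV : Summable V) (x : Bool) :
    Continuous fun p : UnitAddTorus (Fin d) × UnitAddTorus (Fin d) × UnitAddTorus (Fin d) =>
      collisionFactor V x p.1 p.2.1 p.2.2 := by
  have h := continuous_Vhat hV
  unfold collisionFactor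
  cases x <;> simp only [Bool.false_eq_true, if_false, if_true] <;> fun_prop

lemma continuous_collisionKernel (hV : Summable V) (hw : Continuous w) (x : Bool) :
    Continuous fun p : ℝ × UnitAddTorus (Fin d) × UnitAddTorus (Fin d) × UnitAddTorus (Fin d) =>
      collisionKernel V w x p.1 p.2.1 p.2.2 := by
  have h1 : Continuous fun p : ℝ × UnitAddTorus (Fin d) × UnitAddTorus (Fin d) ×
      UnitAddTorus (Fin d) => (p.2.2.1, p.2.2.2, p.2.1 + p.2.2.1 - p.2.2.2) := by fun_prop
  have h2 := Complex.continuous_ofReal.comp ((continuous_collisionFactor hV x).comp h1)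
  have h3 : Continuous fun p : ℝ × UnitAddTorus (Fin d) × UnitAddTorus (Fin d) ×
      UnitAddTorus (Fin d) => Complex.exp (Complex.I * p.1 *
        ((w p.2.1 + w p.2.2.1 - w p.2.2.2 - w (p.2.1 + p.2.2.1 - p.2.2.2) : ℝ) : ℂ)) := by
    fun_prop
  simp only [collisionKernel]
  exact h2.mul h3

/-- The momenta of the pairs of a loss motive and those of the collision are related by a
measure preserving map. -/
lemma integral_lossMomenta {Φ : UnitAddTorus (Fin d) × UnitAddTorus (Fin d) → ℂ}
    (hΦ : Continuous Φ) {σ : ℤ} (hσ : σ = 1 ∨ σ = -1) (i : Fin 6) (q : UnitAddTorus (Fin d)) :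
    ∫ v, ∫ u, Φ (lossMomenta σ i q u v) = ∫ p, Φ p := by
  have hswap : ∀ {Ψ : UnitAddTorus (Fin d) × UnitAddTorus (Fin d) → ℂ}, Continuous Ψ →
      ∫ v, ∫ u, Ψ (u, v) = ∫ p, Ψ p := fun {Ψ} hΨ => by
    have h : ∫ z : UnitAddTorus (Fin d) × UnitAddTorus (Fin d), Ψ z.swap = ∫ p, Ψ p :=
      integral_prod_swap Ψ
    rw [← h]
    exact (integral_prod (fun z : UnitAddTorus (Fin d) × UnitAddTorus (Fin d) => Ψ z.swap)
      (integrable_of_continuous_torus (hΨ.comp continuous_swap))).symm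
  have hswap' : ∀ {Ψ : UnitAddTorus (Fin d) × UnitAddTorus (Fin d) → ℂ}, Continuous Ψ →
      ∫ u, ∫ v, Ψ (u, v) = ∫ p, Ψ p := fun {Ψ} hΨ =>
    (integral_prod Ψ (integrable_of_continuous_torus hΨ)).symm
  have hone : ∀ i : Fin 6, ∫ v, ∫ u, Φ (lossMomenta 1 i q u v) = ∫ p, Φ p := by
    -- Here k₂ is the momentum between the two vertices and the pairs carry k₃ and k₄ up to signs;
    -- for fixed u the change of variables v ↦ k₂ is a translation after a reflection.
    have h0 : ∫ v, ∫ u, Φ (-u + -v - q, -u) = ∫ p, Φ p := by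
      rw [hswap (Ψ := fun p => Φ (-p.1 + -p.2 - q, -p.1)) (by fun_prop),
        ← hswap' (Ψ := fun p => Φ (-p.1 + -p.2 - q, -p.1)) (by fun_prop), ← hswap hΦ,
        ← integral_neg_eq_self]
      refine integral_congr_ae (Eventually.of_forall fun u => ?_)
      simp only [neg_neg]
      rw [← integral_sub_left_eq_self (fun v => Φ (v, u)) volume (u - q)]
      refine integral_congr_ae (Eventually.of_forall fun v => ?_)
      simp only
      congr 2
      abel
    have h1 : ∫ v, ∫ u, Φ (-u, -v) = ∫ p, Φ p := by
      rw [integral_neg_eq_self (fun v => ∫ u, Φ (-u, v)), ← hswap hΦ]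
      exact integral_congr_ae (Eventually.of_forall fun v =>
        integral_neg_eq_self (fun u => Φ (u, v)) volume)
    have h2 : ∫ v, ∫ u, Φ (-u, v) = ∫ p, Φ p := by
      rw [← hswap hΦ]
      exact integral_congr_ae (Eventually.of_forall fun v =>
        integral_neg_eq_self (fun u => Φ (u, v)) volume)
    have h4 : ∫ v, ∫ u, Φ (-u, q + -u - -v) = ∫ p, Φ p := by
      rw [hswap (Ψ := fun p => Φ (-p.1, q + -p.1 - -p.2)) (by fun_prop),
        ← hswap' (Ψ := fun p => Φ (-p.1, q + -p.1 - -p.2)) (by fun_prop), ← hswap' hΦ,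
        ← integral_neg_eq_self (fun u => ∫ v, Φ (u, v))]
      refine integral_congr_ae (Eventually.of_forall fun u => ?_)
      simp only
      rw [← integral_add_left_eq_self (fun v => Φ (-u, v)) (q + -u)]
      refine integral_congr_ae (Eventually.of_forall fun v => ?_)
      simp only [sub_neg_eq_add]
    intro i
    fin_cases i
    exacts [h0, h1, h2, h0, h4, h2]
  rcases hσ with rfl | rfl
  · exact hone i
  -- The mirror image exchanges the legs of the new pairs and so reverses their momenta.
  · have h : ∀ u v, lossMomenta (-1) i q u v = lossMomenta 1 i q (-u) (-v) := fun u v => by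
      fin_cases i <;> simp [lossMomenta]
    simp only [h]
    rw [integral_neg_eq_self (fun v => ∫ u, Φ (lossMomenta 1 i q (-u) v)), ← hone i]
    exact integral_congr_ae (Eventually.of_forall fun v =>
      integral_neg_eq_self (fun u => Φ (lossMomenta 1 i q u v)) volume)

/-- The weights `(h₂, h₃, h₄)` of the collision that corresponds to a loss motive whose pairs have
the weights `hB` and `hC`. -/
def lossWeights (i : Fin 6) (hB hC : UnitAddTorus (Fin d) → ℂ) :
    Fin 3 → UnitAddTorus (Fin d) → ℂ :=
  (![![1, hB, hC], ![hB, hC, 1], ![hB, hC, 1], ![1, hB, hC], ![hB, 1, hC], ![hB, hC, 1]] :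
    Fin 6 → Fin 3 → UnitAddTorus (Fin d) → ℂ) i

lemma lossWeights_induction {p : (UnitAddTorus (Fin d) → ℂ) → Prop} (h1 : p 1) {hB hC}
    (h2 : p hB) (h3 : p hC) (i : Fin 6) (j : Fin 3) : p (lossWeights i hB hC j) := by
  fin_cases i <;> fin_cases j <;> assumption

/-- Of the three momenta k₂, k₃, k₄ two belong to the new pairs, up to signs. The third one only
runs on the edge between the two vertices, where no distribution is attached, and has the weight 1.
-/
lemma lossWeights_eval {hB hC : UnitAddTorus (Fin d) → ℂ} (eB : ∀ k, hB (-k) = hB k)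
    (eC : ∀ k, hC (-k) = hC k) {σ : ℤ} (hσ : σ = 1 ∨ σ = -1) (i : Fin 6)
    (q u v : UnitAddTorus (Fin d)) :
    lossWeights i hB hC 0 (lossMomenta σ i q u v).1 * lossWeights i hB hC 1
      (lossMomenta σ i q u v).2 * lossWeights i hB hC 2
      (q + (lossMomenta σ i q u v).1 - (lossMomenta σ i q u v).2) = hB u * hC v := by
  have key : ∀ {a b : UnitAddTorus (Fin d)}, (a = u ∨ a = -u) → (b = v ∨ b = -v) →
      hB a * hC b = hB u * hC v := fun ha hb => by rw [even_congr eB ha, even_congr eC hb]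
  rcases hσ with rfl | rfl <;> fin_cases i
  all_goals
    simp only [lossWeights, lossMomenta, Fin.zero_eta, Fin.mk_one, Fin.reduceFinMk, if_true,
      Matrix.cons_val, Pi.one_apply, one_mul, mul_one, Int.reduceNeg, reduceCtorEq, if_false]
    try (refine key ?_ ?_ <;> first | (left; abel1) | (right; abel1))

lemma integral_lossMomenta_collision (hV : Summable V) (hw : Continuous w) {σ : ℤ}
    (hσ : σ = 1 ∨ σ = -1) (i : Fin 6) (x : Bool) (τ : ℝ)
    {hB hC : UnitAddTorus (Fin d) → ℂ} (cB : Continuous hB) (cC : Continuous hC)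
    (eB : ∀ k, hB (-k) = hB k) (eC : ∀ k, hC (-k) = hC k) (q : UnitAddTorus (Fin d)) :
    ∫ v, ∫ u, collisionKernel V w x τ q (lossMomenta σ i q u v) * (hB u * hC v) =
      collision V w x τ (lossWeights i hB hC 0) (lossWeights i hB hC 1) (lossWeights i hB hC 2)
        q := by
  have hc : ∀ j, Continuous (lossWeights i hB hC j) := fun j =>
    lossWeights_induction continuous_const cB cC i j
  have hp : Continuous fun p : UnitAddTorus (Fin d) × UnitAddTorus (Fin d) => (τ, q, p) := by
    fun_prop
  have hk := (continuous_collisionKernel hV hw x).comp hp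
  simp only [Function.comp_def] at hk
  have hcont : ∀ {f₂ f₃ f₄ : UnitAddTorus (Fin d) → ℂ}, Continuous f₂ → Continuous f₃ →
      Continuous f₄ → Continuous fun p : UnitAddTorus (Fin d) × UnitAddTorus (Fin d) =>
        collisionKernel V w x τ q p * (f₂ p.1 * f₃ p.2 * f₄ (q + p.1 - p.2)) :=
    fun h2 h3 h4 => hk.mul (by fun_prop)
  rw [collision_eq, ← integral_lossMomenta (Φ := fun p => collisionKernel V w x τ q p *
    (lossWeights i hB hC 0 p.1 * lossWeights i hB hC 1 p.2 *
      lossWeights i hB hC 2 (q + p.1 - p.2))) (hcont (hc 0) (hc 1) (hc 2)) hσ i q]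
  refine integral_congr_ae (Eventually.of_forall fun v => integral_congr_ae
    (Eventually.of_forall fun u => ?_))
  simp only
  rw [lossWeights_eval eB eC hσ]

end Substitutions

/-! ### Integrating out a loss motive -/

section Recursion

variable {d : ℕ} {V : (Fin d → ℤ) → ℝ} {w : UnitAddTorus (Fin d) → ℝ}
  {φ : UnitAddTorus (Fin d) → ℂ}

lemma totalPhase_cons_cons (low up) (vs : List ((UnitAddTorus (Fin d) × UnitAddTorus (Fin d) ×
    UnitAddTorus (Fin d)) × ℤ)) {m : ℕ} (s₀ : ℝ) (s : Fin m → ℝ) :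
    totalPhase w (low :: up :: vs) (Fin.cons s₀ s : Fin (m + 1) → ℝ) =
      s₀ * phase w up + totalPhase w vs s := by
  rw [totalPhase, Fin.sum_univ_succ]
  rfl

/-- Only the phase of the upper vertex of the pair enters, with the duration s₀ of the slice between
the two vertices; it equals minus σ times the energy defect. So e^{-i s₀ Θ} is the phase of a
collision at the time σ s₀. The relation ε² = 1 moves the sign to the other side. -/
lemma PairLocal.graphIntegrand {ε sgn σ : ℤ} {low up} {x : Bool} {q k₂ k₃ : UnitAddTorus (Fin d)}
    (h : PairLocal V w ε low up sgn x σ q k₂ k₃) (hε : ε * ε = 1) {ℓ ℓ' : List ℕ}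
    {k k' : ℕ → UnitAddTorus (Fin d)} (hv : vertices ℓ' k' = low :: up :: vertices ℓ k)
    (ht : topMomentum ℓ' k' = topMomentum ℓ k) {m : ℕ} (s₀ : ℝ) (s : Fin m → ℝ) :
    graphIntegrand V w φ ℓ' (Fin.cons s₀ s : Fin (m + 1) → ℝ) k' =
      graphIntegrand V w φ ℓ s k *
        (((ε * sgn : ℤ) : ℂ) * collisionKernel V w x (σ * s₀) q (k₂, k₃)) := by
  obtain ⟨-, h2, h3⟩ := h
  have h4 : (((low.2 : ℝ) * interaction V low : ℝ) : ℂ) *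
      (((up.2 : ℝ) * interaction V up : ℝ) : ℂ) =
      ((ε * sgn : ℤ) : ℂ) * (collisionFactor V x k₂ k₃ (q + k₂ - k₃) : ℂ) := by
    have h5 : ((ε : ℝ) * ε) = 1 := by exact_mod_cast hε
    have : ((low.2 : ℝ) * interaction V low) * (up.2 * interaction V up) =
        (ε * sgn) * collisionFactor V x k₂ k₃ (q + k₂ - k₃) := by
      linear_combination (ε : ℝ) * h3 - (low.2 * interaction V low * (up.2 * interaction V up)) * h5
    rw [← Complex.ofReal_mul, this]
    push_cast
    ring
  unfold Kinetic.graphIntegrand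
  rw [ht, hv, totalPhase_cons_cons, vertexProd, vertexProd, List.map_cons, List.map_cons,
    List.prod_cons, List.prod_cons, ← mul_assoc (((low.2 : ℝ) * interaction V low : ℝ) : ℂ), h4,
    collisionKernel, h2]
  have h6 : Complex.exp (-(Complex.I * ((s₀ * -(σ * (w q + w k₂ - w k₃ - w (q + k₂ - k₃))) +
      totalPhase w (vertices ℓ k) s : ℝ) : ℂ))) =
      Complex.exp (-(Complex.I * (totalPhase w (vertices ℓ k) s : ℂ))) *
      Complex.exp (Complex.I * ((σ * s₀ : ℝ) : ℂ) *
        ((w q + w k₂ - w k₃ - w (q + k₂ - k₃) : ℝ) : ℂ)) := by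
    rw [← Complex.exp_add]
    congr 1
    push_cast
    ring
  rw [h6]
  ring

lemma leg_of_ne {Γ : Type*} [AddCommGroup Γ] {A : ℕ × ℕ} {l : ℕ} (u : Γ) (h1 : A.1 ≠ l)
    (h2 : A.2 ≠ l) : leg A u l = 0 := by
  rw [leg, if_neg h1, if_neg h2]

lemma leg_fst {Γ : Type*} [AddCommGroup Γ] (A : ℕ × ℕ) (u : Γ) : leg A u A.1 = u := if_pos rfl

lemma leg_snd {Γ : Type*} [AddCommGroup Γ] {A : ℕ × ℕ} (hA : A.1 ≠ A.2) (u : Γ) :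
    leg A u A.2 = -u := by
  rw [leg, if_neg hA, if_pos rfl]

lemma measurable_integral_leg {F : (ℕ → UnitAddTorus (Fin d)) → ℂ} (hF : Measurable F)
    (A : ℕ × ℕ) : Measurable fun k => ∫ u, F (k + leg A u) := by
  refine (StronglyMeasurable.integral_prod_right' (f := fun p : (ℕ → UnitAddTorus (Fin d)) ×
    UnitAddTorus (Fin d) => F (p.1 + leg A p.2)) ?_).measurable
  refine (hF.comp (measurable_pi_iff.mpr fun i => ?_)).stronglyMeasurable
  have h2 := (continuous_leg (d := d) A).measurable
  exact ((measurable_pi_apply i).comp measurable_fst).add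
    (((measurable_pi_apply i).comp h2).comp measurable_snd)

lemma norm_integral_leg_le {F : (ℕ → UnitAddTorus (Fin d)) → ℂ} (hb : ∃ B, ∀ k, ‖F k‖ ≤ B)
    (A : ℕ × ℕ) : ∃ B, ∀ k : ℕ → UnitAddTorus (Fin d), ‖∫ u, F (k + leg A u)‖ ≤ B := by
  obtain ⟨B, hB⟩ := hb
  refine ⟨B, fun k => ?_⟩
  refine (norm_integral_le_of_norm_le_const (Eventually.of_forall fun u => hB _)).trans ?_
  simp

lemma rowIntegral_pair {B C : ℕ × ℕ} (h : B ≠ C) {F : (ℕ → UnitAddTorus (Fin d)) → ℂ}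
    (hF : Measurable F) (hb : ∃ B, ∀ k, ‖F k‖ ≤ B) :
    rowIntegral {B, C} F = ∫ v, ∫ u, F (leg C v + leg B u) := by
  rw [rowIntegral_insert (by simpa using h) hF hb, rowIntegral_singleton]

lemma rowIntegral_triple {B C D : ℕ × ℕ} (h1 : B ≠ C) (h2 : B ≠ D) (h3 : C ≠ D)
    {F : (ℕ → UnitAddTorus (Fin d)) → ℂ} (hF : Measurable F) (hb : ∃ B, ∀ k, ‖F k‖ ≤ B) :
    rowIntegral {B, C, D} F = ∫ x, ∫ v, ∫ u, F (leg D x + leg C v + leg B u) := by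
  rw [rowIntegral_insert (by simp [h1, h2]) hF hb, rowIntegral_pair h3
    (measurable_integral_leg hF B) (norm_integral_leg_le hb B)]

lemma rowIntegral_congr {S : Finset (ℕ × ℕ)}
    {F F' : (ℕ → UnitAddTorus (Fin d)) → ℂ}
    (h : ∀ k, (∀ i, (∀ P ∈ S, P.1 ≠ i ∧ P.2 ≠ i) → k i = 0) → F k = F' k) :
    rowIntegral S F = rowIntegral S F' := by
  refine integral_congr_ae (Eventually.of_forall fun q => h _ fun i hi => ?_)
  refine Finset.sum_eq_zero fun A _ => ?_
  rw [if_neg (hi A.1 A.2).1, if_neg (hi A.1 A.2).2]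

lemma rowIntegral_const_mul (S : Finset (ℕ × ℕ)) (c : ℂ) (F : (ℕ → UnitAddTorus (Fin d)) → ℂ) :
    rowIntegral S (fun k => c * F k) = c * rowIntegral S F := integral_const_mul _ _

lemma measurable_row_add (k : ℕ → UnitAddTorus (Fin d)) :
    Measurable fun k' : ℕ → UnitAddTorus (Fin d) => k + k' :=
  measurable_pi_iff.mpr fun i =>
    (measurable_const.add (measurable_pi_apply i) : Measurable fun k' : ℕ → _ => k i + k' i)

lemma prod_update {S : Finset (ℕ × ℕ)} {A : ℕ × ℕ} (hA : A ∈ S)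
    (h : ℕ × ℕ → UnitAddTorus (Fin d) → ℂ) (g : UnitAddTorus (Fin d) → ℂ)
    (k : ℕ → UnitAddTorus (Fin d)) :
    ∏ P ∈ S, Function.update h A g P (k P.1) = g (k A.1) * ∏ P ∈ S.erase A, h P (k P.1) := by
  rw [← Finset.mul_prod_erase _ _ hA, Function.update_self]
  congr 1
  refine Finset.prod_congr rfl fun P hP => ?_
  rw [Function.update_of_ne (Finset.ne_of_mem_erase hP)]

lemma lossCrossing_mul_self (i : Fin 6) : lossCrossing i * lossCrossing i = 1 := by
  revert i; decide

lemma gainCrossing_mul_self (i : Fin 2) : gainCrossing i * gainCrossing i = 1 := by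
  revert i; decide

/-- The weights of the pairs of `G` that are equivalent to those of `G` with a loss motive
attached to the leg `e` of the pair `A`. -/
noncomputable def lossReduced (V : (Fin d → ℤ) → ℝ) (w : UnitAddTorus (Fin d) → ℝ)
    (G : PairedGraph) (e : ℕ) (i : Fin 6) (h : ℕ × ℕ → UnitAddTorus (Fin d) → ℂ)
    (s₀ : ℝ) : UnitAddTorus (Fin d) → ℂ :=
  let σ := parity G.1 e
  let W := lossWeights i (h (translate e (lossData σ i).2.2.1))
    (h (translate e (lossData σ i).2.2.2))
  collision V w (lossExchange i) (σ * s₀) (W 0) (W 1) (W 2)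

/-- For a fixed row of the old edges, the integral over the momenta of the two new pairs is a
collision in the momentum of the edge `e`. As it is an even function it can be written in the
momentum of the left leg of `A` and absorbed into the weight of `A`, which is kept as a factor
because `A` still exists. -/
lemma momentumIntegral_lossGraph (hV : Summable V) (hV' : ∀ x, V (-x) = V x) (hw : Continuous w)
    (hw' : ∀ k, w (-k) = w k) (hφ : Measurable φ) (hφ' : ∃ B, ∀ k, ‖φ k‖ ≤ B) {G : PairedGraph}
    (hG : IsPairing G.2) {A : ℕ × ℕ} (hA : A ∈ G.2) {e : ℕ} (he : IsLeg A e) (i : Fin 6)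
    {h : ℕ × ℕ → UnitAddTorus (Fin d) → ℂ} (hh : ∀ P, Continuous (h P))
    (hh' : ∀ P k, h P (-k) = h P k) {m : ℕ} (s₀ : ℝ) (s : Fin m → ℝ) :
    momentumIntegral V w φ (lossGraph G e i) h (Fin.cons s₀ s : Fin (m + 1) → ℝ) =
      ((lossCrossing i * lossSign i : ℤ) : ℂ) * momentumIntegral V w φ G
        (Function.update (fun P => h (mapPair (lossShift e (lossData (parity G.1 e) i).2.1) P)) A
          fun q => h (mapPair (lossShift e (lossData (parity G.1 e) i).2.1) A) q *
            lossReduced V w G e i h s₀ q) s := by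
  obtain ⟨σ, hσ⟩ : ∃ σ, parity G.1 e = σ := ⟨_, rfl⟩
  have hs : σ = 1 ∨ σ = -1 := hσ ▸ parity_eq_one_or G.1 e
  have hmeas := measurable_weightedIntegrand hV hw hφ (lossGraph G e i) hh
    (Fin.cons s₀ s : Fin (m + 1) → ℝ)
  obtain ⟨Bd, hBd⟩ := exists_norm_weightedIntegrand_le hV hφ' (lossGraph G e i) hh
  have hdisj := disjoint_loss G e i
  have hpair := lossGraph_snd G e i
  have hsnd' := lossGraph_snd' G e i
  unfold lossReduced
  rw [hσ] at hdisj hpair hsnd' ⊢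
  obtain ⟨ho, hc, hB1, hC1, hne, hne'⟩ := lossData_spec hs i
  set c := (lossData σ i).2.1 with hc_def
  set B := (lossData σ i).2.2.1 with hB_def
  set C := (lossData σ i).2.2.2 with hC_def
  set r := lossShift e c with hr_def
  have hr : StrictMono r := lossShift_strictMono hc e
  have hrange : ∀ x y, y ≤ 4 → y ≠ c → r x ≠ e + y := fun x y hy hyc => by
    rw [hr_def]
    unfold lossShift
    split_ifs <;> omega
  have hdisj' : Disjoint (G.2.image (mapPair r)) {translate e B, translate e C} := by
    rw [hsnd'] at hpair
    have : (lossPairs σ i).image (mapPair (e + ·)) = {translate e B, translate e C} := by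
      simp only [lossPairs, Finset.image_insert, Finset.image_singleton]
      rfl
    rwa [this] at hdisj
  have hBC : translate e B ≠ translate e C := fun hbc => by
    have := (Prod.ext_iff.mp hbc).1
    simp only [Nat.add_left_cancel_iff] at this
    exact hne'.1 this
  -- The full row is the old row, moved to its new places and extended by zero, plus the rows of the
  -- two new pairs, whose legs avoid these places.
  have key : ∀ (k : ℕ → UnitAddTorus (Fin d)), Admissible G.2 k → ∀ u v,
      graphIntegrand V w φ (lossGraph G e i).1 (Fin.cons s₀ s : Fin (m + 1) → ℝ)
          (Function.extend r k 0 + (leg (translate e C) v + leg (translate e B) u)) *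
        ∏ P ∈ (lossGraph G e i).2, h P ((Function.extend r k 0 + (leg (translate e C) v +
          leg (translate e B) u)) P.1) =
      (((lossCrossing i * lossSign i : ℤ) : ℂ) * (graphIntegrand V w φ G.1 s k *
        ∏ P ∈ G.2, h (mapPair r P) (k P.1))) *
        (collisionKernel V w (lossExchange i) (σ * s₀) (k e) (lossMomenta σ i (k e) u v) *
          (h (translate e B) u * h (translate e C) v)) := by
    intro k hk u v
    set row := Function.extend r k 0 + (leg (translate e C) v + leg (translate e B) u) with hrow
    have hext : ∀ y ≤ 4, y ≠ c → Function.extend r k 0 (e + y) = 0 := fun y hy hyc =>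
      Function.extend_apply' _ _ _ fun ⟨x, hx⟩ => hrange x y hy hyc hx
    have hrow_r : row ∘ r = k := by
      funext l
      simp only [hrow, Function.comp_apply, Pi.add_apply]
      rw [hr.injective.extend_apply, leg_of_ne, leg_of_ne, add_zero, add_zero]
      · exact (hrange l _ (by omega) hne.1).symm
      · exact (hrange l _ hB1.2 hne.2.1).symm
      · exact (hrange l _ (by omega) hne.2.2.1).symm
      · exact (hrange l _ hC1.2 hne.2.2.2).symm
    have hrow_e : row (e + c) = k e := by
      have := congrFun hrow_r e
      rwa [Function.comp_apply, hr_def, lossShift_self] at this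
    have hrow_B : row (e + B.1) = u := by
      simp only [hrow, Pi.add_apply]
      rw [hext _ (by omega) hne.1, leg_of_ne, zero_add, zero_add]
      · exact leg_fst (translate e B) u
      · simp only [ne_eq, Nat.add_left_cancel_iff]; exact hne'.1.symm
      · simp only [ne_eq, Nat.add_left_cancel_iff]; exact hne'.2.1.symm
    have hrow_B' : row (e + B.2) = -u := by
      simp only [hrow, Pi.add_apply]
      rw [hext _ hB1.2 hne.2.1, leg_of_ne, zero_add, zero_add]
      · exact leg_snd (A := translate e B) (by simp only; omega) u
      · simp only [ne_eq, Nat.add_left_cancel_iff]; exact hne'.2.2.1.symm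
      · simp only [ne_eq, Nat.add_left_cancel_iff]; exact hne'.2.2.2.symm
    have hrow_C : row (e + C.1) = v := by
      simp only [hrow, Pi.add_apply]
      rw [hext _ (by omega) hne.2.2.1, leg_of_ne (A := translate e B), add_zero, zero_add]
      · exact leg_fst (translate e C) v
      · simp only [ne_eq, Nat.add_left_cancel_iff]; exact hne'.1
      · simp only [ne_eq, Nat.add_left_cancel_iff]; exact hne'.2.2.1
    have hrow_C' : row (e + C.2) = -v := by
      simp only [hrow, Pi.add_apply]
      rw [hext _ hC1.2 hne.2.2.2, leg_of_ne (A := translate e B), add_zero, zero_add]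
      · exact leg_snd (A := translate e C) (by simp only; omega) v
      · simp only [ne_eq, Nat.add_left_cancel_iff]; exact hne'.2.1
      · simp only [ne_eq, Nat.add_left_cancel_iff]; exact hne'.2.2.2
    obtain ⟨low, up, hv, hl⟩ := vertices_lossGraph hw' hV' G e i row hσ
      (by rw [hrow_B, hrow_B']) (by rw [hrow_C, hrow_C'])
    have ht := topMomentum_lossGraph G e i row hσ
      (by rw [hrow_B, hrow_B']) (by rw [hrow_C, hrow_C'])
    simp only [← hc_def, ← hB_def, ← hC_def, ← hr_def, hrow_r, hrow_e, hrow_B, hrow_C] at hv hl ht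
    rw [hl.graphIntegrand (lossCrossing_mul_self i) hv ht, hpair, Finset.prod_union hdisj',
      Finset.prod_image (mapPair_injective hr.injective).injOn, Finset.prod_pair hBC]
    have h1 : ∀ P : ℕ × ℕ, row (mapPair r P).1 = k P.1 := fun P => congrFun hrow_r P.1
    have h2 : row (translate e B).1 = u := hrow_B
    have h3 : row (translate e C).1 = v := hrow_C
    simp only [h1, h2, h3]
    ring
  unfold momentumIntegral
  rw [show rowIntegral (lossGraph G e i).2 _ = rowIntegral (G.2.image (mapPair r) ∪
    {translate e B, translate e C}) _ from congrArg (fun S => rowIntegral S _) hpair,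
    rowIntegral_union hdisj' hmeas ⟨Bd, fun k => hBd _ _ _ _⟩]
  have himg := rowIntegral_image (S := G.2) hr.injective (fun k => rowIntegral
    {translate e B, translate e C} fun k' => graphIntegrand V w φ (lossGraph G e i).1
      (Fin.cons s₀ s : Fin (m + 1) → ℝ) (k + k') * ∏ P ∈ (lossGraph G e i).2, h P ((k + k') P.1))
  refine himg.trans ?_
  rw [← rowIntegral_const_mul]
  refine hG.rowIntegral_congr fun k hk => ?_
  refine (rowIntegral_pair hBC (hmeas.comp (measurable_row_add (Function.extend r k 0)))
    ⟨Bd, fun k' => hBd _ _ _ _⟩).trans ?_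
  simp only [Function.comp_apply, key k hk]
  simp only [integral_const_mul]
  rw [integral_lossMomenta_collision hV hw hs i _ _ (hh _) (hh _) (hh' _) (hh' _), prod_update hA,
    ← Finset.mul_prod_erase _ _ hA]
  have hcoll : ∀ q, collision V w (lossExchange i) (σ * s₀)
      (lossWeights i (h (translate e B)) (h (translate e C)) 0)
      (lossWeights i (h (translate e B)) (h (translate e C)) 1)
      (lossWeights i (h (translate e B)) (h (translate e C)) 2) (-q) =
      collision V w (lossExchange i) (σ * s₀)
      (lossWeights i (h (translate e B)) (h (translate e C)) 0)
      (lossWeights i (h (translate e B)) (h (translate e C)) 1)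
      (lossWeights i (h (translate e B)) (h (translate e C)) 2) q := by
    have hev : ∀ j k, lossWeights i (h (translate e B)) (h (translate e C)) j (-k) =
        lossWeights i (h (translate e B)) (h (translate e C)) j k := fun j =>
      lossWeights_induction (p := fun f => ∀ k, f (-k) = f k) (fun _ => rfl) (hh' _) (hh' _) i j
    exact collision_neg hw' hV' _ _ (hev 0) (hev 1) (hev 2)
  -- The sign depends on whether the motive sits on the left or on the right leg.
  have hke : k e = k A.1 ∨ k e = -k A.1 := by
    rcases he with rfl | rfl
    exacts [Or.inl rfl, Or.inr (hk A hA)]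
  rw [even_congr hcoll hke]
  ring

end Recursion

/-! ### Integrating out a gain motive -/

section GainRecursion

variable {d : ℕ} {V : (Fin d → ℤ) → ℝ} {w : UnitAddTorus (Fin d) → ℝ}
  {φ : UnitAddTorus (Fin d) → ℂ}

/-- Integration over the momenta of the three pairs of a gain motive, with the sum of the three
momenta as one of the variables. -/
lemma integral_gainMomenta {Ψ : UnitAddTorus (Fin d) → ℂ} (hΨ : Measurable Ψ)
    (hΨ' : ∃ B, ∀ q, ‖Ψ q‖ ≤ B)
    {Φ : UnitAddTorus (Fin d) × UnitAddTorus (Fin d) × UnitAddTorus (Fin d) → ℂ}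
    (hΦ : Continuous Φ) :
    ∫ u₀, ∫ u₁, ∫ u₂, Ψ (u₀ + u₁ + u₂) * Φ (u₀ + u₁ + u₂, -u₀, u₁) =
      ∫ q, Ψ q * ∫ p, Φ (q, p) := by
  obtain ⟨B, hB⟩ := hΨ'
  obtain ⟨B', hB'⟩ := (isCompact_range hΦ).isBounded.exists_norm_le
  have hB0 : 0 ≤ B := (norm_nonneg _).trans (hB 0)
  have hint : Integrable (fun z : (UnitAddTorus (Fin d) × UnitAddTorus (Fin d)) ×
      UnitAddTorus (Fin d) => Ψ z.2 * Φ (z.2, z.1)) := by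
    refine Integrable.of_bound (C := B * B') ?_ (Eventually.of_forall fun z => ?_)
    · exact ((hΨ.comp measurable_snd).mul (hΦ.measurable.comp
        (measurable_snd.prodMk measurable_fst))).aestronglyMeasurable
    · rw [norm_mul]
      exact mul_le_mul (hB _) (hB' _ ⟨_, rfl⟩) (norm_nonneg _) hB0
  have hint' : Integrable (fun z : UnitAddTorus (Fin d) × UnitAddTorus (Fin d) =>
      ∫ q, Ψ q * Φ (q, z)) := hint.integral_prod_left
  have h1 : ∀ u₀ u₁ : UnitAddTorus (Fin d),
      ∫ u₂, Ψ (u₀ + u₁ + u₂) * Φ (u₀ + u₁ + u₂, -u₀, u₁) = ∫ q, Ψ q * Φ (q, -u₀, u₁) :=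
    fun u₀ u₁ => integral_add_left_eq_self (fun q => Ψ q * Φ (q, -u₀, u₁)) (u₀ + u₁)
  simp only [h1]
  rw [integral_neg_eq_self (fun u₀ => ∫ u₁, ∫ q, Ψ q * Φ (q, u₀, u₁))]
  have h2 : ∫ z : UnitAddTorus (Fin d) × UnitAddTorus (Fin d), ∫ q, Ψ q * Φ (q, z) =
      ∫ u₀, ∫ u₁, ∫ q, Ψ q * Φ (q, u₀, u₁) := integral_prod _ hint'
  rw [← h2, integral_integral_swap hint]
  simp only [integral_const_mul]

lemma image_univ_fin_three {α : Type*} [DecidableEq α] (f : Fin 3 → α) :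
    Finset.univ.image f = {f 2, f 1, f 0} := by
  ext x
  simp only [Finset.mem_image, Finset.mem_univ, true_and, Finset.mem_insert, Finset.mem_singleton,
    Fin.exists_fin_succ, IsEmpty.exists_iff]
  simp only [Fin.succ_zero_eq_one, Fin.succ_one_eq_two, or_false]
  tauto

lemma gainEdge_sum {Γ : Type*} [AddCommGroup Γ] {σ : ℤ} (hσ : σ = 1 ∨ σ = -1) (a : ℕ → Γ) :
    a 0 + a 1 + a 2 = a (gainEdge σ 0) + a (gainEdge σ 1) + a (gainEdge σ 2) := by
  rcases hσ with rfl | rfl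
  · rfl
  · change _ = a 2 + a 1 + a 0
    abel

/-- The collision that corresponds to a gain motive. -/
noncomputable def gainReduced (V : (Fin d → ℤ) → ℝ) (w : UnitAddTorus (Fin d) → ℝ)
    (G : PairedGraph) (A : ℕ × ℕ) (leftUpper : Bool) (i : Fin 2)
    (h : ℕ × ℕ → UnitAddTorus (Fin d) → ℂ) (s₀ : ℝ) : UnitAddTorus (Fin d) → ℂ :=
  let σ := parity G.1 A.1
  collision V w (gainExchange i) (((if leftUpper then σ else -σ : ℤ) : ℝ) * s₀)
    (h (gainPair σ A i 0)) (h (gainPair σ A i 1)) (h (gainPair σ A i 2))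

-- The pair `A` disappears, and the sum of the momenta of the three new pairs plays the role of its
-- free momentum; the other two degrees of freedom are those of a collision. Hence the weight of `A`
-- is replaced, not multiplied. The sign is always -1, because the product of the crossing sign ε
-- and the sign -ε of the collision is -ε² = -1.
set_option maxHeartbeats 800000 in
lemma momentumIntegral_gainGraph (hV : Summable V) (hV' : ∀ x, V (-x) = V x) (hw : Continuous w)
    (hw' : ∀ k, w (-k) = w k) (hφ : Measurable φ) (hφ' : ∃ B, ∀ k, ‖φ k‖ ≤ B) {G : PairedGraph}
    (hG : IsPairing G.2) {A : ℕ × ℕ} (hA : A ∈ G.2) (hpar : parity G.1 A.2 = -parity G.1 A.1)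
    (leftUpper : Bool) (i : Fin 2)
    {h : ℕ × ℕ → UnitAddTorus (Fin d) → ℂ} (hh : ∀ P, Continuous (h P))
    (hh' : ∀ P k, h P (-k) = h P k) {m : ℕ} (s₀ : ℝ) (s : Fin m → ℝ)
    (hg : Continuous (gainReduced V w G A leftUpper i h s₀)) :
    momentumIntegral V w φ (gainGraph G A leftUpper i) h (Fin.cons s₀ s : Fin (m + 1) → ℝ) =
      -momentumIntegral V w φ G (Function.update (fun P => h (mapPair (gainShift A) P)) A
          (gainReduced V w G A leftUpper i h s₀)) s := by
  obtain ⟨σ, hσ⟩ : ∃ σ, parity G.1 A.1 = σ := ⟨_, rfl⟩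
  have hs : σ = 1 ∨ σ = -1 := hσ ▸ parity_eq_one_or G.1 A.1
  have hlt := hG.lt A hA
  have hmeas := measurable_weightedIntegrand hV hw hφ (gainGraph G A leftUpper i) hh
    (Fin.cons s₀ s : Fin (m + 1) → ℝ)
  obtain ⟨Bd, hBd⟩ := exists_norm_weightedIntegrand_le hV hφ' (gainGraph G A leftUpper i) hh
  have hupd : ∀ P, Continuous (Function.update (fun P => h (mapPair (gainShift A) P)) A
      (gainReduced V w G A leftUpper i h s₀) P) := fun P => by
    by_cases hP : P = A
    · subst hP
      rwa [Function.update_self]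
    · rw [Function.update_of_ne hP]
      exact hh _
  have hmeasG := measurable_weightedIntegrand hV hw hφ G hupd s
  obtain ⟨BG, hBG⟩ := exists_norm_weightedIntegrand_le hV hφ' G hupd
  have hdisj := disjoint_gain hG hA i
  have hpair := gainGraph_snd G A leftUpper i
  have hspec := gainData_spec hs i
  have hinj := gainData_injective hs i
  have hslot := gainSlot_strictMono hlt
  have hr : StrictMono (gainShift A) := gainShift_strictMono A
  have hGe : IsPairing (G.2.erase A) := hG.subset (Finset.erase_subset A G.2)
  unfold gainReduced at *
  rw [hσ] at hdisj hpair hpar hupd hmeasG hBG ⊢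
  have hdisj' : Disjoint ((G.2.erase A).image (mapPair (gainShift A)))
      (Finset.univ.image (gainPair σ A i)) := by
    rw [Finset.image_image] at hdisj
    exact hdisj
  set N := gainPair σ A i with hN
  have hNsep : ∀ j j', j ≠ j' → Separated (N j) (N j') := fun j j' hj => by
    have h1 := hspec j
    have h2 := hspec j'
    have h3 := hinj j j' hj
    refine ⟨?_, ?_, ?_, ?_⟩ <;>
      · simp only [hN, gainPair, mapPair, ne_eq, hslot.injective.eq_iff]
        omega
  have hNne : ∀ j, (N j).1 ≠ (N j).2 := fun j => by
    have h1 := hspec j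
    simp only [hN, gainPair, mapPair, ne_eq, hslot.injective.eq_iff]
    omega
  have hNimg : Finset.univ.image N = {N 2, N 1, N 0} := image_univ_fin_three N
  rw [hNimg] at hpair hdisj'
  have hNfst : ∀ j, (N j).1 = A.1 + gainEdge σ j := fun j => by
    have h1 := hspec j
    simp only [hN, gainPair, mapPair, h1.1, gainSlot, if_pos h1.2.1]
  have hne20 := (hNsep 2 0 (by decide)).ne
  have hne21 := (hNsep 2 1 (by decide)).ne
  have hne10 := (hNsep 1 0 (by decide)).ne
  set τ : ℝ := ((if leftUpper then σ else -σ : ℤ) : ℝ) * s₀ with hτ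
  have key : ∀ (k : ℕ → UnitAddTorus (Fin d)),
      (∀ l, (∀ P ∈ G.2.erase A, P.1 ≠ l ∧ P.2 ≠ l) → k l = 0) → ∀ u₀ u₁ u₂,
      graphIntegrand V w φ (gainGraph G A leftUpper i).1 (Fin.cons s₀ s : Fin (m + 1) → ℝ)
          (Function.extend (gainShift A) k 0 + (leg (N 0) u₀ + leg (N 1) u₁ + leg (N 2) u₂)) *
        ∏ P ∈ (gainGraph G A leftUpper i).2, h P ((Function.extend (gainShift A) k 0 +
          (leg (N 0) u₀ + leg (N 1) u₁ + leg (N 2) u₂)) P.1) =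
      (-(graphIntegrand V w φ G.1 s (k + leg A (u₀ + u₁ + u₂)) *
        ∏ P ∈ G.2.erase A, h (mapPair (gainShift A) P) ((k + leg A (u₀ + u₁ + u₂)) P.1))) *
        (collisionKernel V w (gainExchange i) τ (u₀ + u₁ + u₂) (-u₀, u₁) *
          (h (N 0) (-u₀) * h (N 1) u₁ * h (N 2) (u₀ + u₁ + u₂ + -u₀ - u₁))) := by
    intro k hk u₀ u₁ u₂
    set q := u₀ + u₁ + u₂ with hq
    have hkA : k A.1 = 0 ∧ k A.2 = 0 := by
      constructor <;> refine hk _ fun P hP => ?_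
      · have := hG.disj P (Finset.mem_of_mem_erase hP) A hA (Finset.ne_of_mem_erase hP)
        exact ⟨this.1, this.2.2.1⟩
      · have := hG.disj P (Finset.mem_of_mem_erase hP) A hA (Finset.ne_of_mem_erase hP)
        exact ⟨this.2.1, this.2.2.2⟩
    set row := Function.extend (gainShift A) k 0 +
      (leg (N 0) u₀ + leg (N 1) u₁ + leg (N 2) u₂) with hrow
    -- The renumbering sends the legs of `A` themselves into the slots of the motive, so extension
    -- by zero alone is not enough: one also needs that the row vanishes at these legs once `A` has
    -- been removed.
    have hslotext : ∀ x < 6, Function.extend (gainShift A) k 0 (gainSlot A x) = 0 := by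
      intro x hx
      by_cases hex : ∃ l, gainShift A l = gainSlot A x
      · obtain ⟨l, hl⟩ := hex
        rw [← hl, hr.injective.extend_apply]
        by_cases h1 : l = A.1
        · rw [h1, hkA.1]
        by_cases h2 : l = A.2
        · rw [h2, hkA.2]
        have h3 := gainShift_of_ne hlt h1 h2
        have h4 := gainSlot_spec A hx
        omega
      · rw [Function.extend_apply' _ _ _ hex]
        rfl
    have hrow_old : ∀ l, l ≠ A.1 → l ≠ A.2 → row (gainShift A l) = k l := by
      intro l h1 h2
      have h3 := gainShift_of_ne hlt h1 h2
      have h5 : ∀ j, (N j).1 ≠ gainShift A l ∧ (N j).2 ≠ gainShift A l := fun j => by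
        have h4 := gainSlot_spec A (x := (gainData σ i j).1) (by have := hspec j; omega)
        have h4' := gainSlot_spec A (x := (gainData σ i j).2) (by have := hspec j; omega)
        simp only [hN, gainPair, mapPair]
        omega
      simp only [hrow, Pi.add_apply]
      rw [hr.injective.extend_apply, leg_of_ne _ (h5 0).1 (h5 0).2, leg_of_ne _ (h5 1).1 (h5 1).2,
        leg_of_ne _ (h5 2).1 (h5 2).2]
      simp only [add_zero]
    have hNext : ∀ j, Function.extend (gainShift A) k 0 (N j).1 = 0 ∧
        Function.extend (gainShift A) k 0 (N j).2 = 0 := fun j => by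
      have h1 := hspec j
      exact ⟨hslotext _ (by omega), hslotext _ (by omega)⟩
    have hrow0 : row (N 0).1 = u₀ ∧ row (N 0).2 = -u₀ := by
      have h1 := hNsep 1 0 (by decide)
      have h2 := hNsep 2 0 (by decide)
      simp only [hrow, Pi.add_apply]
      rw [(hNext 0).1, (hNext 0).2, leg_fst, leg_snd (hNne 0), leg_of_ne u₁ h1.1 h1.2.2.1,
        leg_of_ne u₁ h1.2.1 h1.2.2.2, leg_of_ne u₂ h2.1 h2.2.2.1, leg_of_ne u₂ h2.2.1 h2.2.2.2]
      simp
    have hrow1 : row (N 1).1 = u₁ ∧ row (N 1).2 = -u₁ := by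
      have h1 := hNsep 0 1 (by decide)
      have h2 := hNsep 2 1 (by decide)
      simp only [hrow, Pi.add_apply]
      rw [(hNext 1).1, (hNext 1).2, leg_fst, leg_snd (hNne 1), leg_of_ne u₀ h1.1 h1.2.2.1,
        leg_of_ne u₀ h1.2.1 h1.2.2.2, leg_of_ne u₂ h2.1 h2.2.2.1, leg_of_ne u₂ h2.2.1 h2.2.2.2]
      simp
    have hrow2 : row (N 2).1 = u₂ ∧ row (N 2).2 = -u₂ := by
      have h1 := hNsep 0 2 (by decide)
      have h2 := hNsep 1 2 (by decide)
      simp only [hrow, Pi.add_apply]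
      rw [(hNext 2).1, (hNext 2).2, leg_fst, leg_snd (hNne 2), leg_of_ne u₀ h1.1 h1.2.2.1,
        leg_of_ne u₀ h1.2.1 h1.2.2.2, leg_of_ne u₁ h2.1 h2.2.2.1, leg_of_ne u₁ h2.2.1 h2.2.2.2]
      simp
    have hrowpair : ∀ j, row (N j).2 = -row (N j).1 := by
      intro j
      fin_cases j
      exacts [hrow0.2.trans (congrArg _ hrow0.1.symm), hrow1.2.trans (congrArg _ hrow1.1.symm),
        hrow2.2.trans (congrArg _ hrow2.1.symm)]
    have hsum : row A.1 + row (A.1 + 1) + row (A.1 + 2) = q := by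
      have := gainEdge_sum hs fun j => row (A.1 + j)
      simp only [add_zero, ← hNfst, hrow0.1, hrow1.1, hrow2.1] at this
      exact this
    have hfuse : gainFuse A row = k + leg A q := by
      funext l
      unfold gainFuse
      by_cases h1 : l = A.1
      · rw [if_pos h1, h1, Pi.add_apply, hkA.1, leg_fst, zero_add, hsum]
      by_cases h2 : l = A.2
      · rw [if_neg h1, if_pos h2, h2, Pi.add_apply, hkA.2, leg_snd hlt.ne, zero_add, ← hsum]
        have hp := gainPartner_of_pairs hs i A hrowpair
        have p0 := hp 0
        have p1 := hp 1
        have p2 := hp 2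
        simp only [Fin.val_zero, Fin.val_one, Fin.val_two, add_zero] at p0 p1 p2
        exact (congrArg₂ _ (congrArg₂ _ p0 p1) p2).trans
          (gainPartner_sum hs i fun j => row (A.1 + j))
      · rw [if_neg h1, if_neg h2, hrow_old l h1 h2, Pi.add_apply,
          leg_of_ne _ (Ne.symm h1) (Ne.symm h2), add_zero]
    obtain ⟨low, up, hv, hl⟩ := vertices_gainGraph hw' hV' G hlt i leftUpper row hσ hpar hrowpair
    have ht := topMomentum_gainGraph G hlt i leftUpper row
    rw [hfuse] at hv ht
    rw [hsum, ← hNfst, ← hNfst, hrow0.1, hrow1.1] at hl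
    rw [hl.graphIntegrand (gainCrossing_mul_self i) hv ht, ← hτ, hpair, Finset.prod_union hdisj',
      Finset.prod_image (mapPair_injective hr.injective).injOn, Finset.prod_insert (by
        simp [hne21, hne20]), Finset.prod_pair hne10, hrow0.1, hrow1.1, hrow2.1]
    have h1 : ∏ P ∈ G.2.erase A, h (mapPair (gainShift A) P) (row (mapPair (gainShift A) P).1) =
        ∏ P ∈ G.2.erase A, h (mapPair (gainShift A) P) ((k + leg A q) P.1) := by
      refine Finset.prod_congr rfl fun P hP => ?_
      have := hG.disj P (Finset.mem_of_mem_erase hP) A hA (Finset.ne_of_mem_erase hP)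
      rw [Pi.add_apply, leg_of_ne _ this.1.symm this.2.1.symm, add_zero]
      exact congrArg _ (hrow_old P.1 this.1 this.2.1)
    have h2 : q + -u₀ - u₁ = u₂ := by
      rw [hq]
      abel
    have h3 : gainCrossing i * -gainCrossing i = -1 := by
      rw [mul_neg, gainCrossing_mul_self]
    rw [h1, h2, h3, hh' (N 0) u₀, Int.cast_neg, Int.cast_one]
    ring
  unfold momentumIntegral
  rw [show rowIntegral (gainGraph G A leftUpper i).2 _ = rowIntegral ((G.2.erase A).image
    (mapPair (gainShift A)) ∪ {N 2, N 1, N 0}) _ from congrArg (fun S => rowIntegral S _) hpair,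
    rowIntegral_union hdisj' hmeas ⟨Bd, fun k => hBd _ _ _ _⟩]
  have himg := rowIntegral_image (S := G.2.erase A) hr.injective (fun k => rowIntegral
    {N 2, N 1, N 0} fun k' => graphIntegrand V w φ (gainGraph G A leftUpper i).1
      (Fin.cons s₀ s : Fin (m + 1) → ℝ) (k + k') *
        ∏ P ∈ (gainGraph G A leftUpper i).2, h P ((k + k') P.1))
  refine himg.trans ?_
  -- On the other side the pair `A` is split off, so that its momentum can be identified with the
  -- sum of the three new ones.
  have hins : rowIntegral G.2 _ = _ := (congrArg (fun S => rowIntegral S _)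
    (Finset.insert_erase hA).symm).trans (rowIntegral_insert (Finset.notMem_erase A G.2) hmeasG
      ⟨BG, fun k => hBG _ _ _ _⟩)
  rw [hins, ← neg_one_mul, ← rowIntegral_const_mul]
  refine rowIntegral_congr fun k hk => ?_
  refine (rowIntegral_triple hne21 hne20 hne10
    (hmeas.comp (measurable_row_add (Function.extend (gainShift A) k 0)))
    ⟨Bd, fun k' => hBd _ _ _ _⟩).trans ?_
  simp only [Function.comp_apply, key k hk]
  have hkA : k A.1 = 0 := hk _ fun P hP => by
    have := hG.disj P (Finset.mem_of_mem_erase hP) A hA (Finset.ne_of_mem_erase hP)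
    exact ⟨this.1, this.2.2.1⟩
  have hmleg : Measurable fun q : UnitAddTorus (Fin d) => k + leg A q :=
    (measurable_row_add k).comp (continuous_leg A).measurable
  obtain ⟨B₁, hB₁⟩ := exists_norm_graphIntegrand_le hV hφ' G.1
  have hcw : Continuous fun k : ℕ → UnitAddTorus (Fin d) =>
      ∏ P ∈ G.2.erase A, h (mapPair (gainShift A) P) (k P.1) :=
    continuous_weights (S := G.2.erase A) (h := fun P => h (mapPair (gainShift A) P)) fun P => hh _
  obtain ⟨B₂, hB₂⟩ := exists_bound_of_continuous hcw
  have hq3 : Continuous fun z : UnitAddTorus (Fin d) × UnitAddTorus (Fin d) ×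
      UnitAddTorus (Fin d) => (τ, z) := by fun_prop
  have hk3 := (continuous_collisionKernel hV hw (gainExchange i)).comp hq3
  have hw3 : Continuous fun z : UnitAddTorus (Fin d) × UnitAddTorus (Fin d) ×
      UnitAddTorus (Fin d) => h (N 0) z.2.1 * h (N 1) z.2.2 * h (N 2) (z.1 + z.2.1 - z.2.2) := by
    have h0 := hh (N 0)
    have h1 := hh (N 1)
    have h2 := hh (N 2)
    fun_prop
  have hfub := integral_gainMomenta (Ψ := fun q => -(graphIntegrand V w φ G.1 s (k + leg A q) *
      ∏ P ∈ G.2.erase A, h (mapPair (gainShift A) P) ((k + leg A q) P.1)))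
    (((measurable_graphIntegrand hV hw hφ G.1 s).comp hmleg).mul
      (hcw.measurable.comp hmleg)).neg
    ⟨B₁ * B₂, fun q => by
      rw [norm_neg, norm_mul]
      exact mul_le_mul (hB₁ _ _ _ _) (hB₂ _) (norm_nonneg _)
        ((norm_nonneg _).trans (hB₁ w m s 0))⟩ (hk3.mul hw3)
  refine hfub.trans ?_
  rw [← integral_const_mul]
  refine integral_congr_ae (Eventually.of_forall fun q => ?_)
  have hprod := prod_update hA (fun P => h (mapPair (gainShift A) P))
    (collision V w (gainExchange i) τ (h (N 0)) (h (N 1)) (h (N 2))) (k + leg A q)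
  have hq : (k + leg A q) A.1 = q := by rw [Pi.add_apply, hkA, leg_fst, zero_add]
  rw [hq, collision_eq] at hprod
  refine Eq.trans ?_ (congrArg (fun z => -1 * (graphIntegrand V w φ G.1 s (k + leg A q) * z))
    hprod.symm)
  simp only [Pi.mul_apply, Function.comp_apply]
  ring

end GainRecursion

/-! ### An integrable bound on the momentum integrals -/

section Bound

lemma lintegral_fin_cons {m : ℕ} {F : (Fin (m + 1) → ℝ) → ENNReal} (hF : Measurable F) :
    ∫⁻ s, F s = ∫⁻ s₀ : ℝ, ∫⁻ s : Fin m → ℝ, F (Fin.cons s₀ s) := by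
  have h := (volume_preserving_piFinSuccAbove (fun _ : Fin (m + 1) => ℝ) 0).symm
  rw [← h.lintegral_comp hF]
  have h2 := lintegral_prod (μ := (volume : Measure ℝ)) (ν := (volume : Measure (Fin m → ℝ)))
    (fun z => F ((MeasurableEquiv.piFinSuccAbove (fun _ : Fin (m + 1) => ℝ) 0).symm z))
    (hF.comp (MeasurableEquiv.measurable _)).aemeasurable
  refine Eq.trans ?_ (h2.trans ?_)
  · rfl
  · refine lintegral_congr fun s₀ => lintegral_congr fun s => ?_
    exact congrArg F (funext fun i => Fin.cases rfl (fun _ => rfl) i)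

lemma integral_fin_cons_symm {m : ℕ} {F : (Fin (m + 1) → ℝ) → ℂ} (hF : Integrable F) :
    ∫ s, F s = ∫ s : Fin m → ℝ, ∫ s₀ : ℝ, F (Fin.cons s₀ s) := by
  have h := (volume_preserving_piFinSuccAbove (fun _ : Fin (m + 1) => ℝ) 0).symm
  rw [← h.integral_comp']
  have h2 := integral_prod_symm (μ := (volume : Measure ℝ)) (ν := (volume : Measure (Fin m → ℝ)))
    (fun z => F ((MeasurableEquiv.piFinSuccAbove (fun _ : Fin (m + 1) => ℝ) 0).symm z))
    ((h.integrable_comp_emb (MeasurableEquiv.measurableEmbedding _)).mpr hF)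
  refine Eq.trans ?_ (h2.trans ?_)
  · rfl
  · refine integral_congr_ae (Eventually.of_forall fun s =>
      integral_congr_ae (Eventually.of_forall fun s₀ => ?_))
    exact congrArg F (funext fun i => Fin.cases rfl (fun _ => rfl) i)

lemma continuous_collisionDecay (δ : ℝ) : Continuous fun z : ℝ × ℝ => collisionDecay δ z.1 z.2 := by
  unfold collisionDecay
  exact ((continuous_japanese_rpow _).comp (continuous_snd.add continuous_fst)).add
    ((continuous_japanese_rpow _).comp (continuous_snd.sub continuous_fst))

/-- Translation and reflection invariance remove T. This uniformity in the oscillation times of the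
weights is what makes the induction over the motives possible. -/
lemma lintegral_collisionDecay_le (δ T : ℝ) :
    ∫⁻ τ, ENNReal.ofReal (collisionDecay δ τ T) ≤
      2 * ∫⁻ τ, ENNReal.ofReal (japanese τ ^ (-1 - δ)) := by
  have h1 : ∫⁻ τ, ENNReal.ofReal (japanese (T + τ) ^ (-1 - δ)) =
      ∫⁻ τ, ENNReal.ofReal (japanese τ ^ (-1 - δ)) :=
    lintegral_add_left_eq_self (fun τ => ENNReal.ofReal (japanese τ ^ (-1 - δ))) T
  have h2 : ∫⁻ τ, ENNReal.ofReal (japanese (T - τ) ^ (-1 - δ)) =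
      ∫⁻ τ, ENNReal.ofReal (japanese τ ^ (-1 - δ)) :=
    lintegral_sub_left_eq_self (fun τ => ENNReal.ofReal (japanese τ ^ (-1 - δ))) T
  have hm : Measurable fun τ => ENNReal.ofReal (japanese (T + τ) ^ (-1 - δ)) :=
    ENNReal.measurable_ofReal.comp ((continuous_japanese_rpow _).comp (by fun_prop)).measurable
  calc ∫⁻ τ, ENNReal.ofReal (collisionDecay δ τ T)
      ≤ ∫⁻ τ, (ENNReal.ofReal (japanese (T + τ) ^ (-1 - δ)) +
          ENNReal.ofReal (japanese (T - τ) ^ (-1 - δ))) :=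
        lintegral_mono fun τ => ENNReal.ofReal_add_le
    _ = _ := by rw [lintegral_add_left hm, h1, h2, two_mul]

lemma lintegral_japanese_lt_top {δ : ℝ} (hδ : 0 < δ) :
    ∫⁻ τ, ENNReal.ofReal (japanese τ ^ (-1 - δ)) < ⊤ :=
  (integrable_japanese_rpow hδ).lintegral_lt_top

/-- The total decay in time of a collision whose weights oscillate with the times `t`. -/
noncomputable def tripleDecay (δ τ : ℝ) (t : Fin 3 → ℝ) : ℝ :=
  collisionDecay δ τ (t 0) + collisionDecay δ τ (t 1) + collisionDecay δ τ (t 2)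

lemma tripleDecay_nonneg (δ τ : ℝ) (t : Fin 3 → ℝ) : 0 ≤ tripleDecay δ τ t :=
  add_nonneg (add_nonneg (collisionDecay_nonneg _ _ _) (collisionDecay_nonneg _ _ _))
    (collisionDecay_nonneg _ _ _)

lemma tripleDecay_neg (δ τ : ℝ) (t : Fin 3 → ℝ) : tripleDecay δ (-τ) t = tripleDecay δ τ t := by
  simp only [tripleDecay, collisionDecay_neg]

lemma tripleDecay_sign {σ : ℤ} (hσ : σ = 1 ∨ σ = -1) (δ τ : ℝ) (t : Fin 3 → ℝ) :
    tripleDecay δ (σ * τ) t = tripleDecay δ τ t := by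
  rcases hσ with rfl | rfl
  · simp
  · rw [← tripleDecay_neg]; simp

lemma continuous_tripleDecay (δ : ℝ) :
    Continuous fun z : ℝ × (Fin 3 → ℝ) => tripleDecay δ z.1 z.2 := by
  have h := continuous_collisionDecay δ
  unfold tripleDecay
  have h' : ∀ j : Fin 3, Continuous fun z : ℝ × (Fin 3 → ℝ) => collisionDecay δ z.1 (z.2 j) :=
    fun j => h.comp (continuous_fst.prodMk ((continuous_apply j).comp continuous_snd))
  exact ((h' 0).add (h' 1)).add (h' 2)

lemma lintegral_tripleDecay_le (δ : ℝ) (t : Fin 3 → ℝ) :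
    ∫⁻ τ, ENNReal.ofReal (tripleDecay δ τ t) ≤
      6 * ∫⁻ τ, ENNReal.ofReal (japanese τ ^ (-1 - δ)) := by
  have hm : ∀ T, Measurable fun τ => ENNReal.ofReal (collisionDecay δ τ T) := fun T =>
    ENNReal.measurable_ofReal.comp ((continuous_collisionDecay δ).comp
      (continuous_id.prodMk continuous_const)).measurable
  calc ∫⁻ τ, ENNReal.ofReal (tripleDecay δ τ t)
      ≤ ∫⁻ τ, (ENNReal.ofReal (collisionDecay δ τ (t 0)) +
          ENNReal.ofReal (collisionDecay δ τ (t 1)) +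
          ENNReal.ofReal (collisionDecay δ τ (t 2))) :=
        lintegral_mono fun τ => ENNReal.ofReal_add_le.trans
          (add_le_add ENNReal.ofReal_add_le le_rfl)
    _ = (∫⁻ τ, ENNReal.ofReal (collisionDecay δ τ (t 0))) +
          (∫⁻ τ, ENNReal.ofReal (collisionDecay δ τ (t 1))) +
          ∫⁻ τ, ENNReal.ofReal (collisionDecay δ τ (t 2)) := by
        have h2 : Measurable fun τ => ENNReal.ofReal (collisionDecay δ τ (t 0)) +
          ENNReal.ofReal (collisionDecay δ τ (t 1)) := (hm _).add (hm _)
        rw [lintegral_add_left h2, lintegral_add_left (hm _)]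
    _ ≤ _ := by
        refine (add_le_add (add_le_add (lintegral_collisionDecay_le δ _)
          (lintegral_collisionDecay_le δ _)) (lintegral_collisionDecay_le δ _)).trans_eq ?_
        ring

variable {d : ℕ} {V : (Fin d → ℤ) → ℝ}

/-- The momentum integrals of `G` are bounded by the function `B` of the times `Th P` with which
the weights of the pairs oscillate and of the durations of the slices. -/
structure MomentumBound (V : (Fin d → ℤ) → ℝ) (C δ : ℝ) (m : ℕ) (G : PairedGraph)
    (B : (ℕ × ℕ → ℝ) × (Fin m → ℝ) → ℝ) : Prop where
  continuous : Continuous B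
  nonneg : ∀ z, 0 ≤ B z
  integral_le : ∃ K : ENNReal, K < ⊤ ∧ ∀ Th, ∫⁻ s, ENNReal.ofReal (B (Th, s)) ≤ K
  bound : ∀ w : UnitAddTorus (Fin d) → ℝ, Dispersive C δ w → ∀ φ : UnitAddTorus (Fin d) → ℂ,
    Measurable φ → ∀ Mφ, (∀ k, ‖φ k‖ ≤ Mφ) →
    ∀ (h : ℕ × ℕ → UnitAddTorus (Fin d) → ℂ) (Th M : ℕ × ℕ → ℝ),
    (∀ P, PhasedWiener w (Th P) (h P) (M P)) → (∀ P k, h P (-k) = h P k) → ∀ s : Fin m → ℝ,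
    ‖momentumIntegral V w φ G h s‖ ≤ Mφ * (∏ P ∈ G.2, M P) * B (Th, s)

/-- The times with which the weights oscillate, after a motive has been integrated out. -/
noncomputable def reducedTimes (r : ℕ → ℕ) (A : ℕ × ℕ) (a b : ℝ) (z : (ℕ × ℕ → ℝ) × ℝ) :
    ℕ × ℕ → ℝ :=
  Function.update (fun P => z.1 (mapPair r P)) A (a * z.1 (mapPair r A) + b * z.2)

lemma continuous_reducedTimes (r : ℕ → ℕ) (A : ℕ × ℕ) (a b : ℝ) :
    Continuous (reducedTimes r A a b) := by
  refine continuous_pi fun P => ?_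
  unfold reducedTimes
  by_cases hP : P = A
  · subst hP
    simp only [Function.update_self]
    fun_prop
  · simp only [Function.update_of_ne hP]
    fun_prop

/-- The bound for a graph with an attached motive. -/
noncomputable def stepBound (c δ : ℝ) (t : (ℕ × ℕ → ℝ) → Fin 3 → ℝ)
    (θ : (ℕ × ℕ → ℝ) × ℝ → ℕ × ℕ → ℝ) {m : ℕ} (B : (ℕ × ℕ → ℝ) × (Fin m → ℝ) → ℝ)
    (z : (ℕ × ℕ → ℝ) × (Fin (m + 1) → ℝ)) : ℝ :=
  c * tripleDecay δ (z.2 0) (t z.1) * B (θ (z.1, z.2 0), Fin.tail z.2)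

lemma stepBound_cons (c δ : ℝ) (t : (ℕ × ℕ → ℝ) → Fin 3 → ℝ)
    (θ : (ℕ × ℕ → ℝ) × ℝ → ℕ × ℕ → ℝ) {m : ℕ} (B : (ℕ × ℕ → ℝ) × (Fin m → ℝ) → ℝ)
    (Th : ℕ × ℕ → ℝ) (s₀ : ℝ) (s : Fin m → ℝ) :
    stepBound c δ t θ B (Th, (Fin.cons s₀ s : Fin (m + 1) → ℝ)) =
      c * tripleDecay δ s₀ (t Th) * B (θ (Th, s₀), s) := rfl

lemma continuous_stepBound {c δ : ℝ} {t : (ℕ × ℕ → ℝ) → Fin 3 → ℝ} (ht : Continuous t)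
    {θ : (ℕ × ℕ → ℝ) × ℝ → ℕ × ℕ → ℝ} (hθ : Continuous θ) {m : ℕ}
    {B : (ℕ × ℕ → ℝ) × (Fin m → ℝ) → ℝ} (hB : Continuous B) :
    Continuous (stepBound c δ t θ B) := by
  have h0 : Continuous fun z : (ℕ × ℕ → ℝ) × (Fin (m + 1) → ℝ) => z.2 0 :=
    (continuous_apply 0).comp continuous_snd
  have h1 : Continuous fun z : (ℕ × ℕ → ℝ) × (Fin (m + 1) → ℝ) => Fin.tail z.2 :=
    continuous_pi fun i => (continuous_apply i.succ).comp continuous_snd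
  have h2 := (continuous_tripleDecay δ).comp (h0.prodMk (ht.comp continuous_fst))
  have h3 := hB.comp ((hθ.comp (continuous_fst.prodMk h0)).prodMk h1)
  exact (continuous_const.mul h2).mul h3

/-- The oscillation times of the reduced graph depend on s₀. Therefore the other durations are
integrated first, for fixed s₀, with the bound K that holds for all times; then the decay in s₀ is
integrable. -/
lemma lintegral_stepBound_le {c δ : ℝ} (hc : 0 ≤ c) {t : (ℕ × ℕ → ℝ) → Fin 3 → ℝ}
    (ht : Continuous t) {θ : (ℕ × ℕ → ℝ) × ℝ → ℕ × ℕ → ℝ} (hθ : Continuous θ) {m : ℕ}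
    {B : (ℕ × ℕ → ℝ) × (Fin m → ℝ) → ℝ} (hB : Continuous B) {K : ENNReal}
    (hK : ∀ Th, ∫⁻ s, ENNReal.ofReal (B (Th, s)) ≤ K) (Th : ℕ × ℕ → ℝ) :
    ∫⁻ s, ENNReal.ofReal (stepBound c δ t θ B (Th, s)) ≤
      ENNReal.ofReal c * (6 * ∫⁻ τ, ENNReal.ofReal (japanese τ ^ (-1 - δ))) * K := by
  have hcont := continuous_stepBound (c := c) (δ := δ) ht hθ hB
  rw [lintegral_fin_cons (F := fun s => ENNReal.ofReal (stepBound c δ t θ B (Th, s)))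
    (ENNReal.measurable_ofReal.comp
      (hcont.comp (continuous_const.prodMk continuous_id)).measurable)]
  have hm : Measurable fun τ => ENNReal.ofReal (tripleDecay δ τ (t Th)) :=
    ENNReal.measurable_ofReal.comp ((continuous_tripleDecay δ).comp
      (continuous_id.prodMk continuous_const)).measurable
  calc ∫⁻ s₀, ∫⁻ s, ENNReal.ofReal (stepBound c δ t θ B (Th, (Fin.cons s₀ s : Fin (m + 1) → ℝ)))
      ≤ ∫⁻ s₀, ENNReal.ofReal c * ENNReal.ofReal (tripleDecay δ s₀ (t Th)) * K := by
        refine lintegral_mono fun s₀ => ?_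
        have h1 : ∀ s, ENNReal.ofReal (stepBound c δ t θ B (Th, (Fin.cons s₀ s : Fin (m + 1) → ℝ)))
            = ENNReal.ofReal c * ENNReal.ofReal (tripleDecay δ s₀ (t Th)) *
              ENNReal.ofReal (B (θ (Th, s₀), s)) := fun s => by
          rw [stepBound_cons, ENNReal.ofReal_mul (mul_nonneg hc (tripleDecay_nonneg _ _ _)), ENNReal.ofReal_mul hc]
        simp only [h1]
        have hmB : Measurable fun s => ENNReal.ofReal (B (θ (Th, s₀), s)) :=
          ENNReal.measurable_ofReal.comp
            (hB.comp (continuous_const.prodMk continuous_id)).measurable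
        rw [lintegral_const_mul _ hmB]
        exact mul_le_mul_right (hK _) _
    _ = ENNReal.ofReal c * (∫⁻ s₀, ENNReal.ofReal (tripleDecay δ s₀ (t Th))) * K := by
        rw [lintegral_mul_const _ (hm.const_mul _), lintegral_const_mul _ hm]
    _ ≤ _ := by gcongr; exact lintegral_tripleDecay_le δ _

lemma PhasedWiener.congr_mass {w : UnitAddTorus (Fin d) → ℝ} {τ M N : ℝ}
    {h : UnitAddTorus (Fin d) → ℂ} (hh : PhasedWiener w τ h M) (hM : M = N) :
    PhasedWiener w τ h N := hM ▸ hh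

/-- The constant weight 1 of the edge between the two vertices has the oscillation time 0, which is
the first entry of the triple. The bound is symmetric in the three weights, so it has the same form
for all six motives. -/
lemma phasedWiener_lossReduced {C δ : ℝ} (hC : 0 ≤ C) {w : UnitAddTorus (Fin d) → ℝ}
    (hw : Dispersive C δ w) (hV : Summable V) (hV' : ∀ x, V (-x) = V x) (G : PairedGraph) (e : ℕ)
    (i : Fin 6) {h : ℕ × ℕ → UnitAddTorus (Fin d) → ℂ} {Th M : ℕ × ℕ → ℝ}
    (hh : ∀ P, PhasedWiener w (Th P) (h P) (M P)) (s₀ : ℝ) :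
    PhasedWiener w (parity G.1 e * s₀) (lossReduced V w G e i h s₀)
      (potentialMass V * (M (translate e (lossData (parity G.1 e) i).2.2.1) *
        M (translate e (lossData (parity G.1 e) i).2.2.2)) * (C * tripleDecay δ s₀
        ![0, Th (translate e (lossData (parity G.1 e) i).2.2.1),
          Th (translate e (lossData (parity G.1 e) i).2.2.2)])) := by
  have h1 : PhasedWiener w 0 (1 : UnitAddTorus (Fin d) → ℂ) 1 := wienerBound_one.phased w
  have hB := hh (translate e (lossData (parity G.1 e) i).2.2.1)
  have hC' := hh (translate e (lossData (parity G.1 e) i).2.2.2)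
  have key := fun {T₂ T₃ T₄ M₂ M₃ M₄ : ℝ} {h₂ h₃ h₄ : UnitAddTorus (Fin d) → ℂ}
    (H₂ : PhasedWiener w T₂ h₂ M₂) (H₃ : PhasedWiener w T₃ h₃ M₃)
    (H₄ : PhasedWiener w T₄ h₄ M₄) => phasedWiener_collision hC hw hV hV' (lossExchange i)
      (parity G.1 e * s₀) H₂ H₃ H₄
  rw [← tripleDecay_sign (parity_eq_one_or G.1 e)]
  simp only [tripleDecay, Matrix.cons_val]
  have k1 := key h1 hB hC'
  have k2 := key hB hC' h1
  have k3 := key hB h1 hC'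
  rw [one_mul] at k1
  rw [mul_one] at k2
  rw [mul_one] at k3
  unfold lossReduced
  fin_cases i
  · exact k1
  · exact k2.congr_mass (by ring)
  · exact k2.congr_mass (by ring)
  · exact k1
  · exact k3.congr_mass (by ring)
  · exact k2.congr_mass (by ring)

lemma lossReduced_neg {w : UnitAddTorus (Fin d) → ℝ} (hw : ∀ k, w (-k) = w k)
    (hV' : ∀ x, V (-x) = V x) (G : PairedGraph) (e : ℕ) (i : Fin 6)
    {h : ℕ × ℕ → UnitAddTorus (Fin d) → ℂ} (hh : ∀ P k, h P (-k) = h P k) (s₀ : ℝ)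
    (k : UnitAddTorus (Fin d)) :
    lossReduced V w G e i h s₀ (-k) = lossReduced V w G e i h s₀ k := by
  have hev := fun j => lossWeights_induction (p := fun f : UnitAddTorus (Fin d) → ℂ =>
    ∀ k, f (-k) = f k) (fun _ => rfl) (hh (translate e (lossData (parity G.1 e) i).2.2.1))
    (hh (translate e (lossData (parity G.1 e) i).2.2.2)) i j
  exact collision_neg hw hV' _ _ (hev 0) (hev 1) (hev 2) k

lemma gainReduced_neg {w : UnitAddTorus (Fin d) → ℝ} (hw : ∀ k, w (-k) = w k)
    (hV' : ∀ x, V (-x) = V x) (G : PairedGraph) (A : ℕ × ℕ) (b : Bool) (i : Fin 2)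
    {h : ℕ × ℕ → UnitAddTorus (Fin d) → ℂ} (hh : ∀ P k, h P (-k) = h P k) (s₀ : ℝ)
    (k : UnitAddTorus (Fin d)) :
    gainReduced V w G A b i h s₀ (-k) = gainReduced V w G A b i h s₀ k :=
  collision_neg hw hV' _ _ (hh _) (hh _) (hh _) k

lemma gainSign_eq {σ : ℤ} (hσ : σ = 1 ∨ σ = -1) (b : Bool) :
    (if b then σ else -σ) = 1 ∨ (if b then σ else -σ) = -1 := by
  cases b
  · exact neg_one_or_one_neg hσ
  · exact hσ

lemma phasedWiener_gainReduced {C δ : ℝ} (hC : 0 ≤ C) {w : UnitAddTorus (Fin d) → ℝ}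
    (hw : Dispersive C δ w) (hV : Summable V) (hV' : ∀ x, V (-x) = V x) (G : PairedGraph)
    (A : ℕ × ℕ) (b : Bool) (i : Fin 2) {h : ℕ × ℕ → UnitAddTorus (Fin d) → ℂ} {Th M : ℕ × ℕ → ℝ}
    (hh : ∀ P, PhasedWiener w (Th P) (h P) (M P)) (s₀ : ℝ) :
    PhasedWiener w (((if b then parity G.1 A.1 else -parity G.1 A.1 : ℤ) : ℝ) * s₀)
      (gainReduced V w G A b i h s₀)
      (potentialMass V * (∏ j, M (gainPair (parity G.1 A.1) A i j)) * (C * tripleDecay δ s₀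
        fun j => Th (gainPair (parity G.1 A.1) A i j))) := by
  rw [← tripleDecay_sign (gainSign_eq (parity_eq_one_or G.1 A.1) b), Fin.prod_univ_three]
  exact phasedWiener_collision hC hw hV hV' _ _ (hh _) (hh _) (hh _)

lemma prod_update_mul {S : Finset (ℕ × ℕ)} {A : ℕ × ℕ} (hA : A ∈ S) (f : ℕ × ℕ → ℝ) (x : ℝ) :
    ∏ P ∈ S, Function.update f A x P = x * ∏ P ∈ S.erase A, f P := by
  rw [← Finset.mul_prod_erase _ _ hA, Function.update_self]
  congr 1
  exact Finset.prod_congr rfl fun P hP => Function.update_of_ne (Finset.ne_of_mem_erase hP) _ _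

lemma update_induction {ι α : Type*} [DecidableEq ι] {f : ι → α} {A : ι} {x : α}
    {p : ι → α → Prop} (hA : p A x) (hf : ∀ P, p P (f P)) (P : ι) :
    p P (Function.update f A x P) := by
  by_cases hP : P = A
  · subst hP
    rwa [Function.update_self]
  · rw [Function.update_of_ne hP]
    exact hf P

/-- After the reduction the weight of `A` is a product, so its oscillation time is the old one plus
σ s₀; this is the coefficient 1 in `reducedTimes`. -/
lemma MomentumBound.loss {C δ : ℝ} (hC : 0 ≤ C) (hδ : 0 < δ) (hV : Summable V)
    (hV' : ∀ x, V (-x) = V x) {m : ℕ} {G : PairedGraph} {B : (ℕ × ℕ → ℝ) × (Fin m → ℝ) → ℝ}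
    (hB : MomentumBound V C δ m G B) (hG : IsPairing G.2) {A : ℕ × ℕ} (hA : A ∈ G.2) {e : ℕ}
    (he : IsLeg A e) (i : Fin 6) : ∃ B', MomentumBound V C δ (m + 1) (lossGraph G e i) B' := by
  obtain ⟨σ, hσ⟩ : ∃ σ, parity G.1 e = σ := ⟨_, rfl⟩
  have hs : σ = 1 ∨ σ = -1 := hσ ▸ parity_eq_one_or G.1 e
  have hc0 : 0 ≤ potentialMass V * C := mul_nonneg (potentialMass_nonneg V) hC
  set r := lossShift e (lossData σ i).2.1 with hr
  set t : (ℕ × ℕ → ℝ) → Fin 3 → ℝ := fun Th =>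
    ![0, Th (translate e (lossData σ i).2.2.1), Th (translate e (lossData σ i).2.2.2)] with ht_def
  have ht : Continuous t := continuous_pi fun j => by
    fin_cases j
    exacts [continuous_const, continuous_apply _, continuous_apply _]
  have hθ := continuous_reducedTimes r A 1 σ
  refine ⟨stepBound (potentialMass V * C) δ t (reducedTimes r A 1 σ) B,
    continuous_stepBound ht hθ hB.continuous, fun z => ?_, ?_, ?_⟩
  · exact mul_nonneg (mul_nonneg hc0 (tripleDecay_nonneg _ _ _)) (hB.nonneg _)
  · obtain ⟨K, hK, hK'⟩ := hB.integral_le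
    refine ⟨_, ?_, lintegral_stepBound_le hc0 ht hθ hB.continuous hK'⟩
    exact ENNReal.mul_lt_top (ENNReal.mul_lt_top ENNReal.ofReal_lt_top
      (ENNReal.mul_lt_top (by norm_num) (lintegral_japanese_lt_top hδ))) hK
  · intro w hw φ hφ Mφ hMφ h Th M hh heven s
    obtain ⟨s₀, s, rfl⟩ : ∃ s₀ s', s = (Fin.cons s₀ s' : Fin (m + 1) → ℝ) :=
      ⟨s 0, Fin.tail s, (Fin.cons_self_tail s).symm⟩
    have hred := phasedWiener_lossReduced hC hw hV hV' G e i hh s₀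
    have hredneg := lossReduced_neg hw.even hV' G e i heven s₀
    have hdisj := disjoint_loss G e i
    have hpair := lossGraph_snd' G e i
    rw [momentumIntegral_lossGraph hV hV' hw.continuous hw.even hφ ⟨Mφ, hMφ⟩ hG hA he i
      (fun P => (hh P).continuous hw.continuous) heven s₀ s]
    rw [hσ] at hred hdisj hpair ⊢
    rw [← hr] at hdisj hpair ⊢
    have hsign : ‖((lossCrossing i * lossSign i : ℤ) : ℂ)‖ = 1 := by
      fin_cases i <;> simp [lossCrossing, lossSign]
    rw [norm_mul, hsign, one_mul]
    have hmain := hB.bound w hw φ hφ Mφ hMφ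
      (Function.update (fun P => h (mapPair r P)) A
        fun q => h (mapPair r A) q * lossReduced V w G e i h s₀ q)
      (reducedTimes r A 1 σ (Th, s₀))
      (Function.update (fun P => M (mapPair r P)) A (M (mapPair r A) * (potentialMass V *
        (M (translate e (lossData σ i).2.2.1) * M (translate e (lossData σ i).2.2.2)) *
          (C * tripleDecay δ s₀ (t Th)))))
      (fun P => by
        by_cases hP : P = A
        · subst hP
          rw [reducedTimes, Function.update_self, Function.update_self, Function.update_self,
            one_mul]
          exact (hh _).mul hred
        · rw [reducedTimes, Function.update_of_ne hP, Function.update_of_ne hP,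
            Function.update_of_ne hP]
          exact hh _)
      (update_induction (p := fun (_ : ℕ × ℕ) (f : UnitAddTorus (Fin d) → ℂ) =>
        ∀ k, f (-k) = f k)
        (fun k => by rw [heven, hredneg]) fun P => heven _) s
    refine hmain.trans_eq ?_
    have hprod : ∏ P ∈ (lossGraph G e i).2, M P = (M (mapPair r A) *
        ∏ P ∈ G.2.erase A, M (mapPair r P)) * (M (translate e (lossData σ i).2.2.1) *
          M (translate e (lossData σ i).2.2.2)) := by
      rw [hpair, Finset.prod_union hdisj, Finset.prod_image (mapPair_injective
        (lossShift_strictMono (lossData_spec hs i).2.1 e).injective).injOn,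
        Finset.mul_prod_erase _ (fun P => M (mapPair r P)) hA, Finset.prod_image
        (mapPair_injective (strictMono_add e).injective).injOn, lossPairs, Finset.prod_pair]
      intro h
      exact (lossData_spec hs i).2.2.2.2.2.1 (by rw [h])
    rw [prod_update_mul hA, hprod, stepBound_cons]
    ring

/-- After the reduction the weight of `A` is the collision alone, with the oscillation time ± s₀;
the old time of `A` does not enter, whence the coefficient 0 in `reducedTimes`. -/
lemma MomentumBound.gain {C δ : ℝ} (hC : 0 ≤ C) (hδ : 0 < δ) (hV : Summable V)
    (hV' : ∀ x, V (-x) = V x) {m : ℕ} {G : PairedGraph} {B : (ℕ × ℕ → ℝ) × (Fin m → ℝ) → ℝ}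
    (hB : MomentumBound V C δ m G B) (hG : IsPairing G.2) {A : ℕ × ℕ} (hA : A ∈ G.2)
    (hpar : parity G.1 A.2 = -parity G.1 A.1) (b : Bool) (i : Fin 2) :
    ∃ B', MomentumBound V C δ (m + 1) (gainGraph G A b i) B' := by
  have hs := parity_eq_one_or G.1 A.1
  have hc0 : 0 ≤ potentialMass V * C := mul_nonneg (potentialMass_nonneg V) hC
  set ς : ℤ := if b then parity G.1 A.1 else -parity G.1 A.1 with hς
  set N := gainPair (parity G.1 A.1) A i with hN
  have ht : Continuous fun (Th : ℕ × ℕ → ℝ) (j : Fin 3) => Th (N j) :=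
    continuous_pi fun j => continuous_apply _
  have hθ := continuous_reducedTimes (gainShift A) A 0 ς
  refine ⟨stepBound (potentialMass V * C) δ (fun Th j => Th (N j))
    (reducedTimes (gainShift A) A 0 ς) B,
    continuous_stepBound ht hθ hB.continuous, fun z => ?_, ?_, ?_⟩
  · exact mul_nonneg (mul_nonneg hc0 (tripleDecay_nonneg _ _ _)) (hB.nonneg _)
  · obtain ⟨K, hK, hK'⟩ := hB.integral_le
    refine ⟨_, ?_, lintegral_stepBound_le hc0 ht hθ hB.continuous hK'⟩
    exact ENNReal.mul_lt_top (ENNReal.mul_lt_top ENNReal.ofReal_lt_top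
      (ENNReal.mul_lt_top (by norm_num) (lintegral_japanese_lt_top hδ))) hK
  · intro w hw φ hφ Mφ hMφ h Th M hh heven s
    obtain ⟨s₀, s, rfl⟩ : ∃ s₀ s', s = (Fin.cons s₀ s' : Fin (m + 1) → ℝ) :=
      ⟨s 0, Fin.tail s, (Fin.cons_self_tail s).symm⟩
    have hred := phasedWiener_gainReduced hC hw hV hV' G A b i hh s₀
    have hredneg := gainReduced_neg hw.even hV' G A b i heven s₀
    have hdisj := disjoint_gain hG hA i
    have hpair := gainGraph_snd' G A b i
    rw [momentumIntegral_gainGraph hV hV' hw.continuous hw.even hφ ⟨Mφ, hMφ⟩ hG hA hpar b i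
      (fun P => (hh P).continuous hw.continuous) heven s₀ s (hred.continuous hw.continuous),
      norm_neg]
    have hmain := hB.bound w hw φ hφ Mφ hMφ
      (Function.update (fun P => h (mapPair (gainShift A) P)) A (gainReduced V w G A b i h s₀))
      (reducedTimes (gainShift A) A 0 ς (Th, s₀))
      (Function.update (fun P => M (mapPair (gainShift A) P)) A (potentialMass V *
        (∏ j, M (N j)) * (C * tripleDecay δ s₀ fun j => Th (N j))))
      (fun P => by
        by_cases hP : P = A
        · subst hP
          rw [reducedTimes, Function.update_self, Function.update_self, Function.update_self,
            zero_mul, zero_add]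
          exact hred
        · rw [reducedTimes, Function.update_of_ne hP, Function.update_of_ne hP,
            Function.update_of_ne hP]
          exact hh _)
      (update_induction (p := fun (_ : ℕ × ℕ) (f : UnitAddTorus (Fin d) → ℂ) =>
        ∀ k, f (-k) = f k) hredneg fun P => heven _) s
    refine hmain.trans_eq ?_
    have hinj : Function.Injective (gainData (parity G.1 A.1) i) := fun j j' hj => by
      by_contra hne
      exact (gainData_injective hs i j j' hne).2 (by rw [hj])
    have hprod : ∏ P ∈ (gainGraph G A b i).2, M P =
        (∏ P ∈ G.2.erase A, M (mapPair (gainShift A) P)) * ∏ j, M (N j) := by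
      rw [hpair, Finset.prod_union hdisj, Finset.prod_image (mapPair_injective
        (gainShift_strictMono A).injective).injOn, Finset.prod_image
        (mapPair_injective (gainSlot_strictMono (hG.lt A hA)).injective).injOn,
        Finset.prod_image hinj.injOn]
      rfl
    rw [prod_update_mul hA, hprod, stepBound_cons]
    ring

lemma momentumBound_zero (C δ : ℝ) :
    MomentumBound V C δ 0 ([], {(0, 1)}) (fun _ => 1) := by
  refine ⟨continuous_const, fun _ => zero_le_one, ⟨1, by simp, fun Th => ?_⟩, ?_⟩
  · simp [volume_pi]
  · intro w hw φ hφ Mφ hMφ h Th M hh heven s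
    have hM0 : 0 ≤ Mφ := (norm_nonneg _).trans (hMφ 0)
    rw [mul_one, Finset.prod_singleton]
    refine (norm_integral_le_of_norm_le_const (C := Mφ * M (0, 1))
      (Eventually.of_forall fun q => ?_)).trans (by simp)
    rw [norm_mul, norm_graphIntegrand_eq]
    simp only [vertices, vertexProd, List.map_nil, List.prod_nil, norm_one, mul_one,
      Finset.prod_singleton]
    exact mul_le_mul (hMφ _) ((hh _).norm_le _) (norm_nonneg _) hM0

/-- The motive attached last is the lowest one in the history and belongs to the first of the
durations. Peeling it off reduces a graph to its predecessor with other weights, which is why the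
induction hypothesis has to cover arbitrary phased weights. -/
lemma exists_momentumBound {C δ : ℝ} (hC : 0 ≤ C) (hδ : 0 < δ) (hV : Summable V)
    (hV' : ∀ x, V (-x) = V x) {m : ℕ} {G : PairedGraph} (hG : G ∈ leadingGraphs m) :
    ∃ B, MomentumBound V C δ m G B := by
  induction m generalizing G with
  | zero =>
    simp only [leadingGraphs, Finset.mem_singleton] at hG
    subst hG
    exact ⟨_, momentumBound_zero C δ⟩
  | succ m ih =>
    simp only [leadingGraphs, Finset.mem_biUnion] at hG
    obtain ⟨G', hG', A, hA, hH⟩ := hG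
    obtain ⟨B, hB⟩ := ih hG'
    have hl := isLeading_of_mem (d := d) hG'
    rcases mem_attachments hl.pairing hA hH with ⟨e, i, he, -, rfl⟩ | ⟨-, b, i, rfl⟩
    · exact hB.loss hC hδ hV hV' hl.pairing hA he i
    · exact hB.gain hC hδ hV hV' hl.pairing hA (hl.parity_snd A hA) b i

end Bound

/-! ### The time integral -/

section TimeIntegral

/-- The simplex of the nonnegative durations of total length at most `y`. -/
def simplex (m : ℕ) (y : ℝ) : Set (Fin m → ℝ) := {r | (∀ j, 0 ≤ r j) ∧ ∑ j, r j ≤ y}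

lemma isClosed_simplex (m : ℕ) (y : ℝ) : IsClosed (simplex m y) := by
  have h1 : simplex m y = (⋂ j, {r : Fin m → ℝ | 0 ≤ r j}) ∩ {r | ∑ j, r j ≤ y} := by
    ext r; simp [simplex]
  rw [h1]
  exact (isClosed_iInter fun j => isClosed_le continuous_const (continuous_apply j)).inter
    (isClosed_le (continuous_finsetSum _ fun j _ => continuous_apply j) continuous_const)

lemma measurableSet_simplex (m : ℕ) (y : ℝ) : MeasurableSet (simplex m y) :=
  (isClosed_simplex m y).measurableSet

lemma cons_mem_simplex {m : ℕ} {y s₀ : ℝ} {s : Fin m → ℝ} :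
    (Fin.cons s₀ s : Fin (m + 1) → ℝ) ∈ simplex (m + 1) y ↔
      0 ≤ s₀ ∧ s ∈ simplex m (y - s₀) := by
  simp only [simplex, mem_ofPred_eq, Fin.forall_fin_succ, Fin.cons_zero, Fin.cons_succ,
    Fin.sum_univ_succ, and_assoc, le_sub_iff_add_le']

lemma nonneg_of_mem_simplex {m : ℕ} {y : ℝ} {s : Fin m → ℝ} (hs : s ∈ simplex m y) : 0 ≤ y :=
  (Finset.sum_nonneg fun j _ => hs.1 j).trans hs.2

/-- Slicing at the value s₀ of the first coordinate leaves a simplex of size y - s₀, and ∫₀^y (y -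
s₀)^m / m! ds₀ = y^{m+1} / (m+1)!. -/
lemma volume_simplex (m : ℕ) {y : ℝ} (hy : 0 ≤ y) :
    volume (simplex m y) = ENNReal.ofReal (y ^ m / m.factorial) := by
  induction m generalizing y with
  | zero =>
    have h : simplex 0 y = univ := eq_univ_of_forall fun r => ⟨fun j => j.elim0, by simpa⟩
    simp [h, volume_pi]
  | succ m ih =>
    rw [← lintegral_indicator_one (measurableSet_simplex _ _), lintegral_fin_cons
      (measurable_one.indicator (measurableSet_simplex _ _))]
    have h1 : ∀ s₀ : ℝ, ∫⁻ s : Fin m → ℝ, (simplex (m + 1) y).indicator (1 : (Fin (m + 1) → ℝ) → ENNReal)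
        (Fin.cons s₀ s) = (Icc 0 y).indicator
          (fun s₀ => ENNReal.ofReal ((y - s₀) ^ m / m.factorial)) s₀ := by
      intro s₀
      by_cases hs : s₀ ∈ Icc 0 y
      · rw [indicator_of_mem hs, ← ih (sub_nonneg.mpr hs.2),
          ← lintegral_indicator_one (measurableSet_simplex _ _)]
        refine lintegral_congr fun s => ?_
        by_cases h : s ∈ simplex m (y - s₀)
        · rw [indicator_of_mem (cons_mem_simplex.mpr ⟨hs.1, h⟩), indicator_of_mem h]
          rfl
        · rw [indicator_of_notMem fun h' => h (cons_mem_simplex.mp h').2, indicator_of_notMem h]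
      · rw [indicator_of_notMem hs]
        refine (lintegral_congr fun s => ?_).trans lintegral_zero
        rw [indicator_of_notMem]
        intro h
        obtain ⟨h0, h'⟩ := cons_mem_simplex.mp h
        exact hs ⟨h0, sub_nonneg.mp (nonneg_of_mem_simplex h')⟩
    simp only [h1]
    rw [lintegral_indicator measurableSet_Icc, ← ofReal_integral_eq_lintegral_ofReal]
    · congr 1
      rw [integral_Icc_eq_integral_Ioc, ← intervalIntegral.integral_of_le hy,
        intervalIntegral.integral_comp_sub_left (fun x => x ^ m / (m.factorial : ℝ)) y, sub_self,
        sub_zero, intervalIntegral.integral_div, integral_pow, Nat.factorial_succ]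
      push_cast
      field_simp
      simp
    · exact (Continuous.integrableOn_Icc (by fun_prop))
    · refine (ae_restrict_iff' measurableSet_Icc).mpr (Eventually.of_forall fun x hx => ?_)
      exact div_nonneg (pow_nonneg (sub_nonneg.mpr hx.2) _) (Nat.cast_nonneg _)

lemma volume_simplex_lt_top (m : ℕ) (y : ℝ) : volume (simplex m y) < ⊤ := by
  rcases le_or_gt 0 y with hy | hy
  · rw [volume_simplex m hy]
    exact ENNReal.ofReal_lt_top
  · have : simplex m y = ∅ := eq_empty_of_forall_notMem fun s hs =>
      absurd (nonneg_of_mem_simplex hs) (not_le.mpr hy)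
    simp [this]

/-- The numbering in which the odd slices come first. -/
noncomputable def oddEven (m : ℕ) : Fin m ⊕ Fin m ≃ Fin (2 * m) :=
  Equiv.ofBijective (Sum.elim (fun i => ⟨2 * i + 1, by omega⟩) (fun i => ⟨2 * i, by omega⟩)) <| by
    rw [Fintype.bijective_iff_injective_and_card]
    refine ⟨?_, by simp; omega⟩
    rintro (i | i) (j | j) h <;> simp only [Sum.elim_inl, Sum.elim_inr, Fin.mk.injEq] at h
    · exact congrArg _ (Fin.ext (by omega))
    · omega
    · omega
    · exact congrArg _ (Fin.ext (by omega))

/-- The durations of the odd and of the even slices together. -/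
noncomputable def joinDurations (m : ℕ) :
    (Fin m → ℝ) × (Fin m → ℝ) ≃ᵐ (Fin (2 * m) → ℝ) :=
  (MeasurableEquiv.sumPiEquivProdPi fun _ : Fin m ⊕ Fin m => ℝ).symm.trans
    (MeasurableEquiv.piCongrLeft (fun _ => ℝ) (oddEven m))

lemma measurePreserving_joinDurations (m : ℕ) :
    MeasurePreserving (joinDurations m) volume volume :=
  (volume_measurePreserving_piCongrLeft (fun _ => ℝ) (oddEven m)).comp
    (volume_measurePreserving_sumPiEquivProdPi_symm fun _ : Fin m ⊕ Fin m => ℝ)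

lemma joinDurations_oddEven {m : ℕ} (p : (Fin m → ℝ) × (Fin m → ℝ)) (x : Fin m ⊕ Fin m) :
    joinDurations m p (oddEven m x) = Sum.elim p.1 p.2 x := by
  refine (Equiv.piCongrLeft_apply_apply (fun _ => ℝ) (oddEven m) _ x).trans ?_
  cases x <;> rfl

lemma joinDurations_mem_simplex {m : ℕ} {y : ℝ} {p : (Fin m → ℝ) × (Fin m → ℝ)} :
    joinDurations m p ∈ simplex (2 * m) y ↔
      p.1 ∈ simplex m y ∧ p.2 ∈ simplex m (y - ∑ i, p.1 i) := by
  simp only [simplex, mem_ofPred_eq]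
  rw [← (oddEven m).forall_congr_right, ← (oddEven m).sum_comp, Fintype.sum_sum_type]
  simp only [joinDurations_oddEven, Sum.forall, Sum.elim_inl, Sum.elim_inr]
  constructor
  · rintro ⟨⟨h1, h2⟩, h3⟩
    have := Finset.sum_nonneg fun j (_ : j ∈ Finset.univ) => h2 j
    exact ⟨⟨h1, by linarith⟩, h2, by linarith⟩
  · rintro ⟨⟨h1, h2⟩, h3, h4⟩
    exact ⟨⟨h1, h3⟩, by linarith⟩

/-- The weight of the durations `s` of the odd slices, when the durations of the even slices
have been integrated out. -/
noncomputable def durationWeight (m : ℕ) (τ : ℝ) (s : Fin m → ℝ) : ℝ :=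
  (simplex m τ).indicator (fun s => (τ - ∑ i, s i) ^ m / m.factorial) s

lemma measurable_durationWeight (m : ℕ) (τ : ℝ) : Measurable (durationWeight m τ) :=
  Measurable.indicator (by fun_prop) (measurableSet_simplex m τ)

lemma durationWeight_nonneg (m : ℕ) (τ : ℝ) (s : Fin m → ℝ) : 0 ≤ durationWeight m τ s :=
  indicator_nonneg (fun _ hs => div_nonneg (pow_nonneg (sub_nonneg.mpr hs.2) _)
    (Nat.cast_nonneg _)) s

lemma durationWeight_le (m : ℕ) {τ : ℝ} (s : Fin m → ℝ) (hτ : 0 ≤ τ) :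
    durationWeight m τ s ≤ τ ^ m / m.factorial := by
  unfold durationWeight
  by_cases hs : s ∈ simplex m τ
  · rw [indicator_of_mem hs]
    have h0 : 0 ≤ ∑ i, s i := Finset.sum_nonneg fun j _ => hs.1 j
    have h1 : 0 ≤ τ - ∑ i, s i := sub_nonneg.mpr hs.2
    gcongr
    linarith
  · rw [indicator_of_notMem hs]
    positivity

/-- The durations of the even slices do not occur in the integrand. The last slice 2m is an even
one, and its duration is the one eliminated by the delta function; the m other even durations fill a
simplex of size τ - Σ s, whose volume is the weight. -/
lemma timeIntegral_eq {m : ℕ} {γ : ℕ → ℂ} {θ : Fin m → ℝ} (h0 : ∀ i ≤ m, γ (2 * i) = 0)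
    (h1 : ∀ i : Fin m, γ (2 * i + 1) = θ i) (τ : ℝ) :
    timeIntegral (2 * m) γ τ = ∫ s : Fin m → ℝ, (durationWeight m τ s : ℂ) *
      Complex.exp (-(Complex.I * ((∑ i, s i * θ i : ℝ) : ℂ))) := by
  have hmeas := measurableSet_simplex (2 * m) τ
  have hint : ∀ r : Fin (2 * m) → ℝ, (∏ j : Fin (2 * m), Complex.exp (-(Complex.I * (r j : ℂ) *
      γ j))) * Complex.exp (-(Complex.I * ((τ - ∑ j, r j : ℝ) : ℂ) * γ (2 * m))) =
      Complex.exp (-(Complex.I *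
        ((∑ i, r (oddEven m (Sum.inl i)) * θ i : ℝ) : ℂ))) := by
    intro r
    rw [h0 m le_rfl, mul_zero, neg_zero, Complex.exp_zero, mul_one, ← Complex.exp_sum,
      ← (oddEven m).sum_comp, Fintype.sum_sum_type]
    congr 1
    have h2 : ∀ i : Fin m, γ (oddEven m (Sum.inr i)) = 0 := fun i => h0 i i.2.le
    have h3 : ∀ i : Fin m, γ (oddEven m (Sum.inl i)) = θ i := fun i => h1 i
    simp only [h2, h3, mul_zero, neg_zero, Finset.sum_const_zero, add_zero]
    push_cast
    rw [Finset.mul_sum, ← Finset.sum_neg_distrib]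
    exact Finset.sum_congr rfl fun i _ => by ring
  unfold timeIntegral
  simp only [hint]
  change ∫ r in simplex (2 * m) τ, _ = _
  rw [← integral_indicator hmeas]
  set F : (Fin (2 * m) → ℝ) → ℂ := (simplex (2 * m) τ).indicator fun r => Complex.exp
    (-(Complex.I * ((∑ i, r (oddEven m (Sum.inl i)) * θ i : ℝ) : ℂ))) with hF
  have hFi : Integrable F := by
    rw [hF, integrable_indicator_iff hmeas]
    have hcont : Continuous fun r : Fin (2 * m) → ℝ => Complex.exp
      (-(Complex.I * ((∑ i, r (oddEven m (Sum.inl i)) * θ i : ℝ) : ℂ))) := by fun_prop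
    refine Measure.integrableOn_of_bounded (M := 1) (volume_simplex_lt_top _ _).ne
      hcont.aestronglyMeasurable (Eventually.of_forall fun r => ?_)
    rw [← mul_neg, ← Complex.ofReal_neg, mul_comm, Complex.norm_exp_ofReal_mul_I]
  have hpres := measurePreserving_joinDurations m
  rw [← hpres.integral_comp' F]
  have h2 := integral_prod (μ := (volume : Measure (Fin m → ℝ)))
    (ν := (volume : Measure (Fin m → ℝ))) (fun p => F (joinDurations m p))
    ((hpres.integrable_comp_emb (joinDurations m).measurableEmbedding).mpr hFi)
  refine h2.trans (integral_congr_ae (Eventually.of_forall fun s => ?_))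
  beta_reduce
  have h3 : ∀ u, F (joinDurations m (s, u)) = (simplex m τ).indicator (fun s => Complex.exp
      (-(Complex.I * ((∑ i, s i * θ i : ℝ) : ℂ)))) s *
        (simplex m (τ - ∑ i, s i)).indicator 1 u := by
    intro u
    by_cases h : joinDurations m (s, u) ∈ simplex (2 * m) τ
    · obtain ⟨h4, h5⟩ := joinDurations_mem_simplex.mp h
      rw [hF, indicator_of_mem h, indicator_of_mem h4, indicator_of_mem h5]
      simp only [joinDurations_oddEven, Sum.elim_inl, Pi.one_apply, mul_one]
    · rw [hF, indicator_of_notMem h]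
      rcases not_and_or.mp (fun h' => h (joinDurations_mem_simplex.mpr h')) with h' | h'
      · rw [indicator_of_notMem h', zero_mul]
      · rw [indicator_of_notMem h', mul_zero]
  simp only [h3]
  have h4 : ∫ u : Fin m → ℝ, (simplex m (τ - ∑ i, s i)).indicator (1 : (Fin m → ℝ) → ℂ) u =
      (volume.real (simplex m (τ - ∑ i, s i)) : ℂ) := by
    rw [integral_indicator (measurableSet_simplex _ _)]
    simp
  rw [integral_const_mul, h4, durationWeight]
  by_cases hs : s ∈ simplex m τ
  · rw [indicator_of_mem hs, indicator_of_mem hs, Measure.real,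
      volume_simplex m (sub_nonneg.mpr hs.2), ENNReal.toReal_ofReal (div_nonneg
        (pow_nonneg (sub_nonneg.mpr hs.2) _) (Nat.cast_nonneg _)), mul_comm]
  · rw [indicator_of_notMem hs, indicator_of_notMem hs]
    simp

end TimeIntegral

/-! ### The amplitude of a leading graph as an integral over durations -/

section Amplitude

variable {d : ℕ}

lemma length_vertices {G : Type*} [Add G] (ℓ : List ℕ) (k : ℕ → G) :
    (vertices ℓ k).length = ℓ.length := by
  induction ℓ generalizing k with
  | nil => rfl
  | cons p ℓ ih => simp [vertices, ih]

/-- Consecutive terms cancel in pairs, so the sum of a tail is zero if the tail starts with a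
complete pair, and otherwise it is the unpaired first term. -/
lemma sum_drop_of_cancel {α : Type*} (f : α → ℝ) (x : α) {m : ℕ} {l : List α}
    (hl : l.length = 2 * m)
    (h : ∀ i < m, f (l.getD (2 * i) x) + f (l.getD (2 * i + 1) x) = 0) :
    (∀ i ≤ m, ((l.drop (2 * i)).map f).sum = 0) ∧
      ∀ i < m, ((l.drop (2 * i + 1)).map f).sum = f (l.getD (2 * i + 1) x) := by
  induction m generalizing l with
  | zero =>
    have : l = [] := List.length_eq_zero_iff.mp hl
    simp [this]
  | succ m ih =>
    match l, hl with
    | a :: b :: l, hl =>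
      have hl' : l.length = 2 * m := by simp at hl; omega
      obtain ⟨h1, h2⟩ := ih hl' fun i hi => h (i + 1) (by omega)
      have h3 := h1 0 (Nat.zero_le _)
      have h4 : f a + f b = 0 := h 0 (Nat.succ_pos _)
      simp only [mul_zero, List.drop_zero] at h3
      refine ⟨fun i hi => ?_, fun i hi => ?_⟩
      · cases i with
        | zero => simp [h3, h4]
        | succ i => exact h1 i (by omega)
      · cases i with
        | zero => simp [h3]
        | succ i => exact h2 i (by omega)

/-- The equilibrium weights of the pairs of a graph with the history `ℓ`. -/
noncomputable def equilibriumWeights (T : ℝ) (ω : UnitAddTorus (Fin d) → ℝ) (ℓ : List ℕ)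
    (A : ℕ × ℕ) (k : UnitAddTorus (Fin d)) : ℂ :=
  (W0s T ω k (parity ℓ A.1) : ℂ)

lemma W0_denom_pos (T : ℝ) (ω : UnitAddTorus (Fin d) → ℝ) (k : UnitAddTorus (Fin d)) :
    0 < Real.exp (1 / T * ω k) + 1 := by positivity

lemma continuous_W0 (T : ℝ) {ω : UnitAddTorus (Fin d) → ℝ} (hω : Continuous ω) :
    Continuous (W0 T ω) := by
  unfold W0
  refine continuous_const.div (by fun_prop) fun k => (W0_denom_pos T ω k).ne'

lemma continuous_equilibriumWeights (T : ℝ) {ω : UnitAddTorus (Fin d) → ℝ} (hω : Continuous ω)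
    (ℓ : List ℕ) (A : ℕ × ℕ) : Continuous (equilibriumWeights T ω ℓ A) := by
  have := continuous_W0 T hω
  unfold equilibriumWeights W0s
  split_ifs <;> fun_prop

lemma integrable_durationWeight (m : ℕ) {τ : ℝ} (hτ : 0 ≤ τ) : Integrable (durationWeight m τ) := by
  have h : durationWeight m τ = (simplex m τ).indicator (durationWeight m τ) := by
    change (simplex m τ).indicator _ = (simplex m τ).indicator ((simplex m τ).indicator _)
    rw [indicator_indicator, inter_self]
  rw [h, integrable_indicator_iff (measurableSet_simplex m τ)]
  refine Measure.integrableOn_of_bounded (M := τ ^ m / m.factorial) (volume_simplex_lt_top _ _).ne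
    (measurable_durationWeight m τ).aestronglyMeasurable (Eventually.of_forall fun r => ?_)
  rw [Real.norm_of_nonneg (durationWeight_nonneg _ _ _)]
  exact durationWeight_le m r hτ

variable {V : (Fin d → ℤ) → ℝ} {w : UnitAddTorus (Fin d) → ℝ}

/-- The factor (-iλ)^{2m} is (-1)^m λ^{2m}, the parity condition on the pairs holds in a leading
graph, and the integrals over momenta and durations are exchanged. The exchange is justified because
the durations range over a bounded set, where the integrand is bounded. -/
lemma amplitude_eq (T : ℝ) {ω : UnitAddTorus (Fin d) → ℝ} (hω : Continuous ω) (hV : Summable V)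
    (hw : Continuous w) (hw' : ∀ k, w (-k) = w k) {m : ℕ} {G : PairedGraph}
    (hG : IsLeading d m G) {κ : ℕ → ℝ} (hκ : ∀ n ≤ 2 * m, κ n = 0) (lam : ℝ)
    {φ : UnitAddTorus (Fin d) → ℂ} (hφ : Measurable φ) (hφ' : ∃ B, ∀ k, ‖φ k‖ ≤ B) {τ : ℝ}
    (hτ : 0 ≤ τ) :
    amplitude T ω V w κ lam φ τ G = (-1) ^ m * (lam : ℂ) ^ (2 * m) * (pairingSign G.2 : ℂ) *
      ∫ s : Fin m → ℝ, (durationWeight m τ s : ℂ) *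
        momentumIntegral V w φ G (equilibriumWeights T ω G.1) s := by
  have hh := continuous_equilibriumWeights T hω G.1
  have hpow : (-Complex.I * (lam : ℂ)) ^ G.1.length = (-1) ^ m * (lam : ℂ) ^ (2 * m) := by
    rw [hG.length, mul_pow, pow_mul, neg_sq, Complex.I_sq]
  have hint : ∀ q : G.2 → UnitAddTorus (Fin d),
      (let k := initialMomenta G.2 q
      let vs := vertices G.1 k
      φ (topMomentum G.1 k) *
        (vs.map fun v => (((v.2 : ℝ) * interaction V v : ℝ) : ℂ)).prod *
        (∏ A : G.2, if parity G.1 A.1.1 = -parity G.1 A.1.2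
          then (W0s T ω (k A.1.1) (parity G.1 A.1.1) : ℂ) else 0) *
        timeIntegral G.1.length
          (fun j => ((((vs.drop j).map (phase w)).sum : ℝ) : ℂ) -
            Complex.I * (κ (G.1.length - j) : ℂ)) τ) =
      ∫ s : Fin m → ℝ, (durationWeight m τ s : ℂ) *
        (graphIntegrand V w φ G.1 s (initialMomenta G.2 q) *
          ∏ A ∈ G.2, equilibriumWeights T ω G.1 A (initialMomenta G.2 q A.1)) := by
    intro q
    have hk := hG.pairing.admissible_initialMomenta q
    set k := initialMomenta G.2 q
    have hprod : (∏ A : G.2, if parity G.1 A.1.1 = -parity G.1 A.1.2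
        then (W0s T ω (k A.1.1) (parity G.1 A.1.1) : ℂ) else 0) =
        ∏ A ∈ G.2, equilibriumWeights T ω G.1 A (k A.1) := by
      rw [← Finset.prod_coe_sort G.2 fun A => equilibriumWeights T ω G.1 A (k A.1)]
      refine Finset.prod_congr rfl fun A _ => ?_
      rw [if_pos (by rw [hG.parity_snd A.1 A.2, neg_neg])]
      rfl
    obtain ⟨h0, h1⟩ := sum_drop_of_cancel (phase w) default
      ((length_vertices G.1 k).trans hG.length) (hG.phase_add w hw' k hk)
    simp only
    rw [hprod, hG.length, timeIntegral_eq
      (θ := fun i => phase w ((vertices G.1 k).getD (2 * i + 1) default))]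
    · rw [← integral_const_mul]
      refine integral_congr_ae (Eventually.of_forall fun s => ?_)
      simp only [graphIntegrand, vertexProd, totalPhase]
      ring
    · intro i hi
      rw [h0 i hi, hκ _ (by omega)]
      simp
    · intro i
      rw [h1 i i.2, hκ _ (by omega)]
      simp
  obtain ⟨B, hB⟩ := exists_norm_weightedIntegrand_le hV hφ' G hh
  unfold amplitude
  rw [hpow]
  simp only [hint]
  rw [integral_integral_swap]
  · congr 1
    refine integral_congr_ae (Eventually.of_forall fun s => ?_)
    beta_reduce
    rw [integral_const_mul]
    rfl
  · have hmeas : Measurable fun p : (G.2 → UnitAddTorus (Fin d)) × (Fin m → ℝ) =>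
        (durationWeight m τ p.2 : ℂ) * (graphIntegrand V w φ G.1 p.2 (initialMomenta G.2 p.1) *
          ∏ A ∈ G.2, equilibriumWeights T ω G.1 A (initialMomenta G.2 p.1 A.1)) := by
      have h1 := (measurable_graphIntegrand_uncurry hV hw hφ (m := m) G.1).comp
        (measurable_snd.prodMk ((continuous_initialMomenta (d := d) G.2).measurable.comp
          measurable_fst) : Measurable fun p : (G.2 → UnitAddTorus (Fin d)) × (Fin m → ℝ) =>
            (p.2, initialMomenta G.2 p.1))
      have h2 := ((continuous_weights (S := G.2) hh).comp
        ((continuous_initialMomenta (d := d) G.2).comp continuous_fst) :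
          Continuous fun p : (G.2 → UnitAddTorus (Fin d)) × (Fin m → ℝ) => _).measurable
      exact (Complex.measurable_ofReal.comp
        ((measurable_durationWeight m τ).comp measurable_snd)).mul (h1.mul h2)
    refine Integrable.mono' (g := fun p : (G.2 → UnitAddTorus (Fin d)) × (Fin m → ℝ) =>
      durationWeight m τ p.2 * B) (((integrable_durationWeight m hτ).comp_snd _).mul_const B)
      hmeas.aestronglyMeasurable (Eventually.of_forall fun p => ?_)
    simp only [Function.uncurry]
    rw [norm_mul, Complex.norm_real, Real.norm_of_nonneg (durationWeight_nonneg _ _ _)]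
    exact mul_le_mul_of_nonneg_left (hB w m p.2 _) (durationWeight_nonneg _ _ _)

end Amplitude

/-! ### The limit of the amplitude of a leading graph -/

section Parameters

lemma tendsto_japanese_atTop : Tendsto japanese atTop atTop :=
  tendsto_atTop_mono (fun x : ℝ => by
    unfold japanese
    exact Real.le_sqrt_of_sq_le (by linarith) : ∀ x : ℝ, x ≤ japanese x) tendsto_id

/-- For fixed n this is the divergence of N₀: the quotient |ln λ| / ln⟨ln λ⟩ tends to infinity as λ
→ 0, and n < N₀/2 holds as soon as N₀ ≥ 2n + 1. -/
lemma eventually_kappa_eq_zero {γ δ : ℝ} (hγ : 0 < γ) (hδ : 0 < δ) (n : ℕ) :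
    ∀ᶠ lam in 𝓝[>] (0 : ℝ), ∀ j ≤ n, kappa γ δ lam j = 0 := by
  have ha : 0 < a0 γ δ := by unfold a0; positivity
  have hM : (0 : ℝ) < 2 * n + 1 := by positivity
  have h1 : ∀ᶠ x in atTop, (2 * n + 1) * Real.log (japanese x) ≤ a0 γ δ * x := by
    filter_upwards [(Real.isLittleO_log_id_atTop.comp_tendsto tendsto_japanese_atTop).def
      (c := a0 γ δ / (2 * (2 * n + 1))) (by positivity), eventually_ge_atTop 1] with x hx hx1
    -- The factor 2 is compensated by the factor 2 in the constant that was chosen for the little-o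
    -- estimate.
    have h2 : japanese x ≤ 2 * x := by
      unfold japanese
      exact Real.sqrt_le_iff.mpr ⟨by linarith, by nlinarith⟩
    simp only [Function.comp, id, Real.norm_of_nonneg (japanese_pos x).le] at hx
    have h3 := (le_abs_self _).trans hx
    calc (2 * n + 1) * Real.log (japanese x)
        ≤ (2 * n + 1) * (a0 γ δ / (2 * (2 * n + 1)) * (2 * x)) := by
          gcongr
          exact h3.trans (by gcongr)
      _ = a0 γ δ * x := by field_simp
  have h2 : Tendsto (fun lam => |Real.log lam|) (𝓝[>] (0 : ℝ)) atTop :=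
    tendsto_abs_atBot_atTop.comp Real.tendsto_log_nhdsGT_zero
  filter_upwards [h2.eventually h1, h2.eventually (eventually_ge_atTop 1)] with lam hx hx1 j hj
  have h3 : japanese |Real.log lam| = japanese (Real.log lam) := by simp [japanese]
  rw [h3] at hx
  have h4 : 0 < Real.log (japanese (Real.log lam)) := by
    refine Real.log_pos ?_
    rw [← h3]
    unfold japanese
    exact Real.lt_sqrt_of_sq_lt (by nlinarith)
  have h5 : 2 * n + 1 ≤ N0 γ δ lam := by
    refine (Nat.le_floor ?_).trans (le_max_right _ _)
    rw [le_div_iff₀ h4]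
    push_cast
    exact hx
  rw [kappa, if_pos]
  have h6 : ((2 * n + 1 : ℕ) : ℝ) ≤ N0 γ δ lam := Nat.cast_le.mpr h5
  have h7 : (j : ℝ) ≤ n := Nat.cast_le.mpr hj
  push_cast at h6
  linarith

/-- For fixed s ≥ 0 the scaled weight is (t - λ² Σ s)^m / m! as soon as λ² Σ s ≤ t; the constraint
on the durations disappears in the limit. -/
lemma tendsto_durationWeight (m : ℕ) {t : ℝ} (ht : 0 < t) (s : Fin m → ℝ) :
    Tendsto (fun lam : ℝ => lam ^ (2 * m) * durationWeight m (t * lam ^ (-2 : ℤ)) s) (𝓝[>] 0)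
      (𝓝 ((Ici 0).indicator (fun _ => t ^ m / m.factorial) s)) := by
  by_cases hs : s ∈ Ici 0
  · rw [indicator_of_mem hs]
    have h1 : Tendsto (fun lam : ℝ => (t - lam ^ 2 * ∑ i, s i) ^ m / m.factorial) (𝓝[>] 0)
        (𝓝 (t ^ m / m.factorial)) := by
      have : Continuous fun lam : ℝ => (t - lam ^ 2 * ∑ i, s i) ^ m / (m.factorial : ℝ) := by
        fun_prop
      simpa using (this.tendsto 0).mono_left nhdsWithin_le_nhds
    refine h1.congr' ?_
    have h2 : Tendsto (fun lam : ℝ => lam ^ 2 * ∑ i, s i) (𝓝[>] 0) (𝓝 0) := by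
      have : Continuous fun lam : ℝ => lam ^ 2 * ∑ i, s i := by fun_prop
      simpa using (this.tendsto 0).mono_left nhdsWithin_le_nhds
    filter_upwards [h2.eventually_lt_const ht, self_mem_nhdsWithin] with lam h3 h4
    have h5 : lam ≠ 0 := (mem_Ioi.mp h4).ne'
    have h6 : lam ^ 2 * (t * lam ^ (-2 : ℤ)) = t := by
      rw [zpow_neg]
      field_simp
    have h7 : s ∈ simplex m (t * lam ^ (-2 : ℤ)) := by
      refine ⟨hs, le_of_mul_le_mul_left ?_ (pow_pos (mem_Ioi.mp h4) 2)⟩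
      rw [h6]
      exact h3.le
    rw [durationWeight, indicator_of_mem h7, pow_mul, ← mul_div_assoc, ← mul_pow, mul_sub, h6]
  · rw [indicator_of_notMem hs]
    refine tendsto_const_nhds.congr fun lam => ?_
    rw [durationWeight, indicator_of_notMem fun h => hs h.1, mul_zero]

lemma durationWeight_scaled_le (m : ℕ) {t lam : ℝ} (ht : 0 < t) (hlam : 0 < lam)
    (s : Fin m → ℝ) :
    lam ^ (2 * m) * durationWeight m (t * lam ^ (-2 : ℤ)) s ≤ t ^ m / m.factorial := by
  have h6 : lam ^ 2 * (t * lam ^ (-2 : ℤ)) = t := by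
    rw [zpow_neg]
    field_simp
  calc lam ^ (2 * m) * durationWeight m (t * lam ^ (-2 : ℤ)) s
      ≤ lam ^ (2 * m) * ((t * lam ^ (-2 : ℤ)) ^ m / m.factorial) := by
        gcongr
        exact durationWeight_le m s (by positivity)
    _ = t ^ m / m.factorial := by rw [pow_mul, ← mul_div_assoc, ← mul_pow, h6]

end Parameters

/-! ### Dominated convergence for the amplitudes -/

section Limit

variable {d : ℕ} {V : (Fin d → ℤ) → ℝ} {ι : Type*} {l : Filter ι} [l.IsCountablyGenerated]

lemma tendsto_momentumIntegral (hV : Summable V) {w : ι → UnitAddTorus (Fin d) → ℝ}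
    {ω : UnitAddTorus (Fin d) → ℝ} (hw : ∀ᶠ i in l, Continuous (w i))
    (hlim : ∀ k, Tendsto (fun i => w i k) l (𝓝 (ω k))) {φ : UnitAddTorus (Fin d) → ℂ}
    (hφ : Measurable φ) (hφ' : ∃ B, ∀ k, ‖φ k‖ ≤ B) (G : PairedGraph)
    {h : ℕ × ℕ → UnitAddTorus (Fin d) → ℂ} (hh : ∀ A, Continuous (h A)) {m : ℕ} (s : Fin m → ℝ) :
    Tendsto (fun i => momentumIntegral V (w i) φ G h s) l (𝓝 (momentumIntegral V ω φ G h s)) := by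
  obtain ⟨B, hB⟩ := exists_norm_weightedIntegrand_le hV hφ' G hh
  refine tendsto_integral_filter_of_dominated_convergence (fun _ => B) ?_
    (Eventually.of_forall fun i => Eventually.of_forall fun q => hB _ _ _ _) (integrable_const _)
    (Eventually.of_forall fun q => ?_)
  · filter_upwards [hw] with i hi
    exact ((measurable_weightedIntegrand hV hi hφ G hh s).comp
      (continuous_initialMomenta G.2).measurable).aestronglyMeasurable
  · have h1 : ∀ v, Tendsto (fun i => phase (w i) v) l (𝓝 (phase ω v)) := fun v =>
      ((hlim _).sub (hlim _)).add (((hlim _).sub (hlim _)).const_mul _)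
    have h2 : Tendsto (fun i => totalPhase (w i) (vertices G.1 (initialMomenta G.2 q)) s) l
        (𝓝 (totalPhase ω (vertices G.1 (initialMomenta G.2 q)) s)) :=
      tendsto_finsetSum _ fun j _ => (h1 _).const_mul _
    have h3 : Continuous fun x : ℝ => Complex.exp (-(Complex.I * (x : ℂ))) := by fun_prop
    exact (((h3.tendsto _).comp h2).const_mul _).mul_const _

lemma measurable_momentumIntegral (hV : Summable V) {w : UnitAddTorus (Fin d) → ℝ}
    (hw : Continuous w) {φ : UnitAddTorus (Fin d) → ℂ} (hφ : Measurable φ) (G : PairedGraph)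
    {h : ℕ × ℕ → UnitAddTorus (Fin d) → ℂ} (hh : ∀ A, Measurable (h A)) {m : ℕ} :
    Measurable fun s : Fin m → ℝ => momentumIntegral V w φ G h s := by
  have h1 := (measurable_graphIntegrand_uncurry hV hw hφ (m := m) G.1).comp
    (measurable_fst.prodMk ((continuous_initialMomenta (d := d) G.2).measurable.comp
      measurable_snd) : Measurable fun p : (Fin m → ℝ) × (G.2 → UnitAddTorus (Fin d)) =>
        (p.1, initialMomenta G.2 p.2))
  have h2 : Measurable fun p : (Fin m → ℝ) × (G.2 → UnitAddTorus (Fin d)) =>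
      ∏ A ∈ G.2, h A (initialMomenta G.2 p.2 A.1) :=
    Finset.measurable_prod _ fun A _ => (hh A).comp ((measurable_pi_apply A.1).comp
      ((continuous_initialMomenta (d := d) G.2).measurable.comp measurable_snd))
  exact (StronglyMeasurable.integral_prod_right
    (f := fun (s : Fin m → ℝ) (q : G.2 → UnitAddTorus (Fin d)) =>
      graphIntegrand V w φ G.1 s (initialMomenta G.2 q) *
        ∏ A ∈ G.2, h A (initialMomenta G.2 q A.1)) (h1.mul h2).stronglyMeasurable).measurable

/-- Weights without a phase have the oscillation time 0 for every dispersion relation. So B(0, ·) is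
a majorant that does not depend on w, hence neither on λ nor on L. -/
lemma MomentumBound.exists_dominating {C δ : ℝ} {m : ℕ} {G : PairedGraph}
    {B : (ℕ × ℕ → ℝ) × (Fin m → ℝ) → ℝ} (hB : MomentumBound V C δ m G B)
    {φ : UnitAddTorus (Fin d) → ℂ} (hφ : Measurable φ) (hφ' : ∃ B, ∀ k, ‖φ k‖ ≤ B)
    {h : ℕ × ℕ → UnitAddTorus (Fin d) → ℂ} {M : ℕ × ℕ → ℝ} (hh : ∀ P, WienerBound (h P) (M P))
    (hev : ∀ P k, h P (-k) = h P k) : ∃ g : (Fin m → ℝ) → ℝ, Integrable g ∧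
      ∀ w, Dispersive C δ w → ∀ s, ‖momentumIntegral V w φ G h s‖ ≤ g s := by
  obtain ⟨Mφ, hMφ⟩ := hφ'
  obtain ⟨K, hK, hK'⟩ := hB.integral_le
  refine ⟨fun s => Mφ * (∏ P ∈ G.2, M P) * B (0, s), Integrable.const_mul ?_ _,
    fun w hw s => hB.bound w hw φ hφ Mφ hMφ h 0 M (fun P => (hh P).phased w) hev s⟩
  have hc : Continuous fun s => B (0, s) := hB.continuous.comp (by fun_prop)
  refine ⟨hc.aestronglyMeasurable, ?_⟩
  rw [hasFiniteIntegral_iff_ofReal (Eventually.of_forall fun s => hB.nonneg _)]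
  exact (hK' 0).trans_lt hK

/-- The integral over the durations of the odd slices of the momentum integral, with the sign of
the pairing. -/
noncomputable def durationIntegral (V : (Fin d → ℤ) → ℝ) (w : UnitAddTorus (Fin d) → ℝ)
    (φ : UnitAddTorus (Fin d) → ℂ) (m : ℕ) (G : PairedGraph)
    (h : ℕ × ℕ → UnitAddTorus (Fin d) → ℂ) : ℂ :=
  (pairingSign G.2 : ℂ) * ∫ s in Ici (0 : Fin m → ℝ), momentumIntegral V w φ G h s

/-- Dominated convergence in the durations: the scaled weight is at most t^m / m!, the momentum
integrals have a common majorant, and both converge pointwise in s. The filter is left general, so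
that λ and L can be treated together. -/
lemma tendsto_amplitude (T : ℝ) {ω : UnitAddTorus (Fin d) → ℝ} (hV : Summable V)
    (hV' : ∀ x, V (-x) = V x) {C δ : ℝ} (hC : 0 ≤ C) (hδ : 0 < δ) {m : ℕ} {G : PairedGraph}
    (hG : G ∈ leadingGraphs m) {w : ι → UnitAddTorus (Fin d) → ℝ}
    (hw : ∀ᶠ i in l, Dispersive C δ (w i)) (hω : Dispersive C δ ω)
    (hlim : ∀ k, Tendsto (fun i => w i k) l (𝓝 (ω k)))
    {M : ℕ × ℕ → ℝ} (hM : ∀ P, WienerBound (equilibriumWeights T ω G.1 P) (M P))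
    {κ : ι → ℕ → ℝ} (hκ : ∀ᶠ i in l, ∀ n ≤ 2 * m, κ i n = 0) {lam : ι → ℝ}
    (hlam : Tendsto lam l (𝓝[>] 0)) {φ : UnitAddTorus (Fin d) → ℂ}
    (hφ : Measurable φ) (hφ' : ∃ B, ∀ k, ‖φ k‖ ≤ B) {t : ℝ} (ht : 0 < t) :
    Tendsto (fun i => amplitude T ω V (w i) (κ i) (lam i) φ (t * lam i ^ (-2 : ℤ)) G) l
      (𝓝 ((-t : ℂ) ^ m / m.factorial *
        durationIntegral V ω φ m G (equilibriumWeights T ω G.1))) := by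
  have hlead : IsLeading d m G := isLeading_of_mem hG
  have hcont := continuous_equilibriumWeights T hω.continuous G.1
  have hev : ∀ P k, equilibriumWeights T ω G.1 P (-k) = equilibriumWeights T ω G.1 P k := by
    intro P k
    simp only [equilibriumWeights, W0s, W0, hω.even]
  obtain ⟨B, hB⟩ := exists_momentumBound hC hδ hV hV' hG
  obtain ⟨g, hg, hg'⟩ := hB.exists_dominating hφ hφ' hM hev
  have hpos : ∀ᶠ i in l, 0 < lam i := hlam.eventually self_mem_nhdsWithin
  have hlimit : (-t : ℂ) ^ m / m.factorial *
      durationIntegral V ω φ m G (equilibriumWeights T ω G.1) =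
      ((-1) ^ m * (pairingSign G.2 : ℂ)) * ∫ s : Fin m → ℝ,
        (((Ici 0).indicator (fun _ => t ^ m / m.factorial) s : ℝ) : ℂ) *
          momentumIntegral V ω φ G (equilibriumWeights T ω G.1) s := by
    have h1 : ∀ s : Fin m → ℝ, (((Ici 0).indicator (fun _ => t ^ m / m.factorial) s : ℝ) : ℂ) *
        momentumIntegral V ω φ G (equilibriumWeights T ω G.1) s = ((t ^ m / m.factorial : ℝ) : ℂ) *
          (Ici 0).indicator (momentumIntegral V ω φ G (equilibriumWeights T ω G.1)) s := by
      intro s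
      by_cases hs : s ∈ Ici 0
      · rw [indicator_of_mem hs, indicator_of_mem hs]
      · rw [indicator_of_notMem hs, indicator_of_notMem hs]
        simp
    simp only [h1]
    rw [integral_const_mul, integral_indicator measurableSet_Ici, durationIntegral,
      neg_pow (t : ℂ)]
    push_cast
    ring
  rw [hlimit]
  have heq : ∀ᶠ i in l, ((-1) ^ m * (pairingSign G.2 : ℂ)) * ∫ s : Fin m → ℝ,
      ((lam i ^ (2 * m) * durationWeight m (t * lam i ^ (-2 : ℤ)) s : ℝ) : ℂ) *
        momentumIntegral V (w i) φ G (equilibriumWeights T ω G.1) s =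
      amplitude T ω V (w i) (κ i) (lam i) φ (t * lam i ^ (-2 : ℤ)) G := by
    filter_upwards [hw, hκ, hpos] with i hwi hκi hi
    rw [amplitude_eq T hω.continuous hV hwi.continuous hwi.even hlead hκi (lam i) hφ hφ'
      (by positivity)]
    simp only [Complex.ofReal_mul, mul_assoc, integral_const_mul]
    push_cast
    ring
  refine Tendsto.congr' heq (Tendsto.const_mul _ ?_)
  refine tendsto_integral_filter_of_dominated_convergence
    (fun s => t ^ m / m.factorial * g s) ?_ ?_ (hg.const_mul _)
    (Eventually.of_forall fun s => ?_)
  · filter_upwards [hw] with i hwi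
    exact ((Complex.measurable_ofReal.comp ((measurable_durationWeight m _).const_mul _)).mul
      (measurable_momentumIntegral hV hwi.continuous hφ G
        fun A => (hcont A).measurable)).aestronglyMeasurable
  · filter_upwards [hw, hpos] with i hwi hi
    refine Eventually.of_forall fun s => ?_
    rw [norm_mul, Complex.norm_real, Real.norm_of_nonneg
      (mul_nonneg (by positivity) (durationWeight_nonneg _ _ _))]
    exact mul_le_mul (durationWeight_scaled_le m ht hi s) (hg' _ hwi s) (norm_nonneg _)
      (by positivity)
  · exact ((Complex.continuous_ofReal.tendsto _).comp
      ((tendsto_durationWeight m ht s).comp hlam)).mul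
        (tendsto_momentumIntegral hV (hw.mono fun i hi => hi.continuous) hlim hφ hφ' G hcont s)

end Limit

/-! ### Collisions of the equilibrium and the decay coefficient -/

section Collisions

variable {d : ℕ} {V : (Fin d → ℤ) → ℝ} {ω : UnitAddTorus (Fin d) → ℝ} {T : ℝ}

lemma continuous_torusIntegral {X Y : Type*} [TopologicalSpace X] [FirstCountableTopology X]
    [LocallyCompactSpace X] [TopologicalSpace Y] [CompactSpace Y] [SecondCountableTopology Y]
    [MeasurableSpace Y] [OpensMeasurableSpace Y] {μ : Measure Y} [IsFiniteMeasure μ]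
    {F : X → Y → ℂ} (hF : Continuous (Function.uncurry F)) :
    Continuous fun x => ∫ p, F x p ∂μ := by
  have := continuous_parametric_integral_of_continuous (μ := μ) hF isCompact_univ
  simpa only [Measure.restrict_univ] using this

lemma intervalIntegral_torus_swap {Y : Type*} [TopologicalSpace Y] [CompactSpace Y]
    [SecondCountableTopology Y] [MeasurableSpace Y] [OpensMeasurableSpace Y] {μ : Measure Y}
    [IsFiniteMeasure μ] {F : ℝ → Y → ℂ} (hF : Continuous (Function.uncurry F)) (a b : ℝ) :
    ∫ s in a..b, ∫ p, F s p ∂μ = ∫ p, (∫ s in a..b, F s p) ∂μ := by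
  refine intervalIntegral_integral_swap ?_
  obtain ⟨B, hB⟩ := (isCompact_uIcc (a := a) (b := b)).prod (isCompact_univ (X := Y))
    |>.exists_bound_of_continuousOn hF.continuousOn
  have : IsFiniteMeasure ((volume : Measure ℝ).restrict (uIoc a b)) := by
    rw [uIoc]
    infer_instance
  have h1 : ∀ᵐ p ∂(volume.restrict (uIoc a b)).prod μ, p.1 ∈ uIoc a b := by
    rw [Measure.ae_prod_iff_ae_ae (measurable_fst measurableSet_uIoc)]
    exact (ae_restrict_mem measurableSet_uIoc).mono fun s hs => Eventually.of_forall fun _ => hs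
  refine Integrable.of_bound hF.aestronglyMeasurable B (h1.mono fun p hp => hB p ⟨?_, mem_univ _⟩)
  exact uIoc_subset_uIcc hp

/-- Smooth functions on the torus. -/
abbrev TorusSmooth (f : UnitAddTorus (Fin d) → ℝ) : Prop := ContDiff ℝ (⊤ : ℕ∞) (f ∘ torusMk)

/-- The equilibrium distribution of an edge of parity `σ`. -/
noncomputable def fermi (T : ℝ) (ω : UnitAddTorus (Fin d) → ℝ) (σ : ℤ) (k : UnitAddTorus (Fin d)) :
    ℂ :=
  (W0s T ω k σ : ℂ)

lemma continuous_fermi (T : ℝ) (hω : Continuous ω) (σ : ℤ) : Continuous (fermi T ω σ) := by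
  have := continuous_W0 T hω
  unfold fermi W0s
  split_ifs <;> fun_prop

lemma fermi_neg (hω : ∀ k, ω (-k) = ω k) (σ : ℤ) (k : UnitAddTorus (Fin d)) :
    fermi T ω σ (-k) = fermi T ω σ k := by simp only [fermi, W0s, W0, hω]

/-- The exponential factor is needed for detailed balance, where real exponentials of the energy
defect are distributed over the weights. -/
lemma exists_wienerBound_fermi_mul_exp (hω : TorusSmooth ω) (T : ℝ) (σ : ℤ) (u : ℝ) :
    ∃ M, WienerBound (fun k => fermi T ω σ k * Complex.exp ((u * ω k : ℝ) : ℂ)) M := by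
  refine exists_wienerBound ?_
  have h1 : ContDiff ℝ (⊤ : ℕ∞) fun x => W0 T ω (torusMk (d := d) x) := by
    unfold W0
    refine contDiff_const.div ((Real.contDiff_exp.comp (contDiff_const.mul hω)).add contDiff_const)
      fun x => (W0_denom_pos T ω _).ne'
  have h2 : ContDiff ℝ (⊤ : ℕ∞) fun x => W0s T ω (torusMk (d := d) x) σ := by
    unfold W0s
    split_ifs
    · exact h1
    · exact contDiff_const.sub h1
  have h3 := Complex.ofRealCLM.contDiff.comp
    (h2.mul (Real.contDiff_exp.comp (contDiff_const.mul hω : ContDiff ℝ (⊤ : ℕ∞) fun x =>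
      u * ω (torusMk (d := d) x))))
  have h4 : (fun k => fermi T ω σ k * Complex.exp ((u * ω k : ℝ) : ℂ)) ∘ torusMk =
      Complex.ofRealCLM ∘ fun x => W0s T ω (torusMk x) σ *
        (Real.exp ∘ fun x => u * ω (torusMk x)) x := by
    funext x
    simp [fermi]
  rw [h4]
  exact h3

lemma exists_wienerBound_fermi (hω : TorusSmooth ω) (T : ℝ) (σ : ℤ) :
    ∃ M, WienerBound (fermi T ω σ) M := by
  simpa using exists_wienerBound_fermi_mul_exp hω T σ 0

variable {w : UnitAddTorus (Fin d) → ℝ} {h₂ h₃ h₄ : UnitAddTorus (Fin d) → ℂ}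

lemma integrable_collision (hV : Summable V) (hw : Continuous w) (x : Bool) (τ : ℝ)
    (H₂ : Continuous h₂) (H₃ : Continuous h₃) (H₄ : Continuous h₄) (q : UnitAddTorus (Fin d)) :
    Integrable fun p => collisionKernel V w x τ q p *
      (h₂ p.1 * h₃ p.2 * h₄ (q + p.1 - p.2)) := by
  have hp : Continuous fun p : UnitAddTorus (Fin d) × UnitAddTorus (Fin d) => (τ, q, p) := by
    fun_prop
  have hk := (continuous_collisionKernel hV hw x).comp hp
  simp only [Function.comp_def] at hk
  exact integrable_of_continuous_torus (by fun_prop)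

lemma continuous_collision (hV : Summable V) (hw : Continuous w) (x : Bool)
    (H₂ : Continuous h₂) (H₃ : Continuous h₃) (H₄ : Continuous h₄) :
    Continuous fun z : ℝ × UnitAddTorus (Fin d) => collision V w x z.1 h₂ h₃ h₄ z.2 := by
  have hp : Continuous fun p : (ℝ × UnitAddTorus (Fin d)) × UnitAddTorus (Fin d) ×
    UnitAddTorus (Fin d) => (p.1.1, p.1.2, p.2) := by fun_prop
  have hk := (continuous_collisionKernel hV hw x).comp hp
  have hF : Continuous (Function.uncurry fun (z : ℝ × UnitAddTorus (Fin d))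
      (p : UnitAddTorus (Fin d) × UnitAddTorus (Fin d)) => collisionKernel V w x z.1 z.2 p *
        (h₂ p.1 * h₃ p.2 * h₄ (z.2 + p.1 - p.2))) := by
    refine hk.mul ?_
    fun_prop
  exact continuous_torusIntegral (μ := volume) hF

lemma exists_norm_collision_le {C δ : ℝ} (hC : 0 ≤ C) (hw : Dispersive C δ w) (hV : Summable V)
    (hV' : ∀ x, V (-x) = V x) (x : Bool) (H₂ : ∃ M, WienerBound h₂ M)
    (H₃ : ∃ M, WienerBound h₃ M) (H₄ : ∃ M, WienerBound h₄ M) :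
    ∃ K, ∀ τ q, ‖collision V w x τ h₂ h₃ h₄ q‖ ≤ K * japanese τ ^ (-1 - δ) := by
  obtain ⟨M₂, H₂⟩ := H₂
  obtain ⟨M₃, H₃⟩ := H₃
  obtain ⟨M₄, H₄⟩ := H₄
  refine ⟨potentialMass V * (M₂ * M₃ * M₄) * (C * 6), fun τ q => ?_⟩
  refine ((phasedWiener_collision hC hw hV hV' x τ (H₂.phased w) (H₃.phased w)
    (H₄.phased w)).norm_le q).trans_eq ?_
  simp only [collisionDecay, zero_add, zero_sub, japanese_neg]
  ring

/-- The exchange kernel V̂(k₂ - k₃) V̂(k₂ - k₄), together with its phase, is symmetric under k₃ ↔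
k₄; the squared kernel is not. -/
lemma collision_exchange_swap (hV : Summable V) (hw : Continuous w) (τ : ℝ)
    (H₂ : Continuous h₂) (H₃ : Continuous h₃) (H₄ : Continuous h₄) (q : UnitAddTorus (Fin d)) :
    collision V w true τ h₂ h₃ h₄ q = collision V w true τ h₂ h₄ h₃ q := by
  rw [collision_eq, collision_eq]
  refine (integral_prod _ (integrable_collision hV hw true τ H₂ H₃ H₄ q)).trans
    ((integral_congr_ae (Eventually.of_forall fun k₂ => ?_)).trans
      (integral_prod _ (integrable_collision hV hw true τ H₂ H₄ H₃ q)).symm)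
  simp only
  rw [← integral_sub_left_eq_self (fun k₃ => collisionKernel V w true τ q (k₂, k₃) *
    (h₂ k₂ * h₃ k₃ * h₄ (q + k₂ - k₃))) volume (q + k₂)]
  refine integral_congr_ae (Eventually.of_forall fun k₃ => ?_)
  simp only [collisionKernel, collisionFactor, sub_sub_cancel, if_true]
  have h : w q + w k₂ - w (q + k₂ - k₃) - w k₃ = w q + w k₂ - w k₃ - w (q + k₂ - k₃) := by ring
  rw [h]
  push_cast
  ring

/-- The difference of a squared and an exchange collision. -/
noncomputable def antisymCollision (V : (Fin d → ℤ) → ℝ) (w : UnitAddTorus (Fin d) → ℝ) (τ : ℝ)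
    (h₂ h₃ h₄ : UnitAddTorus (Fin d) → ℂ) (q : UnitAddTorus (Fin d)) : ℂ :=
  collision V w false τ h₂ h₃ h₄ q - collision V w true τ h₂ h₃ h₄ q

/-- The kernel of the difference of a squared and an exchange collision. -/
noncomputable def antisymKernel (V : (Fin d → ℤ) → ℝ) (w : UnitAddTorus (Fin d) → ℝ)
    (τ : ℝ) (q : UnitAddTorus (Fin d)) (p : UnitAddTorus (Fin d) × UnitAddTorus (Fin d)) : ℂ :=
  collisionKernel V w false τ q p - collisionKernel V w true τ q p

lemma continuous_antisymKernel (hV : Summable V) (hw : Continuous w) :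
    Continuous fun p : ℝ × UnitAddTorus (Fin d) × UnitAddTorus (Fin d) × UnitAddTorus (Fin d) =>
      antisymKernel V w p.1 p.2.1 p.2.2 :=
  (continuous_collisionKernel hV hw false).sub (continuous_collisionKernel hV hw true)

lemma antisymKernel_eq (τ : ℝ) (q : UnitAddTorus (Fin d)) (p) : antisymKernel V w τ q p =
    antisymKernel V w 0 q p *
      Complex.exp (Complex.I * τ * ((w q + w p.1 - w p.2 - w (q + p.1 - p.2) : ℝ) : ℂ)) := by
  simp only [antisymKernel, collisionKernel, Complex.ofReal_zero, mul_zero, zero_mul,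
    Complex.exp_zero, mul_one]
  ring

lemma antisymCollision_eq (hV : Summable V) (hw : Continuous w) (τ : ℝ)
    (H₂ : Continuous h₂) (H₃ : Continuous h₃) (H₄ : Continuous h₄) (q : UnitAddTorus (Fin d)) :
    antisymCollision V w τ h₂ h₃ h₄ q =
      ∫ p, antisymKernel V w τ q p * (h₂ p.1 * h₃ p.2 * h₄ (q + p.1 - p.2)) := by
  rw [antisymCollision, collision_eq, collision_eq, ← integral_sub
    (integrable_collision hV hw _ _ H₂ H₃ H₄ q) (integrable_collision hV hw _ _ H₂ H₃ H₄ q)]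
  simp only [antisymKernel, sub_mul]

lemma integrable_antisymKernel (hV : Summable V) (hw : Continuous w) (τ : ℝ)
    (H₂ : Continuous h₂) (H₃ : Continuous h₃) (H₄ : Continuous h₄) (q : UnitAddTorus (Fin d)) :
    Integrable fun p => antisymKernel V w τ q p * (h₂ p.1 * h₃ p.2 * h₄ (q + p.1 - p.2)) := by
  simp only [antisymKernel, sub_mul]
  exact (integrable_collision hV hw _ _ H₂ H₃ H₄ q).sub (integrable_collision hV hw _ _ H₂ H₃ H₄ q)

lemma fermi_neg_one (k : UnitAddTorus (Fin d)) : fermi T ω (-1) k = W0 T ω k := by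
  simp [fermi, W0s]

lemma fermi_one (k : UnitAddTorus (Fin d)) : fermi T ω 1 k = 1 - W0 T ω k := by
  simp [fermi, W0s]

lemma nuIntegrand_eq_integral (k : UnitAddTorus (Fin d)) (τ : ℝ) : nuIntegrand T ω V k τ =
    ∫ p, antisymKernel V ω τ k p * ((W0 T ω p.2 * W0 T ω (k + p.1 - p.2) -
      W0 T ω p.1 * W0 T ω (k + p.1 - p.2) + W0 T ω p.1 * (1 - W0 T ω p.2) : ℝ) : ℂ) := by
  unfold nuIntegrand
  refine integral_congr_ae (Eventually.of_forall fun p => ?_)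
  simp only [antisymKernel, collisionKernel, collisionFactor, Bool.false_eq_true, if_false, if_true]
  push_cast
  ring

lemma nuIntegrand_eq (hV : Summable V) (hω : Continuous ω) (k : UnitAddTorus (Fin d)) (τ : ℝ) :
    nuIntegrand T ω V k τ =
      antisymCollision V ω τ 1 (fermi T ω (-1)) (fermi T ω (-1)) k -
      antisymCollision V ω τ (fermi T ω (-1)) 1 (fermi T ω (-1)) k +
      antisymCollision V ω τ (fermi T ω (-1)) (fermi T ω 1) 1 k := by
  have h1 : Continuous (1 : UnitAddTorus (Fin d) → ℂ) := continuous_const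
  have hm := continuous_fermi T hω (-1)
  have hp := continuous_fermi T hω 1
  have h2 : Integrable fun p => antisymKernel V ω τ k p *
      ((1 : UnitAddTorus (Fin d) → ℂ) p.1 * fermi T ω (-1) p.2 * fermi T ω (-1) (k + p.1 - p.2)) -
      antisymKernel V ω τ k p * (fermi T ω (-1) p.1 * (1 : UnitAddTorus (Fin d) → ℂ) p.2 *
        fermi T ω (-1) (k + p.1 - p.2)) :=
    (integrable_antisymKernel hV hω _ h1 hm hm k).sub
      (integrable_antisymKernel hV hω _ hm h1 hm k)
  rw [antisymCollision_eq hV hω _ h1 hm hm, antisymCollision_eq hV hω _ hm h1 hm,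
    antisymCollision_eq hV hω _ hm hp h1, ← integral_sub
      (integrable_antisymKernel hV hω _ h1 hm hm k) (integrable_antisymKernel hV hω _ hm h1 hm k),
    ← integral_add h2 (integrable_antisymKernel hV hω _ hm hp h1 k),
    nuIntegrand_eq_integral]
  refine integral_congr_ae (Eventually.of_forall fun p => ?_)
  simp only [fermi_neg_one, fermi_one, Pi.one_apply]
  push_cast
  ring

/-- The equilibrium weights of the collision that corresponds to a loss motive. -/
noncomputable def lossFermi (T : ℝ) (ω : UnitAddTorus (Fin d) → ℝ) (i : Fin 6) :
    Fin 3 → UnitAddTorus (Fin d) → ℂ :=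
  lossWeights i (fermi T ω (lossLegParity i).1) (fermi T ω (lossLegParity i).2)

/-- The collision that corresponds to a loss motive in equilibrium. -/
noncomputable def lossCollision (T : ℝ) (ω : UnitAddTorus (Fin d) → ℝ) (V : (Fin d → ℤ) → ℝ)
    (i : Fin 6) (τ : ℝ) : UnitAddTorus (Fin d) → ℂ :=
  collision V ω (lossExchange i) τ (lossFermi T ω i 0) (lossFermi T ω i 1) (lossFermi T ω i 2)

lemma lossFermi_induction {p : (UnitAddTorus (Fin d) → ℂ) → Prop} (h1 : p 1)
    (hp : ∀ σ, p (fermi T ω σ)) (i : Fin 6) (j : Fin 3) : p (lossFermi T ω i j) :=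
  lossWeights_induction h1 (hp _) (hp _) i j

lemma continuous_lossCollision (hV : Summable V) (hω : Continuous ω) (T : ℝ) (i : Fin 6) :
    Continuous fun z : ℝ × UnitAddTorus (Fin d) => lossCollision T ω V i z.1 z.2 := by
  have hs : ∀ j, Continuous (lossFermi T ω i j) :=
    lossFermi_induction continuous_const (continuous_fermi T hω) i
  exact continuous_collision hV hω _ (hs 0) (hs 1) (hs 2)

/-- The three terms W₃W₄, -W₂W₄ and W₂(1 - W₃) of ν each occur once with the squared and once, with
the opposite sign, with the exchange kernel; these are the six motives. The second motive yields
W₂W₃ in place of W₂W₄, which is corrected by exchanging k₃ and k₄. -/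
lemma sum_lossSign_mul_lossCollision (hV : Summable V) (hω : Continuous ω)
    (k : UnitAddTorus (Fin d)) (τ : ℝ) :
    ∑ i, (lossSign i : ℂ) * lossCollision T ω V i τ k = nuIntegrand T ω V k τ := by
  have hm := continuous_fermi T hω (-1)
  have h1 : Continuous (1 : UnitAddTorus (Fin d) → ℂ) := continuous_const
  rw [nuIntegrand_eq hV hω, antisymCollision, antisymCollision, antisymCollision,
    collision_exchange_swap hV hω τ hm h1 hm, Fin.sum_univ_six]
  simp only [lossCollision, lossFermi, lossSign, lossExchange, lossWeights, lossLegParity,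
    Matrix.cons_val]
  push_cast
  ring

lemma exists_norm_nuIntegrand_le {C δ : ℝ} (hC : 0 ≤ C) (hd : Dispersive C δ ω) (hV : Summable V)
    (hV' : ∀ x, V (-x) = V x) (hω : TorusSmooth ω) (T : ℝ) :
    ∃ K, ∀ τ q, ‖nuIntegrand T ω V q τ‖ ≤ K * japanese τ ^ (-1 - δ) := by
  have h1 : ∃ M, WienerBound (1 : UnitAddTorus (Fin d) → ℂ) M := ⟨1, wienerBound_one⟩
  have hf := exists_wienerBound_fermi hω T
  have hs : ∀ i j, ∃ M, WienerBound (lossFermi T ω i j) M :=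
    lossFermi_induction (p := fun f => ∃ M, WienerBound f M) h1 hf
  choose K hK using fun i =>
    exists_norm_collision_le hC hd hV hV' (lossExchange i) (hs i 0) (hs i 1) (hs i 2)
  refine ⟨∑ i, K i, fun τ q => ?_⟩
  rw [← sum_lossSign_mul_lossCollision hV hd.continuous, Finset.sum_mul]
  refine norm_sum_le_of_le _ fun i _ => ?_
  have hsign : ‖(lossSign i : ℂ)‖ = 1 := by fin_cases i <;> simp [lossSign]
  rw [norm_mul, hsign, one_mul]
  exact hK i τ q

lemma continuous_nuIntegrand (hV : Summable V) (hω : Continuous ω) (T : ℝ) :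
    Continuous fun z : ℝ × UnitAddTorus (Fin d) => nuIntegrand T ω V z.2 z.1 := by
  simp only [← sum_lossSign_mul_lossCollision hV hω]
  exact continuous_finsetSum _ fun i _ =>
    continuous_const.mul (continuous_lossCollision hV hω T i)

lemma nuIntegrand_neg (hV : Summable V) (hω : Continuous ω) (hω' : ∀ k, ω (-k) = ω k)
    (hV' : ∀ x, V (-x) = V x) (k : UnitAddTorus (Fin d)) (τ : ℝ) :
    nuIntegrand T ω V (-k) τ = nuIntegrand T ω V k τ := by
  have hs : ∀ i j, ∀ k, lossFermi T ω i j (-k) = lossFermi T ω i j k :=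
    lossFermi_induction (p := fun f : UnitAddTorus (Fin d) → ℂ => ∀ k, f (-k) = f k)
      (fun _ => rfl) (fermi_neg hω')
  simp only [← sum_lossSign_mul_lossCollision hV hω]
  exact Finset.sum_congr rfl fun i _ => by
    rw [lossCollision, collision_neg hω' hV' _ _ (hs i 0) (hs i 1) (hs i 2)]

end Collisions

/-! ### Detailed balance -/

section Oscillatory

/-- Both sides equal (e^{-βx} - 1)(e^{iSx} - e^{-iSx}) / (ix). Writing (1 - e^{-βx}) / x as an
integral over u removes the division by x and leaves boundary terms at the times ± S only. -/
lemma integral_exp_mul_sub_one (x S β : ℝ) :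
    ∫ s in (-S)..S, Complex.exp (Complex.I * s * x) * (Complex.exp (-(β * x)) - 1) =
      Complex.I * ∫ u in (0 : ℝ)..β, Complex.exp (-(u * x)) *
        (Complex.exp (Complex.I * S * x) - Complex.exp (Complex.I * (-S : ℝ) * x)) := by
  rcases eq_or_ne x 0 with rfl | hx
  · simp
  · have hx' : (x : ℂ) ≠ 0 := Complex.ofReal_ne_zero.mpr hx
    have h1 : ∀ s : ℝ, Complex.I * s * x = Complex.I * x * s := fun s => by ring
    have h2 : ∀ u : ℝ, -((u : ℂ) * x) = -x * u := fun u => by ring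
    rw [intervalIntegral.integral_mul_const, intervalIntegral.integral_mul_const]
    simp only [h1, h2]
    rw [integral_exp_mul_complex (mul_ne_zero Complex.I_ne_zero hx'),
      integral_exp_mul_complex (neg_ne_zero.mpr hx')]
    simp only [Complex.ofReal_zero, mul_zero, Complex.exp_zero]
    field_simp
    rw [Complex.I_sq]
    ring

variable {Y : Type*} [TopologicalSpace Y] [CompactSpace Y] [SecondCountableTopology Y]
  [MeasurableSpace Y] [OpensMeasurableSpace Y] {μ : Measure Y} [IsFiniteMeasure μ]

/-- The oscillatory integral with phase `x` and real exponential weight. -/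
noncomputable def oscillatory (μ : Measure Y) (D : Y → ℂ) (x : Y → ℝ) (u s : ℝ) : ℂ :=
  ∫ p, D p * Complex.exp (Complex.I * s * x p) * Complex.exp (-(u * x p)) ∂μ

lemma continuous_oscillatory {D : Y → ℂ} {x : Y → ℝ} (hD : Continuous D) (hx : Continuous x) :
    Continuous fun z : ℝ × ℝ => oscillatory μ D x z.1 z.2 := by
  refine continuous_torusIntegral (μ := μ) (F := fun (z : ℝ × ℝ) p => D p *
    Complex.exp (Complex.I * z.2 * x p) * Complex.exp (-(z.1 * x p))) ?_
  simp only [Function.uncurry_def]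
  fun_prop

lemma integral_oscillatory_sub {D : Y → ℂ} {x : Y → ℝ} (hD : Continuous D) (hx : Continuous x)
    (β S : ℝ) : ∫ s in (-S)..S, (oscillatory μ D x β s - oscillatory μ D x 0 s) =
      Complex.I * ∫ u in (0 : ℝ)..β, (oscillatory μ D x u S - oscillatory μ D x u (-S)) := by
  have hint : ∀ u s : ℝ, Integrable (fun p => D p * Complex.exp (Complex.I * s * x p) *
      Complex.exp (-(u * x p))) μ := fun u s => integrable_of_continuous_torus (by fun_prop)
  have h1 : ∀ s : ℝ, oscillatory μ D x β s - oscillatory μ D x 0 s =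
      ∫ p, D p * (Complex.exp (Complex.I * s * x p) * (Complex.exp (-(β * x p)) - 1)) ∂μ := by
    intro s
    rw [oscillatory, oscillatory, ← integral_sub (hint β s) (by simpa using hint 0 s)]
    refine integral_congr_ae (Eventually.of_forall fun p => ?_)
    simp only [Complex.ofReal_zero, zero_mul, neg_zero, Complex.exp_zero]
    ring
  have h2 : ∀ u : ℝ, oscillatory μ D x u S - oscillatory μ D x u (-S) =
      ∫ p, D p * (Complex.exp (-(u * x p)) * (Complex.exp (Complex.I * S * x p) -
        Complex.exp (Complex.I * (-S : ℝ) * x p))) ∂μ := by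
    intro u
    rw [oscillatory, oscillatory, ← integral_sub (hint u S) (hint u (-S))]
    exact integral_congr_ae (Eventually.of_forall fun p => by ring)
  simp only [h1, h2]
  rw [intervalIntegral_torus_swap (by simp only [Function.uncurry_def]; fun_prop),
    intervalIntegral_torus_swap (by simp only [Function.uncurry_def]; fun_prop),
    ← integral_const_mul]
  refine integral_congr_ae (Eventually.of_forall fun p => ?_)
  simp only [intervalIntegral.integral_const_mul]
  rw [integral_exp_mul_sub_one]
  ring

/-- Formally ∫ e^{isx} ds = 2π δ(x), and e^{-βx} - 1 vanishes at x = 0. In rigorous form, the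
truncated time integral equals an average over u of oscillatory integrals at ± S; these are bounded
uniformly in u between 0 and β and tend to zero by assumption. -/
lemma integral_oscillatory_eq_zero {D : Y → ℂ} {x : Y → ℝ} (hD : Continuous D)
    (hx : Continuous x) {β : ℝ}
    (hint : Integrable fun s => oscillatory μ D x β s - oscillatory μ D x 0 s)
    (htop : ∀ u, Tendsto (oscillatory μ D x u) atTop (𝓝 0))
    (hbot : ∀ u, Tendsto (oscillatory μ D x u) atBot (𝓝 0)) :
    ∫ s, (oscillatory μ D x β s - oscillatory μ D x 0 s) = 0 := by
  refine tendsto_nhds_unique (intervalIntegral_tendsto_integral hint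
    (tendsto_neg_atTop_atBot (G := ℝ)) tendsto_id) ?_
  simp only [id, integral_oscillatory_sub hD hx]
  rw [← mul_zero Complex.I]
  refine Tendsto.const_mul _ ?_
  have hcont : Continuous fun p : ℝ × Y => D p.2 * Complex.exp (-(p.1 * x p.2)) := by fun_prop
  obtain ⟨B, hB⟩ := (isCompact_uIcc (a := 0) (b := β)).prod (isCompact_univ (X := Y))
    |>.exists_bound_of_continuousOn hcont.continuousOn
  have hbound : ∀ u ∈ uIoc 0 β, ∀ s, ‖oscillatory μ D x u s‖ ≤ B * μ.real univ := by
    intro u hu s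
    refine norm_integral_le_of_norm_le_const (Eventually.of_forall fun p => ?_)
    refine le_trans (le_of_eq ?_) (hB (u, p) ⟨uIoc_subset_uIcc hu, mem_univ _⟩)
    rw [norm_mul, norm_mul, norm_exp_I_mul_mul, mul_one, norm_mul]
  have hzero : (0 : ℂ) = ∫ u in (0 : ℝ)..β, (0 : ℂ) := by simp
  rw [hzero]
  refine intervalIntegral.tendsto_integral_filter_of_dominated_convergence
    (fun _ => B * μ.real univ + B * μ.real univ) (Eventually.of_forall fun S => ?_)
    (Eventually.of_forall fun S => Eventually.of_forall fun u hu =>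
      norm_sub_le_of_le (hbound u hu S) (hbound u hu (-S))) (by simp)
    (Eventually.of_forall fun u _ => ?_)
  · have h1 := continuous_oscillatory (μ := μ) hD hx
    exact ((h1.comp (by fun_prop : Continuous fun u : ℝ => (u, S))).sub
      (h1.comp (by fun_prop : Continuous fun u : ℝ => (u, -S)))).aestronglyMeasurable
  · simpa using (htop u).sub ((hbot u).comp tendsto_neg_atTop_atBot)

end Oscillatory

/-! ### Cancellation of loss and gain in equilibrium -/

section Balance

variable {d : ℕ} {V : (Fin d → ℤ) → ℝ} {ω : UnitAddTorus (Fin d) → ℝ} {T : ℝ}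

lemma one_sub_W0 (T : ℝ) (ω : UnitAddTorus (Fin d) → ℝ) (k : UnitAddTorus (Fin d)) :
    1 - W0 T ω k = Real.exp (1 / T * ω k) * W0 T ω k := by
  have := (W0_denom_pos T ω k).ne'
  unfold W0
  field_simp
  ring

/-- A consequence of 1 - W⁰ = e^{ω/T} W⁰, applied to each of the four momenta. -/
lemma detailed_balance (T : ℝ) (ω : UnitAddTorus (Fin d) → ℝ) (k₁ k₂ k₃ k₄ : UnitAddTorus (Fin d)) :
    (1 - W0 T ω k₁) * (1 - W0 T ω k₂) * W0 T ω k₃ * W0 T ω k₄ *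
      Real.exp (-(1 / T * (ω k₁ + ω k₂ - ω k₃ - ω k₄))) =
    W0 T ω k₁ * W0 T ω k₂ * (1 - W0 T ω k₃) * (1 - W0 T ω k₄) := by
  simp only [one_sub_W0]
  have h : Real.exp (1 / T * ω k₁) * Real.exp (1 / T * ω k₂) *
      Real.exp (-(1 / T * (ω k₁ + ω k₂ - ω k₃ - ω k₄))) =
      Real.exp (1 / T * ω k₃) * Real.exp (1 / T * ω k₄) := by
    simp only [← Real.exp_add]
    congr 1
    ring
  linear_combination (W0 T ω k₁ * W0 T ω k₂ * W0 T ω k₃ * W0 T ω k₄) * h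

/-- Up to the factor -σ, loss minus gain is W₁W₂(1 - W₃)(1 - W₄) - (1 - W₁)(1 - W₂)W₃W₄, the
difference of the rates of a collision and its inverse; detailed balance brings out the factor
e^{-x/T} - 1, with x the energy defect. -/
lemma balance_identity (T : ℝ) (ω : UnitAddTorus (Fin d) → ℝ) {σ : ℤ} (hσ : σ = 1 ∨ σ = -1)
    (k₁ k₂ k₃ k₄ : UnitAddTorus (Fin d)) :
    W0s T ω k₁ σ * (W0 T ω k₃ * W0 T ω k₄ - W0 T ω k₂ * W0 T ω k₄ +
      W0 T ω k₂ * (1 - W0 T ω k₃)) - W0s T ω k₂ (-σ) * W0s T ω k₃ σ * W0s T ω k₄ σ =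
    -σ * ((1 - W0 T ω k₁) * (1 - W0 T ω k₂) * W0 T ω k₃ * W0 T ω k₄ *
      (Real.exp (-(1 / T * (ω k₁ + ω k₂ - ω k₃ - ω k₄))) - 1)) := by
  have h := detailed_balance T ω k₁ k₂ k₃ k₄
  rcases hσ with rfl | rfl
  · simp only [W0s, Int.reduceNeg, reduceCtorEq, if_false, if_true, Int.cast_one]
    linear_combination h
  · simp only [W0s, Int.reduceNeg, if_true, neg_neg, reduceCtorEq, if_false, Int.cast_neg,
      Int.cast_one]
    linear_combination -h

/-- The change of the occupation by the loss and gain collisions. -/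
noncomputable def balance (T : ℝ) (ω : UnitAddTorus (Fin d) → ℝ) (V : (Fin d → ℤ) → ℝ) (σ : ℤ)
    (k : UnitAddTorus (Fin d)) (τ : ℝ) : ℂ :=
  fermi T ω σ k * nuIntegrand T ω V k τ -
    antisymCollision V ω τ (fermi T ω (-σ)) (fermi T ω σ) (fermi T ω σ) k

/-- The amplitude, without interaction, of the collisions in detailed balance. -/
noncomputable def balanceWeight (T : ℝ) (ω : UnitAddTorus (Fin d) → ℝ) (V : (Fin d → ℤ) → ℝ)
    (k : UnitAddTorus (Fin d)) (p : UnitAddTorus (Fin d) × UnitAddTorus (Fin d)) : ℂ :=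
  antisymKernel V ω 0 k p * (fermi T ω 1 k * fermi T ω 1 p.1 * fermi T ω (-1) p.2 *
    fermi T ω (-1) (k + p.1 - p.2))

/-- The energy transfer of a collision. -/
noncomputable def energyDefect (ω : UnitAddTorus (Fin d) → ℝ) (k : UnitAddTorus (Fin d))
    (p : UnitAddTorus (Fin d) × UnitAddTorus (Fin d)) : ℝ :=
  ω k + ω p.1 - ω p.2 - ω (k + p.1 - p.2)

lemma continuous_balanceWeight (hV : Summable V) (hω : Continuous ω) (k : UnitAddTorus (Fin d)) :
    Continuous (balanceWeight T ω V k) := by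
  have h1 := (continuous_antisymKernel hV hω).comp (by fun_prop :
    Continuous fun p : UnitAddTorus (Fin d) × UnitAddTorus (Fin d) => ((0 : ℝ), k, p))
  have hm := continuous_fermi T hω (-1)
  have hp := continuous_fermi T hω 1
  unfold balanceWeight
  refine h1.mul ?_
  fun_prop

lemma continuous_energyDefect (hω : Continuous ω) (k : UnitAddTorus (Fin d)) :
    Continuous (energyDefect ω k) := by
  unfold energyDefect
  fun_prop

/-- The exponential of the energy defect factorises over the four momenta and can be absorbed into
the weights. The oscillatory integral is thus again a collision with weights in the Wiener algebra,
and the dispersive decay applies for every u. -/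
lemma oscillatory_balanceWeight (hV : Summable V) (hω : Continuous ω) (k : UnitAddTorus (Fin d))
    (u s : ℝ) : oscillatory volume (balanceWeight T ω V k) (energyDefect ω k) u s =
      fermi T ω 1 k * Complex.exp ((-u * ω k : ℝ) : ℂ) * antisymCollision V ω s
        (fun k => fermi T ω 1 k * Complex.exp ((-u * ω k : ℝ) : ℂ))
        (fun k => fermi T ω (-1) k * Complex.exp ((u * ω k : ℝ) : ℂ))
        (fun k => fermi T ω (-1) k * Complex.exp ((u * ω k : ℝ) : ℂ)) k := by
  have hm := continuous_fermi T hω (-1)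
  have hp := continuous_fermi T hω 1
  rw [antisymCollision_eq hV hω s (by fun_prop) (by fun_prop) (by fun_prop), oscillatory,
    ← integral_const_mul]
  refine integral_congr_ae (Eventually.of_forall fun p => ?_)
  simp only [balanceWeight]
  rw [antisymKernel_eq s]
  have h : Complex.exp (-(u * energyDefect ω k p)) = Complex.exp ((-u * ω k : ℝ) : ℂ) *
      Complex.exp ((-u * ω p.1 : ℝ) : ℂ) * Complex.exp ((u * ω p.2 : ℝ) : ℂ) *
      Complex.exp ((u * ω (k + p.1 - p.2) : ℝ) : ℂ) := by
    simp only [← Complex.exp_add, energyDefect]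
    congr 1
    push_cast
    ring
  rw [h]
  simp only [energyDefect]
  ring

lemma balance_eq (hV : Summable V) (hω : Continuous ω) {σ : ℤ} (hσ : σ = 1 ∨ σ = -1)
    (k : UnitAddTorus (Fin d)) (s : ℝ) : balance T ω V σ k s =
      -(σ : ℂ) * (oscillatory volume (balanceWeight T ω V k) (energyDefect ω k) (1 / T) s -
        oscillatory volume (balanceWeight T ω V k) (energyDefect ω k) 0 s) := by
  have hf := fun σ => continuous_fermi T hω σ
  have hW := continuous_W0 T hω
  have hb := continuous_balanceWeight (T := T) hV hω k
  have he := continuous_energyDefect hω k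
  have hk := (continuous_antisymKernel hV hω).comp (by fun_prop :
    Continuous fun p : UnitAddTorus (Fin d) × UnitAddTorus (Fin d) => (s, k, p))
  simp only [Function.comp_def] at hk
  rw [balance, nuIntegrand_eq_integral, antisymCollision_eq hV hω s (hf _) (hf _) (hf _),
    ← integral_const_mul, ← integral_sub (integrable_of_continuous_torus (by fun_prop))
      (integrable_of_continuous_torus (by fun_prop)), oscillatory, oscillatory,
    ← integral_sub (integrable_of_continuous_torus (by fun_prop))
      (integrable_of_continuous_torus (by fun_prop)), ← integral_const_mul]
  refine integral_congr_ae (Eventually.of_forall fun p => ?_)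
  have h := congrArg (fun x : ℝ => (x : ℂ))
    (balance_identity T ω hσ k p.1 p.2 (k + p.1 - p.2))
  simp only [balanceWeight, fermi_one, fermi_neg_one]
  rw [antisymKernel_eq s]
  simp only [fermi, energyDefect]
  push_cast at h ⊢
  simp only [zero_mul, neg_zero, Complex.exp_zero, mul_one]
  linear_combination antisymKernel V ω 0 k p * Complex.exp (Complex.I * s *
    (ω k + ω p.1 - ω p.2 - ω (k + p.1 - p.2))) * h

lemma exists_norm_antisymCollision_le {C δ : ℝ} (hC : 0 ≤ C) {w : UnitAddTorus (Fin d) → ℝ}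
    (hw : Dispersive C δ w) (hV : Summable V)
    (hV' : ∀ x, V (-x) = V x) {h₂ h₃ h₄ : UnitAddTorus (Fin d) → ℂ} (H₂ : ∃ M, WienerBound h₂ M)
    (H₃ : ∃ M, WienerBound h₃ M) (H₄ : ∃ M, WienerBound h₄ M) :
    ∃ K, ∀ τ q, ‖antisymCollision V w τ h₂ h₃ h₄ q‖ ≤ K * japanese τ ^ (-1 - δ) := by
  obtain ⟨K, hK⟩ := exists_norm_collision_le hC hw hV hV' false H₂ H₃ H₄
  obtain ⟨K', hK'⟩ := exists_norm_collision_le hC hw hV hV' true H₂ H₃ H₄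
  refine ⟨K + K', fun τ q => ?_⟩
  rw [add_mul]
  exact norm_sub_le_of_le (hK τ q) (hK' τ q)

lemma exists_norm_balance_le {C δ : ℝ} (hC : 0 ≤ C) (hd : Dispersive C δ ω) (hV : Summable V)
    (hV' : ∀ x, V (-x) = V x) (hω : TorusSmooth ω) (T : ℝ) (σ : ℤ) :
    ∃ K, ∀ s k, ‖balance T ω V σ k s‖ ≤ K * japanese s ^ (-1 - δ) := by
  obtain ⟨K, hK⟩ := exists_norm_nuIntegrand_le hC hd hV hV' hω T
  have hf := exists_wienerBound_fermi hω T
  obtain ⟨K', hK'⟩ := exists_norm_antisymCollision_le hC hd hV hV' (hf (-σ)) (hf σ) (hf σ)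
  obtain ⟨M, hM⟩ := hf σ
  refine ⟨M * K + K', fun s k => ?_⟩
  rw [add_mul, mul_assoc]
  refine norm_sub_le_of_le ?_ (hK' s k)
  rw [norm_mul]
  exact mul_le_mul ((hM.phased ω).norm_le k) (hK s k) (norm_nonneg _) (hM.phased ω).nonneg

lemma continuous_antisymCollision (hV : Summable V) {w : UnitAddTorus (Fin d) → ℝ}
    (hw : Continuous w) {h₂ h₃ h₄ : UnitAddTorus (Fin d) → ℂ}
    (H₂ : Continuous h₂) (H₃ : Continuous h₃) (H₄ : Continuous h₄) :
    Continuous fun z : ℝ × UnitAddTorus (Fin d) => antisymCollision V w z.1 h₂ h₃ h₄ z.2 :=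
  (continuous_collision hV hw false H₂ H₃ H₄).sub (continuous_collision hV hw true H₂ H₃ H₄)

lemma continuous_balance (hV : Summable V) (hω : Continuous ω) (T : ℝ) (σ : ℤ) :
    Continuous fun z : ℝ × UnitAddTorus (Fin d) => balance T ω V σ z.2 z.1 :=
  (((continuous_fermi T hω σ).comp continuous_snd).mul (continuous_nuIntegrand hV hω T)).sub
    (continuous_antisymCollision hV hω (continuous_fermi T hω _) (continuous_fermi T hω _)
      (continuous_fermi T hω _))

lemma tendsto_japanese_rpow {δ : ℝ} (hδ : 0 < δ) {l : Filter ℝ}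
    (hl : Tendsto (fun x : ℝ => |x|) l atTop) :
    Tendsto (fun s => japanese s ^ (-1 - δ)) l (𝓝 0) := by
  have h1 : Tendsto (fun s => japanese |s|) l atTop := tendsto_japanese_atTop.comp hl
  have h2 : ∀ s : ℝ, japanese |s| = japanese s := fun s => by simp [japanese]
  simp only [h2] at h1
  have h3 := (tendsto_rpow_neg_atTop (y := 1 + δ) (by linarith)).comp h1
  simpa only [Function.comp_def, neg_add'] using h3

/-- Both hypotheses of the oscillatory argument come from the same dispersive estimate:
integrability in time from the exponent -1 - δ, and the vanishing of the boundary terms from the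
decay for each fixed u. -/
lemma integral_balance_eq_zero {C δ : ℝ} (hC : 0 ≤ C) (hδ : 0 < δ) (hd : Dispersive C δ ω)
    (hV : Summable V) (hV' : ∀ x, V (-x) = V x) (hω : TorusSmooth ω) {σ : ℤ}
    (hσ : σ = 1 ∨ σ = -1) (k : UnitAddTorus (Fin d)) : ∫ s, balance T ω V σ k s = 0 := by
  have hb := continuous_balanceWeight (T := T) hV hd.continuous k
  have he := continuous_energyDefect hd.continuous k
  obtain ⟨K, hK⟩ := exists_norm_balance_le hC hd hV hV' hω T σ
  have hint : Integrable fun s => balance T ω V σ k s :=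
    ((integrable_japanese_rpow hδ).const_mul K).mono'
      ((continuous_balance hV hd.continuous T σ).comp
        (by fun_prop : Continuous fun s : ℝ => (s, k))).aestronglyMeasurable
      (Eventually.of_forall fun s => hK s k)
  have hdecay : ∀ u {l : Filter ℝ}, Tendsto (fun x : ℝ => |x|) l atTop →
      Tendsto (oscillatory volume (balanceWeight T ω V k) (energyDefect ω k) u) l (𝓝 0) := by
    intro u l hl
    obtain ⟨K', hK'⟩ := exists_norm_antisymCollision_le hC hd hV hV'
      (exists_wienerBound_fermi_mul_exp hω T 1 (-u)) (exists_wienerBound_fermi_mul_exp hω T (-1) u)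
      (exists_wienerBound_fermi_mul_exp hω T (-1) u)
    refine squeeze_zero_norm (a := fun s => ‖fermi T ω 1 k * Complex.exp ((-u * ω k : ℝ) : ℂ)‖ *
      (K' * japanese s ^ (-1 - δ))) (fun s => ?_) ?_
    · rw [oscillatory_balanceWeight hV hd.continuous, norm_mul]
      exact mul_le_mul_of_nonneg_left (hK' s k) (norm_nonneg _)
    · simpa using ((tendsto_japanese_rpow hδ hl).const_mul K').const_mul
        ‖fermi T ω 1 k * Complex.exp ((-u * ω k : ℝ) : ℂ)‖
  have hσ0 : -(σ : ℂ) ≠ 0 := by rcases hσ with rfl | rfl <;> simp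
  simp only [balance_eq hV hd.continuous hσ] at hint ⊢
  rw [integral_const_mul, integral_oscillatory_eq_zero hb he
    ((integrable_const_mul_iff (isUnit_iff_ne_zero.mpr hσ0) _).mp hint)
    (fun u => hdecay u tendsto_abs_atTop_atTop) (fun u => hdecay u tendsto_abs_atBot_atTop),
    mul_zero]

end Balance

/-! ### Sums over the motives that are attached to a pair -/

section DecayCoefficient

variable {d : ℕ} {V : (Fin d → ℤ) → ℝ} {ω : UnitAddTorus (Fin d) → ℝ} {C δ : ℝ}

lemma integrable_nuIntegrand (hC : 0 ≤ C) (hδ : 0 < δ) (hd : Dispersive C δ ω) (hV : Summable V)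
    (hV' : ∀ x, V (-x) = V x) (hω : TorusSmooth ω) (T : ℝ) (k : UnitAddTorus (Fin d)) :
    Integrable (nuIntegrand T ω V k) := by
  obtain ⟨K, hK⟩ := exists_norm_nuIntegrand_le hC hd hV hV' hω T
  exact ((integrable_japanese_rpow hδ).const_mul K).mono'
    ((continuous_nuIntegrand hV hd.continuous T).comp
      (by fun_prop : Continuous fun s : ℝ => (s, k))).aestronglyMeasurable
    (Eventually.of_forall fun s => hK s k)

lemma exists_norm_nu_le (hC : 0 ≤ C) (hδ : 0 < δ) (hd : Dispersive C δ ω) (hV : Summable V)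
    (hV' : ∀ x, V (-x) = V x) (hω : TorusSmooth ω) (T : ℝ) : ∃ B, ∀ k, ‖nu T ω V k‖ ≤ B := by
  obtain ⟨K, hK⟩ := exists_norm_nuIntegrand_le hC hd hV hV' hω T
  exact ⟨∫ s in Ioi (0 : ℝ), K * japanese s ^ (-1 - δ), fun k => norm_integral_le_of_norm_le
    ((integrable_japanese_rpow hδ).const_mul K).integrableOn
    (Eventually.of_forall fun s => hK s k)⟩

lemma measurable_nu (hV : Summable V) (hω : Continuous ω) (T : ℝ) : Measurable (nu T ω V) :=
  (StronglyMeasurable.integral_prod_right (ν := volume.restrict (Ioi (0 : ℝ)))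
    (f := fun (k : UnitAddTorus (Fin d)) (s : ℝ) => nuIntegrand T ω V k s)
    ((continuous_nuIntegrand hV hω T).comp continuous_swap).stronglyMeasurable).measurable

lemma nu_neg (hV : Summable V) (hω : Continuous ω) (hω' : ∀ k, ω (-k) = ω k)
    (hV' : ∀ x, V (-x) = V x) (T : ℝ) (k : UnitAddTorus (Fin d)) :
    nu T ω V (-k) = nu T ω V k := by
  simp only [nu, nuIntegrand_neg hV hω hω' hV']

end DecayCoefficient

/-! ### Dependence of the momentum integral on the weight of a single pair -/

section Slot

variable {d : ℕ} {V : (Fin d → ℤ) → ℝ} {w : UnitAddTorus (Fin d) → ℝ}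
  {φ : UnitAddTorus (Fin d) → ℂ} {G : PairedGraph} {A : ℕ × ℕ}
  {h : ℕ × ℕ → UnitAddTorus (Fin d) → ℂ}

lemma momentumIntegral_congr {h' : ℕ × ℕ → UnitAddTorus (Fin d) → ℂ}
    (hh : ∀ P ∈ G.2, h P = h' P) {m : ℕ} (s : Fin m → ℝ) :
    momentumIntegral V w φ G h s = momentumIntegral V w φ G h' s := by
  unfold momentumIntegral
  congr 1
  funext k
  rw [Finset.prod_congr rfl fun P hP => by rw [hh P hP]]

/-- The integrand of a graph without the weight of the pair `A`. -/
noncomputable def slotIntegrand (V : (Fin d → ℤ) → ℝ) (w : UnitAddTorus (Fin d) → ℝ)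
    (φ : UnitAddTorus (Fin d) → ℂ) (G : PairedGraph) (A : ℕ × ℕ)
    (h : ℕ × ℕ → UnitAddTorus (Fin d) → ℂ) {m : ℕ} (s : Fin m → ℝ)
    (q : G.2 → UnitAddTorus (Fin d)) : ℂ :=
  graphIntegrand V w φ G.1 s (initialMomenta G.2 q) *
    ∏ P ∈ G.2.erase A, h P (initialMomenta G.2 q P.1)

lemma momentumIntegral_update (hA : A ∈ G.2) (g : UnitAddTorus (Fin d) → ℂ) {m : ℕ}
    (s : Fin m → ℝ) : momentumIntegral V w φ G (Function.update h A g) s =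
      ∫ q : G.2 → UnitAddTorus (Fin d), slotIntegrand V w φ G A h s q *
        g (initialMomenta G.2 q A.1) := by
  unfold momentumIntegral rowIntegral slotIntegrand
  refine integral_congr_ae (Eventually.of_forall fun q => ?_)
  simp only [prod_update hA]
  ring

lemma measurable_slotIntegrand (hV : Summable V) (hw : Continuous w) (hφ : Measurable φ)
    (hh : ∀ P, Continuous (h P)) {m : ℕ} (s : Fin m → ℝ) :
    Measurable (slotIntegrand V w φ G A h s) :=
  ((measurable_weightedIntegrand hV hw hφ (G.1, G.2.erase A) hh s).comp
    (continuous_initialMomenta G.2).measurable)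

lemma exists_norm_slotIntegrand_le (hV : Summable V) (hφ' : ∃ B, ∀ k, ‖φ k‖ ≤ B)
    (hh : ∀ P, Continuous (h P)) {m : ℕ} (s : Fin m → ℝ) :
    ∃ B, ∀ q, ‖slotIntegrand V w φ G A h s q‖ ≤ B := by
  obtain ⟨B, hB⟩ := exists_norm_weightedIntegrand_le hV hφ' (G.1, G.2.erase A) hh
  exact ⟨B, fun q => hB _ _ _ _⟩

lemma continuous_initialMomenta_apply (S : Finset (ℕ × ℕ)) (a : ℕ) :
    Continuous fun q : S → UnitAddTorus (Fin d) => initialMomenta S q a :=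
  (continuous_apply a).comp (continuous_initialMomenta S)

/-- The momentum integral is linear in the weight of each pair, so the sum over the motives at `A`
can be taken inside this weight. -/
lemma sum_momentumIntegral_update (hV : Summable V) (hw : Continuous w) (hφ : Measurable φ)
    (hφ' : ∃ B, ∀ k, ‖φ k‖ ≤ B) (hA : A ∈ G.2) (hh : ∀ P, Continuous (h P)) {ι : Type*}
    [Fintype ι] {g : ι → UnitAddTorus (Fin d) → ℂ} (hg : ∀ i, Continuous (g i)) (c : ι → ℂ)
    {m : ℕ} (s : Fin m → ℝ) :
    ∑ i, c i * momentumIntegral V w φ G (Function.update h A (g i)) s =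
      momentumIntegral V w φ G (Function.update h A fun q => ∑ i, c i * g i q) s := by
  simp only [momentumIntegral_update hA, ← integral_const_mul]
  obtain ⟨B, hB⟩ := exists_norm_slotIntegrand_le (w := w) (G := G) (A := A) hV hφ' hh s
  rw [← integral_finsetSum]
  · refine integral_congr_ae (Eventually.of_forall fun q => ?_)
    simp only [Finset.mul_sum]
    exact Finset.sum_congr rfl fun i _ => by ring
  · intro i _
    refine Integrable.const_mul ?_ _
    have h1 : Continuous fun q : G.2 → UnitAddTorus (Fin d) => g i (initialMomenta G.2 q A.1) :=
      (hg i).comp (continuous_initialMomenta_apply G.2 A.1)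
    exact (integrable_of_continuous_torus h1).bdd_mul
      (measurable_slotIntegrand hV hw hφ hh s).aestronglyMeasurable (Eventually.of_forall hB)

/-- The same linearity for integrals: the duration s₀ of the new motive can be integrated inside the
weight of `A`, by Fubini's theorem, because the weights have a bound that is integrable in s₀ and
uniform in the momentum. -/
lemma integral_momentumIntegral_update (hV : Summable V) (hw : Continuous w) (hφ : Measurable φ)
    (hφ' : ∃ B, ∀ k, ‖φ k‖ ≤ B) (hA : A ∈ G.2) (hh : ∀ P, Continuous (h P))
    {E : ℝ → UnitAddTorus (Fin d) → ℂ} (hE : Continuous (Function.uncurry E)) {b : ℝ → ℝ}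
    (hb : Integrable b) (hEb : ∀ s k, ‖E s k‖ ≤ b s) {m : ℕ} (s : Fin m → ℝ) :
    ∫ s₀ in Ioi (0 : ℝ), momentumIntegral V w φ G (Function.update h A (E s₀)) s =
      momentumIntegral V w φ G (Function.update h A fun q => ∫ s₀ in Ioi (0 : ℝ), E s₀ q) s := by
  simp only [momentumIntegral_update hA, ← integral_const_mul]
  obtain ⟨B, hB⟩ := exists_norm_slotIntegrand_le (w := w) (G := G) (A := A) hV hφ' hh s
  refine integral_integral_swap ?_
  have hm : Measurable fun p : ℝ × (G.2 → UnitAddTorus (Fin d)) =>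
      slotIntegrand V w φ G A h s p.2 * E p.1 (initialMomenta G.2 p.2 A.1) :=
    ((measurable_slotIntegrand hV hw hφ hh s).comp measurable_snd).mul
      (hE.comp (continuous_fst.prodMk
        ((continuous_initialMomenta_apply G.2 A.1).comp continuous_snd))).measurable
  refine Integrable.mono' (g := fun p : ℝ × (G.2 → UnitAddTorus (Fin d)) => B * b p.1)
    ((hb.integrableOn.comp_fst _).const_mul B) hm.aestronglyMeasurable
    (Eventually.of_forall fun p => ?_)
  simp only [Function.uncurry]
  rw [norm_mul]
  exact mul_le_mul (hB _) (hEb _ _) (norm_nonneg _) ((norm_nonneg _).trans (hB p.2))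

lemma setIntegral_fin_cons {m : ℕ} {F : (Fin (m + 1) → ℝ) → ℂ} (hF : Integrable F) :
    ∫ s in Ici 0, F s =
      ∫ s in Ici (0 : Fin m → ℝ), ∫ s₀ in Ioi (0 : ℝ), F (Fin.cons s₀ s : Fin (m + 1) → ℝ) := by
  rw [← integral_indicator measurableSet_Ici,
    integral_fin_cons_symm (hF.indicator measurableSet_Ici),
    ← integral_indicator measurableSet_Ici]
  refine integral_congr_ae (Eventually.of_forall fun s => ?_)
  beta_reduce
  have hmem : ∀ s₀ : ℝ, (Fin.cons s₀ s : Fin (m + 1) → ℝ) ∈ Ici 0 ↔ 0 ≤ s₀ ∧ s ∈ Ici 0 := by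
    intro s₀
    simp [Pi.le_def, Fin.forall_fin_succ]
  by_cases hs : s ∈ Ici 0
  · rw [indicator_of_mem hs, ← integral_Ici_eq_integral_Ioi, ← integral_indicator measurableSet_Ici]
    refine integral_congr_ae (Eventually.of_forall fun s₀ => ?_)
    beta_reduce
    by_cases h0 : s₀ ∈ Ici 0
    · rw [indicator_of_mem h0, indicator_of_mem ((hmem s₀).mpr ⟨h0, hs⟩)]
    · rw [indicator_of_notMem h0, indicator_of_notMem fun h' => h0 ((hmem s₀).mp h').1]
  · rw [indicator_of_notMem hs]
    refine (integral_congr_ae (Eventually.of_forall fun s₀ => ?_)).trans (integral_zero ℝ ℂ)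
    exact indicator_of_notMem (fun h' => hs ((hmem s₀).mp h').2) _

end Slot

/-! ### Sums over the loss motives on a leg and over the gain motives of a pair -/

section Motives

variable {d : ℕ} {V : (Fin d → ℤ) → ℝ} {ω : UnitAddTorus (Fin d) → ℝ} {C δ : ℝ}
  {φ : UnitAddTorus (Fin d) → ℂ} {G : PairedGraph} {A : ℕ × ℕ}

lemma equilibriumWeights_eq (T : ℝ) (ω : UnitAddTorus (Fin d) → ℝ) (ℓ : List ℕ) (P : ℕ × ℕ) :
    equilibriumWeights T ω ℓ P = fermi T ω (parity ℓ P.1) := rfl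

/-- The sign by which a loss motive changes the pairing sign occurs a second time in the reduced
momentum integral and cancels. The signs `lossSign` remain, and with these the six collisions add up
to the integrand of ν. -/
lemma sum_lossGraph (T : ℝ) (hV : Summable V) (hV' : ∀ x, V (-x) = V x) (hω : Continuous ω)
    (hω' : ∀ k, ω (-k) = ω k) (hφ : Measurable φ) (hφ' : ∃ B, ∀ k, ‖φ k‖ ≤ B)
    (hG : IsPairing G.2) (hA : A ∈ G.2) {e : ℕ} (he : IsLeg A e) {m : ℕ} (s₀ : ℝ)
    (s : Fin m → ℝ) :
    ∑ i, (pairingSign (lossGraph G e i).2 : ℂ) * momentumIntegral V ω φ (lossGraph G e i)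
        (equilibriumWeights T ω (lossGraph G e i).1) (Fin.cons s₀ s : Fin (m + 1) → ℝ) =
      (pairingSign G.2 : ℂ) * momentumIntegral V ω φ G
        (Function.update (equilibriumWeights T ω G.1) A fun q =>
          equilibriumWeights T ω G.1 A q * nuIntegrand T ω V q (parity G.1 e * s₀)) s := by
  have hW := continuous_equilibriumWeights T hω
  have hσ := parity_eq_one_or G.1 e
  have hold : ∀ i, (fun P => equilibriumWeights T ω (lossGraph G e i).1
      (mapPair (lossShift e (lossData (parity G.1 e) i).2.1) P)) = equilibriumWeights T ω G.1 := by
    intro i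
    funext P
    simp only [equilibriumWeights_eq, parity_lossGraph_old]
  have hred : ∀ i, lossReduced V ω G e i (equilibriumWeights T ω (lossGraph G e i).1) s₀ =
      lossCollision T ω V i (parity G.1 e * s₀) := by
    intro i
    obtain ⟨-, -, ⟨hB, hB'⟩, ⟨hC, hC'⟩, -⟩ := lossData_spec hσ i
    obtain ⟨-, h1, -, h2, -⟩ := lossParity_spec hσ i
    have h3 : equilibriumWeights T ω (lossGraph G e i).1
        (translate e (lossData (parity G.1 e) i).2.2.1) = fermi T ω (lossLegParity i).1 := by
      rw [equilibriumWeights_eq, parity_lossGraph_new G e i (by omega), h1]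
    have h4 : equilibriumWeights T ω (lossGraph G e i).1
        (translate e (lossData (parity G.1 e) i).2.2.2) = fermi T ω (lossLegParity i).2 := by
      rw [equilibriumWeights_eq, parity_lossGraph_new G e i (by omega), h2]
    simp only [lossReduced, h3, h4]
    rfl
  have hterm : ∀ i, (pairingSign (lossGraph G e i).2 : ℂ) * momentumIntegral V ω φ
      (lossGraph G e i) (equilibriumWeights T ω (lossGraph G e i).1)
        (Fin.cons s₀ s : Fin (m + 1) → ℝ) = (pairingSign G.2 : ℂ) * ((lossSign i : ℂ) *
      momentumIntegral V ω φ G (Function.update (equilibriumWeights T ω G.1) A fun q =>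
        equilibriumWeights T ω G.1 A q * lossCollision T ω V i (parity G.1 e * s₀) q) s) := by
    intro i
    have hcross : (lossCrossing i : ℂ) * lossCrossing i = 1 := by
      fin_cases i <;> simp [lossCrossing]
    have hupd : equilibriumWeights T ω (lossGraph G e i).1
        (mapPair (lossShift e (lossData (parity G.1 e) i).2.1) A) = equilibriumWeights T ω G.1 A :=
      congrFun (hold i) A
    rw [pairingSign_lossGraph hG hA he i, momentumIntegral_lossGraph hV hV' hω hω' hφ hφ' hG hA he
      i (hW _) (fun P k => by rw [equilibriumWeights_eq, fermi_neg hω']) s₀ s, hold, hred, hupd]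
    push_cast
    linear_combination (pairingSign G.2 : ℂ) * (lossSign i : ℂ) * momentumIntegral V ω φ G
      (Function.update (equilibriumWeights T ω G.1) A fun q => equilibriumWeights T ω G.1 A q *
        lossCollision T ω V i (parity G.1 e * s₀) q) s * hcross
  have hcont : ∀ i, Continuous fun q : UnitAddTorus (Fin d) => equilibriumWeights T ω G.1 A q *
      lossCollision T ω V i (parity G.1 e * s₀) q := fun i =>
    (hW G.1 A).mul (continuous_lossCollision hV hω T i).along_snd
  simp only [hterm]
  rw [← Finset.mul_sum, sum_momentumIntegral_update hV hω hφ hφ' hA (hW _) hcont]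
  refine congrArg (fun g => (pairingSign G.2 : ℂ) * momentumIntegral V ω φ G
    (Function.update (equilibriumWeights T ω G.1) A g) s) (funext fun q => ?_)
  rw [← sum_lossSign_mul_lossCollision hV hω, Finset.mul_sum]
  exact Finset.sum_congr rfl fun i _ => by ring

/-- Here the reduction yields -1 for both pairings, and the pairing sign distinguishes the exchange
pairing from the direct one. Together they give minus the antisymmetrised collision. -/
lemma sum_gainGraph (T : ℝ) (hV : Summable V) (hV' : ∀ x, V (-x) = V x) (hω : Continuous ω)
    (hω' : ∀ k, ω (-k) = ω k) (hφ : Measurable φ) (hφ' : ∃ B, ∀ k, ‖φ k‖ ≤ B)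
    (hG : IsPairing G.2) (hA : A ∈ G.2) (hpar : parity G.1 A.2 = -parity G.1 A.1) (b : Bool)
    {m : ℕ} (s₀ : ℝ) (s : Fin m → ℝ) :
    ∑ i, (pairingSign (gainGraph G A b i).2 : ℂ) * momentumIntegral V ω φ (gainGraph G A b i)
        (equilibriumWeights T ω (gainGraph G A b i).1) (Fin.cons s₀ s : Fin (m + 1) → ℝ) =
      (pairingSign G.2 : ℂ) * momentumIntegral V ω φ G
        (Function.update (equilibriumWeights T ω G.1) A fun q =>
          -antisymCollision V ω (((if b then parity G.1 A.1 else -parity G.1 A.1 : ℤ) : ℝ) * s₀)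
            (fermi T ω (-parity G.1 A.1)) (fermi T ω (parity G.1 A.1))
            (fermi T ω (parity G.1 A.1)) q) s := by
  have hW := continuous_equilibriumWeights T hω
  have hlt := hG.lt A hA
  obtain ⟨σ, hσ⟩ : ∃ σ, parity G.1 A.1 = σ := ⟨_, rfl⟩
  have hs : σ = 1 ∨ σ = -1 := hσ ▸ parity_eq_one_or G.1 A.1
  have hf := fun σ => continuous_fermi T hω σ
  have hcol : ∀ i, Continuous fun q : UnitAddTorus (Fin d) => collision V ω (gainExchange i)
      (((if b then σ else -σ : ℤ) : ℝ) * s₀) (fermi T ω (-σ)) (fermi T ω σ) (fermi T ω σ) q :=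
    fun i => (continuous_collision hV hω (gainExchange i) (hf _) (hf _) (hf _)).along_snd
  have hred : ∀ i, gainReduced V ω G A b i (equilibriumWeights T ω (gainGraph G A b i).1) s₀ =
      collision V ω (gainExchange i) (((if b then σ else -σ : ℤ) : ℝ) * s₀) (fermi T ω (-σ))
        (fermi T ω σ) (fermi T ω σ) := by
    intro i
    have h3 : ∀ j, equilibriumWeights T ω (gainGraph G A b i).1 (gainPair σ A i j) =
        fermi T ω (gainLegParity σ j) := by
      intro j
      obtain ⟨h4, h5, -⟩ := gainData_spec hs i j
      rw [equilibriumWeights_eq, parity_gainGraph G hlt]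
      simp only [gainPair]
      rw [parity_gain_new G.1 hlt hpar (by omega), hσ, (gainParity_spec hs i j).1]
    simp only [gainReduced, hσ, h3]
    rfl
  have hterm : ∀ i, (pairingSign (gainGraph G A b i).2 : ℂ) * momentumIntegral V ω φ
      (gainGraph G A b i) (equilibriumWeights T ω (gainGraph G A b i).1)
        (Fin.cons s₀ s : Fin (m + 1) → ℝ) = (pairingSign G.2 : ℂ) * (-(gainCrossing i : ℂ) *
      momentumIntegral V ω φ G (Function.update (equilibriumWeights T ω G.1) A
        (collision V ω (gainExchange i) (((if b then σ else -σ : ℤ) : ℝ) * s₀) (fermi T ω (-σ))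
        (fermi T ω σ) (fermi T ω σ))) s) := by
    intro i
    rw [pairingSign_gainGraph hG hA b i, momentumIntegral_gainGraph hV hV' hω hω' hφ hφ' hG hA hpar
      b i (hW _) (fun P k => by rw [equilibriumWeights_eq, fermi_neg hω']) s₀ s
        (by rw [hred]; exact hcol i), hred]
    rw [momentumIntegral_congr (h' := Function.update (equilibriumWeights T ω G.1) A
        (collision V ω (gainExchange i) (((if b then σ else -σ : ℤ) : ℝ) * s₀) (fermi T ω (-σ))
        (fermi T ω σ) (fermi T ω σ)))]
    · push_cast
      ring
    · intro P hP
      by_cases hPA : P = A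
      · subst hPA
        rw [Function.update_self, Function.update_self]
      · rw [Function.update_of_ne hPA, Function.update_of_ne hPA]
        obtain ⟨h1, h2, -⟩ := hG.disj P hP A hA hPA
        rw [equilibriumWeights_eq, equilibriumWeights_eq, parity_gainGraph G hlt,
          parity_gain_old G.1 hlt h1 h2]
  simp only [hterm]
  rw [← Finset.mul_sum, sum_momentumIntegral_update hV hω hφ hφ' hA (hW _) hcol, hσ]
  refine congrArg (fun g => (pairingSign G.2 : ℂ) * momentumIntegral V ω φ G
    (Function.update (equilibriumWeights T ω G.1) A g) s) (funext fun q => ?_)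
  rw [Fin.sum_univ_two, antisymCollision]
  simp only [gainCrossing, gainExchange, Matrix.cons_val]
  push_cast
  ring

end Motives

/-! ### The limits of the leading amplitudes -/

section Leading

variable {d : ℕ} {V : (Fin d → ℤ) → ℝ} {ω : UnitAddTorus (Fin d) → ℝ} {C δ : ℝ}
  {φ : UnitAddTorus (Fin d) → ℂ} {m : ℕ} {G : PairedGraph} {A : ℕ × ℕ}

lemma exists_wienerBound_equilibriumWeights (hω : TorusSmooth ω) (T : ℝ) (ℓ : List ℕ) :
    ∃ M : ℕ × ℕ → ℝ, ∀ P, WienerBound (equilibriumWeights T ω ℓ P) (M P) := by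
  choose M hM using fun P : ℕ × ℕ => exists_wienerBound_fermi hω T (parity ℓ P.1)
  exact ⟨M, hM⟩

lemma integrable_momentumIntegral (hC : 0 ≤ C) (hδ : 0 < δ) (hd : Dispersive C δ ω)
    (hV : Summable V) (hV' : ∀ x, V (-x) = V x) (hω : TorusSmooth ω) (hφ : Measurable φ)
    (hφ' : ∃ B, ∀ k, ‖φ k‖ ≤ B) (hG : G ∈ leadingGraphs m) (T : ℝ) :
    Integrable fun s : Fin m → ℝ => momentumIntegral V ω φ G (equilibriumWeights T ω G.1) s := by
  obtain ⟨B, hB⟩ := exists_momentumBound hC hδ hV hV' hG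
  obtain ⟨M, hM⟩ := exists_wienerBound_equilibriumWeights hω T G.1
  obtain ⟨g, hg, hg'⟩ := hB.exists_dominating hφ hφ' hM fun P k => by
    rw [equilibriumWeights_eq, fermi_neg hd.even]
  exact hg.mono' (measurable_momentumIntegral hV hd.continuous hφ G fun P =>
    (continuous_equilibriumWeights T hd.continuous G.1 P).measurable).aestronglyMeasurable
      (Eventually.of_forall (hg' ω hd))

/-- The common frame for root and other pairs: an identity at fixed durations, which turns the sum
over the motives into one function `E s₀` in the slot of `A`, is integrated over s₀ > 0. -/
lemma sum_durationIntegral_attachments (hC : 0 ≤ C) (hδ : 0 < δ) (hd : Dispersive C δ ω)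
    (hV : Summable V) (hV' : ∀ x, V (-x) = V x) (hω : TorusSmooth ω) (hφ : Measurable φ)
    (hφ' : ∃ B, ∀ k, ‖φ k‖ ≤ B) (hG : G ∈ leadingGraphs m) (hA : A ∈ G.2) (T : ℝ)
    {E : ℝ → UnitAddTorus (Fin d) → ℂ} (hE : Continuous (Function.uncurry E)) {b : ℝ → ℝ}
    (hb : Integrable b) (hEb : ∀ s k, ‖E s k‖ ≤ b s)
    (hsum : ∀ (s₀ : ℝ) (s : Fin m → ℝ), ∑ H ∈ attachments G A, (pairingSign H.2 : ℂ) *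
      momentumIntegral V ω φ H (equilibriumWeights T ω H.1) (Fin.cons s₀ s : Fin (m + 1) → ℝ) =
        (pairingSign G.2 : ℂ) * momentumIntegral V ω φ G
          (Function.update (equilibriumWeights T ω G.1) A (E s₀)) s) :
    ∑ H ∈ attachments G A, durationIntegral V ω φ (m + 1) H (equilibriumWeights T ω H.1) =
      durationIntegral V ω φ m G (Function.update (equilibriumWeights T ω G.1) A
        fun q => ∫ s₀ in Ioi (0 : ℝ), E s₀ q) := by
  have hint : ∀ H ∈ attachments G A, Integrable fun s : Fin (m + 1) → ℝ =>
      (pairingSign H.2 : ℂ) * momentumIntegral V ω φ H (equilibriumWeights T ω H.1) s :=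
    fun H hH => (integrable_momentumIntegral hC hδ hd hV hV' hω hφ hφ'
      (Finset.mem_biUnion.mpr ⟨G, hG, Finset.mem_biUnion.mpr ⟨A, hA, hH⟩⟩) T).const_mul _
  simp only [durationIntegral, ← integral_const_mul]
  rw [← integral_finsetSum _ fun H hH => (hint H hH).integrableOn,
    setIntegral_fin_cons (integrable_finsetSum _ hint)]
  simp only [hsum, integral_const_mul]
  simp only [integral_momentumIntegral_update hV hd.continuous hφ hφ' hA
    (continuous_equilibriumWeights T hd.continuous G.1) hE hb hEb]

lemma IsLeading.parity_root (hG : IsLeading d m G) (hA : A ∈ G.2) (h0 : A.1 = 0) :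
    parity G.1 A.1 = -1 ∧ parity G.1 A.2 = 1 := by
  have h1 : parity G.1 A.1 = -1 := by rw [h0, parity_zero hG.pos]
  exact ⟨h1, by rw [hG.parity_snd A hA, h1, neg_neg]⟩

lemma IsLeading.topMomentum_eq (hG : IsLeading d m G) (hA : A ∈ G.2) (h0 : A.1 = 0)
    {k : ℕ → UnitAddTorus (Fin d)} (hk : Admissible G.2 k) : topMomentum G.1 k = -k A.1 := by
  obtain ⟨b, hb, hb'⟩ := hG.root
  have hAb : A = (0, b) := by
    by_contra h
    exact (hG.pairing.disj A hA _ hb h).1 h0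
  rw [hb' k hk, ← hk A hA, hAb]

/-- The right leg of the root pair has parity 1, so the loss collisions have the time +s₀, and the
integral over s₀ > 0 is ν. The top momentum is minus the momentum of the root pair, and since ν is
even, it can be moved from the weight of the pair to φ. -/
lemma sum_durationIntegral_root (hC : 0 ≤ C) (hδ : 0 < δ) (hd : Dispersive C δ ω)
    (hV : Summable V) (hV' : ∀ x, V (-x) = V x) (hω : TorusSmooth ω) (hφ : Measurable φ)
    (hφ' : ∃ B, ∀ k, ‖φ k‖ ≤ B) (hG : G ∈ leadingGraphs m) (hA : A ∈ G.2) (h0 : A.1 = 0) (T : ℝ) :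
    ∑ H ∈ attachments G A, durationIntegral V ω φ (m + 1) H (equilibriumWeights T ω H.1) =
      durationIntegral V ω (fun k => φ k * nu T ω V k) m G (equilibriumWeights T ω G.1) := by
  have hlead : IsLeading d m G := isLeading_of_mem hG
  obtain ⟨K, hK⟩ := exists_norm_nuIntegrand_le hC hd hV hV' hω T
  have hWc := continuous_equilibriumWeights T hd.continuous G.1 A
  obtain ⟨M, hM⟩ := (isCompact_range hWc).isBounded.exists_norm_le
  have hM0 : 0 ≤ M := (norm_nonneg _).trans (hM _ ⟨0, rfl⟩)
  rw [sum_durationIntegral_attachments (E := fun s₀ q => equilibriumWeights T ω G.1 A q *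
    nuIntegrand T ω V q s₀) hC hδ hd hV hV' hω hφ hφ' hG hA T
    ((hWc.comp continuous_snd).mul (continuous_nuIntegrand hV hd.continuous T))
    (((integrable_japanese_rpow hδ).const_mul K).const_mul M) (fun s k => by
      rw [norm_mul]; exact mul_le_mul (hM _ ⟨k, rfl⟩) (hK s k) (norm_nonneg _) hM0)]
  · unfold durationIntegral
    congr 1
    refine integral_congr_ae (Eventually.of_forall fun s => ?_)
    simp only [integral_const_mul]
    refine hlead.pairing.rowIntegral_congr fun k hk => ?_
    have hp := prod_update (h := equilibriumWeights T ω G.1) hA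
      (fun q => equilibriumWeights T ω G.1 A q * nu T ω V q) k
    have hp' := Finset.mul_prod_erase G.2 (fun P => equilibriumWeights T ω G.1 P (k P.1)) hA
    simp only [graphIntegrand]
    rw [hlead.topMomentum_eq hA h0 hk, nu_neg hV hd.continuous hd.even hV', ← hp']
    erw [hp]
    ring
  · intro s₀ s
    rw [sum_attachments_root hlead.pairing h0, sum_lossGraph T hV hV' hd.continuous hd.even hφ hφ'
      hlead.pairing hA (Or.inr rfl), (hlead.parity_root hA h0).2]
    simp

/-- The legs of `A` have opposite parities, so the loss motives supply the times σ s₀ and -σ s₀; the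
two orders of the gain vertices do the same. The weights add up to the balance at s₀ plus the
balance at -s₀. -/
lemma sum_durationIntegral_of_ne (hC : 0 ≤ C) (hδ : 0 < δ) (hd : Dispersive C δ ω)
    (hV : Summable V) (hV' : ∀ x, V (-x) = V x) (hω : TorusSmooth ω) (hφ : Measurable φ)
    (hφ' : ∃ B, ∀ k, ‖φ k‖ ≤ B) (hG : G ∈ leadingGraphs m) (hA : A ∈ G.2) (h0 : A.1 ≠ 0) (T : ℝ) :
    ∑ H ∈ attachments G A, durationIntegral V ω φ (m + 1) H (equilibriumWeights T ω H.1) = 0 := by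
  have hlead : IsLeading d m G := isLeading_of_mem hG
  obtain ⟨σ, hσ⟩ : ∃ σ, parity G.1 A.1 = σ := ⟨_, rfl⟩
  have hs : σ = 1 ∨ σ = -1 := hσ ▸ parity_eq_one_or G.1 A.1
  have hpar := hlead.parity_snd A hA
  have hW := continuous_equilibriumWeights T hd.continuous G.1
  obtain ⟨K, hK⟩ := exists_norm_balance_le hC hd hV hV' hω T σ
  have hc := continuous_balance hV hd.continuous T σ
  have hcs : Continuous fun z : ℝ × UnitAddTorus (Fin d) => balance T ω V σ z.2 (-z.1) :=
    hc.comp (continuous_fst.neg.prodMk continuous_snd)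
  have hn : ∀ s, japanese (-s) = japanese s := fun s => by simp [japanese]
  have hint : ∀ q, Integrable (balance T ω V σ q) := fun q =>
    ((integrable_japanese_rpow hδ).const_mul K).mono'
      (hc.comp (by fun_prop : Continuous fun s : ℝ => (s, q))).aestronglyMeasurable
      (Eventually.of_forall fun s => hK s q)
  -- The two signs of the time combine the half-line integrals into an integral over ℝ, which
  -- vanishes by detailed balance.
  have hzero : (fun q => ∫ s₀ in Ioi (0 : ℝ), balance T ω V σ q s₀ + balance T ω V σ q (-s₀)) =
      0 := by
    funext q
    rw [integral_add (hint q).integrableOn (hint q).comp_neg.integrableOn,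
      integral_comp_neg_Ioi, neg_zero, add_comm,
      intervalIntegral.integral_Iic_add_Ioi (hint q).integrableOn (hint q).integrableOn,
      integral_balance_eq_zero hC hδ hd hV hV' hω hs, Pi.zero_apply]
  rw [sum_durationIntegral_attachments (E := fun s₀ q => balance T ω V σ q s₀ +
    balance T ω V σ q (-s₀)) hC hδ hd hV hV' hω hφ hφ' hG hA T (hc.add hcs)
    ((integrable_japanese_rpow hδ).const_mul (2 * K)) (fun s k => by
      refine (norm_add_le _ _).trans ?_
      have h1 := hK s k
      have h2 := hK (-s) k
      rw [hn] at h2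
      linarith), hzero]
  · have hz : ∀ s : Fin m → ℝ, momentumIntegral V ω φ G
        (Function.update (equilibriumWeights T ω G.1) A 0) s = 0 := by
      intro s
      rw [momentumIntegral_update hA]
      simp
    simp [durationIntegral, hz]
  · intro s₀ s
    have hN : ∀ c : ℝ, Continuous fun q => equilibriumWeights T ω G.1 A q *
        nuIntegrand T ω V q c := fun c =>
      (hW A).mul (continuous_nuIntegrand hV hd.continuous T).along_snd
    have hR : ∀ c : ℝ, Continuous fun q => -antisymCollision V ω c (fermi T ω (-σ)) (fermi T ω σ)
        (fermi T ω σ) q := fun c =>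
      (continuous_antisymCollision hV hd.continuous (continuous_fermi T hd.continuous _)
        (continuous_fermi T hd.continuous _) (continuous_fermi T hd.continuous _)).along_snd.neg
    have hg : ∀ i : Fin 4, Continuous (![fun q => equilibriumWeights T ω G.1 A q *
        nuIntegrand T ω V q (σ * s₀), fun q => equilibriumWeights T ω G.1 A q *
        nuIntegrand T ω V q (-σ * s₀), fun q => -antisymCollision V ω (σ * s₀) (fermi T ω (-σ))
        (fermi T ω σ) (fermi T ω σ) q, fun q => -antisymCollision V ω (-σ * s₀) (fermi T ω (-σ))
        (fermi T ω σ) (fermi T ω σ) q] i) := by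
      intro i
      fin_cases i
      exacts [hN _, hN _, hR _, hR _]
    have hsum := sum_momentumIntegral_update hV hd.continuous hφ hφ' hA hW hg 1 s
    simp only [Fin.sum_univ_four, Pi.one_apply, one_mul, Matrix.cons_val] at hsum
    rw [sum_attachments_of_ne hlead.pairing hA h0, Finset.sum_add_distrib,
      sum_lossGraph T hV hV' hd.continuous hd.even hφ hφ' hlead.pairing hA (Or.inl rfl),
      sum_lossGraph T hV hV' hd.continuous hd.even hφ hφ' hlead.pairing hA (Or.inr rfl),
      sum_gainGraph T hV hV' hd.continuous hd.even hφ hφ' hlead.pairing hA hpar,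
      sum_gainGraph T hV hV' hd.continuous hd.even hφ hφ' hlead.pairing hA hpar, hpar, hσ]
    simp only [if_true, Bool.false_eq_true, if_false, Int.cast_neg]
    rw [← mul_add, ← mul_add, ← mul_add, ← add_assoc, hsum]
    refine congrArg (fun g => (pairingSign G.2 : ℂ) * momentumIntegral V ω φ G
      (Function.update (equilibriumWeights T ω G.1) A g) s) (funext fun q => ?_)
    have hf : equilibriumWeights T ω G.1 A = fermi T ω σ := by rw [equilibriumWeights_eq, hσ]
    rw [hf]
    rcases hs with rfl | rfl
    · simp only [balance, Int.cast_one, one_mul, neg_mul]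
      ring
    · simp only [balance, Int.cast_one, Int.cast_neg, one_mul, neg_mul, neg_neg]
      ring

lemma durationIntegral_zero (T : ℝ) (hd : Dispersive C δ ω) :
    durationIntegral V ω φ 0 ([], {(0, 1)}) (equilibriumWeights T ω []) =
      ∫ k, φ k * (W0 T ω k : ℂ) := by
  have hsign : pairingSign {(0, 1)} = 1 := by decide
  have hvol : (volume : Measure (Fin 0 → ℝ)).restrict (Ici 0) = Measure.dirac 0 := by
    rw [Measure.volume_pi_eq_dirac 0, Measure.restrict_eq_self_of_ae_mem]
    simp [ae_dirac_eq]
  rw [durationIntegral, hvol, integral_dirac, hsign, Int.cast_one, one_mul, momentumIntegral,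
    rowIntegral_singleton, ← integral_neg_eq_self]
  refine integral_congr_ae (Eventually.of_forall fun q => ?_)
  simp [graphIntegrand, topMomentum, vertices, vertexProd, totalPhase, leg, equilibriumWeights,
    W0s, parity, W0, hd.even]

/-- Only the motives at the root pair survive, and they replace φ by φν. The induction is therefore
over all bounded measurable φ, not just the given trigonometric polynomial. -/
lemma sum_durationIntegral_leadingGraphs (hC : 0 ≤ C) (hδ : 0 < δ) (hd : Dispersive C δ ω)
    (hV : Summable V) (hV' : ∀ x, V (-x) = V x) (hω : TorusSmooth ω) (hφ : Measurable φ)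
    (hφ' : ∃ B, ∀ k, ‖φ k‖ ≤ B) (T : ℝ) (m : ℕ) :
    ∑ G ∈ leadingGraphs m, durationIntegral V ω φ m G (equilibriumWeights T ω G.1) =
      ∫ k, φ k * (W0 T ω k : ℂ) * nu T ω V k ^ m := by
  induction m generalizing φ with
  | zero =>
    rw [leadingGraphs, Finset.sum_singleton, durationIntegral_zero T hd]
    simp
  | succ m ih =>
    have hν := measurable_nu hV hd.continuous T
    obtain ⟨B, hB⟩ := hφ'
    obtain ⟨B', hB'⟩ := exists_norm_nu_le hC hδ hd hV hV' hω T
    rw [sum_leadingGraphs_succ m fun G =>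
      durationIntegral V ω φ (m + 1) G (equilibriumWeights T ω G.1)]
    have hstep : ∀ G ∈ leadingGraphs m, ∑ A ∈ G.2, ∑ H ∈ attachments G A,
        durationIntegral V ω φ (m + 1) H (equilibriumWeights T ω H.1) =
        durationIntegral V ω (fun k => φ k * nu T ω V k) m G (equilibriumWeights T ω G.1) := by
      intro G hG
      have hlead : IsLeading d m G := isLeading_of_mem hG
      obtain ⟨b, hb, -⟩ := hlead.root
      rw [Finset.sum_eq_single_of_mem _ hb fun A hA hAb =>
        sum_durationIntegral_of_ne hC hδ hd hV hV' hω hφ ⟨B, hB⟩ hG hA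
          (hlead.pairing.disj A hA _ hb hAb).1 T]
      exact sum_durationIntegral_root hC hδ hd hV hV' hω hφ ⟨B, hB⟩ hG hb rfl T
    rw [Finset.sum_congr rfl hstep, ih (φ := fun k => φ k * nu T ω V k) (hφ.mul hν) ⟨B * B', fun k => by
      rw [norm_mul]; exact mul_le_mul (hB k) (hB' k) (norm_nonneg _) ((norm_nonneg _).trans (hB k))⟩]
    refine integral_congr_ae (Eventually.of_forall fun k => ?_)
    simp only [pow_succ]
    ring

end Leading

/-! ### The kinetic limit, uniformly in the volume -/

section KineticLimit

variable {d : ℕ} {V : (Fin d → ℤ) → ℝ} {ω : UnitAddTorus (Fin d) → ℝ}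
  {φ : UnitAddTorus (Fin d) → ℂ} {m : ℕ} {G : PairedGraph}

/-- The value λ = 0 is included in the assumption, and there the modified dispersion relation is ω
itself, for every L; so ω is dispersive with the same constant. The bound at t = 0 shows that C ≥ 0.
-/
lemma L3Dispersive.exists_dispersive {T δ : ℝ} {L₀ : ℕ} (h : L3Dispersive T ω V δ L₀)
    (hω : Continuous ω) (hω' : ∀ k, ω (-k) = ω k) (hV : Summable V) (hV' : ∀ x, V (-x) = V x) :
    ∃ C, 0 ≤ C ∧ Dispersive C δ ω ∧
      ∀ᶠ p : ℝ × ℕ+ in 𝓝[>] (0 : ℝ) ×ˢ 𝓟 {L : ℕ+ | L₀ ≤ (L : ℕ)},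
        Dispersive C δ (modDisp (p.2 : ℕ) T ω V p.1) := by
  obtain ⟨lam₀, hlam₀, C, hC⟩ := h
  have hdisp : ∀ lam : ℝ, 0 ≤ lam → lam < lam₀ → ∀ L : ℕ+, L₀ ≤ (L : ℕ) →
      Dispersive C δ (modDisp (L : ℕ) T ω V lam) := fun lam h0 h1 L hL =>
    ⟨continuous_modDisp T hω hV lam, modDisp_neg T hω' hV' lam, fun t => (hC lam h0 h1 L hL t).1,
      fun t => (hC lam h0 h1 L hL t).2⟩
  have hω₀ : Dispersive C δ ω := by
    have := hdisp 0 le_rfl hlam₀ L₀.succPNat L₀.le_succ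
    rwa [modDisp_zero] at this
  refine ⟨C, ?_, hω₀, ?_⟩
  · have h1 : (0 : ℝ) ≤ C * japanese 0 ^ (-1 - δ) :=
      (tsum_nonneg fun x => by positivity).trans (hω₀.bound 0)
    simpa [japanese] using h1
  · rw [eventually_prod_principal_iff]
    filter_upwards [Ioo_mem_nhdsGT hlam₀] with lam hlam L hL
    exact hdisp lam hlam.1.le hlam.2 L hL

lemma tendsto_modDisp (T : ℝ) (hV : Summable V) (hV' : ∀ x, V (-x) = V x) (s : Set ℕ+)
    (k : UnitAddTorus (Fin d)) : Tendsto (fun p : ℝ × ℕ+ => modDisp (p.2 : ℕ) T ω V p.1 k)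
      (𝓝[>] (0 : ℝ) ×ˢ 𝓟 s) (𝓝 (ω k)) := by
  have h1 : Tendsto (fun p : ℝ × ℕ+ => |p.1| * (2 * ∑' x, |V x|)) (𝓝[>] (0 : ℝ) ×ˢ 𝓟 s) (𝓝 0) := by
    have h2 : Tendsto (fun lam : ℝ => |lam| * (2 * ∑' x, |V x|)) (𝓝 0) (𝓝 0) := by
      have : Continuous fun lam : ℝ => |lam| * (2 * ∑' x, |V x|) := by fun_prop
      simpa using this.tendsto 0
    exact (h2.mono_left nhdsWithin_le_nhds).comp tendsto_fst
  rw [tendsto_iff_norm_sub_tendsto_zero]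
  exact squeeze_zero (fun _ => norm_nonneg _)
    (fun p => abs_modDisp_sub_le T ω hV hV' p.1 k) h1

lemma tendsto_mainAmplitude {T γ δ : ℝ} {L₀ : ℕ} (hγ : 0 < γ) (hδ : 0 < δ)
    (hDR : L3Dispersive T ω V δ L₀) (hω : TorusSmooth ω) (hω' : ∀ k, ω (-k) = ω k)
    (hV : Summable V) (hV' : ∀ x, V (-x) = V x) (hG : G ∈ leadingGraphs m) (hφ : Measurable φ)
    (hφ' : ∃ B, ∀ k, ‖φ k‖ ≤ B) {t : ℝ} (ht : 0 < t) :
    Tendsto (fun p : ℝ × ℕ+ => mainAmplitude T ω V γ δ φ t p.1 p.2 G)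
      (𝓝[>] (0 : ℝ) ×ˢ 𝓟 {L : ℕ+ | L₀ ≤ (L : ℕ)}) (𝓝 ((-t : ℂ) ^ m / m.factorial *
        durationIntegral V ω φ m G (equilibriumWeights T ω G.1))) := by
  obtain ⟨C, hC, hd, hev⟩ := hDR.exists_dispersive
    (continuous_of_comp_torusMk hω.continuous) hω' hV hV'
  obtain ⟨M, hM⟩ := exists_wienerBound_equilibriumWeights hω T G.1
  exact tendsto_amplitude T hV hV' hC hδ hG hev hd (tendsto_modDisp T hV hV' _) hM
    (tendsto_fst.eventually (eventually_kappa_eq_zero hγ hδ (2 * m))) tendsto_fst hφ hφ' ht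

lemma durationIntegral_mul_neg (ν : UnitAddTorus (Fin d) → ℂ) (h : ℕ × ℕ → UnitAddTorus (Fin d) → ℂ) :
    durationIntegral V ω (fun k => φ k * -ν k) m G h =
      -durationIntegral V ω (fun k => φ k * ν k) m G h := by
  simp only [durationIntegral, momentumIntegral, rowIntegral, graphIntegrand, mul_neg, neg_mul,
    integral_neg]

/-- Uniform convergence on a set is convergence along the product with its principal filter. This
reduces the uniformity in L to a single limit in the pair (λ, L). -/
lemma tendstoUniformlyOn_const {ι α : Type*} {F : ι → α → ℂ} {c : ℂ} {l : Filter ι} {s : Set α}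
    (h : Tendsto (fun p : ι × α => F p.1 p.2) (l ×ˢ 𝓟 s) (𝓝 c)) :
    TendstoUniformlyOn F (fun _ => c) l s :=
  tendstoUniformlyOn_iff_tendsto.mpr (Uniform.tendsto_nhds_right.mp h)

lemma continuous_fourierFin (f : (Fin d → ℤ) →₀ ℂ) : Continuous (fourierFin f) :=
  continuous_finsetSum _ fun x _ => continuous_const.mul (UnitAddTorus.mFourier (-x)).continuous

end KineticLimit

end Kinetic

theorem lemma7p3 {d : ℕ} (T : ℝ) (hT : 0 < T)
    (ω : UnitAddTorus (Fin d) → ℝ)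
    (hω_analytic : AnalyticOnNhd ℝ
      (fun x : Fin d → ℝ => ω (fun i => (x i : UnitAddCircle))) Set.univ)
    (hω_even : ∀ k, ω (-k) = ω k)
    (V : (Fin d → ℤ) → ℝ) (hV_summable : Summable V) (hV_even : ∀ x, V (-x) = V x)
    (γ δ : ℝ) (hγ : 0 < γ) (hδ : 0 < δ)
    (L₀ : ℕ) (hDR : Kinetic.L3Dispersive T ω V δ L₀)
    (f g : (Fin d → ℤ) →₀ ℂ) :
    -- the time integral that defines `ν` converges absolutely, and `ν` is bounded and measurable
    (∀ k₁, MeasureTheory.IntegrableOn (Kinetic.nuIntegrand T ω V k₁) (Set.Ioi 0)) ∧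
    Measurable (Kinetic.nu T ω V) ∧ (∃ B : ℝ, ∀ k, ‖Kinetic.nu T ω V k‖ ≤ B) ∧
    ∀ t : ℝ, 0 < t →
      -- the limit of the sum over the leading graphs with `n = 2m` interactions
      (∀ m : ℕ, TendstoUniformlyOn
        (fun (lam : ℝ) (L : ℕ+) => ∑ G ∈ Kinetic.leadingGraphs m,
          Kinetic.mainAmplitude T ω V γ δ
            (fun k => star (Kinetic.fourierFin g k) * Kinetic.fourierFin f k) t lam L G)
        (fun _ => ∫ k : UnitAddTorus (Fin d),
          star (Kinetic.fourierFin g k) * Kinetic.fourierFin f k * (Kinetic.W0 T ω k : ℂ) *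
            Kinetic.nu T ω V k ^ m * ((-t : ℝ) : ℂ) ^ m / (m.factorial : ℂ))
        (𝓝[>] (0 : ℝ)) {L : ℕ+ | L₀ ≤ (L : ℕ)}) ∧
      -- attaching the loss motives to the root pair produces the factor `-ν`
      (∀ m : ℕ, ∀ G ∈ Kinetic.leadingGraphs m, ∀ A ∈ G.2, A.1 = 0 → TendstoUniformlyOn
        (fun (lam : ℝ) (L : ℕ+) =>
          (∑ H ∈ Kinetic.attachments G A, Kinetic.mainAmplitude T ω V γ δ
            (fun k => star (Kinetic.fourierFin g k) * Kinetic.fourierFin f k) t lam L H) -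
          ((t / (m + 1) : ℝ) : ℂ) * Kinetic.mainAmplitude T ω V γ δ
            (fun k => star (Kinetic.fourierFin g k) * Kinetic.fourierFin f k *
              (-Kinetic.nu T ω V k)) t lam L G)
        (fun _ => 0) (𝓝[>] (0 : ℝ)) {L : ℕ+ | L₀ ≤ (L : ℕ)}) ∧
      -- the leading motives attached to any other pair cancel
      (∀ m : ℕ, ∀ G ∈ Kinetic.leadingGraphs m, ∀ A ∈ G.2, A.1 ≠ 0 → TendstoUniformlyOn
        (fun (lam : ℝ) (L : ℕ+) =>
          ∑ H ∈ Kinetic.attachments G A, Kinetic.mainAmplitude T ω V γ δ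
            (fun k => star (Kinetic.fourierFin g k) * Kinetic.fourierFin f k) t lam L H)
        (fun _ => 0) (𝓝[>] (0 : ℝ)) {L : ℕ+ | L₀ ≤ (L : ℕ)}) := by
  open Kinetic in
  -- Smoothness of ω is what is needed below: it puts W⁰ and W⁰ e^{uω} into the Wiener algebra.
  have hω : TorusSmooth ω := hω_analytic.contDiff
  have hωc : Continuous ω := continuous_of_comp_torusMk hω.continuous
  obtain ⟨C, hC, hd, -⟩ := hDR.exists_dispersive hωc hω_even hV_summable hV_even
  have hν := measurable_nu hV_summable hωc T
  obtain ⟨B, hB⟩ := exists_norm_nu_le hC hδ hd hV_summable hV_even hω T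
  refine ⟨fun k => (integrable_nuIntegrand hC hδ hd hV_summable hV_even hω T k).integrableOn, hν,
    ⟨B, hB⟩, fun t ht => ?_⟩
  set φ : UnitAddTorus (Fin d) → ℂ := fun k => star (fourierFin g k) * fourierFin f k with hφdef
  have hφc : Continuous φ := (continuous_fourierFin g).star.mul (continuous_fourierFin f)
  have hφ' : ∃ B, ∀ k, ‖φ k‖ ≤ B := by
    obtain ⟨B, hB⟩ := (isCompact_range hφc).isBounded.exists_norm_le
    exact ⟨B, fun k => hB _ ⟨k, rfl⟩⟩
  have hlim : ∀ {ψ : UnitAddTorus (Fin d) → ℂ}, Measurable ψ → (∃ B, ∀ k, ‖ψ k‖ ≤ B) →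
      ∀ {m : ℕ} {G : PairedGraph}, G ∈ leadingGraphs m → _ := fun h1 h2 _ _ hG =>
    tendsto_mainAmplitude (γ := γ) hγ hδ hDR hω hω_even hV_summable hV_even hG h1 h2 ht
  have hatt : ∀ {m : ℕ} {G : PairedGraph}, G ∈ leadingGraphs m → ∀ {A : ℕ × ℕ}, A ∈ G.2 →
      ∀ H ∈ attachments G A, H ∈ leadingGraphs (m + 1) := fun hG _ hA H hH =>
    Finset.mem_biUnion.mpr ⟨_, hG, Finset.mem_biUnion.mpr ⟨_, hA, hH⟩⟩
  refine ⟨fun m => tendstoUniformlyOn_const ?_, fun m G hG A hA h0 => tendstoUniformlyOn_const ?_,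
    fun m G hG A hA h0 => tendstoUniformlyOn_const ?_⟩
  · convert tendsto_finsetSum (leadingGraphs m) fun G hG => hlim hφc.measurable hφ' hG using 2
    rw [← Finset.mul_sum, sum_durationIntegral_leadingGraphs hC hδ hd hV_summable hV_even hω
      hφc.measurable hφ', ← integral_const_mul]
    refine integral_congr_ae (Eventually.of_forall fun k => ?_)
    simp only [hφdef, Complex.ofReal_neg]
    ring
  · have hφν : ∃ B, ∀ k, ‖φ k * -nu T ω V k‖ ≤ B := by
      obtain ⟨B', hB'⟩ := hφ'
      refine ⟨B' * B, fun k => ?_⟩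
      rw [norm_mul, norm_neg]
      exact mul_le_mul (hB' k) (hB k) (norm_nonneg _) ((norm_nonneg _).trans (hB' k))
    have h1 := (tendsto_finsetSum (attachments G A) fun H hH =>
      hlim hφc.measurable hφ' (hatt hG hA H hH)).sub
        ((hlim (ψ := fun k => φ k * -nu T ω V k) (hφc.measurable.mul hν.neg) hφν hG).const_mul
          ((t / (m + 1) : ℝ) : ℂ))
    rw [← Finset.mul_sum, sum_durationIntegral_root hC hδ hd hV_summable hV_even hω
      hφc.measurable hφ' hG hA h0, durationIntegral_mul_neg] at h1
    -- The two limits cancel, since (-t)^{m+1} / (m+1)! = -(t / (m+1)) (-t)^m / m!; the minus sign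
    -- is that of -ν.
    convert h1 using 2
    have hm : (m + 1 : ℂ) ≠ 0 := by exact_mod_cast m.succ_ne_zero
    have hm' : (m.factorial : ℂ) ≠ 0 := by exact_mod_cast m.factorial_ne_zero
    rw [Nat.factorial_succ, pow_succ]
    push_cast
    field_simp
    ring
  · convert tendsto_finsetSum (attachments G A) fun H hH =>
      hlim hφc.measurable hφ' (hatt hG hA H hH) using 2
    rw [← Finset.mul_sum, sum_durationIntegral_of_ne hC hδ hd hV_summable hV_even hω
      hφc.measurable hφ' hG hA h0, mul_zero]
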